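/- Let $\mu$ be either Lebesgue measure on $\mathbb R$ (continuous set-up) or the counting measure on $\mathbb Z$ (discrete set-up), and let $V:\mathbb R\to\mathbb R\cup\{+\infty\}$ be measurable with $V(0)<\infty$ and $\kappa:=\int e^{-V}\,d\mu<\infty$. For $\varepsilon\ge 0$, $N\in\mathbb N$ and $a\in\{\mathrm f,\mathrm c\}$ let $$\mathbf P^a_{\varepsilon,N}(dx)=\frac1{Z^a_{\varepsilon,N}}\,e^{-H^a_N(x)}\prod_{i=1}^N\bigl(1_{(x_i>0)}\,\mu(dx_i)+\varepsilon\,\delta_0(dx_i)\bigr)\quad\text{on }[0,\infty)^N,$$ where $H^{\mathrm f}_N(x)=\sum_{i=0}^{N-1}V(x_{i+1}-x_i)$ with $x_0=0$, $H^{\mathrm c}_N(x)=\sum_{i=0}^{N}V(x_{i+1}-x_i)$ with $x_0=x_{N+1}=0$, and $Z^a_{\varepsilon,N}$ is the normalizing constant ($Z^{\mathrm c}_{\varepsilon,0}:=e^{-V(0)}$). Let $Y_1,Y_2,\dots$ be i.i.d. with law $\kappa^{-1}e^{-V(x)}\mu(dx)$ and let $S_n=Y_1+\dots+Y_n$. Assume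 that $Y_1$ is integrable, $\mathbf E[Y_1]=0$, and the truncated variance $t\mapsto\mathbf E[|Y_1|^2 1_{\{|Y_1|\le t\}}]$ is slowly varying at infinity. In the continuous set-up assume also that $e^{-V}$ is continuous, that $Z^{\mathrm c}_{0,N}<\infty$ for every $N$, and that $S_n$ has a bounded density for some $n\ge1$ (the last two hold, for instance, if $e^{-V}$ is bounded). Set $\gamma:=\sum_{n\ge1}Z^{\mathrm c}_{0,n-1}/\kappa^n$, $q(n):=\gamma^{-1}Z^{\mathrm c}_{0,n-1}/\kappa^n$ for $n\ge1$, $\varepsilon_c:=1/\gamma$ and $\delta:=\gamma\varepsilon$. Let $p^a_{\varepsilon,N}$ be the law under $\mathbf P^a_{\varepsilon,N}$ of the contact set $\{1\le n\le N:\ x_n=0\}$, regarded as a random element of $\{0,1\}^{\mathbb N}$, $\mathbb N=\{1,2,\dots\}$. For a subset $A$ of $\mathbb N$ let $\tau_0=0$ and $\tau_{j+1}=\inf\{n\in A:\ n>\tau_j\}$ (with $\inf\emptyset=\infty$). Then $0<\gamma<\infty$, and for every $\varepsilon\ge0$ there is a probability measure $p_\varepsilon$ on $\{0,1\}^{\mathbb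 N}$ such that both $p^{\mathrm f}_{\varepsilon,N}$ and $p^{\mathrm c}_{\varepsilon,N}$ are, for all large $N$, well-defined probability measures and converge weakly to $p_\varepsilon$ as $N\to\infty$. Under $p_\varepsilon$ the sequence $(\tau_k)_{k\ge0}$ is: 1. for $\varepsilon>\varepsilon_c$, a renewal process with interarrival probability $q_\delta(t)=\delta\,q(t)\,e^{-\mathsf F_\delta t}$, where $\mathsf F_\delta>0$ is such that $\sum_{t\ge1}q_\delta(t)=1$; 2. for $\varepsilon<\varepsilon_c$, a terminating renewal process with defective interarrival probability $\delta\,q(\cdot)$; 3. for $\varepsilon=\varepsilon_c$, a renewal process with interarrival probability $q(\cdot)$. Here $(\tau_k)_{k\ge 0}$ is a renewal process (respectively a terminating renewal process) with interarrival probability $K$ on $\mathbb N$, $\sum_n K(n)=1$ (respectively $\sum_n K(n)<1$), if it has the law of $(T_1+\dots+T_k)_{k\ge0}$ with $T_i$ i.i.d. in $\mathbb N\cup\{\infty\}$, $P(T_i=n)=K(n)$ for $n\in\mathbb N$ and $P(T_i=\infty)=1-\sum_nK(n)$. -/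

import Mathlib

open MeasureTheory ProbabilityTheory Filter Topology Set
open scoped ENNReal NNReal BoundedContinuousFunction

noncomputable section

namespace Wetting

/-! ### The potential and the random walk -/

/-- The two set-ups of the model. -/
inductive Setup
  | continuous
  | discrete

/-- The single site a priori measure `μ` on `ℝ`: Lebesgue measure in the continuous set-up, the
counting measure on `ℤ` (as a measure on `ℝ`) in the discrete one. -/
def refMeasure : Setup → Measure ℝ
  | .continuous => volume
  | .discrete => (Measure.count : Measure ℤ).map (fun z : ℤ => (z : ℝ))

/-- The function `exp (-V)`, with `exp (-∞) = 0`. -/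
def boltzmann (V : ℝ → EReal) (x : ℝ) : ℝ≥0∞ := EReal.exp (-V x)

/-- `κ = ∫ exp (-V) dμ`. -/
def kappa (s : Setup) (V : ℝ → EReal) : ℝ≥0∞ := ∫⁻ y, boltzmann V y ∂(refMeasure s)

/-- The law of the step `Y₁` of the random walk: `P(Y₁ ∈ dx) = κ⁻¹ exp (-V x) μ(dx)`. -/
def stepLaw (s : Setup) (V : ℝ → EReal) : Measure ℝ :=
  (kappa s V)⁻¹ • (refMeasure s).withDensity (boltzmann V)

/-- The law of `S_n = Y₁ + ⋯ + Y_n`, where the `Y_i` are independent with law `stepLaw`. -/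
def walkLaw (s : Setup) (V : ℝ → EReal) (n : ℕ) : Measure ℝ :=
  (Measure.pi fun _ : Fin n => stepLaw s V).map (fun y => ∑ i, y i)

/-- The truncated variance `t ↦ E[|Y₁|² 1_{|Y₁| ≤ t}]`. -/
def truncatedVariance (s : Setup) (V : ℝ → EReal) (t : ℝ) : ℝ :=
  ∫ y in {y : ℝ | |y| ≤ t}, |y| ^ 2 ∂(stepLaw s V)

/-- `L` is slowly varying at infinity. -/
def IsSlowlyVarying (L : ℝ → ℝ) : Prop :=
  ∀ c : ℝ, 0 < c → Tendsto (fun t => L (c * t) / L t) atTop (𝓝 1)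

/-! ### The wetting model -/

/-- The boundary conditions `a = f` (free) and `a = c` (constrained). -/
inductive BoundaryCondition
  | free
  | constrained

/-- The height `x_i` at site `i` of a configuration `x = (x_1, …, x_N)`, whose coordinates are
stored at the indices `0, …, N - 1`, with the convention `x_0 = 0` and `x_i = 0` for `i > N`. -/
def height {N : ℕ} (x : Fin N → ℝ) : ℕ → ℝ
  | 0 => 0
  | i + 1 => if h : i < N then x ⟨i, h⟩ else 0

/-- The Hamiltonians `H_N^f = ∑_{i=0}^{N-1} V(x_{i+1} - x_i)` and
`H_N^c = ∑_{i=0}^{N} V(x_{i+1} - x_i)`, where `x_0 = x_{N+1} = 0`. -/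
def hamiltonian (V : ℝ → EReal) (a : BoundaryCondition) {N : ℕ} (x : Fin N → ℝ) : EReal :=
  match a with
  | .free => ∑ i ∈ Finset.range N, V (height x (i + 1) - height x i)
  | .constrained => ∑ i ∈ Finset.range (N + 1), V (height x (i + 1) - height x i)

/-- The product measure `∏_{i=1}^N (1_{x_i > 0} μ(dx_i) + ε δ_0(dx_i))`; it is carried by
`[0, ∞)^N`. -/
def aPriori (s : Setup) (ε : ℝ≥0) (N : ℕ) : Measure (Fin N → ℝ) :=
  Measure.pi fun _ => (refMeasure s).restrict (Ioi 0) + ε • Measure.dirac 0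

/-- The partition function `Z^a_{ε,N}`; in particular `Z^c_{ε,0} = exp (-V 0)`. -/
def partitionFunction (s : Setup) (V : ℝ → EReal) (a : BoundaryCondition) (ε : ℝ≥0) (N : ℕ) :
    ℝ≥0∞ :=
  ∫⁻ x, EReal.exp (-hamiltonian V a x) ∂(aPriori s ε N)

/-- The law `P^a_{ε,N}` of the interface. -/
def interfaceLaw (s : Setup) (V : ℝ → EReal) (a : BoundaryCondition) (ε : ℝ≥0) (N : ℕ) :
    Measure (Fin N → ℝ) :=
  (partitionFunction s V a ε N)⁻¹ •
    (aPriori s ε N).withDensity (fun x => EReal.exp (-hamiltonian V a x))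

/-- The standing assumptions on the potential `V : ℝ → ℝ ∪ {+∞}`. -/
structure IsAdmissible (s : Setup) (V : ℝ → EReal) : Prop where
  measurable : Measurable V
  ne_bot : ∀ x, V x ≠ ⊥
  zero_lt_top : V 0 < ⊤
  kappa_lt_top : kappa s V < ∞
  /-- In the continuous set-up `exp (-V)` is continuous. -/
  continuous_boltzmann : s = .continuous → Continuous (boltzmann V)
  /-- In the continuous set-up the partition functions are finite (in the discrete set-up this is
  automatic). -/
  partitionFunction_lt_top :
    s = .continuous → ∀ N, partitionFunction s V .constrained 0 N < ∞
  /-- In the continuous set-up `S_n` has a bounded density for some `n ≥ 1`. -/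
  bounded_density :
    s = .continuous → ∃ n : ℕ, 1 ≤ n ∧ ∃ C : ℝ≥0, walkLaw s V n ≤ C • (volume : Measure ℝ)
  /-- The step of the walk is integrable and centred. -/
  integrable_step : Integrable (fun y : ℝ => y) (stepLaw s V)
  mean_zero : ∫ y, y ∂(stepLaw s V) = 0
  slowlyVarying : IsSlowlyVarying (truncatedVariance s V)

/-! ### The laws `q`, `q_δ` and the critical point -/

/-- `γ = ∑_{n ≥ 1} Z^c_{0,n-1} / κ^n`. -/
def gammaConst (s : Setup) (V : ℝ → EReal) : ℝ≥0∞ :=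
  ∑' n : ℕ, partitionFunction s V .constrained 0 n / kappa s V ^ (n + 1)

/-- `q(n) = γ⁻¹ Z^c_{0,n-1} / κ^n` for `n ≥ 1`, and `q(0) = 0`. -/
def q (s : Setup) (V : ℝ → EReal) : ℕ → ℝ≥0∞
  | 0 => 0
  | n + 1 => (gammaConst s V)⁻¹ *
      (partitionFunction s V .constrained 0 n / kappa s V ^ (n + 1))

/-- The parameter `δ = γ ε`. -/
def delta (s : Setup) (V : ℝ → EReal) (ε : ℝ≥0) : ℝ≥0∞ := gammaConst s V * ε

/-- The critical value `ε_c = 1 / γ`, that is, the value of `ε` at which `δ = 1`. -/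
def epsCrit (s : Setup) (V : ℝ → EReal) : ℝ≥0∞ := (gammaConst s V)⁻¹

/-- `t ↦ δ q(t) exp (-F t)`; it is `q_δ` if `F = F_δ`, the value that gives it total mass one. -/
def tilted (s : Setup) (V : ℝ → EReal) (ε : ℝ≥0) (F : ℝ) (t : ℕ) : ℝ≥0∞ :=
  delta s V ε * q s V t * ENNReal.ofReal (Real.exp (-F * t))

/-! ### Contact sets and renewal processes -/

open Classical in
/-- The set of the `n ∈ {1, …, N}` with `x_n = 0`, as an element of `{0,1}^{1,2,…}`. -/
def contactSet {N : ℕ} (x : Fin N → ℝ) : ℕ+ → Bool :=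
  fun n => decide ((n : ℕ) ≤ N ∧ height x n = 0)

/-- The law `p^a_{ε,N}` of the contact set under `P^a_{ε,N}`. -/
def contactLaw (s : Setup) (V : ℝ → EReal) (a : BoundaryCondition) (ε : ℝ≥0) (N : ℕ) :
    Measure (ℕ+ → Bool) :=
  (interfaceLaw s V a ε N).map contactSet

/-- The contact times: `τ_0 = 0`, and `τ_{j+1}` is the smallest element of the set `A` that exceeds
`τ_j` (`∞` if there is none). -/
def contactTime (A : ℕ+ → Bool) : ℕ → ℕ∞
  | 0 => 0
  | j + 1 => sInf {t : ℕ∞ | contactTime A j < t ∧ ∃ n : ℕ+, A n = true ∧ t = ((n : ℕ) : ℕ∞)}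

/-- Under the measure `P`, the sequence `τ` has the law of the partial sums `T_1 + ⋯ + T_k`,
`k ≥ 0`, of independent `ℕ ∪ {∞}`-valued random variables with `P(T_i = n) = K n` for every
natural number `n` (so that `P(T_i = ∞) = 1 - ∑ K`). -/
def HasRenewalLaw {Ω : Type*} [MeasurableSpace Ω] (P : Measure Ω) (τ : Ω → ℕ → ℕ∞)
    (K : ℕ → ℝ≥0∞) : Prop :=
  ∃ (Ω' : Type) (_ : MeasurableSpace Ω') (P' : Measure Ω') (T : ℕ → Ω' → ℕ∞),
    IsProbabilityMeasure P' ∧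
    (∀ i, Measurable (T i)) ∧
    iIndepFun T P' ∧
    (∀ (i n : ℕ), P' {ω | T i ω = (n : ℕ∞)} = K n) ∧
    AEMeasurable τ P ∧
    P.map τ = P'.map (fun ω k => ∑ i ∈ Finset.range k, T i ω)

/-- `τ` is a renewal process with interarrival probability `K`. -/
def IsRenewalProcess {Ω : Type*} [MeasurableSpace Ω] (P : Measure Ω) (τ : Ω → ℕ → ℕ∞)
    (K : ℕ → ℝ≥0∞) : Prop :=
  K 0 = 0 ∧ ∑' n, K n = 1 ∧ HasRenewalLaw P τ K

/-- `τ` is a terminating renewal process with defective interarrival probability `K`. -/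
def IsTerminatingRenewalProcess {Ω : Type*} [MeasurableSpace Ω] (P : Measure Ω)
    (τ : Ω → ℕ → ℕ∞) (K : ℕ → ℝ≥0∞) : Prop :=
  K 0 = 0 ∧ ∑' n, K n < 1 ∧ HasRenewalLaw P τ K

/-- Weak convergence of probability measures (`p N` need be a probability measure only for large
`N`). -/
def ConvergesWeakly {X : Type*} [TopologicalSpace X] [MeasurableSpace X] (p : ℕ → Measure X)
    (p' : Measure X) : Prop :=
  (∀ᶠ N in atTop, IsProbabilityMeasure (p N)) ∧ IsProbabilityMeasure p' ∧
    ∀ f : X →ᵇ ℝ, Tendsto (fun N => ∫ x, f x ∂(p N)) atTop (𝓝 (∫ x, f x ∂p'))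

end Wetting

end

namespace Wetting

/-! A pattern of contacts and dry sites that ends with a contact has a probability that factorizes
at its contacts: a product of weights ε Z^c_{0,n-1}, one for each gap n, times the ratio of the
partition functions of sizes N - m and N, where m is the length of the pattern
(`contactLaw_cylinder_append`). Convergence of these probabilities implies weak convergence
(`convergesWeakly_of_cylinder`), and a renewal law with interarrival masses K gives the pattern the
product of the K(n) (`renewalLaw_cylinder`). Hence everything rests on a ratio limit: after division
by powers of κ, Z^a_{ε,N} / Z^a_{ε,N+1} tends to exp(-F), with F = 0 if εγ ≤ 1 and F > 0 the root of
the tilted equation if εγ > 1.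

Put k(n) = Z^c_{0,n-1}/κ^n (`excursionSeq`). Expanding at the first contact identifies ε Z^c_{ε,N},
normalized, with the value at N + 1 of the renewal mass function u of the interarrival masses a =
εk, and Z^f_{ε,N} with the convolution of u and p(n) = P(S_1 > 0, …, S_n > 0). For εγ > 1 an
exponential tilt turns a into a probability with finite mean, and the classical renewal theorem
`tendsto_renewalSeq` applies. For εγ ≤ 1 the law a is defective or has infinite mean, and
u(n+1)/u(n) → 1 has to be proved directly; this is the property `IsFlat`, which is stable under
convolution (`IsFlat.seqConv`).

Flatness of u comes from the identity u' = a'u² of generating functions: (n+1) u(n+1) is the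
convolution of the sequence n a(n) with v = u * u. If n a(n) is flat, a shift of n costs little,
provided that single terms of v are negligible (`isFlat_of_mul_succ_eq_seqConv`). With n a(n) at
most of order n^(-1/2) and at least of order n^(-1/2-1/36), a bootstrap in two rounds compares v(n)
with its own partial sums and gives what is needed (`isFlat_renewalSeq`). The same criterion,
applied to the Sparre Andersen identity (n+1) p(n+1) = ∑ P(S_{i+1} > 0) p(n-i) with P(S_n > 0) →
1/2, shows that p is flat (`isFlat_positivityProb`).

The asymptotics of k come from bridges. Let f(m) be the mass or density at 0 of S_{m+1}. Rotating a
bridge so that it starts from its last minimum gives (m+1) k(m+1) = f(m) - e (k * f)(m), where e =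
μ{0} is 0 or 1 (`succ_mul_excursionSeq`). A local limit theorem, proved by Fourier inversion both on
a lattice and for densities, gives f(m) ~ K θ(m), where θ is the inverse norming sequence of the
normal domain of attraction, including infinite variance. As e ∑ k < 1, the sequence n k(n) is
asymptotic to a positive multiple of θ, hence flat and of the required order
(`IsAdmissible.hasSquareRootTail`). -/

/-! ### Flat sequences and their convolutions. -/

/-- Consecutive terms of `a` are asymptotically equal. -/
def IsFlat (a : ℕ → ℝ) : Prop :=
  ∀ η : ℝ, 0 < η → ∀ᶠ n in atTop, |a (n + 1) - a n| ≤ η * a n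

theorem IsFlat.tendsto_div {a : ℕ → ℝ} (h : IsFlat a) (hpos : ∀ᶠ n in atTop, 0 < a n) :
    Tendsto (fun n => a n / a (n + 1)) atTop (𝓝 1) := by
  have h1 : Tendsto (fun n => a (n + 1) / a n) atTop (𝓝 1) := by
    rw [Metric.tendsto_atTop']
    intro ε hε
    have := (h (ε / 2) (by positivity)).and hpos
    rw [eventually_atTop] at this
    obtain ⟨N, hN⟩ := this
    refine ⟨N, fun n hn => ?_⟩
    obtain ⟨h1, h2⟩ := hN n hn.le
    rw [Real.dist_eq, div_sub_one h2.ne', abs_div, abs_of_pos h2, div_lt_iff₀ h2]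
    nlinarith
  have := h1.inv₀ one_ne_zero
  simpa using this

theorem isFlat_of_tendsto_div {a : ℕ → ℝ} (hpos : ∀ᶠ n in atTop, 0 < a n)
    (h : Tendsto (fun n => a (n + 1) / a n) atTop (𝓝 1)) : IsFlat a := by
  intro η hη
  rw [Metric.tendsto_atTop'] at h
  obtain ⟨N, hN⟩ := h η hη
  filter_upwards [hpos, eventually_gt_atTop N] with n h1 h2
  have := hN n h2
  rw [Real.dist_eq, div_sub_one h1.ne', abs_div, abs_of_pos h1, div_lt_iff₀ h1] at this
  exact this.le

/-- The convolution of two sequences. -/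
def seqConv (a b : ℕ → ℝ) (n : ℕ) : ℝ := ∑ i ∈ Finset.range (n + 1), a i * b (n - i)

theorem seqConv_eq_antidiagonal (a b : ℕ → ℝ) (n : ℕ) :
    seqConv a b n = ∑ p ∈ Finset.HasAntidiagonal.antidiagonal n, a p.1 * b p.2 := by
  rw [Finset.Nat.sum_antidiagonal_eq_sum_range_succ (fun i j => a i * b j)]
  rfl

theorem coeff_mk_mul_mk (a b : ℕ → ℝ) :
    PowerSeries.mk a * PowerSeries.mk b = PowerSeries.mk (seqConv a b) := by
  ext n
  simp [PowerSeries.coeff_mul, seqConv_eq_antidiagonal]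

theorem seqConv_nonneg {a b : ℕ → ℝ} (ha : ∀ n, 0 ≤ a n) (hb : ∀ n, 0 ≤ b n) (n : ℕ) :
    0 ≤ seqConv a b n :=
  Finset.sum_nonneg fun i _ => mul_nonneg (ha i) (hb _)

theorem seqConv_succ_sub (a b : ℕ → ℝ) {n m : ℕ} (hm : m ≤ n) :
    seqConv a b (n + 1) - seqConv a b n =
      (∑ i ∈ Finset.range (m + 1), a i * (b (n - i + 1) - b (n - i))) + a (m + 1) * b (n - m) +
        ∑ i ∈ Finset.Ico (m + 1) (n + 1), (a (i + 1) - a i) * b (n - i) := by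
  have h1 : seqConv a b (n + 1) = (∑ i ∈ Finset.range (m + 1), a i * b (n - i + 1)) +
      (a (m + 1) * b (n - m) + ∑ i ∈ Finset.Ico (m + 1) (n + 1), a (i + 1) * b (n - i)) := by
    unfold seqConv
    rw [← Finset.sum_range_add_sum_Ico _ (show m + 1 ≤ n + 1 + 1 by omega)]
    congr 1
    · refine Finset.sum_congr rfl fun i hi => ?_
      rw [Finset.mem_range] at hi
      rw [show n + 1 - i = n - i + 1 by omega]
    · rw [Finset.sum_eq_sum_Ico_succ_bot (by omega), ← Finset.sum_Ico_add' _ (m + 1) (n + 1) 1]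
      simp
  have h2 : seqConv a b n = (∑ i ∈ Finset.range (m + 1), a i * b (n - i)) +
      ∑ i ∈ Finset.Ico (m + 1) (n + 1), a i * b (n - i) :=
    (Finset.sum_range_add_sum_Ico _ (by omega)).symm
  rw [h1, h2]
  simp only [mul_sub, sub_mul, Finset.sum_sub_distrib]
  ring

/-- Split the convolution at a site `m` that is far from both ends. To the left of `m` the shift of
`n` is put on `b`, to the right on `a`, so each factor is compared with its neighbour only where it
is already flat. What remains is the boundary term `a (m + 1) * b (n - m)`, which is small for a
good choice of `m`. -/
theorem IsFlat.seqConv {a b : ℕ → ℝ} (ha : IsFlat a) (hb : IsFlat b) (ha0 : ∀ n, 0 ≤ a n)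
    (hb0 : ∀ n, 0 ≤ b n) : IsFlat (seqConv a b) := by
  intro η hη
  -- The bound by `1` serves the boundary term: it gives `a (m + 1) ≤ 2 * a m`.
  set δ := min (η / 3) 1 with hδ
  have hδ0 : 0 < δ := by positivity
  have hδ1 : δ ≤ η / 3 := min_le_left _ _
  obtain ⟨J, hJ⟩ := eventually_atTop.1 ((ha δ hδ0).and (hb δ hδ0))
  obtain ⟨K, hK⟩ := exists_nat_gt (2 / (η / 3))
  filter_upwards [eventually_ge_atTop (2 * J + K)] with n hn
  have hw0 := seqConv_nonneg ha0 hb0 n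
  -- a splitting point at which the boundary term is small
  obtain ⟨m, hm, hmb⟩ : ∃ m ∈ Finset.Icc J (n - J),
      a m * b (n - m) ≤ (η / 3) / 2 * Wetting.seqConv a b n := by
    -- If all the candidates for `m` were bad, their sum would exceed the whole convolution, since
    -- there are at least `K > 6 / η` of them.
    by_contra! hcon
    have hcard : (Finset.Icc J (n - J)).card = n - J + 1 - J := Nat.card_Icc _ _
    have h1 : (Finset.Icc J (n - J)).card • ((η / 3) / 2 * Wetting.seqConv a b n) ≤
        ∑ m ∈ Finset.Icc J (n - J), a m * b (n - m) :=
      Finset.card_nsmul_le_sum _ _ _ fun m hm => (hcon m hm).le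
    have hne : (Finset.Icc J (n - J)).Nonempty := by
      rw [Finset.nonempty_Icc]; omega
    have h1' : (∑ _m ∈ Finset.Icc J (n - J), (η / 3) / 2 * Wetting.seqConv a b n) <
        ∑ m ∈ Finset.Icc J (n - J), a m * b (n - m) := Finset.sum_lt_sum_of_nonempty hne hcon
    have h2 : ∑ m ∈ Finset.Icc J (n - J), a m * b (n - m) ≤ Wetting.seqConv a b n := by
      refine Finset.sum_le_sum_of_subset_of_nonneg ?_ fun i _ _ => mul_nonneg (ha0 i) (hb0 _)
      intro i hi
      rw [Finset.mem_Icc] at hi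
      rw [Finset.mem_range]; omega
    rw [Finset.sum_const, hcard, nsmul_eq_mul] at h1'
    have h3 : (K : ℝ) ≤ ((n - J + 1 - J : ℕ) : ℝ) := by exact_mod_cast (by omega)
    have h4 : 1 ≤ ((n - J + 1 - J : ℕ) : ℝ) * ((η / 3) / 2) := by
      rw [div_lt_iff₀ (by positivity)] at hK
      nlinarith
    nlinarith
  rw [Finset.mem_Icc] at hm
  have hmn : m ≤ n := by omega
  rw [seqConv_succ_sub a b hmn]
  have hS1 : |∑ i ∈ Finset.range (m + 1), a i * (b (n - i + 1) - b (n - i))| ≤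
      δ * ∑ i ∈ Finset.range (m + 1), a i * b (n - i) := by
    rw [Finset.mul_sum]
    refine (Finset.abs_sum_le_sum_abs _ _).trans (Finset.sum_le_sum fun i hi => ?_)
    rw [Finset.mem_range] at hi
    rw [abs_mul, abs_of_nonneg (ha0 i)]
    have := (hJ (n - i) (by omega)).2
    nlinarith [ha0 i]
  have hS2 : |∑ i ∈ Finset.Ico (m + 1) (n + 1), (a (i + 1) - a i) * b (n - i)| ≤
      δ * ∑ i ∈ Finset.Ico (m + 1) (n + 1), a i * b (n - i) := by
    rw [Finset.mul_sum]
    refine (Finset.abs_sum_le_sum_abs _ _).trans (Finset.sum_le_sum fun i hi => ?_)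
    rw [Finset.mem_Ico] at hi
    rw [abs_mul, abs_of_nonneg (hb0 (n - i)), ← mul_assoc]
    exact mul_le_mul_of_nonneg_right (hJ i (by omega)).1 (hb0 _)
  have hsum : Wetting.seqConv a b n = (∑ i ∈ Finset.range (m + 1), a i * b (n - i)) +
      ∑ i ∈ Finset.Ico (m + 1) (n + 1), a i * b (n - i) :=
    (Finset.sum_range_add_sum_Ico _ (by omega)).symm
  have hb3 : |a (m + 1) * b (n - m)| ≤ (η / 3) * Wetting.seqConv a b n := by
    rw [abs_of_nonneg (mul_nonneg (ha0 _) (hb0 _))]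
    have h1 := (abs_le.1 (hJ m hm.1).1).2
    have h2 : δ ≤ 1 := min_le_right _ _
    have h3 : a (m + 1) ≤ 2 * a m := by nlinarith [ha0 m]
    nlinarith [hb0 (n - m)]
  have := abs_add_three (∑ i ∈ Finset.range (m + 1), a i * (b (n - i + 1) - b (n - i)))
    (a (m + 1) * b (n - m)) (∑ i ∈ Finset.Ico (m + 1) (n + 1), (a (i + 1) - a i) * b (n - i))
  nlinarith

/-- If `(n+1) w (n+1)` is the convolution of a flat sequence `c` with a sequence `z` whose single
terms are negligible, then `w` is flat. -/
theorem isFlat_of_mul_succ_eq_seqConv {w c z : ℕ → ℝ}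
    (hw : ∀ n : ℕ, (n + 1 : ℝ) * w (n + 1) = seqConv c z n) (hw0 : ∀ n, 0 ≤ w n)
    (hc0 : ∀ n, 0 ≤ c n) (hc : IsFlat c) (hz0 : ∀ n, 0 ≤ z n)
    (hz : ∀ J : ℕ, ∀ η : ℝ, 0 < η → ∀ᶠ n : ℕ in atTop, ∀ m, n ≤ m + J → m ≤ n + 1 →
      z m ≤ η * ((n + 1 : ℝ) * w (n + 1))) : IsFlat w := by
  have key : ∀ η : ℝ, 0 < η → ∀ᶠ n : ℕ in atTop,
      |seqConv c z (n + 1) - seqConv c z n| ≤ η * ((n + 1 : ℝ) * w (n + 1)) := by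
    intro η hη
    obtain ⟨J, hJ⟩ := eventually_atTop.1 (hc (η / 3) (by positivity))
    set A : ℝ := ∑ i ∈ Finset.range J, |c (i + 1) - c i| with hA
    have hA0 : 0 ≤ A := Finset.sum_nonneg fun _ _ => abs_nonneg _
    filter_upwards [hz J (η / 3 / (A + c 0 + 1)) (by have := hc0 0; positivity),
      eventually_ge_atTop J] with n hn hnJ
    set T := ((n + 1 : ℝ) * w (n + 1)) with hT
    have hT0 : 0 ≤ T := mul_nonneg (by positivity) (hw0 _)
    set ζ := η / 3 / (A + c 0 + 1)
    have hζ : ζ * (A + c 0 + 1) = η / 3 := by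
      have := hc0 0
      simp only [ζ]; field_simp
    have hζ0 : 0 < ζ := by have := hc0 0; positivity
    -- The shift is put entirely on `c`. Flatness controls the indices from `J` on; the first `J`
    -- terms and `c 0 * z (n + 1)` involve single values of `z` near `n`, which `hz` makes
    -- negligible.
    have e1 : seqConv c z (n + 1) - seqConv c z n =
        c 0 * z (n + 1) + ((∑ i ∈ Finset.range J, (c (i + 1) - c i) * z (n - i)) +
          ∑ i ∈ Finset.Ico J (n + 1), (c (i + 1) - c i) * z (n - i)) := by
      rw [Finset.sum_range_add_sum_Ico _ (by omega)]
      unfold seqConv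
      rw [Finset.sum_range_succ']
      simp [sub_mul, Finset.sum_sub_distrib]
      ring
    have e2 : |∑ i ∈ Finset.range J, (c (i + 1) - c i) * z (n - i)| ≤ A * (ζ * T) := by
      rw [hA, Finset.sum_mul]
      refine (Finset.abs_sum_le_sum_abs _ _).trans (Finset.sum_le_sum fun i hi => ?_)
      rw [Finset.mem_range] at hi
      rw [abs_mul, abs_of_nonneg (hz0 (n - i))]
      exact mul_le_mul_of_nonneg_left (hn _ (by omega) (by omega)) (abs_nonneg _)
    have e3 : |∑ i ∈ Finset.Ico J (n + 1), (c (i + 1) - c i) * z (n - i)| ≤ η / 3 * T := by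
      rw [hT, hw]
      have : ∑ i ∈ Finset.Ico J (n + 1), c i * z (n - i) ≤ seqConv c z n := by
        refine Finset.sum_le_sum_of_subset_of_nonneg ?_ fun i _ _ => mul_nonneg (hc0 i) (hz0 _)
        intro i hi
        rw [Finset.mem_Ico] at hi
        rw [Finset.mem_range]; omega
      refine le_trans ?_ (mul_le_mul_of_nonneg_left this (by positivity))
      rw [Finset.mul_sum]
      refine (Finset.abs_sum_le_sum_abs _ _).trans (Finset.sum_le_sum fun i hi => ?_)
      rw [Finset.mem_Ico] at hi
      rw [abs_mul, abs_of_nonneg (hz0 (n - i)), ← mul_assoc]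
      exact mul_le_mul_of_nonneg_right (hJ i (by omega)) (hz0 _)
    have e4 : |c 0 * z (n + 1)| ≤ c 0 * (ζ * T) := by
      rw [abs_of_nonneg (mul_nonneg (hc0 _) (hz0 _))]
      exact mul_le_mul_of_nonneg_left (hn _ (by omega) (by omega)) (hc0 _)
    rw [e1]
    refine (abs_add_le _ _).trans ?_
    have := abs_add_le (∑ i ∈ Finset.range J, (c (i + 1) - c i) * z (n - i))
      (∑ i ∈ Finset.Ico J (n + 1), (c (i + 1) - c i) * z (n - i))
    have h5 : A * (ζ * T) + c 0 * (ζ * T) ≤ η / 3 * T := by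
      rw [← hζ]; nlinarith [mul_nonneg hζ0.le hT0]
    nlinarith [mul_nonneg hη.le hT0]
  intro η hη
  -- Removing the factor `n + 1` costs one extra `w (n + 1)`, which is absorbed because `1 ≤ η / 2 *
  -- (n + 1)`.
  have h1 := key (η / 2) (by positivity)
  obtain ⟨K, hK⟩ := exists_nat_gt (2 / η)
  have h2 : ∀ᶠ n : ℕ in atTop, |w (n + 1 + 1) - w (n + 1)| ≤ η * w (n + 1) := by
    filter_upwards [h1, eventually_ge_atTop K] with n hn hnK
    have ha := hw n
    have hb := hw (n + 1)
    push_cast at hb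
    rw [← ha, ← hb] at hn
    have e : (n + 1 + 1 : ℝ) * (w (n + 1 + 1) - w (n + 1)) =
      ((n + 1 + 1 : ℝ) * w (n + 1 + 1) - (n + 1 : ℝ) * w (n + 1)) - w (n + 1) := by ring
    have h3 : (n + 1 + 1 : ℝ) * |w (n + 1 + 1) - w (n + 1)| ≤
        η / 2 * ((n + 1 : ℝ) * w (n + 1)) + w (n + 1) := by
      rw [← abs_of_nonneg (show (0 : ℝ) ≤ n + 1 + 1 by positivity), ← abs_mul, e]
      refine (abs_sub _ _).trans ?_
      rw [abs_of_nonneg (hw0 _)]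
      gcongr
    have hK' : 1 ≤ η / 2 * (n + 1 : ℝ) := by
      rw [div_lt_iff₀ hη] at hK
      have : (K : ℝ) ≤ n := by exact_mod_cast hnK
      nlinarith
    have h4 : (0 : ℝ) < n + 1 + 1 := by positivity
    have hwn := hw0 (n + 1)
    have : (n + 1 + 1 : ℝ) * |w (n + 1 + 1) - w (n + 1)| ≤ (n + 1 + 1 : ℝ) * (η * w (n + 1)) := by
      nlinarith [mul_nonneg hη.le hwn, mul_le_mul_of_nonneg_right hK' hwn]
    exact le_of_mul_le_mul_left this h4
  obtain ⟨N, hN⟩ := eventually_atTop.1 h2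
  refine eventually_atTop.2 ⟨N + 1, fun n hn => ?_⟩
  obtain ⟨m, rfl⟩ : ∃ m, n = m + 1 := ⟨n - 1, by omega⟩
  exact hN m (by omega)

/-! ### Renewal mass functions as power series. -/

/-- The renewal mass function `∑_k a^{*k}` of the (defective) interarrival law `a`. -/
noncomputable def renewalSeq (a : ℕ → ℝ) (n : ℕ) : ℝ :=
  PowerSeries.coeff n (1 - PowerSeries.mk a)⁻¹

theorem mk_renewalSeq (a : ℕ → ℝ) : PowerSeries.mk (renewalSeq a) = (1 - PowerSeries.mk a)⁻¹ := by
  ext n; simp [renewalSeq]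

theorem mk_renewalSeq_mul {a : ℕ → ℝ} (h0 : a 0 = 0) :
    PowerSeries.mk (renewalSeq a) * (1 - PowerSeries.mk a) = 1 := by
  rw [mk_renewalSeq, mul_comm]
  exact PowerSeries.mul_inv_cancel _ (by simp [h0])

theorem eq_renewalSeq {a u : ℕ → ℝ} (h0 : a 0 = 0)
    (h : PowerSeries.mk u = 1 + PowerSeries.mk a * PowerSeries.mk u) : u = renewalSeq a := by
  have h1 : PowerSeries.mk u * (1 - PowerSeries.mk a) = 1 := by
    rw [mul_sub, mul_one, mul_comm (PowerSeries.mk u) (PowerSeries.mk a)]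
    nth_rewrite 1 [h]
    ring
  have h2 : PowerSeries.mk u = PowerSeries.mk (renewalSeq a) := by
    calc PowerSeries.mk u = PowerSeries.mk u *
          ((1 - PowerSeries.mk a) * PowerSeries.mk (renewalSeq a)) := by
          rw [mul_comm (1 - PowerSeries.mk a), mk_renewalSeq_mul h0, mul_one]
      _ = _ := by rw [← mul_assoc, h1, one_mul]
  ext n
  simpa using congrArg (PowerSeries.coeff n) h2

theorem mk_eq_X_mul {a : ℕ → ℝ} (h0 : a 0 = 0) :
    PowerSeries.mk a = PowerSeries.X * PowerSeries.mk (fun n => a (n + 1)) := by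
  ext n
  cases n with
  | zero => simp [h0]
  | succ n => simp [PowerSeries.coeff_succ_X_mul]

theorem mk_renewalSeq_eq {a : ℕ → ℝ} (h0 : a 0 = 0) :
    PowerSeries.mk (renewalSeq a) = 1 + PowerSeries.mk a * PowerSeries.mk (renewalSeq a) := by
  have := mk_renewalSeq_mul h0
  rw [mul_sub, mul_one, sub_eq_iff_eq_add] at this
  nth_rewrite 1 [this]
  ring

theorem renewalSeq_zero {a : ℕ → ℝ} (h0 : a 0 = 0) : renewalSeq a 0 = 1 := by
  have := congrArg (PowerSeries.coeff 0) (mk_renewalSeq_eq h0)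
  simpa [h0] using this

theorem renewalSeq_succ {a : ℕ → ℝ} (h0 : a 0 = 0) (n : ℕ) :
    renewalSeq a (n + 1) = seqConv (fun i => a (i + 1)) (renewalSeq a) n := by
  have := congrArg (PowerSeries.coeff (n + 1)) (mk_renewalSeq_eq h0)
  rw [mk_eq_X_mul h0, mul_assoc, coeff_mk_mul_mk, map_add, PowerSeries.coeff_succ_X_mul] at this
  simpa [PowerSeries.coeff_one] using this

theorem renewalSeq_nonneg {a : ℕ → ℝ} (h0 : a 0 = 0) (ha : ∀ n, 0 ≤ a n) (n : ℕ) :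
    0 ≤ renewalSeq a n := by
  induction n using Nat.strong_induction_on with
  | _ n ih =>
    cases n with
    | zero => rw [renewalSeq_zero h0]; exact zero_le_one
    | succ n =>
      rw [renewalSeq_succ h0]
      exact Finset.sum_nonneg fun i hi => mul_nonneg (ha _) (ih _ (by omega))

theorem renewalSeq_succ_ge {a : ℕ → ℝ} (h0 : a 0 = 0) (ha : ∀ n, 0 ≤ a n) {i n : ℕ} (hi : i ≤ n) :
    a (i + 1) * renewalSeq a (n - i) ≤ renewalSeq a (n + 1) := by
  rw [renewalSeq_succ h0]
  exact Finset.single_le_sum (f := fun i => a (i + 1) * renewalSeq a (n - i))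
    (fun j _ => mul_nonneg (ha _) (renewalSeq_nonneg h0 ha _)) (Finset.mem_range.2 (by omega))

theorem renewalSeq_pos {a : ℕ → ℝ} (h0 : a 0 = 0) (ha : ∀ n, 0 ≤ a n) (h1 : 0 < a 1) (n : ℕ) :
    0 < renewalSeq a n := by
  induction n with
  | zero => rw [renewalSeq_zero h0]; exact zero_lt_one
  | succ n ih => exact (mul_pos h1 ih).trans_le (renewalSeq_succ_ge h0 ha (Nat.zero_le n))

/-- For a probability `a` this is the decomposition at the last renewal before `n`. Algebraically,
`(1 - A) / (1 - X)` is the generating function of the tails, and `U * (1 - A) = 1`. -/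
theorem seqConv_renewalSeq_tail {a : ℕ → ℝ} (h0 : a 0 = 0) (n : ℕ) :
    seqConv (renewalSeq a) (fun n => 1 - ∑ j ∈ Finset.range (n + 1), a j) n = 1 := by
  have h1 : (1 - PowerSeries.mk a) * PowerSeries.mk (fun _ => (1 : ℝ)) =
      PowerSeries.mk (fun n => 1 - ∑ j ∈ Finset.range (n + 1), a j) := by
    rw [sub_mul, one_mul, coeff_mk_mul_mk]
    ext n
    simp [seqConv]
  have h2 := mk_renewalSeq_mul h0
  have h3 := congrArg (fun p => p * PowerSeries.mk (fun _ => (1 : ℝ))) h2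
  simp only [mul_assoc, one_mul, h1, coeff_mk_mul_mk] at h3
  simpa using congrArg (PowerSeries.coeff n) h3

/-- The identity `u' = a' u²` for the generating function of a renewal mass function. -/
theorem succ_mul_renewalSeq_succ {a : ℕ → ℝ} (h0 : a 0 = 0) (n : ℕ) :
    (n + 1 : ℝ) * renewalSeq a (n + 1) = seqConv (fun i => (i + 1 : ℝ) * a (i + 1))
      (seqConv (renewalSeq a) (renewalSeq a)) n := by
  set U := PowerSeries.mk (renewalSeq a) with hU
  set A := PowerSeries.mk a with hA
  have h1 : U * (1 - A) = 1 := mk_renewalSeq_mul h0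
  have h2 := congrArg (PowerSeries.derivative ℝ) (mk_renewalSeq_eq h0)
  rw [← hU, ← hA, map_add, Derivation.leibniz, smul_eq_mul, smul_eq_mul] at h2
  simp only [Derivation.map_one_eq_zero, zero_add] at h2
  have h3 : PowerSeries.derivative ℝ U * (1 - A) = U * PowerSeries.derivative ℝ A := by
    linear_combination h2
  -- From `U' (1 - A) = U A'`, multiply by `U` and use `U (1 - A) = 1`.
  have h4 : PowerSeries.derivative ℝ U = PowerSeries.derivative ℝ A * (U * U) := by
    linear_combination U * h3 - PowerSeries.derivative ℝ U * h1
  have h5 : PowerSeries.derivative ℝ A = PowerSeries.mk (fun i => (i + 1 : ℝ) * a (i + 1)) := by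
    ext n; simp [PowerSeries.coeff_derivative, hA, mul_comm]
  rw [h5, hU, coeff_mk_mul_mk, coeff_mk_mul_mk] at h4
  have := congrArg (PowerSeries.coeff n) h4
  simp only [PowerSeries.coeff_derivative, PowerSeries.coeff_mk] at this
  rw [mul_comm, this]

/-- In each product one of the indices `i`, `n - i` is at least `n / 2`, and that factor is at most
`M`. -/
theorem seqConv_self_le {u : ℕ → ℝ} (hu : ∀ n, 0 ≤ u n) {n : ℕ} {M : ℝ}
    (hM : ∀ i, i ≤ n → n ≤ 2 * i → u i ≤ M) :
    seqConv u u n ≤ 2 * M * ∑ i ∈ Finset.range (n + 1), u i := by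
  have h1 : ∀ i ∈ Finset.range (n + 1), u i * u (n - i) ≤ M * (u i + u (n - i)) := by
    intro i hi
    rw [Finset.mem_range] at hi
    have hM0 : 0 ≤ M := (hu n).trans (hM n le_rfl (by omega))
    rcases le_total n (2 * i) with h | h
    · have := hM i (by omega) h
      nlinarith [hu i, hu (n - i)]
    · have := hM (n - i) (by omega) (by omega)
      nlinarith [hu i, hu (n - i)]
  refine (Finset.sum_le_sum h1).trans ?_
  rw [← Finset.mul_sum, Finset.sum_add_distrib]
  have h2 : ∑ i ∈ Finset.range (n + 1), u (n - i) = ∑ i ∈ Finset.range (n + 1), u i := by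
    rw [← Finset.sum_range_reflect u (n + 1)]
    exact Finset.sum_congr rfl fun i hi => by congr 1
  rw [h2]; linarith

theorem eventually_mul_rpow_le (K : ℝ) {p q : ℝ} (h : p < q) :
    ∀ᶠ n : ℕ in atTop, K * (n : ℝ) ^ p ≤ (n : ℝ) ^ q := by
  have h1 : Tendsto (fun n : ℕ => (n : ℝ) ^ (q - p)) atTop atTop :=
    (tendsto_rpow_atTop (sub_pos.2 h)).comp tendsto_natCast_atTop_atTop
  filter_upwards [h1.eventually_ge_atTop K, eventually_gt_atTop 0] with n hn h0
  have h0' : (0 : ℝ) < n := by exact_mod_cast h0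
  calc K * (n : ℝ) ^ p ≤ (n : ℝ) ^ (q - p) * (n : ℝ) ^ p := by gcongr
    _ = _ := by rw [← Real.rpow_add h0']; ring_nf

theorem rpow_le_four_mul_rpow {x y s : ℝ} (hx : 0 < x) (hxy : x ≤ 2 * y) (hs : s ≤ 0)
    (hs2 : -2 ≤ s) : y ^ s ≤ 4 * x ^ s := by
  have hy : 0 < y := by linarith
  calc y ^ s ≤ (x / 2) ^ s := Real.rpow_le_rpow_of_nonpos (by positivity) (by linarith) hs
    _ = (1 / 2 : ℝ) ^ s * x ^ s := by
      rw [div_eq_mul_one_div, mul_comm, Real.mul_rpow (by norm_num) hx.le]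
    _ ≤ (1 / 2 : ℝ) ^ (-2 : ℝ) * x ^ s := by
      gcongr 1
      exact Real.rpow_le_rpow_of_exponent_ge (by norm_num) (by norm_num) hs2
    _ = _ := by norm_num [Real.rpow_neg]

/-! ### Flatness of renewal mass functions whose interarrival law has a square root tail. -/

section Renewal

variable {a : ℕ → ℝ} {C c e : ℝ}

/-- Tails decrease, so `seqConv_renewalSeq_tail` bounds the partial sum of `u` up to `n` times the
tail beyond `n` by `1`; the tail is bounded below by the mass of the block `(n, 2n]`. -/
theorem sum_renewalSeq_le (h0 : a 0 = 0) (ha : ∀ n, 0 ≤ a n)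
    (hsum : ∀ n, ∑ j ∈ Finset.range n, a j ≤ 1) (hc : 0 < c) (he : 0 ≤ e) (he1 : e ≤ 1 / 2)
    (hlb : ∀ᶠ i : ℕ in atTop, c * (i + 1 : ℝ) ^ (-1 / 2 - e) ≤ (i + 1 : ℝ) * a (i + 1)) :
    ∃ C₁ : ℝ, 0 < C₁ ∧ ∀ᶠ n : ℕ in atTop,
      ∑ m ∈ Finset.range (n + 1), renewalSeq a m ≤ C₁ * (n : ℝ) ^ (1 / 2 + e) := by
  obtain ⟨N, hN⟩ := eventually_atTop.1 hlb
  refine ⟨8 / c, by positivity, ?_⟩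
  filter_upwards [eventually_ge_atTop (N + 1)] with n hn
  have hn0 : (0 : ℝ) < n := by exact_mod_cast (by omega)
  set U := ∑ m ∈ Finset.range (n + 1), renewalSeq a m with hU
  have hU0 : 0 ≤ U := Finset.sum_nonneg fun i _ => renewalSeq_nonneg h0 ha i
  -- the tail of `a`
  have htail : c / 8 * (n : ℝ) ^ (-1 / 2 - e) ≤ 1 - ∑ j ∈ Finset.range (n + 1), a j := by
    have h1 := hsum (2 * n + 1)
    rw [← Finset.sum_range_add_sum_Ico _ (show n + 1 ≤ 2 * n + 1 by omega)] at h1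
    -- The factor `1/8` is `1/4` from the power of `j ≤ 2n` times `1/2` from `1/j ≥ 1/(2n)`.
    have h2 : ∀ j ∈ Finset.Ico (n + 1) (2 * n + 1),
        c / 8 * (n : ℝ) ^ (-1 / 2 - e) / n ≤ a j := by
      intro j hj
      rw [Finset.mem_Ico] at hj
      have h3 := hN (j - 1) (by omega)
      rw [show j - 1 + 1 = j by omega, show ((j - 1 : ℕ) : ℝ) + 1 = j by
        exact_mod_cast (by omega : j - 1 + 1 = j)] at h3
      have hj0 : (0 : ℝ) < j := by exact_mod_cast (by omega)
      have hj2 : (j : ℝ) ≤ 2 * n := by exact_mod_cast (by omega)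
      have h4 := rpow_le_four_mul_rpow (s := -1 / 2 - e) hj0 hj2 (by linarith) (by linarith)
      rw [div_le_iff₀ hn0]
      have h5 : (j : ℝ) * a j ≤ 2 * n * a j := mul_le_mul_of_nonneg_right hj2 (ha j)
      nlinarith [mul_le_mul_of_nonneg_left h4 hc.le]
    have h3 := Finset.card_nsmul_le_sum _ _ _ h2
    have hcard : (Finset.Ico (n + 1) (2 * n + 1)).card = n := by
      rw [Nat.card_Ico]; omega
    rw [hcard, nsmul_eq_mul, mul_div_cancel₀ _ hn0.ne'] at h3
    linarith
  have h1 : U * (1 - ∑ j ∈ Finset.range (n + 1), a j) ≤ 1 := by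
    refine le_of_le_of_eq ?_ (seqConv_renewalSeq_tail h0 n)
    rw [hU, Finset.sum_mul]
    refine Finset.sum_le_sum fun i hi => ?_
    refine mul_le_mul_of_nonneg_left ?_ (renewalSeq_nonneg h0 ha i)
    have : ∑ j ∈ Finset.range (n - i + 1), a j ≤ ∑ j ∈ Finset.range (n + 1), a j :=
      Finset.sum_le_sum_of_subset_of_nonneg
        (Finset.range_mono (by omega)) fun j _ _ => ha j
    exact sub_le_sub_left this 1
  have h2 : U * (c / 8 * (n : ℝ) ^ (-1 / 2 - e)) ≤ 1 :=
    (mul_le_mul_of_nonneg_left htail hU0).trans h1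
  have h3 : (n : ℝ) ^ (-1 / 2 - e) * (n : ℝ) ^ (1 / 2 + e) = 1 := by
    rw [← Real.rpow_add hn0]; ring_nf; simp
  have h4 : 0 < (n : ℝ) ^ (1 / 2 + e) := by positivity
  calc U = U * (c / 8 * (n : ℝ) ^ (-1 / 2 - e)) * (8 / c * (n : ℝ) ^ (1 / 2 + e)) := by
        rw [show U * (c / 8 * (n : ℝ) ^ (-1 / 2 - e)) * (8 / c * (n : ℝ) ^ (1 / 2 + e)) =
          U * (c / 8 * (8 / c)) * ((n : ℝ) ^ (-1 / 2 - e) * (n : ℝ) ^ (1 / 2 + e)) by ring, h3]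
        field_simp
    _ ≤ 1 * (8 / c * (n : ℝ) ^ (1 / 2 + e)) := by gcongr
    _ = _ := one_mul _

/-- Partial sums of the convolution square of the renewal mass function. -/
noncomputable def squareSum (a : ℕ → ℝ) (n : ℕ) : ℝ :=
  ∑ m ∈ Finset.range n, seqConv (renewalSeq a) (renewalSeq a) m

theorem squareSum_mono (h0 : a 0 = 0) (ha : ∀ n, 0 ≤ a n) : Monotone (squareSum a) := by
  refine monotone_nat_of_le_succ fun n => ?_
  unfold squareSum
  rw [Finset.sum_range_succ]
  have := seqConv_nonneg (renewalSeq_nonneg h0 ha) (renewalSeq_nonneg h0 ha) n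
  linarith

theorem squareSum_nonneg (h0 : a 0 = 0) (ha : ∀ n, 0 ≤ a n) (n : ℕ) : 0 ≤ squareSum a n :=
  Finset.sum_nonneg fun _ _ =>
    seqConv_nonneg (renewalSeq_nonneg h0 ha) (renewalSeq_nonneg h0 ha) _

theorem squareSum_succ (n : ℕ) :
    squareSum a (n + 1) = squareSum a n + seqConv (renewalSeq a) (renewalSeq a) n :=
  Finset.sum_range_succ _ _

theorem sum_reflect_le_squareSum (h0 : a 0 = 0) (ha : ∀ n, 0 ≤ a n) {s : Finset ℕ} {n J : ℕ}
    (hs : ∀ i ∈ s, J ≤ i ∧ i ≤ n) :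
    ∑ i ∈ s, seqConv (renewalSeq a) (renewalSeq a) (n - i) ≤ squareSum a (n + 1 - J) := by
  have hinj : Set.InjOn (fun i => n - i) s := by
    intro i hi j hj hij
    have := hs i hi; have := hs j hj
    simp only at hij; omega
  rw [← Finset.sum_image (f := fun m => seqConv (renewalSeq a) (renewalSeq a) m) hinj]
  refine Finset.sum_le_sum_of_subset_of_nonneg ?_ fun i _ _ =>
    seqConv_nonneg (renewalSeq_nonneg h0 ha) (renewalSeq_nonneg h0 ha) _
  intro m hm
  obtain ⟨i, hi, rfl⟩ := Finset.mem_image.1 hm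
  have := hs i hi
  rw [Finset.mem_range]; omega

/-- One half of a round of the bootstrap: a bound on `u` relative to `squareSum` becomes a bound on
`u * u`. One factor of each product has index at least `n / 2` and takes the pointwise bound; the
other is summed, at the price of `n ^ (1/2 + e)`. -/
theorem seqConv_renewalSeq_self_le_of_bound (h0 : a 0 = 0) (ha : ∀ n, 0 ≤ a n)
    {p K C₁ : ℝ} (hp1 : -2 ≤ p) (hp2 : p ≤ 0) (hK : 0 ≤ K)
    (hU : ∀ᶠ n : ℕ in atTop,
      ∑ m ∈ Finset.range (n + 1), renewalSeq a m ≤ C₁ * (n : ℝ) ^ (1 / 2 + e))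
    (hu : ∀ᶠ n : ℕ in atTop, renewalSeq a n ≤ K * (n : ℝ) ^ p * squareSum a n) :
    ∀ᶠ n : ℕ in atTop, seqConv (renewalSeq a) (renewalSeq a) n ≤
      8 * K * C₁ * (n : ℝ) ^ (p + 1 / 2 + e) * squareSum a n := by
  obtain ⟨N, hN⟩ := eventually_atTop.1 hu
  filter_upwards [hU, eventually_ge_atTop (2 * N + 1)] with n hn hn2
  have hn0 : (0 : ℝ) < n := by exact_mod_cast (by omega)
  have hV := squareSum_nonneg h0 ha n
  have hM : ∀ i, i ≤ n → n ≤ 2 * i → renewalSeq a i ≤ 4 * K * (n : ℝ) ^ p * squareSum a n := by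
    intro i hi hi2
    refine (hN i (by omega)).trans ?_
    have h1 : (i : ℝ) ^ p ≤ 4 * (n : ℝ) ^ p :=
      rpow_le_four_mul_rpow hn0 (by exact_mod_cast hi2) hp2 hp1
    have h2 := squareSum_mono h0 ha hi
    have h3 := squareSum_nonneg h0 ha i
    calc K * (i : ℝ) ^ p * squareSum a i ≤ K * (4 * (n : ℝ) ^ p) * squareSum a n := by gcongr
      _ = _ := by ring
  refine (seqConv_self_le (renewalSeq_nonneg h0 ha) hM).trans ?_
  have h4 : 0 ≤ 2 * (4 * K * (n : ℝ) ^ p * squareSum a n) := by positivity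
  refine (mul_le_mul_of_nonneg_left hn h4).trans (le_of_eq ?_)
  rw [add_assoc, Real.rpow_add hn0 p]
  ring

/-- The starting point of the bootstrap: in `u' = a' u²` the weights `(i + 1) * a (i + 1)` are just
bounded by a constant. -/
theorem renewalSeq_le_squareSum (h0 : a 0 = 0) (ha : ∀ n, 0 ≤ a n)
    (hub : ∀ i : ℕ, (i + 1 : ℝ) * a (i + 1) ≤ C) {n : ℕ} (hn : 0 < n) :
    renewalSeq a n ≤ C * (n : ℝ) ^ (-1 : ℝ) * squareSum a n := by
  obtain ⟨m, rfl⟩ : ∃ m, n = m + 1 := ⟨n - 1, by omega⟩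
  have h1 := succ_mul_renewalSeq_succ h0 m
  have hC : 0 ≤ C := le_trans (mul_nonneg (by positivity) (ha _)) (hub 0)
  have h2 : (m + 1 : ℝ) * renewalSeq a (m + 1) ≤ C * squareSum a (m + 1) := by
    rw [h1]
    refine le_trans ?_ (mul_le_mul_of_nonneg_left (sum_reflect_le_squareSum h0 ha
      (s := Finset.range (m + 1)) (n := m) (J := 0) fun i hi => ?_) hC)
    · rw [Finset.mul_sum]
      exact Finset.sum_le_sum fun i _ => mul_le_mul_of_nonneg_right (hub i)
        (seqConv_nonneg (renewalSeq_nonneg h0 ha) (renewalSeq_nonneg h0 ha) _)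
    · rw [Finset.mem_range] at hi; omega
  rw [Real.rpow_neg_one, mul_right_comm, ← div_eq_mul_inv, le_div_iff₀ (by positivity)]
  push_cast
  linarith

/-- The second round gains `n ^ (-1/6)` by splitting `n u(n) = ∑ b(i) v(n-1-i)`, `b(i) = (i+1)
a(i+1)`, at `J ~ n ^ (1/3)`. Below `J` there are few terms, each with `v` of relative size `n ^
(-1/2 + e)`; above `J` the weight `b(i)` is at most of order `J ^ (-1/2) = n ^ (-1/6)` and the
values of `v` sum to at most `squareSum`. -/
theorem renewalSeq_le_squareSum_improved (h0 : a 0 = 0) (ha : ∀ n, 0 ≤ a n) (hC : 0 < C)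
    (he : 0 ≤ e) (he1 : e ≤ 1 / 12)
    (hub : ∀ i : ℕ, (i + 1 : ℝ) * a (i + 1) ≤ C * (i + 1 : ℝ) ^ (-1 / 2 : ℝ))
    {C₂ : ℝ} (hC₂ : 0 < C₂)
    (hv : ∀ᶠ n : ℕ in atTop, seqConv (renewalSeq a) (renewalSeq a) n ≤
      C₂ * (n : ℝ) ^ (-1 / 2 + e) * squareSum a n) :
    ∃ C₃ : ℝ, 0 < C₃ ∧ ∀ᶠ n : ℕ in atTop,
      renewalSeq a n ≤ C₃ * (n : ℝ) ^ (-7 / 6 + e) * squareSum a n := by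
  obtain ⟨N, hN⟩ := eventually_atTop.1 hv
  refine ⟨8 * C * C₂ + C, by positivity, ?_⟩
  have hJ := eventually_mul_rpow_le 8 (show (1 / 3 : ℝ) < 1 by norm_num)
  filter_upwards [hJ, eventually_ge_atTop (4 * N + 8)] with n hn hn2
  obtain ⟨m, rfl⟩ : ∃ m, n = m + 1 := ⟨n - 1, by omega⟩
  have hm0 : (0 : ℝ) < ((m + 1 : ℕ) : ℝ) := by positivity
  rw [Real.rpow_one] at hn
  set x : ℝ := ((m + 1 : ℕ) : ℝ) with hx
  have hx1 : 1 ≤ x := by rw [hx]; push_cast; linarith [(Nat.cast_nonneg m : (0 : ℝ) ≤ m)]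
  set J := ⌈x ^ (1 / 3 : ℝ)⌉₊ with hJd
  have hJ1 : x ^ (1 / 3 : ℝ) ≤ J := Nat.le_ceil _
  have hx3 : 1 ≤ x ^ (1 / 3 : ℝ) := Real.one_le_rpow hx1 (by norm_num)
  have hJ2 : (J : ℝ) ≤ 2 * x ^ (1 / 3 : ℝ) := by
    have := (Nat.ceil_lt_add_one (show 0 ≤ x ^ (1 / 3 : ℝ) by positivity)).le
    linarith
  have hJ4 : 4 * J ≤ m + 1 := by
    have : ((4 * J : ℕ) : ℝ) ≤ ((m + 1 : ℕ) : ℝ) := by push_cast at hx hn ⊢; linarith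
    exact Nat.cast_le.1 this
  set v := seqConv (renewalSeq a) (renewalSeq a) with hvd
  have hv0 : ∀ n, 0 ≤ v n := seqConv_nonneg (renewalSeq_nonneg h0 ha) (renewalSeq_nonneg h0 ha)
  set V := squareSum a (m + 1) with hV
  have hV0 : 0 ≤ V := squareSum_nonneg h0 ha _
  have hb1 : ∀ i : ℕ, (i + 1 : ℝ) * a (i + 1) ≤ C := fun i => (hub i).trans (by
    have : (i + 1 : ℝ) ^ (-1 / 2 : ℝ) ≤ 1 :=
      Real.rpow_le_one_of_one_le_of_nonpos (by linarith [(Nat.cast_nonneg i : (0 : ℝ) ≤ i)])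
        (by norm_num)
    nlinarith)
  have h1 := succ_mul_renewalSeq_succ h0 m
  have e1 : x * renewalSeq a (m + 1) =
      (∑ i ∈ Finset.range J, (i + 1 : ℝ) * a (i + 1) * v (m - i)) +
        ∑ i ∈ Finset.Ico J (m + 1), (i + 1 : ℝ) * a (i + 1) * v (m - i) := by
    rw [Finset.sum_range_add_sum_Ico _ (by omega), hx]
    push_cast
    exact h1
  have e2 : ∑ i ∈ Finset.range J, (i + 1 : ℝ) * a (i + 1) * v (m - i) ≤
      8 * C * C₂ * x ^ (-1 / 6 + e) * V := by
    have h2 : ∀ i ∈ Finset.range J, (i + 1 : ℝ) * a (i + 1) * v (m - i) ≤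
        C * (C₂ * (4 * x ^ (-1 / 2 + e)) * V) := by
      intro i hi
      rw [Finset.mem_range] at hi
      have h3 := hN (m - i) (by omega)
      have h4 : ((m - i : ℕ) : ℝ) ^ (-1 / 2 + e) ≤ 4 * x ^ (-1 / 2 + e) :=
        rpow_le_four_mul_rpow hm0 (by rw [hx]; exact_mod_cast (by omega)) (by linarith)
          (by linarith)
      have h5 : squareSum a (m - i) ≤ V := squareSum_mono h0 ha (by omega)
      have h6 := squareSum_nonneg h0 ha (m - i)
      refine mul_le_mul (hb1 i) (h3.trans ?_) (hv0 _) hC.le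
      gcongr
    refine (Finset.sum_le_card_nsmul _ _ _ h2).trans ?_
    rw [Finset.card_range, nsmul_eq_mul]
    have h7 : x ^ (-1 / 6 + e) = x ^ (1 / 3 : ℝ) * x ^ (-1 / 2 + e) := by
      rw [← Real.rpow_add hm0]; ring_nf
    rw [h7]
    calc (J : ℝ) * (C * (C₂ * (4 * x ^ (-1 / 2 + e)) * V))
        ≤ (2 * x ^ (1 / 3 : ℝ)) * (C * (C₂ * (4 * x ^ (-1 / 2 + e)) * V)) := by gcongr
      _ = _ := by ring
  have e3 : ∑ i ∈ Finset.Ico J (m + 1), (i + 1 : ℝ) * a (i + 1) * v (m - i) ≤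
      C * x ^ (-1 / 6 + e) * V := by
    have h2 : ∀ i ∈ Finset.Ico J (m + 1), (i + 1 : ℝ) * a (i + 1) * v (m - i) ≤
        C * x ^ (-1 / 6 + e) * v (m - i) := by
      intro i hi
      rw [Finset.mem_Ico] at hi
      refine mul_le_mul_of_nonneg_right ((hub i).trans ?_) (hv0 _)
      have h3 : x ^ (1 / 3 : ℝ) ≤ (i + 1 : ℝ) := by
        have : (J : ℝ) ≤ i := by exact_mod_cast hi.1
        linarith
      have h4 : (i + 1 : ℝ) ^ (-1 / 2 : ℝ) ≤ (x ^ (1 / 3 : ℝ)) ^ (-1 / 2 : ℝ) :=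
        Real.rpow_le_rpow_of_nonpos (by positivity) h3 (by norm_num)
      rw [← Real.rpow_mul hm0.le] at h4
      have h5 : x ^ ((1 / 3 : ℝ) * (-1 / 2)) ≤ x ^ (-1 / 6 + e) :=
        Real.rpow_le_rpow_of_exponent_le hx1 (by linarith)
      exact mul_le_mul_of_nonneg_left (h4.trans h5) hC.le
    refine (Finset.sum_le_sum h2).trans ?_
    rw [← Finset.mul_sum]
    refine mul_le_mul_of_nonneg_left ?_ (by positivity)
    have := sum_reflect_le_squareSum h0 ha (s := Finset.Ico J (m + 1)) (n := m) (J := 0)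
      fun i hi => by rw [Finset.mem_Ico] at hi; omega
    exact this
  have e4 : x * renewalSeq a (m + 1) ≤ (8 * C * C₂ + C) * x ^ (-1 / 6 + e) * V := by
    rw [e1]; linarith
  have h8 : x * x ^ (-7 / 6 + e) = x ^ (-1 / 6 + e) := by
    nth_rewrite 1 [← Real.rpow_one x]
    rw [← Real.rpow_add hm0]; ring_nf
  rw [← h8] at e4
  refine le_of_mul_le_mul_left (e4.trans (le_of_eq ?_)) hm0
  ring

/-- The mass function of a renewal process, recurrent or terminating, whose interarrival law `a`
is such that `n a(n)` is flat and is roughly of order `n ^ (-1/2)`, is flat. -/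
theorem isFlat_renewalSeq (h0 : a 0 = 0) (ha : ∀ n, 0 ≤ a n)
    (hsum : ∀ n, ∑ j ∈ Finset.range n, a j ≤ 1) (hC : 0 < C) (hc : 0 < c)
    (hub : ∀ i : ℕ, (i + 1 : ℝ) * a (i + 1) ≤ C * (i + 1 : ℝ) ^ (-1 / 2 : ℝ))
    (hlb : ∀ᶠ i : ℕ in atTop,
      c * (i + 1 : ℝ) ^ (-1 / 2 - 1 / 36 : ℝ) ≤ (i + 1 : ℝ) * a (i + 1))
    (hflat : IsFlat fun i => (i + 1 : ℝ) * a (i + 1)) : IsFlat (renewalSeq a) := by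
  have hu0 := renewalSeq_nonneg h0 ha
  set v := seqConv (renewalSeq a) (renewalSeq a) with hvd
  have hv0 : ∀ n, 0 ≤ v n := seqConv_nonneg hu0 hu0
  have hb0 : ∀ i : ℕ, 0 ≤ (i + 1 : ℝ) * a (i + 1) := fun i => mul_nonneg (by positivity) (ha _)
  have hb1 : ∀ i : ℕ, (i + 1 : ℝ) * a (i + 1) ≤ C := fun i => (hub i).trans (by
    have : (i + 1 : ℝ) ^ (-1 / 2 : ℝ) ≤ 1 :=
      Real.rpow_le_one_of_one_le_of_nonpos (by linarith [(Nat.cast_nonneg i : (0 : ℝ) ≤ i)])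
        (by norm_num)
    nlinarith)
  obtain ⟨C₁, hC₁, hU⟩ := sum_renewalSeq_le h0 ha hsum hc (by norm_num) (by norm_num) hlb
  -- First round: `v n` is of order at most `n ^ (-1/2 + 1/36)` relative to `squareSum`. This is not
  -- enough, because the comparison below needs a power less than `-1/2 - 1/36`.
  have hv1 := seqConv_renewalSeq_self_le_of_bound h0 ha (e := 1 / 36)
    (p := -1) (by norm_num) (by norm_num) hC.le hU
    ((eventually_gt_atTop 0).mono fun n hn => renewalSeq_le_squareSum h0 ha hb1 hn)
  have hv1' : ∀ᶠ n : ℕ in atTop, v n ≤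
      8 * C * C₁ * (n : ℝ) ^ (-1 / 2 + 1 / 36 : ℝ) * squareSum a n := by
    filter_upwards [hv1] with n hn
    convert hn using 4
    norm_num
  obtain ⟨C₃, hC₃, hu3⟩ := renewalSeq_le_squareSum_improved h0 ha hC (e := 1 / 36) (by norm_num)
    (by norm_num) hub (show 0 < 8 * C * C₁ by positivity) hv1'
  -- Second round: the relative order is now `-7/6 + 1/36 + 1/2 + 1/36 = -22/36`, which is below
  -- `-1/2 - 1/36 = -19/36`.
  have hv2 := seqConv_renewalSeq_self_le_of_bound h0 ha (e := 1 / 36)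
    (p := -7 / 6 + 1 / 36) (by norm_num) (by norm_num) hC₃.le hU hu3
  set C₅ := 8 * C₃ * C₁ with hC₅
  have hC₅0 : 0 < C₅ := by positivity
  -- doubling of the partial sums
  have hdouble : ∀ᶠ n : ℕ in atTop, squareSum a (n + 1) ≤ 2 * squareSum a n := by
    filter_upwards [hv1', eventually_mul_rpow_le (8 * C * C₁)
      (show (-1 / 2 + 1 / 36 : ℝ) < 0 by norm_num)] with n h1 h2
    rw [Real.rpow_zero] at h2
    rw [squareSum_succ]
    have := squareSum_nonneg h0 ha n
    nlinarith
  obtain ⟨D, hD⟩ := eventually_atTop.1 hdouble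
  have hdouble' : ∀ J n : ℕ, D ≤ n → squareSum a (n + J) ≤ 2 ^ J * squareSum a n := by
    intro J n hn
    induction J with
    | zero => simp
    | succ J ih =>
      have := hD (n + J) (by omega)
      rw [← add_assoc, pow_succ]
      linarith
  obtain ⟨J₀, hJ₀⟩ := eventually_atTop.1 hlb
  -- The lower bound on the weights holds only from `J₀` on. The sum loses its `J₀` terms with the
  -- smallest `i`, that is the last values of `v`; by the doubling bound this costs a factor `2 ^
  -- J₀` at most.
  have hlow : ∀ n : ℕ, D + J₀ ≤ n → c * (n + 1 : ℝ) ^ (-1 / 2 - 1 / 36 : ℝ) *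
      ((2 ^ J₀)⁻¹ * squareSum a (n + 1)) ≤ (n + 1 : ℝ) * renewalSeq a (n + 1) := by
    intro n hn
    rw [succ_mul_renewalSeq_succ h0]
    have h1 : (2 ^ J₀)⁻¹ * squareSum a (n + 1) ≤ squareSum a (n + 1 - J₀) := by
      have := hdouble' J₀ (n + 1 - J₀) (by omega)
      rw [Nat.sub_add_cancel (by omega)] at this
      rwa [inv_mul_le_iff₀ (by positivity)]
    have h2 : squareSum a (n + 1 - J₀) = ∑ i ∈ Finset.Ico J₀ (n + 1), v (n - i) := by
      unfold squareSum
      rw [Finset.sum_Ico_eq_sum_range, ← Finset.sum_range_reflect]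
      refine Finset.sum_congr rfl fun i hi => ?_
      rw [Finset.mem_range] at hi
      congr 1; omega
    have hpos : 0 ≤ c * (n + 1 : ℝ) ^ (-1 / 2 - 1 / 36 : ℝ) := by positivity
    refine (mul_le_mul_of_nonneg_left h1 hpos).trans ?_
    rw [h2, Finset.mul_sum]
    refine (Finset.sum_le_sum fun i hi => ?_).trans (Finset.sum_le_sum_of_subset_of_nonneg
      (f := fun i : ℕ => (i + 1 : ℝ) * a (i + 1) * v (n - i)) (s := Finset.Ico J₀ (n + 1)) ?_
        fun i _ _ => mul_nonneg (hb0 i) (hv0 _))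
    · rw [Finset.mem_Ico] at hi
      refine mul_le_mul_of_nonneg_right (le_trans ?_ (hJ₀ i hi.1)) (hv0 _)
      refine mul_le_mul_of_nonneg_left ?_ hc.le
      refine Real.rpow_le_rpow_of_nonpos (by positivity) ?_ (by norm_num)
      have : (i : ℝ) ≤ n := by exact_mod_cast (by omega)
      linarith
    · intro i hi
      rw [Finset.mem_Ico] at hi
      rw [Finset.mem_range]; omega
  refine isFlat_of_mul_succ_eq_seqConv (succ_mul_renewalSeq_succ h0) hu0 hb0 hflat hv0 ?_
  intro J η hη
  obtain ⟨M, hM⟩ := eventually_atTop.1 hv2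
  have hfin := (tendsto_add_atTop_nat 1).eventually
    (eventually_mul_rpow_le (4 * C₅ / (η * (c * (2 ^ J₀)⁻¹)))
      (show (-7 / 6 + 1 / 36 + 1 / 2 + 1 / 36 : ℝ) < -1 / 2 - 1 / 36 by norm_num))
  filter_upwards [hfin, eventually_ge_atTop (M + D + J₀ + 2 * J + 1)] with n hn hn2 m hm1 hm2
  push_cast at hn
  have hx : (0 : ℝ) < n + 1 := by positivity
  have hV := squareSum_nonneg h0 ha (n + 1)
  rw [div_mul_eq_mul_div, div_le_iff₀ (by positivity)] at hn
  have h1 : (m : ℝ) ^ (-7 / 6 + 1 / 36 + 1 / 2 + 1 / 36 : ℝ) ≤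
      4 * (n + 1 : ℝ) ^ (-7 / 6 + 1 / 36 + 1 / 2 + 1 / 36 : ℝ) :=
    rpow_le_four_mul_rpow hx (by exact_mod_cast (by omega)) (by norm_num) (by norm_num)
  calc v m ≤ C₅ * (m : ℝ) ^ (-7 / 6 + 1 / 36 + 1 / 2 + 1 / 36 : ℝ) * squareSum a m :=
        hM m (by omega)
    _ ≤ C₅ * (4 * (n + 1 : ℝ) ^ (-7 / 6 + 1 / 36 + 1 / 2 + 1 / 36 : ℝ)) *
        squareSum a (n + 1) := by
      have := squareSum_mono h0 ha hm2
      have := squareSum_nonneg h0 ha m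
      gcongr
    _ = 4 * C₅ * (n + 1 : ℝ) ^ (-7 / 6 + 1 / 36 + 1 / 2 + 1 / 36 : ℝ) *
        squareSum a (n + 1) := by ring
    _ ≤ (n + 1 : ℝ) ^ (-1 / 2 - 1 / 36 : ℝ) * (η * (c * (2 ^ J₀)⁻¹)) * squareSum a (n + 1) :=
      mul_le_mul_of_nonneg_right hn hV
    _ = η * (c * (n + 1 : ℝ) ^ (-1 / 2 - 1 / 36 : ℝ) *
        ((2 ^ J₀)⁻¹ * squareSum a (n + 1))) := by ring
    _ ≤ _ := mul_le_mul_of_nonneg_left (hlow n (by omega)) hη.le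

end Renewal

/-! ### The renewal theorem for finite means, and exponential tilting. -/

/-- Dominated convergence for truncated convolutions along a sequence of indices. -/
theorem tendsto_seqConv_of_summable {g u x : ℕ → ℝ} {φ : ℕ → ℕ} {B : ℝ} (hg : Summable g)
    (hg0 : ∀ n, 0 ≤ g n) (hu : ∀ n, |u n| ≤ B) (hφ : Tendsto φ atTop atTop)
    (hx : ∀ i, Tendsto (fun k => u (φ k - i)) atTop (𝓝 (x i))) :
    Tendsto (fun k => seqConv g u (φ k)) atTop (𝓝 (∑' i, g i * x i)) := by
  have h1 : ∀ k, seqConv g u (φ k) = ∑' i, if i ≤ φ k then g i * u (φ k - i) else 0 := by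
    intro k
    rw [tsum_eq_sum (s := Finset.range (φ k + 1))]
    · refine Finset.sum_congr rfl fun i hi => ?_
      rw [Finset.mem_range] at hi
      rw [if_pos (by omega)]
    · intro i hi
      rw [Finset.mem_range] at hi
      rw [if_neg (by omega)]
  simp_rw [h1]
  refine tendsto_tsum_of_dominated_convergence (hg.mul_right B) (fun i => ?_)
    (Eventually.of_forall fun k i => ?_)
  · refine ((hx i).const_mul (g i)).congr' ?_
    filter_upwards [hφ.eventually_ge_atTop i] with k hk
    rw [if_pos hk]
  · split_ifs
    · rw [norm_mul, Real.norm_of_nonneg (hg0 i)]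
      exact mul_le_mul_of_nonneg_left (hu _) (hg0 i)
    · rw [norm_zero]
      exact mul_nonneg (hg0 i) ((abs_nonneg _).trans (hu 0))

/-- A maximum principle: an average of values that all lie on one side of `L` equals `L` only if
every value of positive weight is `L`; the weight of `y 0` is positive. -/
theorem eq_of_tsum_mul_eq {a y : ℕ → ℝ} {L : ℝ} (ha : ∀ n, 0 ≤ a n) (h1 : 0 < a 0)
    (hsum : HasSum a 1) (hy : ∀ n, |y n| ≤ 1)
    (hL : (∀ n, y n ≤ L) ∨ ∀ n, L ≤ y n) (h : ∑' i, a i * y i = L) : y 0 = L := by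
  have hs : Summable fun i => a i * y i :=
    Summable.of_norm_bounded hsum.summable fun i => by
      rw [norm_mul, Real.norm_of_nonneg (ha i)]
      exact mul_le_of_le_one_right (ha i) (hy i)
  have h2 : HasSum (fun i => a i * (y i - L)) 0 := by
    have := hs.hasSum.sub (hsum.mul_right L)
    rw [h, one_mul, sub_self] at this
    simpa [mul_sub] using this
  have h3 : a 0 * (y 0 - L) = 0 := by
    rcases hL with hL | hL
    · have h4 : HasSum (fun i => a i * (L - y i)) 0 := by
        have := h2.neg
        simpa [mul_sub] using this
      have := (hasSum_zero_iff_of_nonneg fun i => mul_nonneg (ha i) (sub_nonneg.2 (hL i))).1 h4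
      have := congrFun this 0
      simp only [Pi.zero_apply] at this
      linarith
    · have := (hasSum_zero_iff_of_nonneg fun i => mul_nonneg (ha i) (sub_nonneg.2 (hL i))).1 h2
      exact congrFun this 0
  rcases mul_eq_zero.1 h3 with h4 | h4
  · exact absurd h4 h1.ne'
  · linarith

theorem renewalSeq_le_one {a : ℕ → ℝ} (h0 : a 0 = 0) (ha : ∀ n, 0 ≤ a n)
    (hsum : ∀ n, ∑ j ∈ Finset.range n, a j ≤ 1) (n : ℕ) : renewalSeq a n ≤ 1 := by
  induction n using Nat.strong_induction_on with
  | _ n ih =>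
    cases n with
    | zero => rw [renewalSeq_zero h0]
    | succ n =>
      rw [renewalSeq_succ h0]
      calc seqConv (fun i => a (i + 1)) (renewalSeq a) n
          ≤ ∑ i ∈ Finset.range (n + 1), a (i + 1) := by
            refine Finset.sum_le_sum fun i hi => mul_le_of_le_one_right (ha _) (ih _ (by omega))
        _ ≤ ∑ i ∈ Finset.range (n + 2), a i := by
            rw [Finset.sum_range_succ' _ (n + 1)]
            linarith [ha 0]
        _ ≤ 1 := hsum _

/-- The renewal theorem for an interarrival law that charges `1` and has a finite mean. -/
theorem tendsto_renewalSeq {a : ℕ → ℝ} (h0 : a 0 = 0) (ha : ∀ n, 0 ≤ a n) (h1 : 0 < a 1)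
    (hsum : HasSum a 1) (htail : Summable fun n => 1 - ∑ j ∈ Finset.range (n + 1), a j) :
    ∃ L : ℝ, 0 < L ∧ Tendsto (renewalSeq a) atTop (𝓝 L) := by
  set u := renewalSeq a with hu
  set Q := fun n => 1 - ∑ j ∈ Finset.range (n + 1), a j with hQ
  have hle : ∀ n, ∑ j ∈ Finset.range n, a j ≤ 1 := fun n => sum_le_hasSum _ (fun i _ => ha i) hsum
  have hu0 : ∀ n, 0 ≤ u n := renewalSeq_nonneg h0 ha
  have hu1 : ∀ n, u n ≤ 1 := renewalSeq_le_one h0 ha hle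
  have huabs : ∀ n, |u n| ≤ 1 := fun n => by rw [abs_of_nonneg (hu0 n)]; exact hu1 n
  have hQ0 : ∀ n, 0 ≤ Q n := fun n => sub_nonneg.2 (hle _)
  have hb1 : IsBoundedUnder (· ≤ ·) atTop u := isBoundedUnder_of ⟨1, hu1⟩
  have hb2 : IsBoundedUnder (· ≥ ·) atTop u := isBoundedUnder_of ⟨0, hu0⟩
  have hsucc : HasSum (fun i => a (i + 1)) 1 := by
    rw [hasSum_nat_add_iff' 1 (f := a) (g := 1) |>.symm] at hsum
    simpa [h0] using hsum
  -- an extremal cluster point `L` satisfies `L * ∑ Q = 1`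
  have key : ∀ L : ℝ, ((∀ x, MapClusterPt x atTop u → x ≤ L) ∨
      ∀ x, MapClusterPt x atTop u → L ≤ x) → MapClusterPt L atTop u → L * ∑' n, Q n = 1 := by
    intro L hL hLc
    obtain ⟨φ, hφu, hφ⟩ := hLc.exists_seq_tendsto
    -- Seen backwards from a time at which `u` is close to `L`, the sequence is a point of the
    -- compact space `[0,1]^ℕ`. The limit `x` of a subsequence inherits the renewal equation.
    obtain ⟨x, hxI, ψ, hψ, hx⟩ := (isCompact_univ_pi fun _ : ℕ => isCompact_Icc (a := (0 : ℝ))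
      (b := 1)).tendsto_subseq (x := fun k i => u (φ k - i)) fun k i _ => ⟨hu0 _, hu1 _⟩
    set θ := φ ∘ ψ with hθ
    have hθt : Tendsto θ atTop atTop := hφ.comp hψ.tendsto_atTop
    have hxi : ∀ i, Tendsto (fun k => u (θ k - i)) atTop (𝓝 (x i)) := tendsto_pi_nhds.1 hx
    have hxabs : ∀ i, |x i| ≤ 1 := fun i => by
      have := hxI i trivial
      rw [abs_of_nonneg this.1]; exact this.2
    have hcl : ∀ i, MapClusterPt (x i) atTop u := fun i =>
      MapClusterPt.of_comp ((tendsto_sub_atTop_nat i).comp hθt) (hxi i).mapClusterPt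
    have hx0 : x 0 = L := tendsto_nhds_unique (f := fun k => u (θ k)) (hxi 0)
      (hφu.comp hψ.tendsto_atTop)
    have hrec : ∀ i, ∑' j, a (j + 1) * x (i + 1 + j) = x i := by
      intro i
      have h2 : Tendsto (fun k => seqConv (fun j => a (j + 1)) u (θ k - (i + 1))) atTop
          (𝓝 (∑' j, a (j + 1) * x (i + 1 + j))) := by
        refine tendsto_seqConv_of_summable hsucc.summable (fun n => ha _) huabs
          (φ := fun k => θ k - (i + 1)) ((tendsto_sub_atTop_nat (i + 1)).comp hθt) fun j => ?_
        refine (hxi (i + 1 + j)).congr fun k => ?_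
        rw [Nat.sub_sub]
      refine tendsto_nhds_unique h2 ((hxi i).congr' ?_)
      filter_upwards [hθt.eventually_ge_atTop (i + 1)] with k hk
      rw [← renewalSeq_succ h0, hu]
      congr 1; omega
    -- As `L` is extremal and `a 1 > 0`, the maximum principle propagates the value `L` from each
    -- time to the preceding one.
    have hconst : ∀ i, x i = L := by
      intro i
      induction i with
      | zero => exact hx0
      | succ i ih =>
        refine eq_of_tsum_mul_eq (a := fun j => a (j + 1)) (y := fun j => x (i + 1 + j))
          (fun n => ha _) h1 hsucc (fun n => hxabs _) ?_ ((hrec i).trans ih)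
        exact hL.imp (fun h n => h _ (hcl _)) (fun h n => h _ (hcl _))
    -- With a constant limit, passing to the limit in the convolution of the tails with `u`, which
    -- is identically `1`, determines `L`.
    have h3 := tendsto_seqConv_of_summable (g := Q) htail hQ0 huabs hθt hxi
    have h4 : ∀ n, seqConv Q u n = 1 := fun n => by
      have h5 := coeff_mk_mul_mk Q u
      rw [mul_comm, coeff_mk_mul_mk] at h5
      have := congrArg (PowerSeries.coeff n) h5
      simp only [PowerSeries.coeff_mk] at this
      rw [← this]
      exact seqConv_renewalSeq_tail h0 n
    simp only [h4, hconst] at h3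
    rw [tsum_mul_right] at h3
    rw [mul_comm]
    exact (tendsto_nhds_unique h3 tendsto_const_nhds)
  have hs := key (limsup u atTop) (Or.inl fun x hx => hx.le_limsup hb1)
    (MapClusterPt.limsup hb2.isCoboundedUnder_le hb1)
  have hi := key (liminf u atTop) (Or.inr fun x hx => hx.liminf_le hb2)
    (MapClusterPt.liminf hb1.isCoboundedUnder_ge hb2)
  have hm : 0 < ∑' n, Q n := by
    have := htail.sum_le_tsum {0} fun i _ => hQ0 i
    simp only [Finset.sum_singleton] at this
    have h2 : Q 0 = 1 := by simp [hQ, h0]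
    linarith
  refine ⟨limsup u atTop, ?_, tendsto_of_liminf_eq_limsup ?_ rfl hb1 hb2⟩
  · exact pos_of_mul_pos_left (by rw [hs]; exact one_pos) hm.le
  · exact mul_right_cancel₀ hm.ne' (hi.trans hs.symm)

/-- Exponential tilting of a renewal mass function. -/
theorem renewalSeq_mul_pow {a : ℕ → ℝ} (h0 : a 0 = 0) (r : ℝ) (n : ℕ) :
    renewalSeq (fun n => a n * r ^ n) n = renewalSeq a n * r ^ n := by
  refine congrFun (eq_renewalSeq (u := fun n => renewalSeq a n * r ^ n) (by simp [h0]) ?_).symm n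
  ext n
  rw [coeff_mk_mul_mk]
  have h := congrArg (PowerSeries.coeff n) (mk_renewalSeq_eq h0)
  rw [coeff_mk_mul_mk] at h
  simp only [map_add, PowerSeries.coeff_mk] at h ⊢
  rw [h, add_mul]
  congr 1
  · rw [PowerSeries.coeff_one]; split_ifs with h <;> simp [h]
  · unfold seqConv
    rw [Finset.sum_mul]
    refine Finset.sum_congr rfl fun i hi => ?_
    rw [Finset.mem_range] at hi
    have : r ^ n = r ^ i * r ^ (n - i) := by rw [← pow_add]; congr 1; omega
    rw [this]; ring

/-- Intermediate value theorem for the generating function on `[0, 1]`, which runs from `0` to `S >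
1`. -/
theorem exists_pow_tsum_eq_one {a : ℕ → ℝ} (h0 : a 0 = 0) (ha : ∀ n, 0 ≤ a n) {S : ℝ}
    (hS : HasSum a S) (h1 : 1 < S) :
    ∃ r : ℝ, 0 < r ∧ r < 1 ∧ HasSum (fun n => a n * r ^ n) 1 := by
  have hsum : ∀ r ∈ Icc (0 : ℝ) 1, Summable fun n => a n * r ^ n := fun r hr =>
    Summable.of_nonneg_of_le (fun n => mul_nonneg (ha n) (pow_nonneg hr.1 n))
      (fun n => mul_le_of_le_one_right (ha n) (pow_le_one₀ hr.1 hr.2)) hS.summable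
  have hcont : ContinuousOn (fun r : ℝ => ∑' n, a n * r ^ n) (Icc 0 1) := by
    refine continuousOn_tsum (u := a) (fun n => by fun_prop) hS.summable fun n r hr => ?_
    rw [Real.norm_of_nonneg (mul_nonneg (ha n) (pow_nonneg hr.1 n))]
    exact mul_le_of_le_one_right (ha n) (pow_le_one₀ hr.1 hr.2)
  have h00 : ∑' n, a n * (0 : ℝ) ^ n = 0 := by
    have : (fun n => a n * (0 : ℝ) ^ n) = fun _ => 0 := by
      funext n
      cases n with
      | zero => simp [h0]
      | succ n => simp
    rw [this, tsum_zero]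
  have h11 : ∑' n, a n * (1 : ℝ) ^ n = S := by simpa using hS.tsum_eq
  obtain ⟨r, hr, hr1⟩ := intermediate_value_Icc (zero_le_one' ℝ) hcont
    (show (1 : ℝ) ∈ Icc _ _ by simp only [h00, h11]; exact ⟨zero_le_one, h1.le⟩)
  simp only at hr1
  refine ⟨r, lt_of_le_of_ne hr.1 ?_, lt_of_le_of_ne hr.2 ?_, ?_⟩
  · rintro rfl; rw [h00] at hr1; exact zero_ne_one hr1
  · rintro rfl; rw [h11] at hr1; exact h1.ne' hr1
  · rw [← hr1]; exact (hsum r hr).hasSum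

/-- The tilted law has a finite mean, in the form of summable tails: the tail beyond `n` is at most
`r ^ n` times the total mass of `a`. -/
theorem summable_tail_mul_pow {a : ℕ → ℝ} (ha : ∀ n, 0 ≤ a n) (hS : Summable a) {r : ℝ}
    (hr0 : 0 < r) (hr1 : r < 1) (h1 : HasSum (fun n => a n * r ^ n) 1) :
    Summable fun n => 1 - ∑ j ∈ Finset.range (n + 1), a j * r ^ j := by
  have hp : ∀ n, 0 ≤ a n * r ^ n := fun n => mul_nonneg (ha n) (pow_nonneg hr0.le n)
  refine Summable.of_nonneg_of_le (fun n => sub_nonneg.2 (sum_le_hasSum _ (fun i _ => hp i) h1))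
    (fun n => ?_) ((summable_geometric_of_lt_one hr0.le hr1).mul_left (∑' n, a n))
  have h2 := h1.summable.sum_add_tsum_nat_add (n + 1)
  rw [h1.tsum_eq] at h2
  rw [← h2, add_sub_cancel_left]
  have hs1 : Summable fun i => a (i + (n + 1)) := (summable_nat_add_iff (n + 1)).2 hS
  have hs2 : Summable fun i => a (i + (n + 1)) * r ^ (i + (n + 1)) :=
    (summable_nat_add_iff (f := fun i => a i * r ^ i) (n + 1)).2 h1.summable
  have hle : ∀ i, a (i + (n + 1)) * r ^ (i + (n + 1)) ≤ a (i + (n + 1)) * r ^ n := fun i =>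
    mul_le_mul_of_nonneg_left
      (pow_le_pow_of_le_one hr0.le hr1.le (show n ≤ i + (n + 1) by omega)) (ha _)
  have h3 := Summable.tsum_le_tsum hle hs2 (hs1.mul_right _)
  rw [tsum_mul_right] at h3
  refine h3.trans (mul_le_mul_of_nonneg_right ?_ (pow_nonneg hr0.le n))
  rw [← hS.sum_add_tsum_nat_add (n + 1)]
  exact le_add_of_nonneg_left (Finset.sum_nonneg fun i _ => ha i)

/-! ### Ratio limits of partition functions in terms of renewal sequences. -/

/-- The asymptotics of `n k(n)` that make renewal mass functions flat. -/
structure HasSquareRootTail (k : ℕ → ℝ) : Prop where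
  zero : k 0 = 0
  nonneg : ∀ n, 0 ≤ k n
  one_pos : 0 < k 1
  upper : ∃ C : ℝ, 0 < C ∧ ∀ i : ℕ, (i + 1 : ℝ) * k (i + 1) ≤ C * (i + 1 : ℝ) ^ (-1 / 2 : ℝ)
  lower : ∃ c : ℝ, 0 < c ∧ ∀ᶠ i : ℕ in atTop,
    c * (i + 1 : ℝ) ^ (-1 / 2 - 1 / 36 : ℝ) ≤ (i + 1 : ℝ) * k (i + 1)
  flat : IsFlat fun i => (i + 1 : ℝ) * k (i + 1)

theorem IsFlat.const_mul {a : ℕ → ℝ} (h : IsFlat a) {c : ℝ} (hc : 0 ≤ c) :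
    IsFlat fun n => c * a n := by
  intro η hη
  filter_upwards [h η hη] with n hn
  rw [← mul_sub, abs_mul, abs_of_nonneg hc]
  nlinarith

theorem HasSquareRootTail.summable {k : ℕ → ℝ} (h : HasSquareRootTail k) : Summable k := by
  obtain ⟨C, hC, hub⟩ := h.upper
  rw [← summable_nat_add_iff 1]
  refine Summable.of_nonneg_of_le (fun n => h.nonneg _) (fun n => ?_)
    (((summable_nat_add_iff 1).2 (Real.summable_nat_rpow (p := -3 / 2)
      |>.2 (by norm_num))).mul_left C)
  have hn : (0 : ℝ) < n + 1 := by positivity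
  have h1 := hub n
  push_cast
  have h2 : (n + 1 : ℝ) * (n + 1 : ℝ) ^ (-3 / 2 : ℝ) = (n + 1 : ℝ) ^ (-1 / 2 : ℝ) := by
    nth_rewrite 1 [← Real.rpow_one (n + 1 : ℝ)]
    rw [← Real.rpow_add hn]; norm_num
  rw [← h2] at h1
  refine le_of_mul_le_mul_left (h1.trans (le_of_eq (by ring))) hn

/-- Ratio limits of the renewal mass function `u` with interarrival law `ε k`, and of its
convolution with a flat sequence. -/
theorem HasSquareRootTail.exists_ratio_limit {k p : ℕ → ℝ} (hk : HasSquareRootTail k)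
    (hp0 : ∀ n, 0 < p n) (hp1 : ∀ n, p n ≤ 1) (hp : IsFlat p) {ε γ : ℝ} (hε : 0 < ε)
    (hγ : HasSum k γ) :
    ∃ F : ℝ, (ε * γ ≤ 1 → F = 0) ∧
      (1 < ε * γ → 0 < F ∧ HasSum (fun n : ℕ => ε * k n * Real.exp (-F * n)) 1) ∧
      Tendsto (fun n => renewalSeq (fun n => ε * k n) n / renewalSeq (fun n => ε * k n) (n + 1))
        atTop (𝓝 (Real.exp (-F))) ∧
      Tendsto (fun n => seqConv (renewalSeq fun n => ε * k n) p n /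
        seqConv (renewalSeq fun n => ε * k n) p (n + 1)) atTop (𝓝 (Real.exp (-F))) := by
  set a := fun n => ε * k n with ha
  have h0 : a 0 = 0 := by simp [ha, hk.zero]
  have ha0 : ∀ n, 0 ≤ a n := fun n => mul_nonneg hε.le (hk.nonneg n)
  have ha1 : 0 < a 1 := mul_pos hε hk.one_pos
  have hsum : HasSum a (ε * γ) := hγ.mul_left ε
  have hu : ∀ n, 0 < renewalSeq a n := renewalSeq_pos h0 ha0 ha1
  rcases le_or_gt (ε * γ) 1 with hle | hgt
  · refine ⟨0, fun _ => rfl, fun h => absurd hle (not_le.2 h), ?_⟩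
    obtain ⟨C, hC, hub⟩ := hk.upper
    obtain ⟨c, hc, hlb⟩ := hk.lower
    have hflat : IsFlat (renewalSeq a) := by
      refine isFlat_renewalSeq (C := ε * C) (c := ε * c) h0 ha0
        (fun n => (sum_le_hasSum _ (fun i _ => ha0 i) hsum).trans hle) (by positivity)
        (by positivity) (fun i => ?_) (hlb.mono fun i hi => ?_) ?_
      · have := mul_le_mul_of_nonneg_left (hub i) hε.le
        simp only [ha]; linarith
      · have := mul_le_mul_of_nonneg_left hi hε.le
        simp only [ha]; linarith
      · convert hk.flat.const_mul hε.le using 2 with i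
        simp only [ha]; ring
    have hw := hflat.seqConv hp (fun n => (hu n).le) fun n => (hp0 n).le
    have hwpos : ∀ n, 0 < seqConv (renewalSeq a) p n := fun n =>
      Finset.sum_pos (fun i _ => mul_pos (hu i) (hp0 _)) (by simp)
    simp only [neg_zero, Real.exp_zero]
    exact ⟨hflat.tendsto_div (Eventually.of_forall hu), hw.tendsto_div (Eventually.of_forall hwpos)⟩
  · obtain ⟨r, hr0, hr1, hr⟩ := exists_pow_tsum_eq_one h0 ha0 hsum hgt
    -- Supercritical case: the free energy is `F = -log r`, with `r` the tilt that gives `a` total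
    -- mass one.
    have hexp : Real.exp (- -Real.log r) = r := by rw [neg_neg, Real.exp_log hr0]
    refine ⟨-Real.log r, fun h => absurd h (not_le.2 hgt), fun _ => ⟨?_, ?_⟩, ?_⟩
    · have := Real.log_neg hr0 hr1; linarith
    · convert hr using 2 with n
      rw [neg_neg, mul_comm (Real.log r), Real.exp_nat_mul, Real.exp_log hr0]
    rw [hexp]
    have hb0 : (fun n => a n * r ^ n) 0 = 0 := by simp [h0]
    have hbn : ∀ n, 0 ≤ (fun n => a n * r ^ n) n := fun n =>
      mul_nonneg (ha0 n) (pow_nonneg hr0.le n)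
    obtain ⟨L, hL, hlim⟩ := tendsto_renewalSeq (a := fun n => a n * r ^ n) hb0 hbn
      (by simp only [pow_one]; exact mul_pos ha1 hr0) hr
      (summable_tail_mul_pow ha0 hsum.summable hr0 hr1 hr)
    have hu1 : ∀ n, |renewalSeq (fun n => a n * r ^ n) n| ≤ 1 := fun n => by
      rw [abs_of_nonneg (renewalSeq_nonneg hb0 hbn n)]
      exact renewalSeq_le_one hb0 hbn (fun n => sum_le_hasSum _ (fun i _ => hbn i) hr) n
    have hpr : Summable fun n => p n * r ^ n :=
      Summable.of_nonneg_of_le (fun n => mul_nonneg (hp0 n).le (pow_nonneg hr0.le n))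
        (fun n => mul_le_of_le_one_left (pow_nonneg hr0.le n) (hp1 n))
        (summable_geometric_of_lt_one hr0.le hr1)
    have hprpos : 0 < ∑' n, p n * r ^ n :=
      hpr.tsum_pos (fun n => mul_nonneg (hp0 n).le (pow_nonneg hr0.le n)) 0
        (by simpa using hp0 0)
    -- Tilting commutes with convolution. The tilted `p` is summable, so the tilted convolution also
    -- has a positive limit, and its ratios have the same limit `r`.
    have hwlim := tendsto_seqConv_of_summable hpr
      (fun n => mul_nonneg (hp0 n).le (pow_nonneg hr0.le n)) hu1 tendsto_id
      (x := fun _ => L) fun i => hlim.comp (tendsto_sub_atTop_nat i)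
    rw [tsum_mul_right] at hwlim
    have hweq : ∀ n, seqConv (fun n => p n * r ^ n) (renewalSeq fun n => a n * r ^ n) n =
        seqConv (renewalSeq a) p n * r ^ n := by
      intro n
      have h1 := coeff_mk_mul_mk (fun n => p n * r ^ n) (renewalSeq fun n => a n * r ^ n)
      rw [mul_comm, coeff_mk_mul_mk] at h1
      have h2 := congrArg (PowerSeries.coeff n) h1
      simp only [PowerSeries.coeff_mk] at h2
      rw [← h2]
      unfold seqConv
      rw [Finset.sum_mul]
      refine Finset.sum_congr rfl fun i hi => ?_
      rw [Finset.mem_range] at hi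
      have : r ^ n = r ^ i * r ^ (n - i) := by rw [← pow_add]; congr 1; omega
      rw [renewalSeq_mul_pow h0, this]; ring
    have hratio : ∀ {y : ℕ → ℝ} {M : ℝ}, 0 < M →
        Tendsto (fun n => y n * r ^ n) atTop (𝓝 M) →
        Tendsto (fun n => y n / y (n + 1)) atTop (𝓝 r) := by
      intro y M hM hy
      have h1 := (hy.div (hy.comp (tendsto_add_atTop_nat 1)) hM.ne').const_mul r
      rw [div_self hM.ne', mul_one] at h1
      refine h1.congr fun n => ?_
      have : r ^ n ≠ 0 := by positivity
      simp only [Pi.div_apply, Function.comp_apply, pow_succ]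
      rcases eq_or_ne (y (n + 1)) 0 with hy0 | hy0
      · simp [hy0]
      · field_simp
    refine ⟨hratio hL (hlim.congr fun n => renewalSeq_mul_pow h0 r n), ?_⟩
    exact hratio (mul_pos hprpos hL) (hwlim.congr fun n => hweq n)

/-! ### Iterated integrals along a path, one measure for each site. -/

section Chain

/-- The iterated integral `∫ b(y₁ - x) ρ₁(dy₁) ∫ b(y₂ - y₁) ρ₂(dy₂) ⋯ t(y_n)`. -/
noncomputable def chain (b t : ℝ → ℝ≥0∞) : List (Measure ℝ) → ℝ → ℝ≥0∞
  | [], x => t x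
  | ρ :: l, x => ∫⁻ y, b (y - x) * chain b t l y ∂ρ

variable {b t : ℝ → ℝ≥0∞}

theorem measurable_chain (hb : Measurable b) (ht : Measurable t) :
    ∀ {l : List (Measure ℝ)}, (∀ ρ ∈ l, SFinite ρ) → Measurable (chain b t l)
  | [], _ => ht
  | ρ :: l, hl => by
    have h1 := measurable_chain hb ht (l := l) fun σ hσ => hl σ (List.mem_cons_of_mem _ hσ)
    have : SFinite ρ := hl ρ List.mem_cons_self
    simp only [chain]
    exact Measurable.lintegral_prod_right' (f := fun p : ℝ × ℝ => b (p.2 - p.1) * chain b t l p.2)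
      ((hb.comp (measurable_snd.sub measurable_fst)).mul (h1.comp measurable_snd))

theorem chain_append (l₁ l₂ : List (Measure ℝ)) (x : ℝ) :
    chain b t (l₁ ++ l₂) x = chain b (chain b t l₂) l₁ x := by
  induction l₁ generalizing x with
  | nil => rfl
  | cons ρ l ih => simp only [List.cons_append, chain, ih]

theorem chain_add_cons (ρ σ : Measure ℝ) (l : List (Measure ℝ)) (x : ℝ) :
    chain b t ((ρ + σ) :: l) x = chain b t (ρ :: l) x + chain b t (σ :: l) x := by
  simp only [chain, lintegral_add_measure]

theorem chain_smul_dirac_cons (ε : ℝ≥0) (l : List (Measure ℝ)) (x : ℝ) :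
    chain b t ((ε • Measure.dirac 0) :: l) x = b (-x) * (ε * chain b t l 0) := by
  simp only [chain, lintegral_smul_measure, lintegral_dirac, zero_sub]
  rw [ENNReal.smul_def, smul_eq_mul]; ring

theorem chain_mul_const (hb : Measurable b) (ht : Measurable t) (c : ℝ≥0∞)
    {l : List (Measure ℝ)} (hl : ∀ ρ ∈ l, SFinite ρ) (x : ℝ) :
    chain b (fun y => t y * c) l x = chain b t l x * c := by
  induction l generalizing x with
  | nil => rfl
  | cons ρ l ih =>
    have hl' : ∀ σ ∈ l, SFinite σ := fun σ hσ => hl σ (List.mem_cons_of_mem _ hσ)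
    simp only [chain]
    rw [← lintegral_mul_const]
    · refine lintegral_congr fun y => ?_
      rw [ih hl', mul_assoc]
    · exact (hb.comp (measurable_id.sub_const x)).mul (measurable_chain hb ht hl')

theorem chain_add_terminal (hb : Measurable b) {t₁ t₂ : ℝ → ℝ≥0∞} (ht₁ : Measurable t₁)
    {l : List (Measure ℝ)} (hl : ∀ ρ ∈ l, SFinite ρ) (x : ℝ) :
    chain b (fun y => t₁ y + t₂ y) l x = chain b t₁ l x + chain b t₂ l x := by
  induction l generalizing x with
  | nil => rfl
  | cons ρ l ih =>
    have hl' : ∀ σ ∈ l, SFinite σ := fun σ hσ => hl σ (List.mem_cons_of_mem _ hσ)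
    simp only [chain]
    have hm : Measurable fun y => b (y - x) * chain b t₁ l y :=
      (hb.comp (measurable_id.sub_const x)).mul (measurable_chain hb ht₁ hl')
    rw [← lintegral_add_left hm]
    refine lintegral_congr fun y => ?_
    rw [ih hl', mul_add]

/-- Factorization at a site that is pinned at zero. -/
theorem chain_append_dirac (hb : Measurable b) (ε : ℝ≥0)
    {l₁ : List (Measure ℝ)} (h₁ : ∀ ρ ∈ l₁, SFinite ρ) (l₂ : List (Measure ℝ)) (x : ℝ) :
    chain b t (l₁ ++ (ε • Measure.dirac 0) :: l₂) x =
      chain b (fun y => b (-y)) l₁ x * (ε * chain b t l₂ 0) := by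
  rw [chain_append, ← chain_mul_const hb (t := fun y => b (-y)) (hb.comp measurable_neg) _ h₁]
  congr 1
  funext y
  exact chain_smul_dirac_cons ε l₂ y

/-- Expansion according to the first contact. -/
theorem chain_replicate_add_dirac (hb : Measurable b) (ht : Measurable t) (ρ : Measure ℝ) [SFinite ρ] (ε : ℝ≥0)
    (i m : ℕ) (x : ℝ) :
    chain b t (List.replicate i ρ ++ List.replicate m (ρ + ε • Measure.dirac 0)) x =
      chain b t (List.replicate (i + m) ρ) x + ∑ j ∈ Finset.range m,
        chain b (fun y => b (-y)) (List.replicate (i + j) ρ) x *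
          (ε * chain b t (List.replicate (m - 1 - j) (ρ + ε • Measure.dirac 0)) 0) := by
  induction m generalizing i with
  | zero => simp
  | succ m ih =>
    have h1 : chain b t (List.replicate i ρ ++ List.replicate (m + 1) (ρ + ε • Measure.dirac 0)) x =
        chain b t (List.replicate i ρ ++ ρ :: List.replicate m (ρ + ε • Measure.dirac 0)) x +
        chain b t (List.replicate i ρ ++ (ε • Measure.dirac 0) ::
          List.replicate m (ρ + ε • Measure.dirac 0)) x := by
      have hρ : ∀ σ ∈ List.replicate i ρ, SFinite σ := fun σ hσ => by
        rw [List.eq_of_mem_replicate hσ]; infer_instance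
      have hε : ∀ σ ∈ ρ :: List.replicate m (ρ + ε • Measure.dirac 0), SFinite σ := by
        intro σ hσ
        rcases List.mem_cons.1 hσ with rfl | hσ
        · infer_instance
        · rw [List.eq_of_mem_replicate hσ]; infer_instance
      rw [List.replicate_succ, chain_append, chain_append, chain_append,
        ← chain_add_terminal hb (measurable_chain hb ht hε) hρ]
      congr 1
      funext y
      exact chain_add_cons _ _ _ _
    rw [h1, chain_append_dirac hb ε (fun σ hσ => by
      rw [List.eq_of_mem_replicate hσ]; infer_instance)]
    have h2 : List.replicate i ρ ++ ρ :: List.replicate m (ρ + ε • Measure.dirac 0) =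
        List.replicate (i + 1) ρ ++ List.replicate m (ρ + ε • Measure.dirac 0) := by
      rw [List.replicate_succ', List.append_assoc]; rfl
    rw [h2, ih (i + 1), Finset.sum_range_succ', add_assoc]
    congr 1
    · rw [show i + 1 + m = i + (m + 1) by ring]
    · congr 1
      refine Finset.sum_congr rfl fun j _ => ?_
      rw [show i + 1 + j = i + (j + 1) by ring, show m + 1 - 1 - (j + 1) = m - 1 - j by omega]

/-- The height at site `i` of a path started from `x`. -/
def pathFrom (x : ℝ) {N : ℕ} (y : Fin N → ℝ) : Fin (N + 1) → ℝ := Fin.cons x y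

theorem measurable_pathFrom {N : ℕ} (i : Fin (N + 1)) :
    Measurable fun p : ℝ × (Fin N → ℝ) => pathFrom p.1 p.2 i := by
  refine Fin.cases ?_ (fun j => ?_) i
  · exact measurable_fst
  · exact (measurable_pi_apply j).comp measurable_snd

/-- The weight of a path started from `x`. -/
noncomputable def pathWeight (b t : ℝ → ℝ≥0∞) (x : ℝ) {N : ℕ} (y : Fin N → ℝ) : ℝ≥0∞ :=
  (∏ i : Fin N, b (y i - pathFrom x y i.castSucc)) * t (pathFrom x y (Fin.last N))

theorem measurable_pathWeight (hb : Measurable b) (ht : Measurable t) {N : ℕ} :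
    Measurable fun p : ℝ × (Fin N → ℝ) => pathWeight b t p.1 p.2 := by
  refine Measurable.mul (Finset.measurable_prod _ fun i _ => hb.comp ?_)
    (ht.comp (measurable_pathFrom _))
  exact ((measurable_pi_apply i).comp measurable_snd).sub (measurable_pathFrom _)

theorem pathWeight_cons (x z : ℝ) {N : ℕ} (y : Fin N → ℝ) :
    pathWeight b t x (Fin.cons z y : Fin (N + 1) → ℝ) = b (z - x) * pathWeight b t z y := by
  unfold pathWeight pathFrom
  rw [Fin.prod_univ_succ, mul_assoc]
  rfl

/-- Tonelli, peeling off the first site. With it, partition functions and cylinder probabilities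
become chains, in which conditioning a site means changing one entry of a list of measures. -/
theorem chain_ofFn (hb : Measurable b) (ht : Measurable t) {N : ℕ} (ρ : Fin N → Measure ℝ)
    [∀ i, SigmaFinite (ρ i)] (x : ℝ) :
    chain b t (List.ofFn ρ) x = ∫⁻ y, pathWeight b t x y ∂(Measure.pi ρ) := by
  induction N generalizing x with
  | zero =>
    rw [Measure.pi_of_empty, lintegral_dirac]
    simp [chain, pathWeight, pathFrom]
  | succ N ih =>
    have hmp := (measurePreserving_piFinSuccAbove ρ 0).symm
    have hcons : ∀ p : ℝ × (Fin N → ℝ),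
        (MeasurableEquiv.piFinSuccAbove (fun _ : Fin (N + 1) => ℝ) 0).symm p =
          (Fin.cons p.1 p.2 : Fin (N + 1) → ℝ) := fun p => by
      simp [MeasurableEquiv.piFinSuccAbove, Fin.insertNthEquiv]
    have hm : Measurable fun y : Fin (N + 1) → ℝ => pathWeight b t x y :=
      (measurable_pathWeight hb ht).comp (measurable_const.prodMk measurable_id)
    rw [← hmp.lintegral_comp hm, lintegral_prod (fun p => pathWeight b t x
      ((MeasurableEquiv.piFinSuccAbove (fun _ : Fin (N + 1) => ℝ) 0).symm p))
      (hm.comp hmp.measurable).aemeasurable, List.ofFn_succ]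
    simp only [chain]
    refine lintegral_congr fun z => ?_
    rw [ih (fun i => ρ i.succ), ← lintegral_const_mul]
    · refine lintegral_congr fun y => ?_
      rw [hcons, pathWeight_cons]
    · exact (measurable_pathWeight hb ht).comp (measurable_const.prodMk measurable_id)

end Chain

/-! ### Partition functions and cylinder probabilities as chains; factorization at contacts. -/

section Partition

instance (s : Setup) : SigmaFinite (refMeasure s) := by
  cases s
  · exact inferInstanceAs (SigmaFinite (volume : Measure ℝ))
  · have h : MeasurableEmbedding (fun z : ℤ => (z : ℝ)) :=
      Int.isClosedEmbedding_coe_real.measurableEmbedding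
    exact h.sigmaFinite_map

/-- The a priori measure of a site that is not in contact with the wall. -/
noncomputable def dryMeasure (s : Setup) : Measure ℝ := (refMeasure s).restrict (Ioi 0)

instance (s : Setup) : SigmaFinite (dryMeasure s) := by
  unfold dryMeasure; infer_instance

/-- The factor of the last bond. -/
noncomputable def terminal (V : ℝ → EReal) : BoundaryCondition → ℝ → ℝ≥0∞
  | .free => fun _ => 1
  | .constrained => fun y => boltzmann V (-y)

variable {V : ℝ → EReal}

theorem measurable_boltzmann (hV : Measurable V) : Measurable (boltzmann V) :=
  EReal.measurable_exp.comp hV.neg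

theorem measurable_terminal (hV : Measurable V) (a : BoundaryCondition) :
    Measurable (terminal V a) := by
  cases a
  · exact measurable_const
  · exact (measurable_boltzmann hV).comp measurable_neg

/-- The exclusion of `⊥` matters: with `x = ⊥`, `y = ⊤` the sum is `⊥`, so the left side is `∞`
while the right side is `∞ * 0 = 0`. -/
theorem exp_neg_add {x y : EReal} (hx : x ≠ ⊥) (hy : y ≠ ⊥) :
    EReal.exp (-(x + y)) = EReal.exp (-x) * EReal.exp (-y) := by
  rw [EReal.exp_neg, EReal.exp_neg, EReal.exp_neg, EReal.exp_add, ENNReal.mul_inv]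
  · left; simpa using hx
  · right; simpa using hy

theorem sum_ne_bot {ι : Type*} (s : Finset ι) {f : ι → EReal} (hf : ∀ i, f i ≠ ⊥) :
    ∑ i ∈ s, f i ≠ ⊥ := by
  classical
  induction s using Finset.induction_on with
  | empty => simp
  | insert i s hi ih =>
    rw [Finset.sum_insert hi]
    simp [EReal.add_eq_bot_iff, hf i, ih]

theorem exp_neg_sum {ι : Type*} (s : Finset ι) {f : ι → EReal} (hf : ∀ i, f i ≠ ⊥) :
    EReal.exp (-∑ i ∈ s, f i) = ∏ i ∈ s, EReal.exp (-f i) := by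
  classical
  induction s using Finset.induction_on with
  | empty => simp
  | insert i s hi ih =>
    rw [Finset.sum_insert hi, Finset.prod_insert hi, exp_neg_add (hf i) (sum_ne_bot s hf), ih]

theorem height_eq_pathFrom {N : ℕ} (x : Fin N → ℝ) (i : Fin (N + 1)) :
    height x i = pathFrom 0 x i := by
  refine Fin.cases ?_ (fun j => ?_) i
  · rfl
  · simp [height, pathFrom]

theorem height_succ {N : ℕ} (x : Fin N → ℝ) (i : Fin N) : height x (i + 1) = x i := by
  simp [height]

theorem exp_neg_hamiltonian (hV : ∀ x, V x ≠ ⊥) (a : BoundaryCondition) {N : ℕ} (x : Fin N → ℝ) :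
    EReal.exp (-hamiltonian V a x) = pathWeight (boltzmann V) (terminal V a) 0 x := by
  have h1 : ∏ i ∈ Finset.range N, EReal.exp (-V (height x (i + 1) - height x i)) =
      ∏ i : Fin N, boltzmann V (x i - pathFrom 0 x i.castSucc) := by
    rw [Finset.prod_range]
    refine Finset.prod_congr rfl fun i _ => ?_
    rw [height_succ, ← height_eq_pathFrom]
    rfl
  cases a
  · simp only [hamiltonian, pathWeight, terminal, mul_one]
    rw [exp_neg_sum _ fun i => hV _, h1]
  · simp only [hamiltonian, pathWeight, terminal]
    rw [exp_neg_sum _ fun i => hV _, Finset.prod_range_succ, h1, ← height_eq_pathFrom]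
    -- The last bond ends at `x_{N+1}`, which is the default value `0` of `height`.
    simp [height, boltzmann]

theorem partitionFunction_eq_chain (hV : Measurable V) (hV' : ∀ x, V x ≠ ⊥) (s : Setup)
    (a : BoundaryCondition) (ε : ℝ≥0) (N : ℕ) :
    partitionFunction s V a ε N = chain (boltzmann V) (terminal V a)
      (List.replicate N (dryMeasure s + ε • Measure.dirac 0)) 0 := by
  rw [← List.ofFn_const, chain_ofFn (measurable_boltzmann hV) (measurable_terminal hV a)]
  simp only [partitionFunction, exp_neg_hamiltonian hV']
  rfl

theorem partitionFunction_zero_eq_chain (hV : Measurable V) (hV' : ∀ x, V x ≠ ⊥) (s : Setup)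
    (a : BoundaryCondition) (N : ℕ) :
    partitionFunction s V a 0 N = chain (boltzmann V) (terminal V a)
      (List.replicate N (dryMeasure s)) 0 := by
  rw [partitionFunction_eq_chain hV hV', zero_smul, add_zero]

/-- Renewal equation for the partition functions. -/
theorem partitionFunction_renewal (hV : Measurable V) (hV' : ∀ x, V x ≠ ⊥) (s : Setup)
    (a : BoundaryCondition) (ε : ℝ≥0) (N : ℕ) :
    partitionFunction s V a ε N = partitionFunction s V a 0 N + ∑ j ∈ Finset.range N,
      partitionFunction s V .constrained 0 j * (ε * partitionFunction s V a ε (N - 1 - j)) := by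
  simp only [partitionFunction_zero_eq_chain hV hV', partitionFunction_eq_chain hV hV' s a ε]
  have := chain_replicate_add_dirac (measurable_boltzmann hV) (measurable_terminal hV a)
    (dryMeasure s) ε 0 N 0
  simp only [List.replicate_zero, List.nil_append, zero_add] at this
  exact this

/-- The a priori measure of a site, restricted to the configurations with prescribed contact. -/
noncomputable def siteMeasure (s : Setup) (ε : ℝ≥0) : Bool → Measure ℝ
  | true => ε • Measure.dirac 0
  | false => dryMeasure s

theorem restrict_singleton_dry (s : Setup) (ε : ℝ≥0) :
    (dryMeasure s + ε • Measure.dirac 0).restrict {0} = siteMeasure s ε true := by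
  rw [Measure.restrict_add, Measure.restrict_smul, dryMeasure,
    Measure.restrict_restrict (measurableSet_singleton _)]
  simp [siteMeasure]

theorem restrict_compl_dry (s : Setup) (ε : ℝ≥0) :
    (dryMeasure s + ε • Measure.dirac 0).restrict {0}ᶜ = siteMeasure s ε false := by
  rw [Measure.restrict_add, Measure.restrict_smul, dryMeasure,
    Measure.restrict_restrict (measurableSet_singleton _).compl]
  have : ({0}ᶜ ∩ Ioi 0 : Set ℝ) = Ioi 0 := by
    ext x; simp only [mem_inter_iff, mem_compl_iff, mem_singleton_iff, mem_Ioi]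
    exact ⟨fun h => h.2, fun h => ⟨h.ne', h⟩⟩
  rw [this]
  simp [siteMeasure, dryMeasure, restrict_dirac]

/-- The contact sets with a prescribed initial segment. -/
def cylinder (l : List Bool) : Set (ℕ+ → Bool) :=
  {A | ∀ (i : ℕ) (h : i < l.length), A i.succPNat = l[i]}

theorem measurableSet_cylinder (l : List Bool) : MeasurableSet (cylinder l) := by
  have : cylinder l = ⋂ i : ℕ, ⋂ h : i < l.length, {A | A i.succPNat = l[i]} := by
    ext A; simp [cylinder]
  rw [this]
  refine MeasurableSet.iInter fun i => MeasurableSet.iInter fun h => ?_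
  exact (measurable_pi_apply i.succPNat) (measurableSet_singleton _)

/-- The index shift: site `i + 1`, written `i.succPNat`, has its height stored at coordinate `i`. -/
theorem contactSet_succPNat {N : ℕ} (x : Fin N → ℝ) (i : ℕ) :
    contactSet x i.succPNat = true ↔ ∃ h : i < N, x ⟨i, h⟩ = 0 := by
  rw [contactSet, decide_eq_true_iff]
  simp only [Nat.succPNat_coe, height]
  constructor
  · rintro ⟨h, h2⟩
    refine ⟨h, ?_⟩
    rwa [dif_pos (by omega)] at h2
  · rintro ⟨h, h2⟩
    exact ⟨h, by rw [dif_pos h]; exact h2⟩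

theorem measurable_contactSet {N : ℕ} :
    Measurable (contactSet : (Fin N → ℝ) → ℕ+ → Bool) := by
  rw [measurable_pi_iff]
  intro n
  obtain ⟨i, rfl⟩ : ∃ i : ℕ, i.succPNat = n := ⟨n.natPred, PNat.succPNat_natPred n⟩
  refine measurable_to_bool ?_
  have : (fun x : Fin N → ℝ => contactSet x i.succPNat) ⁻¹' {true} =
      {x | ∃ h : i < N, x ⟨i, h⟩ = 0} := by
    ext x; exact contactSet_succPNat x i
  rw [this]
  by_cases h : i < N
  · have : {x : Fin N → ℝ | ∃ h : i < N, x ⟨i, h⟩ = 0} = (fun x => x ⟨i, h⟩) ⁻¹' {0} := by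
      ext x; simp [h]
    rw [this]
    exact measurable_pi_apply _ (measurableSet_singleton _)
  · simp [h]

/-- The constraint on the height of a site that prescribes its contact. -/
def siteSet : Bool → Set ℝ
  | true => {0}
  | false => {0}ᶜ

/-- The event is a box, so restricting the product measure to it restricts each factor: to `ε δ_0`
at a prescribed contact and to `dryMeasure` at a prescribed dry site. -/
theorem preimage_cylinder {N : ℕ} {l : List Bool} (hl : l.length ≤ N) :
    (contactSet : (Fin N → ℝ) → ℕ+ → Bool) ⁻¹' cylinder l =
      univ.pi fun i : Fin N => if h : (i : ℕ) < l.length then siteSet l[(i : ℕ)] else univ := by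
  ext x
  simp only [mem_preimage, cylinder, mem_ofPred_eq, mem_univ_pi]
  constructor
  · intro h i
    split_ifs with hi
    · have h1 := h i hi
      have h2 := contactSet_succPNat x i
      rw [h1] at h2
      cases hb : l[(i : ℕ)] with
      | true =>
        obtain ⟨_, h3⟩ := h2.1 hb
        simpa [siteSet] using h3
      | false =>
        simp only [hb, Bool.false_eq_true, false_iff, not_exists] at h2
        simpa [siteSet] using h2 i.2
    · trivial
  · intro h i hi
    have h1 := h ⟨i, by omega⟩
    simp only [hi, dif_pos] at h1
    have h2 := contactSet_succPNat x i
    cases hb : l[i] with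
    | true =>
      rw [hb] at h1
      exact h2.2 ⟨by omega, by simpa [siteSet] using h1⟩
    | false =>
      rw [hb] at h1
      rw [Bool.eq_false_iff, Ne, h2]
      rintro ⟨h3, h4⟩
      exact h1 h4

theorem ofFn_restrict_siteSet (s : Setup) (ε : ℝ≥0) {N : ℕ} {l : List Bool} (hl : l.length ≤ N) :
    (List.ofFn fun i : Fin N => (dryMeasure s + ε • Measure.dirac 0).restrict
      (if h : (i : ℕ) < l.length then siteSet l[(i : ℕ)] else univ)) =
      l.map (siteMeasure s ε) ++
        List.replicate (N - l.length) (dryMeasure s + ε • Measure.dirac 0) := by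
  refine List.ext_getElem (by simp; omega) fun i h1 h2 => ?_
  rw [List.getElem_ofFn]
  by_cases hi : i < l.length
  · rw [List.getElem_append_left (by simpa using hi)]
    simp only [hi, dif_pos, List.getElem_map]
    cases l[i] with
    | true => exact restrict_singleton_dry s ε
    | false => exact restrict_compl_dry s ε
  · rw [List.getElem_append_right (by simpa using hi)]
    simp [hi]

theorem contactLaw_cylinder (hV : Measurable V) (hV' : ∀ x, V x ≠ ⊥) (s : Setup)
    (a : BoundaryCondition) (ε : ℝ≥0) {N : ℕ} {l : List Bool} (hl : l.length ≤ N) :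
    contactLaw s V a ε N (cylinder l) = (partitionFunction s V a ε N)⁻¹ *
      chain (boltzmann V) (terminal V a) (l.map (siteMeasure s ε) ++
        List.replicate (N - l.length) (dryMeasure s + ε • Measure.dirac 0)) 0 := by
  have hR : MeasurableSet ((contactSet : (Fin N → ℝ) → ℕ+ → Bool) ⁻¹' cylinder l) :=
    measurable_contactSet (measurableSet_cylinder l)
  have hsig : ∀ i : Fin N, SigmaFinite ((dryMeasure s + ε • Measure.dirac 0).restrict
      (if h : (i : ℕ) < l.length then siteSet l[(i : ℕ)] else univ)) := fun i => inferInstance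
  rw [contactLaw, Measure.map_apply measurable_contactSet (measurableSet_cylinder l),
    interfaceLaw, Measure.smul_apply, smul_eq_mul, withDensity_apply _ hR,
    ← ofFn_restrict_siteSet s ε hl, chain_ofFn (measurable_boltzmann hV) (measurable_terminal hV a),
    ← Measure.restrict_pi_pi, ← preimage_cylinder hl]
  simp only [exp_neg_hamiltonian hV']
  rfl

/-- The gaps between the contacts of the pattern `0^r l 1`. -/
def gaps : ℕ → List Bool → List ℕ
  | r, [] => [r + 1]
  | r, false :: l => gaps (r + 1) l
  | r, true :: l => (r + 1) :: gaps 0 l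

/-- Induction on the pattern; `r` counts the dry sites since the last contact. The next contact
closes an excursion through exactly these sites, whose weight is a constrained partition function
without pinning, and the chain starts afresh from height `0`. -/
theorem chain_pattern (hV : Measurable V) (hV' : ∀ x, V x ≠ ⊥) (s : Setup) (ε : ℝ≥0)
    (t : ℝ → ℝ≥0∞) (r : ℕ) (l : List Bool) (rest : List (Measure ℝ)) :
    chain (boltzmann V) t (List.replicate r (dryMeasure s) ++ (l.map (siteMeasure s ε) ++
        (siteMeasure s ε true :: rest))) 0 =
      ((gaps r l).map fun n => partitionFunction s V .constrained 0 (n - 1) * ε).prod *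
        chain (boltzmann V) t rest 0 := by
  have hrep : ∀ r : ℕ, ∀ σ ∈ List.replicate r (dryMeasure s), SFinite σ := fun r σ hσ => by
    rw [List.eq_of_mem_replicate hσ]; infer_instance
  induction l generalizing r with
  | nil =>
    simp only [List.map_nil, List.nil_append, gaps, List.map_cons, List.prod_cons, List.prod_nil,
      mul_one, siteMeasure]
    rw [chain_append_dirac (measurable_boltzmann hV) ε (hrep r),
      partitionFunction_zero_eq_chain hV hV', mul_assoc]
    rfl
  | cons c l ih =>
    cases c with
    | true =>
      simp only [List.map_cons, List.cons_append, gaps, List.prod_cons]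
      rw [siteMeasure, chain_append_dirac (measurable_boltzmann hV) ε (hrep r),
        partitionFunction_zero_eq_chain hV hV']
      have := ih 0
      simp only [List.replicate_zero, List.nil_append, siteMeasure] at this
      rw [this]
      simp only [mul_assoc, terminal, Nat.add_sub_cancel]
    | false =>
      have h2 : List.replicate r (dryMeasure s) ++ ((false :: l).map (siteMeasure s ε) ++
          (siteMeasure s ε true :: rest)) = List.replicate (r + 1) (dryMeasure s) ++
          (l.map (siteMeasure s ε) ++ (siteMeasure s ε true :: rest)) := by
        rw [List.replicate_succ', List.append_assoc]; rfl
      rw [h2, ih (r + 1), gaps]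

/-- After the final contact the remaining sites form the same model started from `0`, with the same
boundary condition `a`. This is why cylinders that end with a contact are the convenient ones. -/
theorem contactLaw_cylinder_append (hV : Measurable V) (hV' : ∀ x, V x ≠ ⊥) (s : Setup)
    (a : BoundaryCondition) (ε : ℝ≥0) {N : ℕ} {l : List Bool} (hl : l.length + 1 ≤ N) :
    contactLaw s V a ε N (cylinder (l ++ [true])) =
      ((gaps 0 l).map fun n => partitionFunction s V .constrained 0 (n - 1) * ε).prod *
        (partitionFunction s V a ε (N - (l.length + 1)) / partitionFunction s V a ε N) := by
  rw [contactLaw_cylinder hV hV' s a ε (by simpa using hl)]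
  have := chain_pattern hV hV' s ε (terminal V a) 0 l
    (List.replicate (N - (l.length + 1)) (dryMeasure s + ε • Measure.dirac 0))
  simp only [List.replicate_zero, List.nil_append] at this
  simp only [List.map_append, List.map_cons, List.map_nil, List.append_assoc, List.cons_append,
    List.nil_append, List.length_append, List.length_cons, List.length_nil, zero_add]
  rw [this, partitionFunction_eq_chain hV hV' s a ε (N - (l.length + 1)), ENNReal.div_eq_inv_mul]
  ring

theorem sum_gaps (r : ℕ) (l : List Bool) : (gaps r l).sum = r + l.length + 1 := by
  induction l generalizing r with
  | nil => simp [gaps]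
  | cons c l ih => cases c <;> simp [gaps, ih] <;> omega

theorem pos_of_mem_gaps {r n : ℕ} {l : List Bool} (h : n ∈ gaps r l) : 0 < n := by
  induction l generalizing r with
  | nil => simp [gaps] at h; omega
  | cons c l ih =>
    cases c with
    | true =>
      rcases List.mem_cons.1 h with rfl | h
      · omega
      · exact ih h
    | false => exact ih h

end Partition

/-! ### Renewal processes as random subsets, and their cylinder probabilities. -/

section Renewals

theorem measurable_of_measurableSet_le {Ω : Type*} [MeasurableSpace Ω] {f : Ω → ℕ∞}
    (h : ∀ c : ℕ∞, MeasurableSet {ω | c ≤ f ω}) : Measurable f := by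
  refine measurable_to_countable' fun c => ?_
  have : f ⁻¹' {c} = {ω | c ≤ f ω} \ ⋃ d : ℕ∞, ⋃ _ : c < d, {ω | d ≤ f ω} := by
    ext ω
    simp only [mem_preimage, mem_singleton_iff, Set.mem_sdiff, mem_ofPred_eq, mem_iUnion, exists_prop,
      not_exists, not_and]
    constructor
    · rintro rfl
      exact ⟨le_rfl, fun d hd => not_le.2 hd⟩
    · rintro ⟨h1, h2⟩
      rcases h1.eq_or_lt with h3 | h3
      · exact h3.symm
      · exact absurd le_rfl (h2 _ h3)
  rw [this]
  exact (h c).diff (MeasurableSet.iUnion fun d => MeasurableSet.iUnion fun _ => h d)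

theorem measurable_contactTime : Measurable contactTime := by
  rw [measurable_pi_iff]
  intro k
  induction k with
  | zero => exact measurable_const
  | succ j ih =>
    refine measurable_of_measurableSet_le fun c => ?_
    have : {A : ℕ+ → Bool | c ≤ contactTime A (j + 1)} =
        ⋂ n : ℕ+, ({A | contactTime A j < ((n : ℕ) : ℕ∞)} ∩ {A | A n = true})ᶜ ∪
          {_A : ℕ+ → Bool | c ≤ ((n : ℕ) : ℕ∞)} := by
      ext A
      simp only [contactTime, mem_ofPred_eq, le_sInf_iff, mem_iInter, mem_union, mem_compl_iff,
        mem_inter_iff]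
      constructor
      · intro h n
        by_cases hn : contactTime A j < ((n : ℕ) : ℕ∞) ∧ A n = true
        · exact Or.inr (h _ ⟨hn.1, n, hn.2, rfl⟩)
        · exact Or.inl hn
      · rintro h t ⟨ht, n, hn, rfl⟩
        exact (h n).resolve_left fun h' => h' ⟨ht, hn⟩
    rw [this]
    refine MeasurableSet.iInter fun n => MeasurableSet.union (MeasurableSet.compl
      (MeasurableSet.inter ?_ ?_)) (MeasurableSet.const _)
    · exact ih (MeasurableSet.of_discrete (s := {t | t < ((n : ℕ) : ℕ∞)}))
    · exact measurableSet_eq_fun (measurable_pi_apply n) measurable_const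

open Classical in
/-- The set of the partial sums of a sequence of interarrival times. -/
noncomputable def renewalSet (T : ℕ → ℕ∞) : ℕ+ → Bool :=
  fun n => decide (∃ k : ℕ, ∑ i ∈ Finset.range (k + 1), T i = ((n : ℕ) : ℕ∞))

theorem renewalSet_eq_true {T : ℕ → ℕ∞} {n : ℕ+} :
    renewalSet T n = true ↔ ∃ k : ℕ, ∑ i ∈ Finset.range (k + 1), T i = ((n : ℕ) : ℕ∞) := by
  simp only [renewalSet, decide_eq_true_iff]

theorem measurable_renewalSet : Measurable renewalSet := by
  rw [measurable_pi_iff]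
  intro n
  refine measurable_to_bool ?_
  have : (fun T => renewalSet T n) ⁻¹' {true} =
      ⋃ k : ℕ, (fun T : ℕ → ℕ∞ => ∑ i ∈ Finset.range (k + 1), T i) ⁻¹' {((n : ℕ) : ℕ∞)} := by
    ext T
    simp only [mem_preimage, mem_singleton_iff, mem_iUnion]
    exact renewalSet_eq_true
  rw [this]
  refine MeasurableSet.iUnion fun k => ?_
  exact (Finset.measurable_fun_sum _ fun i _ => measurable_pi_apply i) (measurableSet_singleton _)

theorem sum_range_mono (T : ℕ → ℕ∞) : Monotone fun k => ∑ i ∈ Finset.range k, T i :=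
  monotone_nat_of_le_succ fun k => by rw [Finset.sum_range_succ]; exact le_self_add

/-- Nonzero increments make the partial sums strictly increasing as long as they are finite, so the
elements of the set, read in order, are the partial sums; after an infinite increment both sides
stay at `⊤`. -/
theorem contactTime_renewalSet {T : ℕ → ℕ∞} (hT : ∀ i, T i ≠ 0) (k : ℕ) :
    contactTime (renewalSet T) k = ∑ i ∈ Finset.range k, T i := by
  induction k with
  | zero => rfl
  | succ j ih =>
    rw [contactTime, ih]
    apply le_antisymm
    · by_cases htop : ∑ i ∈ Finset.range (j + 1), T i = ⊤
      · rw [htop]; exact le_top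
      · obtain ⟨m, hm⟩ := ENat.ne_top_iff_exists.1 htop
        have hlt : ∑ i ∈ Finset.range j, T i < ∑ i ∈ Finset.range (j + 1), T i := by
          rw [Finset.sum_range_succ] at htop ⊢
          have h1 : ∑ i ∈ Finset.range j, T i ≠ ⊤ := fun h => htop (by rw [h]; simp)
          rw [add_comm]
          exact ENat.lt_add_left h1 (pos_iff_ne_zero.2 (hT j))
        have hm0 : 0 < m := by
          have : (0 : ℕ∞) < m := by rw [hm]; exact lt_of_le_of_lt zero_le hlt
          exact_mod_cast this
        exact sInf_le ⟨hlt, ⟨m, hm0⟩, renewalSet_eq_true.2 ⟨j, hm.symm⟩, hm.symm⟩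
    · refine le_sInf ?_
      rintro t ⟨ht, n, hn, rfl⟩
      obtain ⟨k, hk⟩ := renewalSet_eq_true.1 hn
      rw [← hk] at ht ⊢
      have hjk : j < k + 1 := by
        by_contra! h
        exact absurd (sum_range_mono T h) (not_le.2 ht)
      exact sum_range_mono T hjk

theorem mem_cylinder_append {A : ℕ+ → Bool} {l₁ l₂ : List Bool} :
    A ∈ cylinder (l₁ ++ l₂) ↔ A ∈ cylinder l₁ ∧
      ∀ (i : ℕ) (h : i < l₂.length), A (l₁.length + i).succPNat = l₂[i] := by
  simp only [cylinder, mem_ofPred_eq]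
  constructor
  · intro h
    refine ⟨fun i hi => ?_, fun i hi => ?_⟩
    · rw [h i (by simp; omega), List.getElem_append_left hi]
    · rw [h (l₁.length + i) (by simp; omega), List.getElem_append_right (by omega)]
      simp
  · rintro ⟨h1, h2⟩ i hi
    by_cases h : i < l₁.length
    · rw [h1 i h, List.getElem_append_left h]
    · have h3 := h2 (i - l₁.length) (by simp at hi; omega)
      rw [show l₁.length + (i - l₁.length) = i by omega] at h3
      rw [h3, List.getElem_append_right (by omega)]

theorem first_gap_iff {T : ℕ → ℕ∞} (hT : ∀ i, T i ≠ 0) (r : ℕ) :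
    ((∀ i < r, renewalSet T i.succPNat = false) ∧ renewalSet T r.succPNat = true) ↔
      T 0 = ((r + 1 : ℕ) : ℕ∞) := by
  have h0 : ∀ k, T 0 ≤ ∑ i ∈ Finset.range (k + 1), T i := fun k => by
    have := sum_range_mono T (show 1 ≤ k + 1 by omega)
    simpa using this
  constructor
  · rintro ⟨h1, h2⟩
    obtain ⟨k, hk⟩ := renewalSet_eq_true.1 h2
    have h3 : T 0 ≤ ((r + 1 : ℕ) : ℕ∞) := (h0 k).trans hk.le
    obtain ⟨m, hm⟩ := ENat.ne_top_iff_exists.1 (ne_top_of_le_ne_top (ENat.natCast_ne_top _) h3)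
    rw [← hm] at h3 ⊢
    have hm1 : m ≤ r + 1 := by exact_mod_cast h3
    have hm0 : m ≠ 0 := by rintro rfl; exact hT 0 (by rw [← hm]; rfl)
    rcases hm1.eq_or_lt with h4 | h4
    · rw [h4]
    · have h5 := h1 (m - 1) (by omega)
      have h6 : renewalSet T (m - 1).succPNat = true := by
        refine renewalSet_eq_true.2 ⟨0, ?_⟩
        simp only [zero_add, Finset.sum_range_one, ← hm, Nat.succPNat_coe]
        congr 1; omega
      rw [h5] at h6; exact absurd h6 (by simp)
  · intro h
    refine ⟨fun i hi => ?_, renewalSet_eq_true.2 ⟨0, by simp [h]⟩⟩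
    rw [Bool.eq_false_iff, Ne, renewalSet_eq_true]
    rintro ⟨k, hk⟩
    have := h0 k
    rw [hk, h, Nat.succPNat_coe] at this
    have h2 : r + 1 ≤ i + 1 := by exact_mod_cast this
    omega

theorem renewalSet_shift {T : ℕ → ℕ∞} {r : ℕ} (h : T 0 = ((r + 1 : ℕ) : ℕ∞)) (i : ℕ) :
    renewalSet T (r + 1 + i).succPNat = renewalSet (fun j => T (j + 1)) i.succPNat := by
  rw [Bool.eq_iff_iff, renewalSet_eq_true, renewalSet_eq_true]
  have hc : ∀ x : ℕ∞, x + ((r + 1 : ℕ) : ℕ∞) = ((r + 1 + i + 1 : ℕ) : ℕ∞) ↔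
      x = ((i + 1 : ℕ) : ℕ∞) := fun x => by
    rw [show r + 1 + i + 1 = (i + 1) + (r + 1) by ring, Nat.cast_add (i + 1)]
    exact (ENat.add_left_injective_of_ne_top (ENat.natCast_ne_top _)).eq_iff
  simp only [Nat.succPNat_coe, Nat.succ_eq_add_one]
  constructor
  · rintro ⟨k, hk⟩
    rw [Finset.sum_range_succ', h, hc] at hk
    cases k with
    | zero =>
      simp only [Finset.range_zero, Finset.sum_empty] at hk
      have : 0 = i + 1 := by exact_mod_cast hk
      omega
    | succ k => exact ⟨k, hk⟩
  · rintro ⟨k, hk⟩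
    exact ⟨k + 1, by rw [Finset.sum_range_succ', h, hc]; exact hk⟩

theorem mem_cylinder_replicate_true {T : ℕ → ℕ∞} (hT : ∀ i, T i ≠ 0) (r : ℕ) (l : List Bool) :
    renewalSet T ∈ cylinder (List.replicate r false ++ true :: l) ↔
      T 0 = ((r + 1 : ℕ) : ℕ∞) ∧ renewalSet (fun j => T (j + 1)) ∈ cylinder l := by
  rw [show List.replicate r false ++ true :: l = (List.replicate r false ++ [true]) ++ l by simp,
    mem_cylinder_append, mem_cylinder_append, ← first_gap_iff hT]
  have h1 : renewalSet T ∈ cylinder (List.replicate r false) ↔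
      ∀ i < r, renewalSet T i.succPNat = false := by
    simp [cylinder]
  have h2 : (∀ (i : ℕ) (h : i < [true].length),
      renewalSet T ((List.replicate r false).length + i).succPNat = [true][i]) ↔
      renewalSet T r.succPNat = true := by
    simp
  rw [h1, h2]
  refine and_congr_right fun h => ?_
  rw [first_gap_iff hT] at h
  simp only [cylinder, mem_ofPred_eq, List.length_append, List.length_replicate, List.length_cons,
    List.length_nil, zero_add, renewalSet_shift h]

/-- A pattern that ends with a contact says exactly what the first few increments are. Reading it
from the left, `r` zeros followed by a one fix `T 0 = r + 1`, and the rest of the pattern concerns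
the shifted sequence. -/
theorem mem_cylinder_iff_gaps {T : ℕ → ℕ∞} (hT : ∀ i, T i ≠ 0) (r : ℕ) (l : List Bool) :
    renewalSet T ∈ cylinder (List.replicate r false ++ (l ++ [true])) ↔
      ∀ (i : ℕ) (h : i < (gaps r l).length), T i = (((gaps r l)[i] : ℕ) : ℕ∞) := by
  induction l generalizing r T with
  | nil =>
    rw [List.nil_append, mem_cylinder_replicate_true hT]
    simp [gaps, cylinder]
  | cons c l ih =>
    cases c with
    | true =>
      rw [List.cons_append, mem_cylinder_replicate_true hT]
      have := ih (T := fun j => T (j + 1)) (fun i => hT _) 0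
      rw [List.replicate_zero, List.nil_append] at this
      rw [this]
      simp only [gaps]
      constructor
      · rintro ⟨h1, h2⟩ i hi
        cases i with
        | zero => exact h1
        | succ i => exact h2 i (by simpa using hi)
      · intro h
        exact ⟨h 0 (by simp), fun i hi => h (i + 1) (by simpa using hi)⟩
    | false =>
      have h2 : List.replicate r false ++ (false :: l ++ [true]) =
          List.replicate (r + 1) false ++ (l ++ [true]) := by
        rw [List.replicate_succ', List.append_assoc]; rfl
      rw [h2, ih hT (r + 1)]
      rfl

/-- The law on `ℕ ∪ {∞}` with masses `K` on `ℕ`. -/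
noncomputable def interarrivalLaw (K : ℕ → ℝ≥0∞) : Measure ℕ∞ :=
  Measure.sum (fun n : ℕ => K n • Measure.dirac (n : ℕ∞)) + (1 - ∑' n, K n) • Measure.dirac ⊤

variable {K : ℕ → ℝ≥0∞}

theorem interarrivalLaw_coe (K : ℕ → ℝ≥0∞) (n : ℕ) : interarrivalLaw K {(n : ℕ∞)} = K n := by
  simp only [interarrivalLaw, Measure.add_apply, Measure.smul_apply, smul_eq_mul,
    Measure.sum_apply _ (measurableSet_singleton _),
    Measure.dirac_apply' _ (measurableSet_singleton _)]
  rw [tsum_eq_single n]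
  · simp
  · intro m hm
    simp [hm]

theorem isProbabilityMeasure_interarrivalLaw (hK : ∑' n, K n ≤ 1) :
    IsProbabilityMeasure (interarrivalLaw K) := by
  constructor
  simp only [interarrivalLaw, Measure.add_apply, Measure.smul_apply, smul_eq_mul,
    Measure.sum_apply _ MeasurableSet.univ, measure_univ, mul_one]
  exact add_tsub_cancel_of_le hK

/-- The law of the set of the renewal times. -/
noncomputable def renewalLaw (K : ℕ → ℝ≥0∞) : Measure (ℕ+ → Bool) :=
  (Measure.infinitePi fun _ : ℕ => interarrivalLaw K).map renewalSet

theorem ae_ne_zero (h0 : K 0 = 0) (hK : ∑' n, K n ≤ 1) :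
    ∀ᵐ T ∂(Measure.infinitePi fun _ : ℕ => interarrivalLaw K), ∀ i, T i ≠ 0 := by
  have := isProbabilityMeasure_interarrivalLaw hK
  rw [ae_all_iff]
  intro i
  have h1 := (measurePreserving_eval_infinitePi (fun _ : ℕ => interarrivalLaw K) i)
  have h2 : ∀ᵐ t ∂(interarrivalLaw K), t ≠ 0 := by
    rw [ae_iff]
    have := interarrivalLaw_coe K 0
    rw [h0] at this
    simpa using this
  exact h1.quasiMeasurePreserving.ae h2

theorem isProbabilityMeasure_renewalLaw (hK : ∑' n, K n ≤ 1) :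
    IsProbabilityMeasure (renewalLaw K) := by
  have := isProbabilityMeasure_interarrivalLaw hK
  exact Measure.isProbabilityMeasure_map measurable_renewalSet.aemeasurable

theorem hasRenewalLaw_renewalLaw (h0 : K 0 = 0) (hK : ∑' n, K n ≤ 1) :
    HasRenewalLaw (renewalLaw K) contactTime K := by
  have := isProbabilityMeasure_interarrivalLaw hK
  refine ⟨ℕ → ℕ∞, inferInstance, Measure.infinitePi fun _ : ℕ => interarrivalLaw K,
    fun i T => T i, inferInstance, fun i => measurable_pi_apply i, ?_, fun i n => ?_,
    measurable_contactTime.aemeasurable, ?_⟩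
  · exact iIndepFun_infinitePi (X := fun _ t => t) fun _ => measurable_id
  · have h1 := (measurePreserving_eval_infinitePi (fun _ : ℕ => interarrivalLaw K) i)
    rw [← interarrivalLaw_coe K n, ← h1.measure_preimage
      (measurableSet_singleton _).nullMeasurableSet]
    rfl
  · rw [renewalLaw, Measure.map_map measurable_contactTime measurable_renewalSet]
    refine Measure.map_congr ?_
    filter_upwards [ae_ne_zero h0 hK] with T hT
    funext k
    exact contactTime_renewalSet hT k

theorem renewalLaw_cylinder (h0 : K 0 = 0) (hK : ∑' n, K n ≤ 1) (l : List Bool) :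
    renewalLaw K (cylinder (l ++ [true])) = ((gaps 0 l).map K).prod := by
  have := isProbabilityMeasure_interarrivalLaw hK
  rw [renewalLaw, Measure.map_apply measurable_renewalSet (measurableSet_cylinder _)]
  -- Only the increments with index below the number of gaps are constrained; the default of `getD`
  -- is never read.
  have h1 : renewalSet ⁻¹' cylinder (l ++ [true]) =ᵐ[Measure.infinitePi
      fun _ : ℕ => interarrivalLaw K] (Finset.range (gaps 0 l).length : Set ℕ).pi
        fun i => {(((gaps 0 l).getD i 0 : ℕ) : ℕ∞)} := by
    filter_upwards [ae_ne_zero h0 hK] with T hT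
    have h2 := mem_cylinder_iff_gaps hT 0 l
    rw [List.replicate_zero, List.nil_append] at h2
    refine propext (h2.trans ?_)
    simp only [Finset.coe_range]
    constructor
    · intro h i hi
      have hi' : i < (gaps 0 l).length := hi
      rw [mem_singleton_iff, h i hi', List.getD_eq_getElem _ _ hi']
    · intro h i hi
      have := h i hi
      rwa [mem_singleton_iff, List.getD_eq_getElem _ _ hi] at this
  rw [measure_congr h1, Measure.infinitePi_pi _ fun i _ => measurableSet_singleton _]
  simp only [interarrivalLaw_coe]
  rw [Finset.prod_range, ← List.prod_ofFn]
  congr 1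
  refine List.ext_getElem (by simp) fun i h1 h2 => ?_
  simp

end Renewals

/-! ### Weak convergence from cylinders. -/

section Weak

variable {p : ℕ → Measure (ℕ+ → Bool)} {p' : Measure (ℕ+ → Bool)}

theorem cylinder_append_false (l : List Bool) :
    cylinder (l ++ [false]) = cylinder l \ cylinder (l ++ [true]) := by
  ext A
  simp only [Set.mem_sdiff, mem_cylinder_append]
  cases h : A (l.length).succPNat <;> simp [h]

theorem cylinder_append_true_subset (l : List Bool) : cylinder (l ++ [true]) ⊆ cylinder l :=
  fun _ hA => (mem_cylinder_append.1 hA).1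

/-- Induction on the last letter: a cylinder that ends with a dry site is the difference of its
parent and of the sibling that ends with a contact. -/
theorem tendsto_cylinder (hp : ∀ᶠ N in atTop, IsProbabilityMeasure (p N))
    (hp' : IsProbabilityMeasure p')
    (h : ∀ l, Tendsto (fun N => p N (cylinder (l ++ [true]))) atTop
      (𝓝 (p' (cylinder (l ++ [true]))))) (l : List Bool) :
    Tendsto (fun N => p N (cylinder l)) atTop (𝓝 (p' (cylinder l))) := by
  induction l using List.reverseRecOn with
  | nil =>
    have : cylinder [] = univ := by ext A; simp [cylinder]
    rw [this, measure_univ]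
    refine tendsto_const_nhds.congr' ?_
    filter_upwards [hp] with N hN
    rw [measure_univ]
  | append_singleton l c ih =>
    cases c with
    | true => exact h l
    | false =>
      have hsub : ∀ μ : Measure (ℕ+ → Bool), IsProbabilityMeasure μ →
          μ (cylinder (l ++ [false])) = μ (cylinder l) - μ (cylinder (l ++ [true])) := by
        intro μ hμ
        rw [cylinder_append_false, measure_sdiff (cylinder_append_true_subset l)
          (measurableSet_cylinder _).nullMeasurableSet (measure_ne_top _ _)]
      rw [hsub p' hp']
      refine (ENNReal.Tendsto.sub ih (h l) (Or.inl (measure_ne_top _ _))).congr' ?_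
      filter_upwards [hp] with N hN
      rw [hsub (p N) hN]

/-- The initial segment of length `m` of a contact set. -/
def initialSegment (m : ℕ) (A : ℕ+ → Bool) : Fin m → Bool := fun i => A (i : ℕ).succPNat

/-- The contact set without contacts after `m` and with a given initial segment. -/
def extendSegment (m : ℕ) (B : Fin m → Bool) : ℕ+ → Bool :=
  fun n => if h : n.natPred < m then B ⟨n.natPred, h⟩ else false

theorem measurable_initialSegment (m : ℕ) : Measurable (initialSegment m) :=
  measurable_pi_iff.2 fun _ => measurable_pi_apply _

theorem initialSegment_preimage (m : ℕ) (B : Fin m → Bool) :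
    initialSegment m ⁻¹' {B} = cylinder (List.ofFn B) := by
  ext A
  simp only [mem_preimage, mem_singleton_iff, cylinder, mem_ofPred_eq, List.length_ofFn,
    List.getElem_ofFn]
  constructor
  · rintro rfl i hi; rfl
  · intro h; funext i; exact h i i.2

theorem tendsto_integral_initialSegment (hp : ∀ᶠ N in atTop, IsProbabilityMeasure (p N))
    (hp' : IsProbabilityMeasure p')
    (h : ∀ l, Tendsto (fun N => p N (cylinder l)) atTop (𝓝 (p' (cylinder l)))) (m : ℕ)
    (g : (Fin m → Bool) → ℝ) :
    Tendsto (fun N => ∫ A, g (initialSegment m A) ∂(p N)) atTop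
      (𝓝 (∫ A, g (initialSegment m A) ∂p')) := by
  have key : ∀ μ : Measure (ℕ+ → Bool), IsProbabilityMeasure μ →
      ∫ A, g (initialSegment m A) ∂μ = ∑ B, (μ (cylinder (List.ofFn B))).toReal * g B := by
    intro μ hμ
    have : IsProbabilityMeasure (μ.map (initialSegment m)) :=
      Measure.isProbabilityMeasure_map (measurable_initialSegment m).aemeasurable
    rw [← integral_map (measurable_initialSegment m).aemeasurable
      (measurable_of_finite g).aestronglyMeasurable, integral_fintype (.of_finite)]
    refine Finset.sum_congr rfl fun B _ => ?_
    rw [measureReal_def, Measure.map_apply (measurable_initialSegment m)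
      (measurableSet_singleton B), initialSegment_preimage, smul_eq_mul]
  rw [key p' hp']
  refine Tendsto.congr' (f₁ := fun N => ∑ B, (p N (cylinder (List.ofFn B))).toReal * g B) ?_ ?_
  · filter_upwards [hp] with N hN
    rw [key (p N) hN]
  · refine tendsto_finsetSum _ fun B _ => Tendsto.mul_const _ ?_
    exact (ENNReal.tendsto_toReal (measure_ne_top _ _)).comp (h _)

theorem tendsto_extendSegment {A : ℕ → ℕ+ → Bool} {A' : ℕ+ → Bool} {φ : ℕ → ℕ}
    (hφ : Tendsto φ atTop atTop) (hA : Tendsto (fun m => A (φ m)) atTop (𝓝 A')) :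
    Tendsto (fun m => extendSegment (φ m) (initialSegment (φ m) (A (φ m)))) atTop (𝓝 A') := by
  rw [tendsto_pi_nhds] at hA ⊢
  intro n
  refine (hA n).congr' ?_
  filter_upwards [hφ.eventually_gt_atTop n.natPred] with m hm
  simp [extendSegment, initialSegment, hm]

/-- By compactness of `{0,1}^ℕ`: a sequence of counterexamples has a subsequence along which both
the points and their truncations converge to the same point, which contradicts the continuity of
`f`. -/
theorem exists_initialSegment_approx (f : (ℕ+ → Bool) →ᵇ ℝ) {ε : ℝ} (hε : 0 < ε) :
    ∃ m, ∀ A, |f A - f (extendSegment m (initialSegment m A))| ≤ ε := by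
  by_contra! hcon
  choose A hA using hcon
  obtain ⟨A', φ, hφ, hlim⟩ := CompactSpace.tendsto_subseq A
  have h1 := (f.continuous.tendsto A').comp hlim
  have h2 := (f.continuous.tendsto A').comp (tendsto_extendSegment hφ.tendsto_atTop hlim)
  have h3 := (h1.sub h2).abs
  rw [sub_self, abs_zero] at h3
  obtain ⟨m, hm⟩ := (h3.eventually_lt_const hε).exists
  exact absurd (hA (φ m)) (not_lt.2 hm.le)

/-- Weak convergence of laws on `{0,1}^ℕ` follows from the convergence of the probabilities of
the cylinders that end with a contact. -/
theorem convergesWeakly_of_cylinder (hp : ∀ᶠ N in atTop, IsProbabilityMeasure (p N))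
    (hp' : IsProbabilityMeasure p')
    (h : ∀ l, Tendsto (fun N => p N (cylinder (l ++ [true]))) atTop
      (𝓝 (p' (cylinder (l ++ [true]))))) : ConvergesWeakly p p' := by
  refine ⟨hp, hp', fun f => ?_⟩
  have hcyl := tendsto_cylinder hp hp' h
  rw [Metric.tendsto_nhds]
  intro ε hε
  obtain ⟨m, hm⟩ := exists_initialSegment_approx f (show 0 < ε / 4 by positivity)
  set g : (Fin m → Bool) → ℝ := fun B => f (extendSegment m B) with hg
  have happrox : ∀ μ : Measure (ℕ+ → Bool), IsProbabilityMeasure μ →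
      |∫ A, f A ∂μ - ∫ A, g (initialSegment m A) ∂μ| ≤ ε / 4 := by
    intro μ hμ
    have hi : Integrable (fun A => g (initialSegment m A)) μ := by
      refine Integrable.of_bound (((measurable_of_finite g).comp
        (measurable_initialSegment m)).aestronglyMeasurable) ‖f‖ (Eventually.of_forall fun A => ?_)
      exact f.norm_coe_le_norm _
    rw [← integral_sub (f.integrable μ) hi]
    have := norm_integral_le_of_norm_le_const (μ := μ) (C := ε / 4)
      (f := fun A => f A - g (initialSegment m A)) (Eventually.of_forall fun A => hm A)
    simpa using this
  have hlim := tendsto_integral_initialSegment hp hp' hcyl m g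
  rw [Metric.tendsto_nhds] at hlim
  filter_upwards [hp, hlim (ε / 4) (by positivity)] with N hN h1
  have h2 := happrox p' hp'
  have h3 := happrox (p N) hN
  rw [Real.dist_eq] at h1 ⊢
  rw [abs_lt] at h1 ⊢
  rw [abs_le] at h2 h3
  constructor <;> linarith [h1.1, h1.2, h2.1, h2.2, h3.1, h3.2]

end Weak

/-! ### Truncated moments of a law with slowly varying truncated variance. -/

section TruncatedMoments

/-- The truncated second moment of a law on the line. -/
noncomputable def truncSq (μ : Measure ℝ) (t : ℝ) : ℝ := ∫ y in {y : ℝ | |y| ≤ t}, |y| ^ 2 ∂μ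

theorem measurableSet_abs_le (t : ℝ) : MeasurableSet {y : ℝ | |y| ≤ t} :=
  measurableSet_le measurable_id.abs measurable_const

theorem truncSq_nonneg {μ : Measure ℝ} (t : ℝ) : 0 ≤ truncSq μ t :=
  setIntegral_nonneg (measurableSet_abs_le t) fun y _ => by positivity

variable {μ : Measure ℝ} [IsProbabilityMeasure μ]

theorem integrableOn_sq (t : ℝ) : IntegrableOn (fun y : ℝ => |y| ^ 2) {y : ℝ | |y| ≤ t} μ := by
  refine Measure.integrableOn_of_bounded (M := t ^ 2) (measure_ne_top _ _)
    (by fun_prop) ?_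
  refine (ae_restrict_iff' (measurableSet_abs_le t)).2 (Eventually.of_forall fun y hy => ?_)
  rw [Real.norm_of_nonneg (by positivity)]
  exact pow_le_pow_left₀ (abs_nonneg y) hy 2

theorem truncSq_mono : Monotone (truncSq μ) := fun _ t hst =>
  setIntegral_mono_set (integrableOn_sq t) (Eventually.of_forall fun y => by positivity)
    (Eventually.of_forall fun _ hy => le_trans hy hst)

theorem setIntegral_sq_annulus {s t : ℝ} (hst : s ≤ t) :
    ∫ y in {y : ℝ | s < |y| ∧ |y| ≤ t}, |y| ^ 2 ∂μ = truncSq μ t - truncSq μ s := by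
  have h1 : {y : ℝ | s < |y| ∧ |y| ≤ t} = {y | |y| ≤ t} \ {y | |y| ≤ s} := by
    ext y; simp [and_comm]
  rw [h1, setIntegral_sdiff (measurableSet_abs_le s) (integrableOn_sq t)
    fun y hy => le_trans hy hst]
  rfl

-- Since `0 / 0 = 0`, slow variation with `c = 1` already excludes a truncated variance that
-- vanishes for arbitrarily large arguments.
omit [IsProbabilityMeasure μ] in
theorem eventually_truncSq_pos (h : IsSlowlyVarying (truncSq μ)) :
    ∃ t₀ : ℝ, 0 < t₀ ∧ 0 < truncSq μ t₀ := by
  have h1 := (h 1 one_pos).eventually_ne one_ne_zero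
  obtain ⟨t, ht, ht0⟩ := (h1.and (eventually_gt_atTop 0)).exists
  refine ⟨t, ht0, lt_of_le_of_ne (truncSq_nonneg t) fun h0 => ht ?_⟩
  rw [← h0, div_zero]

/-- The first moment outside of `[-t, t]`. -/
noncomputable def tailMoment (μ : Measure ℝ) (t : ℝ) : ℝ := ∫ y in {y : ℝ | t < |y|}, |y| ∂μ

theorem measurableSet_lt_abs (t : ℝ) : MeasurableSet {y : ℝ | t < |y|} :=
  measurableSet_lt measurable_const measurable_id.abs

/-- On the shell `t < |y| ≤ 2t` one has `|y| ≤ |y|² / t`. -/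
theorem tailMoment_le (hint : Integrable (fun y : ℝ => y) μ) {t : ℝ} (ht : 0 < t) :
    tailMoment μ t ≤ (truncSq μ (2 * t) - truncSq μ t) / t + tailMoment μ (2 * t) := by
  have h1 : {y : ℝ | t < |y|} = {y | t < |y| ∧ |y| ≤ 2 * t} ∪ {y | 2 * t < |y|} := by
    ext y
    simp only [mem_ofPred_eq, mem_union]
    constructor
    · intro h
      rcases le_or_gt (|y|) (2 * t) with h2 | h2
      · exact Or.inl ⟨h, h2⟩
      · exact Or.inr h2
    · rintro (h | h)
      · exact h.1
      · linarith
  have hm : MeasurableSet {y : ℝ | t < |y| ∧ |y| ≤ 2 * t} :=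
    (measurableSet_lt_abs t).inter (measurableSet_abs_le _)
  have hd : Disjoint {y : ℝ | t < |y| ∧ |y| ≤ 2 * t} {y | 2 * t < |y|} := by
    rw [Set.disjoint_left]
    rintro y ⟨_, h2⟩ h3
    exact absurd h2 (not_le.2 h3)
  rw [tailMoment, h1, setIntegral_union hd (measurableSet_lt_abs _) hint.abs.integrableOn
    hint.abs.integrableOn]
  refine add_le_add ?_ le_rfl
  rw [← setIntegral_sq_annulus (by linarith), ← integral_div]
  refine setIntegral_mono_on hint.abs.integrableOn ?_ hm fun y hy => ?_
  · exact (((integrableOn_sq (μ := μ) (2 * t)).mono_set fun y hy => hy.2)).div_const t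
  · rw [le_div_iff₀ ht]
    nlinarith [hy.1]

omit [IsProbabilityMeasure μ] in
theorem tendsto_tailMoment (hint : Integrable (fun y : ℝ => y) μ) :
    Tendsto (tailMoment μ) atTop (𝓝 0) := by
  have h1 : ∀ t, tailMoment μ t = ∫ y, {y : ℝ | t < |y|}.indicator (fun y => |y|) y ∂μ :=
    fun t => (integral_indicator (measurableSet_lt_abs t)).symm
  rw [show tailMoment μ = _ from funext h1, ← integral_zero ℝ ℝ (μ := μ)]
  refine tendsto_integral_filter_of_dominated_convergence (fun y => |y|)
    (Eventually.of_forall fun t => ?_) (Eventually.of_forall fun t => Eventually.of_forall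
      fun y => ?_) hint.abs (Eventually.of_forall fun y => ?_)
  · exact (measurable_id.abs.indicator (measurableSet_lt_abs t)).aestronglyMeasurable
  · rw [Real.norm_of_nonneg (indicator_nonneg (fun _ _ => abs_nonneg _) y)]
    exact indicator_le_self' (fun _ _ => abs_nonneg _) y
  · refine tendsto_const_nhds.congr' ?_
    filter_upwards [eventually_ge_atTop |y|] with t ht
    rw [indicator_of_notMem]
    exact not_lt.2 ht

/-- Sum `tailMoment_le` over dyadic shells. By slow variation each shell contributes at most `ζ`
times the truncated variance over `t`, and the division by the doubled radius makes the series
geometric. -/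
theorem eventually_mul_tailMoment_le (hint : Integrable (fun y : ℝ => y) μ)
    (h : IsSlowlyVarying (truncSq μ)) {η : ℝ} (hη : 0 < η) :
    ∀ᶠ t in atTop, t * tailMoment μ t ≤ η * truncSq μ t := by
  set ζ := min (η / 4) (1 / 2) with hζ
  have hζ0 : 0 < ζ := by positivity
  have hζ1 : ζ ≤ η / 4 := min_le_left _ _
  have hζ2 : ζ ≤ 1 / 2 := min_le_right _ _
  obtain ⟨t₀, ht₀, hL₀⟩ := eventually_truncSq_pos h
  have h1 := (h 2 two_pos).eventually_le_const (show (1 : ℝ) < 1 + ζ by linarith)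
  obtain ⟨t₁, ht₁⟩ := eventually_atTop.1 h1
  have hstep : ∀ t, max t₀ t₁ ≤ t → truncSq μ (2 * t) ≤ (1 + ζ) * truncSq μ t := by
    intro t ht
    have h2 := ht₁ t ((le_max_right _ _).trans ht)
    have h3 : 0 < truncSq μ t := hL₀.trans_le (truncSq_mono ((le_max_left _ _).trans ht))
    rwa [div_le_iff₀ h3] at h2
  -- The constant `4 * ζ` reproduces itself: `ζ + 4ζ (1 + ζ)/2 ≤ 4ζ` is the condition `ζ ≤ 1/2`.
  have hmain : ∀ M : ℕ, ∀ t, max t₀ t₁ ≤ t →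
      tailMoment μ t ≤ 4 * ζ * (truncSq μ t / t) + tailMoment μ (2 ^ M * t) := by
    intro M
    induction M with
    | zero =>
      intro t ht
      have ht0 : 0 < t := ht₀.trans_le ((le_max_left _ _).trans ht)
      have := truncSq_nonneg (μ := μ) t
      rw [pow_zero, one_mul]
      exact le_add_of_nonneg_left (by positivity)
    | succ M ih =>
      intro t ht
      have ht0 : 0 < t := ht₀.trans_le ((le_max_left _ _).trans ht)
      have h2 := ih (2 * t) (by linarith)
      have h3 := tailMoment_le hint ht0
      have h4 := hstep t ht
      have h5 := truncSq_nonneg (μ := μ) t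
      have h6 : (truncSq μ (2 * t) - truncSq μ t) / t ≤ ζ * (truncSq μ t / t) := by
        rw [← mul_div_assoc]
        gcongr
        linarith
      have h7 : truncSq μ (2 * t) / (2 * t) ≤ (1 + ζ) / 2 * (truncSq μ t / t) := by
        rw [div_mul_div_comm]
        gcongr
      rw [show (2 : ℝ) ^ (M + 1) * t = 2 ^ M * (2 * t) by ring]
      have h8 : 0 ≤ truncSq μ t / t := by positivity
      have h9 : 4 * ζ * (truncSq μ (2 * t) / (2 * t)) ≤
          4 * ζ * ((1 + ζ) / 2 * (truncSq μ t / t)) := by gcongr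
      nlinarith [mul_nonneg (mul_nonneg hζ0.le h8) (sub_nonneg.2 hζ2)]
  filter_upwards [eventually_ge_atTop (max t₀ t₁)] with t ht
  have ht0 : 0 < t := ht₀.trans_le ((le_max_left _ _).trans ht)
  have h2 : Tendsto (fun M : ℕ => 4 * ζ * (truncSq μ t / t) + tailMoment μ (2 ^ M * t)) atTop
      (𝓝 (4 * ζ * (truncSq μ t / t) + 0)) := by
    refine tendsto_const_nhds.add ((tendsto_tailMoment hint).comp ?_)
    exact (tendsto_pow_atTop_atTop_of_one_lt one_lt_two).atTop_mul_const ht0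
  have h3 := ge_of_tendsto' h2 fun M => hmain M t ht
  have h5 := truncSq_nonneg (μ := μ) t
  rw [add_zero, ← mul_div_assoc, le_div_iff₀ ht0] at h3
  nlinarith

theorem integrableOn_cube (t : ℝ) : IntegrableOn (fun y : ℝ => |y| ^ 3) {y : ℝ | |y| ≤ t} μ := by
  refine Measure.integrableOn_of_bounded (M := t ^ 3) (measure_ne_top _ _)
    (by fun_prop) ?_
  refine (ae_restrict_iff' (measurableSet_abs_le t)).2 (Eventually.of_forall fun y hy => ?_)
  rw [Real.norm_of_nonneg (by positivity)]
  exact pow_le_pow_left₀ (abs_nonneg y) hy 3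

/-- Cut at `ζ t`. Inside, one factor `|y|` is at most `ζ t`; outside, it is at most `t`, but the
second moment of the annulus is negligible by slow variation. -/
theorem eventually_setIntegral_cube_le (h : IsSlowlyVarying (truncSq μ)) {η : ℝ} (hη : 0 < η) :
    ∀ᶠ t in atTop, ∫ y in {y : ℝ | |y| ≤ t}, |y| ^ 3 ∂μ ≤ η * (t * truncSq μ t) := by
  set ζ := min (η / 2) 1 with hζ
  have hζ0 : 0 < ζ := by positivity
  have hζ1 : ζ ≤ η / 2 := min_le_left _ _
  have hζ2 : ζ ≤ 1 := min_le_right _ _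
  obtain ⟨t₀, ht₀, hL₀⟩ := eventually_truncSq_pos h
  have h1 := (h ζ hζ0).eventually_const_le (show 1 - η / 2 < 1 by linarith)
  filter_upwards [h1, eventually_ge_atTop t₀] with t ht htt
  have ht0 : 0 < t := ht₀.trans_le htt
  have hL : 0 < truncSq μ t := hL₀.trans_le (truncSq_mono htt)
  rw [le_div_iff₀ hL] at ht
  have hle : ζ * t ≤ t := mul_le_of_le_one_left ht0.le hζ2
  have h2 : {y : ℝ | |y| ≤ t} = {y | |y| ≤ ζ * t} ∪ {y | ζ * t < |y| ∧ |y| ≤ t} := by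
    ext y
    simp only [mem_ofPred_eq, mem_union]
    constructor
    · intro h
      rcases le_or_gt (|y|) (ζ * t) with h2 | h2
      · exact Or.inl h2
      · exact Or.inr ⟨h2, h⟩
    · rintro (h | h)
      · exact h.trans hle
      · exact h.2
  have hd : Disjoint {y : ℝ | |y| ≤ ζ * t} {y | ζ * t < |y| ∧ |y| ≤ t} := by
    rw [Set.disjoint_left]
    rintro y h2 ⟨h3, _⟩
    exact absurd h2 (not_le.2 h3)
  have hm : MeasurableSet {y : ℝ | ζ * t < |y| ∧ |y| ≤ t} :=
    (measurableSet_lt_abs _).inter (measurableSet_abs_le _)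
  have hi : IntegrableOn (fun y : ℝ => |y| ^ 3) {y | ζ * t < |y| ∧ |y| ≤ t} μ :=
    (integrableOn_cube t).mono_set fun y hy => hy.2
  have hi2 : IntegrableOn (fun y : ℝ => |y| ^ 2) {y | ζ * t < |y| ∧ |y| ≤ t} μ :=
    (integrableOn_sq t).mono_set fun y hy => hy.2
  rw [h2, setIntegral_union hd hm (integrableOn_cube _) hi]
  have e1 : ∫ y in {y : ℝ | |y| ≤ ζ * t}, |y| ^ 3 ∂μ ≤ ζ * t * truncSq μ (ζ * t) := by
    rw [truncSq, ← integral_const_mul]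
    refine setIntegral_mono_on (integrableOn_cube _) ((integrableOn_sq _).const_mul _)
      (measurableSet_abs_le _) fun y hy => ?_
    rw [pow_succ, mul_comm]
    exact mul_le_mul_of_nonneg_right hy (by positivity)
  have e2 : ∫ y in {y : ℝ | ζ * t < |y| ∧ |y| ≤ t}, |y| ^ 3 ∂μ ≤
      t * (truncSq μ t - truncSq μ (ζ * t)) := by
    rw [← setIntegral_sq_annulus hle, ← integral_const_mul]
    refine setIntegral_mono_on hi (hi2.const_mul _) hm fun y hy => ?_
    rw [pow_succ, mul_comm]
    exact mul_le_mul_of_nonneg_right hy.2 (by positivity)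
  have e3 : truncSq μ (ζ * t) ≤ truncSq μ t := truncSq_mono hle
  have e4 : ζ * t * truncSq μ (ζ * t) ≤ η / 2 * (t * truncSq μ t) := by
    calc ζ * t * truncSq μ (ζ * t) ≤ η / 2 * t * truncSq μ t := by
          have := truncSq_nonneg (μ := μ) (ζ * t)
          gcongr
      _ = _ := by ring
  have e5 : t * (truncSq μ t - truncSq μ (ζ * t)) ≤ η / 2 * (t * truncSq μ t) := by
    nlinarith
  linarith

/-- The expectation of `min(|y|³/t, t|y|)`, which is negligible with respect to `truncSq μ t`. -/
theorem eventually_integral_min_le (hint : Integrable (fun y : ℝ => y) μ)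
    (h : IsSlowlyVarying (truncSq μ)) {η : ℝ} (hη : 0 < η) :
    ∀ᶠ t in atTop, (∫ y in {y : ℝ | |y| ≤ t}, |y| ^ 3 ∂μ) / t + t * tailMoment μ t ≤
      η * truncSq μ t := by
  filter_upwards [eventually_mul_tailMoment_le hint h (show 0 < η / 2 by positivity),
    eventually_setIntegral_cube_le h (show 0 < η / 2 by positivity), eventually_gt_atTop 0]
    with t h1 h2 ht
  have h3 : (∫ y in {y : ℝ | |y| ≤ t}, |y| ^ 3 ∂μ) / t ≤ η / 2 * truncSq μ t := by
    rw [div_le_iff₀ ht]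
    linarith
  linarith

end TruncatedMoments

/-! ### The characteristic function near the origin. -/

/-- The expectation of `min(θ²y², 1)`. -/
noncomputable def truncMoment (μ : Measure ℝ) (θ : ℝ) : ℝ := ∫ y, min (θ ^ 2 * y ^ 2) 1 ∂μ

theorem truncMoment_zero (μ : Measure ℝ) : truncMoment μ 0 = 0 := by
  simp [truncMoment]

theorem truncMoment_nonneg (μ : Measure ℝ) (θ : ℝ) : 0 ≤ truncMoment μ θ :=
  integral_nonneg fun y => by positivity

section

variable {μ : Measure ℝ} [IsProbabilityMeasure μ]

theorem integrable_min_sq (θ : ℝ) : Integrable (fun y : ℝ => min (θ ^ 2 * y ^ 2) 1) μ := by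
  refine (integrable_const (1 : ℝ)).mono' (by fun_prop) (Eventually.of_forall fun y => ?_)
  rw [Real.norm_of_nonneg (by positivity)]
  exact min_le_right _ _

/-- Continuity and monotonicity are the reason for working with `truncMoment` instead of the
asymptotically equal `θ² truncSq (1/θ)`, which may jump: the equation that defines the scale can
then be solved by the intermediate value theorem. -/
theorem continuous_truncMoment : Continuous (truncMoment μ) := by
  refine continuous_of_dominated (bound := fun _ => (1 : ℝ)) (fun θ => by fun_prop)
    (fun θ => Eventually.of_forall fun y => ?_) (integrable_const _)
    (Eventually.of_forall fun y => by fun_prop)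
  rw [Real.norm_of_nonneg (by positivity)]
  exact min_le_right _ _

theorem truncMoment_mono {s t : ℝ} (hs : 0 ≤ s) (hst : s ≤ t) :
    truncMoment μ s ≤ truncMoment μ t :=
  integral_mono (integrable_min_sq s) (integrable_min_sq t) fun y =>
    min_le_min_right _ (by gcongr)

theorem truncMoment_le_one (θ : ℝ) : truncMoment μ θ ≤ 1 := by
  have := integral_mono (integrable_min_sq (μ := μ) θ) (integrable_const (1 : ℝ))
    fun y => min_le_right _ _
  simpa [truncMoment] using this

/-- The bound for the error terms: `θ²` times the quantity of `eventually_integral_min_le`. -/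
noncomputable def truncError (μ : Measure ℝ) (t : ℝ) : ℝ :=
  (∫ y in {y : ℝ | |y| ≤ t}, |y| ^ 3 ∂μ) / t + t * tailMoment μ t

theorem truncMoment_inv {t : ℝ} (ht : 0 < t) :
    truncMoment μ t⁻¹ = (t⁻¹) ^ 2 * truncSq μ t + ∫ _ in {y : ℝ | t < |y|}, (1 : ℝ) ∂μ := by
  have h1 : {y : ℝ | t < |y|} = {y : ℝ | |y| ≤ t}ᶜ := by ext; simp
  rw [truncMoment, ← integral_add_compl (measurableSet_abs_le t) (integrable_min_sq _), h1,
    truncSq, ← integral_const_mul]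
  congr 1
  · refine setIntegral_congr_fun (measurableSet_abs_le t) fun y (hy : |y| ≤ t) => ?_
    rw [sq_abs, min_eq_left]
    rw [← mul_pow, sq_le_one_iff_abs_le_one, abs_mul, abs_inv, abs_of_pos ht,
      inv_mul_le_one₀ ht]
    exact hy
  · refine setIntegral_congr_fun (measurableSet_abs_le t).compl fun y hy => ?_
    have hy : t < |y| := not_le.1 hy
    rw [min_eq_right]
    rw [← mul_pow, one_le_sq_iff_one_le_abs, abs_mul, abs_inv, abs_of_pos ht,
      ← div_eq_inv_mul, one_le_div ht]
    exact hy.le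

theorem sq_mul_truncSq_le {t : ℝ} (ht : 0 < t) :
    (t⁻¹) ^ 2 * truncSq μ t ≤ truncMoment μ t⁻¹ := by
  rw [truncMoment_inv ht]
  exact le_add_of_nonneg_right (integral_nonneg fun _ => zero_le_one)

theorem truncMoment_inv_le (hint : Integrable (fun y : ℝ => y) μ) {t : ℝ} (ht : 0 < t) :
    truncMoment μ t⁻¹ ≤ (t⁻¹) ^ 2 * (truncSq μ t + truncError μ t) := by
  rw [truncMoment_inv ht, mul_add]
  refine add_le_add le_rfl ?_
  have h1 : ∫ _ in {y : ℝ | t < |y|}, (1 : ℝ) ∂μ ≤ t⁻¹ * tailMoment μ t := by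
    rw [tailMoment, ← integral_const_mul]
    refine setIntegral_mono_on (integrable_const _).integrableOn
      (hint.abs.integrableOn.const_mul _) (measurableSet_lt_abs t) fun y hy => ?_
    rw [← div_eq_inv_mul, one_le_div ht]
    exact le_of_lt hy
  refine h1.trans ?_
  have h2 : 0 ≤ (∫ y in {y : ℝ | |y| ≤ t}, |y| ^ 3 ∂μ) / t :=
    div_nonneg (integral_nonneg fun _ => by positivity) ht.le
  rw [truncError, mul_add]
  have h3 : (t⁻¹) ^ 2 * (t * tailMoment μ t) = t⁻¹ * tailMoment μ t := by
    field_simp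
  rw [h3]
  exact le_add_of_nonneg_left (by positivity)

/-- Taylor expansion to third order where `|x| ≤ 1`, the trivial bound elsewhere; the two regimes
are those of `truncError`. -/
theorem norm_exp_mul_I_sub_le (x : ℝ) :
    ‖1 + x * Complex.I - Complex.exp (x * Complex.I) -
      (if |x| ≤ 1 then (x : ℂ) ^ 2 / 2 else 0)‖ ≤ 3 * (if |x| ≤ 1 then |x| ^ 3 else |x|) := by
  split_ifs with h
  · have h1 := Complex.exp_bound (x := x * Complex.I) (by simpa using h) (n := 3) (by norm_num)
    rw [norm_sub_rev] at h1
    have h2 : (1 + x * Complex.I - Complex.exp (x * Complex.I) - (x : ℂ) ^ 2 / 2) =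
        ∑ m ∈ Finset.range 3, (x * Complex.I) ^ m / (m.factorial : ℂ) -
          Complex.exp (x * Complex.I) := by
      simp only [Finset.sum_range_succ, Finset.range_zero, Finset.sum_empty, Nat.factorial,
        mul_pow, Complex.I_sq]
      push_cast
      ring
    rw [h2]
    refine h1.trans ?_
    have h3 : ‖(x : ℂ) * Complex.I‖ = |x| := by simp
    rw [h3]
    have h4 : 0 ≤ |x| ^ 3 := by positivity
    norm_num [Nat.factorial]
    linarith
  · rw [sub_zero]
    have h : 1 < |x| := not_le.1 h
    calc ‖1 + (x : ℂ) * Complex.I - Complex.exp (x * Complex.I)‖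
        ≤ ‖(1 : ℂ)‖ + ‖(x : ℂ) * Complex.I‖ + ‖Complex.exp (x * Complex.I)‖ :=
          (norm_sub_le _ _).trans (add_le_add (norm_add_le _ _) le_rfl)
      _ ≤ 3 * |x| := by
          rw [Complex.norm_exp_ofReal_mul_I]
          simp
          linarith

/-- Integrate `norm_exp_mul_I_sub_le` at `θ y`. The linear term disappears because the mean is zero,
and the quadratic one is the truncated variance. -/
theorem norm_one_sub_charFun_sub_le (hint : Integrable (fun y : ℝ => y) μ)
    (hmean : ∫ y, y ∂μ = 0) {t : ℝ} (ht : 0 < t) :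
    ‖1 - charFun μ t⁻¹ - ((((t⁻¹) ^ 2 * truncSq μ t : ℝ) : ℂ) / 2)‖ ≤
      3 * ((t⁻¹) ^ 2 * truncError μ t) := by
  set θ := t⁻¹ with hθ
  have hθ0 : 0 < θ := inv_pos.2 ht
  have hiff : ∀ y : ℝ, |θ * y| ≤ 1 ↔ |y| ≤ t := fun y => by
    rw [abs_mul, abs_of_pos hθ0, hθ, inv_mul_le_one₀ ht]
  have i1 : Integrable (fun y : ℝ => Complex.exp ((θ * y : ℝ) * Complex.I)) μ := by
    refine (integrable_const (1 : ℝ)).mono' (by fun_prop) (Eventually.of_forall fun y => ?_)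
    rw [Complex.norm_exp_ofReal_mul_I]
  have i2 : Integrable (fun y : ℝ => ((θ * y : ℝ) : ℂ) * Complex.I) μ :=
    ((hint.const_mul θ).ofReal).mul_const _
  have i3 : Integrable (fun y : ℝ => if |θ * y| ≤ 1 then (((θ * y : ℝ) : ℂ)) ^ 2 / 2 else 0) μ := by
    refine (integrable_const (1 : ℝ)).mono' ?_ (Eventually.of_forall fun y => ?_)
    · refine (Measurable.ite ?_ (by fun_prop) measurable_const).aestronglyMeasurable
      exact measurableSet_le (by fun_prop) measurable_const
    · split_ifs with h
      · rw [norm_div, norm_pow, Complex.norm_real, Real.norm_eq_abs]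
        have : |θ * y| ^ 2 ≤ 1 := pow_le_one₀ (abs_nonneg _) h
        have h2 : ‖(2 : ℂ)‖ = 2 := by simp
        rw [h2]
        linarith
      · simp
  have e3 : ∫ y : ℝ, (if |θ * y| ≤ 1 then (((θ * y : ℝ) : ℂ)) ^ 2 / 2 else 0) ∂μ =
      ((θ ^ 2 * truncSq μ t : ℝ) : ℂ) / 2 := by
    have : (fun y : ℝ => if |θ * y| ≤ 1 then (((θ * y : ℝ) : ℂ)) ^ 2 / 2 else 0) =
        fun y => {y : ℝ | |y| ≤ t}.indicator (fun y => (((θ ^ 2 * |y| ^ 2 : ℝ) : ℂ)) / 2) y := by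
      funext y
      rw [indicator_apply]
      simp only [hiff, mem_ofPred_eq]
      split_ifs
      · rw [sq_abs]; push_cast; ring
      · rfl
    rw [this, integral_indicator (measurableSet_abs_le t), integral_div, integral_complex_ofReal,
      integral_const_mul, truncSq]
  have e2 : ∫ y : ℝ, ((θ * y : ℝ) : ℂ) * Complex.I ∂μ = 0 := by
    rw [integral_mul_const, integral_complex_ofReal, integral_const_mul, hmean]
    simp
  have e1 : ∫ y : ℝ, Complex.exp ((θ * y : ℝ) * Complex.I) ∂μ = charFun μ θ := by
    rw [charFun_apply_real]
    push_cast
    rfl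
  have key : 1 - charFun μ θ - (((θ ^ 2 * truncSq μ t : ℝ) : ℂ) / 2) =
      ∫ y : ℝ, (1 + ((θ * y : ℝ) : ℂ) * Complex.I - Complex.exp ((θ * y : ℝ) * Complex.I) -
      (if |θ * y| ≤ 1 then (((θ * y : ℝ) : ℂ)) ^ 2 / 2 else 0)) ∂μ := by
    have i4 : Integrable (fun y : ℝ => 1 + ((θ * y : ℝ) : ℂ) * Complex.I) μ :=
      (integrable_const _).add i2
    have i5 : Integrable (fun y : ℝ => 1 + ((θ * y : ℝ) : ℂ) * Complex.I -
      Complex.exp ((θ * y : ℝ) * Complex.I)) μ := i4.sub i1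
    rw [integral_sub i5 i3, integral_sub i4 i1, integral_add (integrable_const _) i2,
      e1, e2, e3]
    simp
  rw [key]
  have j1 : IntegrableOn (fun y : ℝ => θ ^ 3 * |y| ^ 3) {y : ℝ | |y| ≤ t} μ :=
    (integrableOn_cube t).const_mul _
  have j2 : IntegrableOn (fun y : ℝ => θ * |y|) {y : ℝ | t < |y|} μ :=
    hint.abs.integrableOn.const_mul _
  have hcompl : {y : ℝ | |y| ≤ t}ᶜ = {y : ℝ | t < |y|} := by ext; simp
  refine (norm_integral_le_of_norm_le (g := fun y => 3 * ({y : ℝ | |y| ≤ t}.indicator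
    (fun y => θ ^ 3 * |y| ^ 3) y + {y : ℝ | t < |y|}.indicator (fun y => θ * |y|) y)) ?_
    (Eventually.of_forall fun y => ?_)).trans_eq ?_
  · exact (((j1.integrable_indicator (measurableSet_abs_le t))).add
      (j2.integrable_indicator (measurableSet_lt_abs t))).const_mul 3
  · refine (norm_exp_mul_I_sub_le _).trans_eq ?_
    simp only [indicator_apply, hiff, mem_ofPred_eq]
    rcases le_or_gt (|y|) t with h | h
    · simp [h, not_lt.2 h, mul_pow, abs_mul, abs_of_pos hθ0]
    · simp [h, not_le.2 h, abs_mul, abs_of_pos hθ0]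
  · rw [integral_const_mul, integral_add (j1.integrable_indicator (measurableSet_abs_le t))
      (j2.integrable_indicator (measurableSet_lt_abs t)),
      integral_indicator (measurableSet_abs_le t), integral_indicator (measurableSet_lt_abs t),
      integral_const_mul, integral_const_mul, truncError, tailMoment, hθ]
    field_simp

/-- The content is `1 - φ(θ) ~ truncMoment θ / 2` and `truncMoment θ ~ θ² truncSq (1/θ)` as `θ ↓ 0`:
both errors are at most a multiple of `θ² truncError (1/θ)`, which is negligible. -/
theorem eventually_truncMoment_bounds (hint : Integrable (fun y : ℝ => y) μ)
    (hmean : ∫ y, y ∂μ = 0) (h : IsSlowlyVarying (truncSq μ)) {η : ℝ} (hη : 0 < η) :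
    ∀ᶠ t in atTop, 0 < truncSq μ t ∧
      ‖1 - charFun μ t⁻¹ - ((truncMoment μ t⁻¹ : ℝ) : ℂ) / 2‖ ≤ η * truncMoment μ t⁻¹ ∧
      truncMoment μ t⁻¹ ≤ (1 + η) * ((t⁻¹) ^ 2 * truncSq μ t) := by
  obtain ⟨t₀, ht₀, hL₀⟩ := eventually_truncSq_pos h
  filter_upwards [eventually_integral_min_le hint h (show 0 < η / 4 by positivity),
    eventually_ge_atTop t₀] with t h1 h2
  have ht : 0 < t := ht₀.trans_le h2
  have hL : 0 < truncSq μ t := hL₀.trans_le (truncSq_mono h2)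
  change truncError μ t ≤ _ at h1
  have a1 := sq_mul_truncSq_le (μ := μ) ht
  have a2 := truncMoment_inv_le hint ht
  have a3 := norm_one_sub_charFun_sub_le hint hmean ht
  have hθ : 0 < (t⁻¹) ^ 2 := by positivity
  have a4 : (t⁻¹) ^ 2 * truncError μ t ≤ η / 4 * ((t⁻¹) ^ 2 * truncSq μ t) := by
    rw [mul_left_comm]
    exact mul_le_mul_of_nonneg_left h1 hθ.le
  have a5 : 0 < (t⁻¹) ^ 2 * truncSq μ t := by positivity
  refine ⟨hL, ?_, ?_⟩
  · have a6 : ‖((((t⁻¹) ^ 2 * truncSq μ t : ℝ) : ℂ) / 2) - ((truncMoment μ t⁻¹ : ℝ) : ℂ) / 2‖ ≤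
        (η / 4) * ((t⁻¹) ^ 2 * truncSq μ t) := by
      rw [← sub_div, ← Complex.ofReal_sub, norm_div, Complex.norm_real, Real.norm_eq_abs,
        abs_sub_comm, abs_of_nonneg (by linarith)]
      have h2 : ‖(2 : ℂ)‖ = 2 := by simp
      rw [h2]
      rw [mul_add] at a2
      linarith
    have a7 := norm_add_le (1 - charFun μ t⁻¹ - ((((t⁻¹) ^ 2 * truncSq μ t : ℝ) : ℂ) / 2))
      (((((t⁻¹) ^ 2 * truncSq μ t : ℝ) : ℂ) / 2) - ((truncMoment μ t⁻¹ : ℝ) : ℂ) / 2)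
    rw [sub_add_sub_cancel] at a7
    calc _ ≤ _ := a7
      _ ≤ η * ((t⁻¹) ^ 2 * truncSq μ t) := by linarith
      _ ≤ _ := by gcongr
  · nlinarith

theorem tendsto_truncMoment_div (hint : Integrable (fun y : ℝ => y) μ)
    (hmean : ∫ y, y ∂μ = 0) (h : IsSlowlyVarying (truncSq μ)) :
    Tendsto (fun t => truncMoment μ t⁻¹ / ((t⁻¹) ^ 2 * truncSq μ t)) atTop (𝓝 1) := by
  rw [Metric.tendsto_atTop']
  intro η hη
  obtain ⟨T, hT⟩ := eventually_atTop.1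
    (eventually_truncMoment_bounds hint hmean h (show 0 < η / 2 by positivity))
  refine ⟨max T 1, fun t ht => ?_⟩
  obtain ⟨h1, _, h2⟩ := hT t ((le_max_left _ _).trans ht.le)
  have ht0 : 0 < t := zero_lt_one.trans_le ((le_max_right _ _).trans ht.le)
  have h3 : 0 < (t⁻¹) ^ 2 * truncSq μ t := by positivity
  have h4 := sq_mul_truncSq_le (μ := μ) ht0
  rw [Real.dist_eq, abs_of_nonneg, sub_lt_iff_lt_add, div_lt_iff₀ h3]
  · nlinarith
  · rw [sub_nonneg, one_le_div h3]
    exact h4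

/-- Regular variation with index `2` at the origin: `θ²` times a slowly varying function of `1/θ`.
-/
theorem tendsto_truncMoment_mul_div (hint : Integrable (fun y : ℝ => y) μ)
    (hmean : ∫ y, y ∂μ = 0) (h : IsSlowlyVarying (truncSq μ)) {c : ℝ} (hc : 0 < c) :
    Tendsto (fun θ => truncMoment μ (c * θ) / truncMoment μ θ) (𝓝[>] 0) (𝓝 (c ^ 2)) := by
  have hA := tendsto_truncMoment_div hint hmean h
  have hs : Tendsto (fun t : ℝ => c⁻¹ * t) atTop atTop :=
    tendsto_id.const_mul_atTop (inv_pos.2 hc)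
  have h1 := ((hA.comp hs).div hA one_ne_zero).mul (h c⁻¹ (inv_pos.2 hc))
  have h2 := (h1.const_mul (c ^ 2)).comp tendsto_inv_nhdsGT_zero
  rw [div_one, mul_one, mul_one] at h2
  refine h2.congr' ?_
  obtain ⟨t₀, ht₀, hL₀⟩ := eventually_truncSq_pos h
  have hmem : Ioo (0 : ℝ) (t₀⁻¹ * min 1 c⁻¹) ∈ 𝓝[>] (0 : ℝ) :=
    Ioo_mem_nhdsGT (by positivity)
  filter_upwards [hmem] with θ hθ
  have hθ0 : 0 < θ := hθ.1
  have g1 : t₀ ≤ θ⁻¹ := by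
    rw [le_inv_comm₀ ht₀ hθ0]
    exact hθ.2.le.trans (mul_le_of_le_one_right (by positivity) (min_le_left _ _))
  have g2 : t₀ ≤ c⁻¹ * θ⁻¹ := by
    rw [← mul_inv, le_inv_comm₀ ht₀ (by positivity), ← le_div_iff₀' hc, div_eq_mul_inv]
    exact hθ.2.le.trans (mul_le_mul_of_nonneg_left (min_le_right _ _) (by positivity))
  have p1 : 0 < truncSq μ θ⁻¹ := hL₀.trans_le (truncSq_mono g1)
  have p2 : 0 < truncSq μ (c⁻¹ * θ⁻¹) := hL₀.trans_le (truncSq_mono g2)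
  have p3 : 0 < truncMoment μ θ := by
    have := sq_mul_truncSq_le (μ := μ) (inv_pos.2 hθ0)
    rw [inv_inv] at this
    exact lt_of_lt_of_le (by positivity) this
  simp only [Function.comp_apply, Pi.div_apply]
  rw [mul_inv, inv_inv, inv_inv]
  generalize truncSq μ (c⁻¹ * θ⁻¹) = A at *
  generalize truncSq μ θ⁻¹ = B at *
  field_simp

theorem truncMoment_pos (h : IsSlowlyVarying (truncSq μ)) {θ : ℝ} (hθ : 0 < θ) :
    0 < truncMoment μ θ := by
  obtain ⟨t₀, ht₀, hL₀⟩ := eventually_truncSq_pos h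
  set t := max t₀ θ⁻¹
  have ht : 0 < t := lt_max_of_lt_left ht₀
  have h1 := sq_mul_truncSq_le (μ := μ) ht
  have h2 : 0 < truncSq μ t := hL₀.trans_le (truncSq_mono (le_max_left _ _))
  have h3 : t⁻¹ ≤ θ := inv_le_of_inv_le₀ hθ (le_max_right _ _)
  exact (lt_of_lt_of_le (by positivity) h1).trans_le (truncMoment_mono (inv_pos.2 ht).le h3)

end

/-! ### The norming sequence. -/

/-- `θ n` is the inverse of the norming constant of the `n`-th partial sum of a random walk with
step law `μ`. -/
structure IsScale (μ : Measure ℝ) (θ : ℕ → ℝ) : Prop where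
  pos : ∀ n, 0 < θ n
  antitone : Antitone θ
  tendsto : Tendsto θ atTop (𝓝 0)
  eq : ∀ᶠ n : ℕ in atTop, truncMoment μ (θ n) = 1 / n

section

variable {μ : Measure ℝ} [IsProbabilityMeasure μ]

theorem lt_of_truncMoment_lt {s t : ℝ} (ht : 0 ≤ t)
    (h : truncMoment μ s < truncMoment μ t) : s < t := by
  by_contra! h1
  exact absurd (truncMoment_mono ht h1) (not_le.2 h)

/-- Solve `truncMoment θ = 1/n` on `[0, 1]`. For small `n` there may be no solution there, hence the
cut-off `n₀`. -/
theorem exists_isScale (h : IsSlowlyVarying (truncSq μ)) : ∃ θ, IsScale μ θ := by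
  have h1 := truncMoment_pos h one_pos
  obtain ⟨n₀, hn₀, hn₁⟩ : ∃ n₀ : ℕ, 0 < n₀ ∧ 1 / (n₀ : ℝ) ≤ truncMoment μ 1 := by
    obtain ⟨n, hn⟩ := exists_nat_one_div_lt h1
    exact ⟨n + 1, n.succ_pos, by exact_mod_cast hn.le⟩
  have h2 : ∀ n : ℕ, ∃ θ ∈ Icc (0 : ℝ) 1, truncMoment μ θ = 1 / ((max n n₀ : ℕ) : ℝ) := by
    intro n
    refine intermediate_value_Icc zero_le_one continuous_truncMoment.continuousOn ⟨?_, ?_⟩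
    · rw [truncMoment_zero]; positivity
    · refine le_trans ?_ hn₁
      have : (n₀ : ℝ) ≤ ((max n n₀ : ℕ) : ℝ) := by exact_mod_cast le_max_right _ _
      have : (0 : ℝ) < n₀ := by exact_mod_cast hn₀
      gcongr
  choose ϑ hϑ hϑ' using h2
  -- `truncMoment` need not be strictly increasing, so solutions need not be unique. Choosing them
  -- as a function of `max n n₀` gives equal values to equal equations, which is what antitonicity
  -- needs.
  set θ : ℕ → ℝ := fun n => ϑ (max n n₀) with hθdef
  have hθ : ∀ n, θ n ∈ Icc (0 : ℝ) 1 := fun n => hϑ _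
  have hθ' : ∀ n, truncMoment μ (θ n) = 1 / ((max n n₀ : ℕ) : ℝ) := fun n => by
    rw [hθdef]
    simp only [hϑ', max_eq_left (le_max_right n n₀)]
  have hpos : ∀ n, 0 < θ n := fun n => by
    refine (hθ n).1.lt_of_ne fun h0 => ?_
    have := hθ' n
    rw [← h0, truncMoment_zero] at this
    have h3 : (0 : ℝ) < ((max n n₀ : ℕ) : ℝ) := by
      exact_mod_cast hn₀.trans_le (le_max_right _ _)
    exact absurd this (by positivity)
  refine ⟨θ, hpos, fun m n hmn => ?_, ?_, ?_⟩
  · by_contra! hlt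
    have h3 := truncMoment_mono (μ := μ) (hpos m).le hlt.le
    rw [hθ', hθ'] at h3
    have h4 : (0 : ℝ) < ((max m n₀ : ℕ) : ℝ) := by
      exact_mod_cast hn₀.trans_le (le_max_right _ _)
    have h5 : ((max m n₀ : ℕ) : ℝ) ≤ ((max n n₀ : ℕ) : ℝ) := by
      exact_mod_cast max_le_max_right _ hmn
    rw [one_div_le_one_div h4 (h4.trans_le h5)] at h3
    have h6 : max m n₀ = max n n₀ := by exact_mod_cast le_antisymm h5 h3
    exact absurd hlt (by simp [hθdef, h6])
  · rw [Metric.tendsto_atTop]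
    intro η hη
    obtain ⟨N, hN⟩ := exists_nat_one_div_lt (truncMoment_pos h hη)
    refine ⟨N + 1, fun n hn => ?_⟩
    rw [Real.dist_eq, sub_zero, abs_of_pos (hpos n)]
    refine lt_of_truncMoment_lt (μ := μ) hη.le ?_
    rw [hθ']
    refine lt_of_le_of_lt ?_ hN
    have : (N : ℝ) + 1 ≤ ((max n n₀ : ℕ) : ℝ) := by exact_mod_cast hn.trans (le_max_left _ _)
    gcongr
  · filter_upwards [eventually_ge_atTop n₀] with n hn
    rw [hθ', max_eq_left hn]

namespace IsScale

variable {θ : ℕ → ℝ}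

omit [IsProbabilityMeasure μ] in
theorem tendsto_nhdsGT (hθ : IsScale μ θ) : Tendsto θ atTop (𝓝[>] 0) :=
  tendsto_nhdsWithin_iff.2 ⟨hθ.tendsto, Eventually.of_forall hθ.pos⟩

theorem tendsto_ratio (hθ : IsScale μ θ) (hint : Integrable (fun y : ℝ => y) μ)
    (hmean : ∫ y, y ∂μ = 0) (h : IsSlowlyVarying (truncSq μ)) {c : ℝ} (hc : 0 < c) :
    Tendsto (fun n => n * truncMoment μ (c * θ n)) atTop (𝓝 (c ^ 2)) := by
  refine ((tendsto_truncMoment_mul_div hint hmean h hc).comp hθ.tendsto_nhdsGT).congr' ?_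
  filter_upwards [hθ.eq] with n hn
  rw [Function.comp_apply, hn, one_div, div_inv_eq_mul, mul_comm]

/-- For `r < 1`, regular variation gives `truncMoment (r θ n) ~ r²/n`, which is less than `1/(n+1) =
truncMoment (θ (n+1))` for large `n`; monotonicity then yields `r θ n < θ (n+1)`. -/
theorem isFlat (hθ : IsScale μ θ) (hint : Integrable (fun y : ℝ => y) μ)
    (hmean : ∫ y, y ∂μ = 0) (h : IsSlowlyVarying (truncSq μ)) : IsFlat θ := by
  have key : ∀ r : ℝ, 0 < r → r < 1 → ∀ᶠ n in atTop, r * θ n < θ (n + 1) := by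
    intro r hr hr1
    obtain ⟨b, hb1, hb2⟩ : ∃ b, r ^ 2 < b ∧ b < 1 := exists_between (by nlinarith)
    have h3 : Tendsto (fun n : ℕ => (n : ℝ) / ((n : ℝ) + 1)) atTop (𝓝 1) :=
      tendsto_natCast_div_add_atTop 1
    filter_upwards [(hθ.tendsto_ratio hint hmean h hr).eventually_lt_const hb1,
      h3.eventually_const_lt hb2, (tendsto_add_atTop_nat 1).eventually hθ.eq,
      eventually_gt_atTop 0] with n h4 h5 h6 hn
    refine lt_of_truncMoment_lt (μ := μ) (hθ.pos _).le ?_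
    have hn' : (0 : ℝ) < n := by exact_mod_cast hn
    rw [h6]
    have h7 := h4.trans h5
    rw [lt_div_iff₀ (by positivity)] at h7
    rw [lt_div_iff₀ (by positivity)]
    push_cast
    nlinarith
  intro η hη
  have hr : (0 : ℝ) < max (1 / 2) (1 - η) := by positivity
  filter_upwards [key (max (1 / 2) (1 - η)) hr (max_lt (by norm_num) (by linarith))] with n hn
  have h1 := hθ.antitone n.le_succ
  have h2 := mul_le_mul_of_nonneg_right (le_max_right (1 / 2) (1 - η)) (hθ.pos n).le
  rw [abs_le]
  have := hθ.pos n
  constructor <;> nlinarith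

theorem eventually_mul_le_two_mul (hθ : IsScale μ θ) (hint : Integrable (fun y : ℝ => y) μ)
    (hmean : ∫ y, y ∂μ = 0) (h : IsSlowlyVarying (truncSq μ)) {r : ℝ} (hr : 0 < r)
    (hr2 : r ^ 2 < 1 / 2) : ∀ᶠ n in atTop, r * θ n ≤ θ (2 * n) := by
  have h2 : Tendsto (fun n : ℕ => 2 * n) atTop atTop :=
    tendsto_id.const_mul_atTop' two_pos
  filter_upwards [(hθ.tendsto_ratio hint hmean h hr).eventually_lt_const hr2,
    h2.eventually hθ.eq, eventually_gt_atTop 0] with n h4 h6 hn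
  refine (lt_of_truncMoment_lt (μ := μ) (hθ.pos _).le ?_).le
  have hn' : (0 : ℝ) < n := by exact_mod_cast hn
  rw [h6]
  push_cast
  rw [lt_div_iff₀ (by positivity)]
  linarith

/-- The truncated variance is bounded away from zero, so `θ n ^ 2` is at most of order `1/n`. -/
theorem exists_le_rpow (hθ : IsScale μ θ) (h : IsSlowlyVarying (truncSq μ)) :
    ∃ C : ℝ, 0 < C ∧ ∀ n : ℕ, θ n ≤ C * ((n : ℝ) + 1) ^ (-(1 / 2) : ℝ) := by
  obtain ⟨t₀, ht₀, hL₀⟩ := eventually_truncSq_pos h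
  have h1 : ∀ᶠ n : ℕ in atTop, θ n ^ 2 * truncSq μ t₀ ≤ 1 / n := by
    filter_upwards [hθ.eq, hθ.tendsto.eventually_le_const (inv_pos.2 ht₀)] with n h2 h3
    have h4 := sq_mul_truncSq_le (μ := μ) (inv_pos.2 (hθ.pos n))
    rw [inv_inv, h2] at h4
    refine le_trans ?_ h4
    refine mul_le_mul_of_nonneg_left (truncSq_mono ?_) (by positivity)
    rwa [le_inv_comm₀ ht₀ (hθ.pos n)]
  obtain ⟨N, hN⟩ := eventually_atTop.1 h1
  have hθ0 := hθ.pos 0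
  refine ⟨Real.sqrt (2 / truncSq μ t₀) + θ 0 * ((N : ℝ) + 1) ^ (1 / 2 : ℝ), by positivity,
    fun n => ?_⟩
  have hpos : (0 : ℝ) < (n : ℝ) + 1 := by positivity
  have hrp : ((n : ℝ) + 1) ^ (-(1 / 2) : ℝ) = (Real.sqrt ((n : ℝ) + 1))⁻¹ := by
    rw [Real.rpow_neg hpos.le, Real.sqrt_eq_rpow]
  have hs : 0 < Real.sqrt ((n : ℝ) + 1) := by positivity
  rcases le_or_gt (N + 1) n with hn | hn
  · have h2 := hN n (by omega)
    have hn1 : (1 : ℝ) ≤ n := by exact_mod_cast (by omega : 1 ≤ n)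
    have h3 : θ n ≤ Real.sqrt (2 / truncSq μ t₀) * (Real.sqrt ((n : ℝ) + 1))⁻¹ := by
      rw [← Real.sqrt_inv, ← Real.sqrt_mul (by positivity)]
      refine Real.le_sqrt_of_sq_le ?_
      rw [div_mul_eq_mul_div, le_div_iff₀ hL₀]
      refine h2.trans ?_
      rw [← div_eq_mul_inv, div_le_div_iff₀ (by linarith) hpos]
      linarith
    rw [hrp, add_mul]
    exact h3.trans (le_add_of_nonneg_right (by positivity))
  · rw [add_mul]
    refine le_trans ?_ (le_add_of_nonneg_left (by positivity))
    refine (hθ.antitone (Nat.zero_le n)).trans ?_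
    rw [mul_assoc]
    refine le_mul_of_one_le_right hθ0.le ?_
    rw [Real.rpow_neg hpos.le, ← div_eq_mul_inv, one_le_div (by positivity)]
    have : (n : ℝ) ≤ N := by exact_mod_cast (by omega : n ≤ N)
    gcongr

/-- Iterate `2 ^ (-a) * θ n ≤ θ (2 * n)`, valid for large `n` because `a = 1/2 + 1/36` exceeds
`1/2`. The `1/36` is the loss that `isFlat_renewalSeq` tolerates. -/
theorem exists_rpow_le (hθ : IsScale μ θ) (hint : Integrable (fun y : ℝ => y) μ)
    (hmean : ∫ y, y ∂μ = 0) (h : IsSlowlyVarying (truncSq μ)) :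
    ∃ c : ℝ, 0 < c ∧ ∀ᶠ n : ℕ in atTop, c * ((n : ℝ) + 1) ^ (-(1 / 2) - 1 / 36 : ℝ) ≤ θ n := by
  set a : ℝ := 1 / 2 + 1 / 36 with ha
  have ha' : (-(1 / 2) - 1 / 36 : ℝ) = -a := by rw [ha]; ring
  have hr : (0 : ℝ) < 2 ^ (-a) := by positivity
  have hr2 : ((2 : ℝ) ^ (-a)) ^ 2 < 1 / 2 := by
    rw [← Real.rpow_natCast, ← Real.rpow_mul two_pos.le, one_div, ← Real.rpow_neg_one]
    refine Real.rpow_lt_rpow_of_exponent_lt one_lt_two ?_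
    rw [ha]; norm_num
  obtain ⟨N, hN⟩ := eventually_atTop.1 (hθ.eventually_mul_le_two_mul hint hmean h hr hr2)
  set M := max N 2 with hM
  refine ⟨θ (2 * M), hθ.pos _, eventually_atTop.2 ⟨M, ?_⟩⟩
  have hc : 0 < θ (2 * M) := hθ.pos _
  have ha0 : -a ≤ 0 := by rw [ha]; norm_num
  -- The base `n - 1` makes the induction exact for odd `n` too: `m = ⌈n/2⌉` satisfies `2 (m - 1) ≤
  -- n - 1`.
  have claim : ∀ n : ℕ, M ≤ n → θ (2 * M) * ((n : ℝ) - 1) ^ (-a) ≤ θ n := by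
    intro n
    induction n using Nat.strong_induction_on with
    | _ n ih =>
      intro hn
      have hM2 : 2 ≤ M := le_max_right _ _
      rcases le_or_gt n (2 * M) with h1 | h1
      · refine le_trans ?_ (hθ.antitone h1)
        refine mul_le_of_le_one_right hc.le ?_
        refine Real.rpow_le_one_of_one_le_of_nonpos ?_ ha0
        have : (2 : ℝ) ≤ n := by exact_mod_cast hM2.trans hn
        linarith
      · obtain ⟨m, hm⟩ : ∃ m, n ≤ 2 * m ∧ 2 * m ≤ n + 1 := ⟨(n + 1) / 2, by omega, by omega⟩
        have h2 := ih m (by omega) (by omega)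
        have h3 := hN m ((le_max_left N 2).trans (by omega))
        have hm1 : (0 : ℝ) < (m : ℝ) - 1 := by
          have : (2 : ℝ) ≤ m := by exact_mod_cast (by omega : 2 ≤ m)
          linarith
        have h4 : ((n : ℝ) - 1) ^ (-a) ≤ 2 ^ (-a) * ((m : ℝ) - 1) ^ (-a) := by
          rw [← Real.mul_rpow two_pos.le hm1.le]
          refine Real.rpow_le_rpow_of_nonpos (by positivity) ?_ ha0
          have : 2 * (m : ℝ) ≤ n + 1 := by exact_mod_cast hm.2
          linarith
        calc θ (2 * M) * ((n : ℝ) - 1) ^ (-a)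
            ≤ θ (2 * M) * (2 ^ (-a) * ((m : ℝ) - 1) ^ (-a)) := by gcongr
          _ = 2 ^ (-a) * (θ (2 * M) * ((m : ℝ) - 1) ^ (-a)) := by ring
          _ ≤ 2 ^ (-a) * θ m := by gcongr
          _ ≤ θ (2 * m) := h3
          _ ≤ θ n := hθ.antitone hm.1
  intro n hn
  refine le_trans ?_ (claim n hn)
  rw [ha']
  have : (2 : ℝ) ≤ n := by exact_mod_cast (le_max_right N 2).trans hn
  refine mul_le_mul_of_nonneg_left ?_ hc.le
  exact Real.rpow_le_rpow_of_nonpos (by linarith) (by linarith) ha0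

theorem tendsto_mul_one_sub_charFun (hθ : IsScale μ θ) (hint : Integrable (fun y : ℝ => y) μ)
    (hmean : ∫ y, y ∂μ = 0) (h : IsSlowlyVarying (truncSq μ)) {c : ℝ} (hc : 0 < c) :
    Tendsto (fun n : ℕ => (n : ℂ) * (charFun μ (c * θ n) - 1)) atTop
      (𝓝 (-((c : ℂ) ^ 2 / 2))) := by
  have h1 := hθ.tendsto_ratio hint hmean h hc
  have h2 : Tendsto (fun n : ℕ => ((n * truncMoment μ (c * θ n) : ℝ) : ℂ) / 2) atTop
      (𝓝 (((c ^ 2 : ℝ) : ℂ) / 2)) :=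
    ((Complex.continuous_ofReal.tendsto _).comp h1).div_const 2
  have h3 : Tendsto (fun n : ℕ => (n : ℂ) * (1 - charFun μ (c * θ n)) -
      ((n * truncMoment μ (c * θ n) : ℝ) : ℂ) / 2) atTop (𝓝 0) := by
    have hinv : Tendsto (fun n => (c * θ n)⁻¹) atTop atTop := by
      refine tendsto_inv_nhdsGT_zero.comp (tendsto_nhdsWithin_iff.2 ⟨?_, ?_⟩)
      · simpa using hθ.tendsto.const_mul c
      · exact Eventually.of_forall fun n => mul_pos hc (hθ.pos n)
    rw [Metric.tendsto_atTop']
    intro η hη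
    have hc2 : 0 < c ^ 2 + 1 := by positivity
    have h4 := hinv.eventually (eventually_truncMoment_bounds hint hmean h
      (show 0 < η / (c ^ 2 + 1) by positivity))
    have h5 := h1.eventually_lt_const (show c ^ 2 < c ^ 2 + 1 by linarith)
    obtain ⟨N, hN⟩ := eventually_atTop.1 (h4.and h5)
    refine ⟨N, fun n hn => ?_⟩
    obtain ⟨⟨_, h6, _⟩, h7⟩ := hN n hn.le
    rw [inv_inv] at h6
    rw [dist_zero_right]
    have h8 : (n : ℂ) * (1 - charFun μ (c * θ n)) -
        ((n * truncMoment μ (c * θ n) : ℝ) : ℂ) / 2 =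
        n * (1 - charFun μ (c * θ n) - ((truncMoment μ (c * θ n) : ℝ) : ℂ) / 2) := by
      push_cast; ring
    rw [h8, norm_mul, Complex.norm_natCast]
    calc (n : ℝ) * ‖1 - charFun μ (c * θ n) - ((truncMoment μ (c * θ n) : ℝ) : ℂ) / 2‖
        ≤ n * (η / (c ^ 2 + 1) * truncMoment μ (c * θ n)) := by gcongr
      _ = η / (c ^ 2 + 1) * (n * truncMoment μ (c * θ n)) := by ring
      _ < η / (c ^ 2 + 1) * (c ^ 2 + 1) := by gcongr
      _ = η := by field_simp
  have h4 := (h3.add h2).neg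
  rw [zero_add] at h4
  push_cast at h4
  refine h4.congr fun n => ?_
  ring

/-- The central limit theorem at the level of characteristic functions; negative arguments follow by
conjugation. -/
theorem tendsto_charFun_pow (hθ : IsScale μ θ) (hint : Integrable (fun y : ℝ => y) μ)
    (hmean : ∫ y, y ∂μ = 0) (h : IsSlowlyVarying (truncSq μ)) (c : ℝ) :
    Tendsto (fun n : ℕ => charFun μ (c * θ n) ^ n) atTop (𝓝 (Complex.exp (-((c : ℂ) ^ 2 / 2)))) := by
  have key : ∀ c : ℝ, 0 < c → Tendsto (fun n : ℕ => charFun μ (c * θ n) ^ n) atTop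
      (𝓝 (Complex.exp (-((c : ℂ) ^ 2 / 2)))) := by
    intro c hc
    have := Complex.tendsto_one_add_pow_exp_of_tendsto
      (hθ.tendsto_mul_one_sub_charFun hint hmean h hc)
    refine this.congr fun n => ?_
    rw [add_sub_cancel]
  rcases lt_trichotomy c 0 with hc | hc | hc
  · have h1 := (Complex.continuous_conj.tendsto _).comp (key (-c) (neg_pos.2 hc))
    have h2 : (starRingEnd ℂ) (Complex.exp (-(((-c : ℝ) : ℂ) ^ 2 / 2))) =
        Complex.exp (-((c : ℂ) ^ 2 / 2)) := by
      rw [← Complex.exp_conj]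
      simp [map_ofNat]
    rw [h2] at h1
    refine h1.congr fun n => ?_
    rw [Function.comp_apply, map_pow, ← charFun_neg, neg_mul, neg_neg]
  · simp [hc]
  · exact key c hc

/-- The dominating function of the local limit theorem. Near the origin `‖φ(x)‖ ≤ 1 - truncMoment x
/ 4`, and `truncMoment` at least doubles when its argument doubles, since the limiting factor is
`4`. Hence `truncMoment (c θ n) ≥ c / (2n)` for `c ≥ 1`, and the `n`-th power is at most `exp
(-c/8)`. The `1` in the exponent covers `|c| < 1`. -/
theorem exists_norm_charFun_pow_le (hθ : IsScale μ θ) (hint : Integrable (fun y : ℝ => y) μ)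
    (hmean : ∫ y, y ∂μ = 0) (h : IsSlowlyVarying (truncSq μ)) :
    ∃ δ : ℝ, 0 < δ ∧ ∀ᶠ n : ℕ in atTop, ∀ c : ℝ, |c| * θ n ≤ δ →
      ‖charFun μ (c * θ n)‖ ^ n ≤ Real.exp (1 - |c| / 8) := by
  obtain ⟨T, hT⟩ := eventually_atTop.1
    (eventually_truncMoment_bounds hint hmean h (show (0 : ℝ) < 1 / 4 by norm_num))
  obtain ⟨δ', hδ', hδ''⟩ := mem_nhdsGT_iff_exists_Ioo_subset.1
    ((tendsto_truncMoment_mul_div hint hmean h two_pos).eventually_const_le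
      (show (2 : ℝ) < 2 ^ 2 by norm_num))
  have hδ'0 : (0 : ℝ) < δ' := hδ'
  set δ := min (δ' / 2) (max T 1)⁻¹ with hδ
  have hT1 : 0 < max T 1 := lt_max_of_lt_right one_pos
  have hδ0 : 0 < δ := by positivity
  have hchar : ∀ x : ℝ, 0 < x → x ≤ δ → ‖charFun μ x‖ ≤ 1 - truncMoment μ x / 4 := by
    intro x hx hxδ
    have h1 : T ≤ x⁻¹ := by
      refine (le_max_left T 1).trans ?_
      rw [le_inv_comm₀ hT1 hx]
      exact hxδ.trans (min_le_right _ _)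
    obtain ⟨_, h2, _⟩ := hT _ h1
    rw [inv_inv] at h2
    have h3 : charFun μ x = ((1 - truncMoment μ x / 2 : ℝ) : ℂ) -
        (1 - charFun μ x - ((truncMoment μ x : ℝ) : ℂ) / 2) := by push_cast; ring
    have h4 : ‖((1 - truncMoment μ x / 2 : ℝ) : ℂ)‖ = 1 - truncMoment μ x / 2 := by
      rw [Complex.norm_real, Real.norm_of_nonneg]
      linarith [truncMoment_le_one (μ := μ) x]
    rw [h3]
    refine (norm_sub_le _ _).trans ?_
    rw [h4]
    linarith
  have hdouble : ∀ x : ℝ, 0 < x → x ≤ δ → 2 * truncMoment μ x ≤ truncMoment μ (2 * x) := by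
    intro x hx hxδ
    have h1 : x < δ' := by
      have := hxδ.trans (min_le_left _ _)
      linarith
    have h2 := hδ'' ⟨hx, h1⟩
    rw [mem_ofPred_eq, le_div_iff₀ (truncMoment_pos h hx)] at h2
    exact h2
  have hiter : ∀ j : ℕ, ∀ x : ℝ, 0 < x → 2 ^ j * x ≤ δ →
      2 ^ j * truncMoment μ x ≤ truncMoment μ (2 ^ j * x) := by
    intro j
    induction j with
    | zero => intro x _ _; simp
    | succ j ih =>
      intro x hx hxδ
      have h1 := ih (2 * x) (by positivity) (by rw [pow_succ] at hxδ; linarith)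
      have h2 : x ≤ δ := le_trans (le_mul_of_one_le_left hx.le (one_le_pow₀ one_le_two)) hxδ
      have h3 := hdouble x hx h2
      have e1 : (2 : ℝ) ^ (j + 1) * x = 2 ^ j * (2 * x) := by ring
      rw [e1]
      refine le_trans ?_ h1
      rw [pow_succ, mul_assoc]
      gcongr
  have hlin : ∀ c x : ℝ, 1 ≤ c → 0 < x → c * x ≤ δ →
      c / 2 * truncMoment μ x ≤ truncMoment μ (c * x) := by
    intro c x hc hx hcx
    obtain ⟨j, hj1, hj2⟩ := exists_nat_pow_near hc one_lt_two
    have h1 : (2 : ℝ) ^ j * x ≤ c * x := by gcongr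
    refine le_trans ?_ ((hiter j x hx (h1.trans hcx)).trans
      (truncMoment_mono (by positivity) h1))
    have := truncMoment_nonneg μ x
    rw [pow_succ] at hj2
    gcongr
    linarith
  refine ⟨δ, hδ0, ?_⟩
  filter_upwards [hθ.eq, eventually_gt_atTop 0] with n hn hn0 c hc
  have hn' : (0 : ℝ) < n := by exact_mod_cast hn0
  have habs : ‖charFun μ (c * θ n)‖ = ‖charFun μ (|c| * θ n)‖ := by
    rcases abs_cases c with ⟨h1, _⟩ | ⟨h1, _⟩
    · rw [h1]
    · rw [h1, neg_mul, charFun_neg, RCLike.norm_conj]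
  rw [habs]
  rcases le_or_gt 1 |c| with h1 | h1
  · have hx : 0 < |c| * θ n := mul_pos (by linarith) (hθ.pos n)
    have h2 := hlin _ _ h1 (hθ.pos n) hc
    have h3 := hchar _ hx hc
    rw [hn] at h2
    have h4 : ‖charFun μ (|c| * θ n)‖ ≤ Real.exp (-(|c| / (8 * n))) := by
      refine h3.trans (le_trans ?_ (Real.add_one_le_exp _))
      have : |c| / (8 * n) = |c| / 2 * (1 / n) / 4 := by field_simp; norm_num
      rw [this]
      linarith
    calc ‖charFun μ (|c| * θ n)‖ ^ n ≤ Real.exp (-(|c| / (8 * n))) ^ n := by gcongr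
      _ = Real.exp (-(|c| / 8)) := by
        rw [← Real.exp_nat_mul]
        congr 1
        field_simp
      _ ≤ _ := Real.exp_le_exp.2 (by linarith)
  · calc ‖charFun μ (|c| * θ n)‖ ^ n ≤ 1 := pow_le_one₀ (norm_nonneg _) (norm_charFun_le_one _)
      _ ≤ _ := Real.one_le_exp (by linarith)

end IsScale

end

/-! ### Fourier integrals of powers of a characteristic function. -/

theorem integral_cexp_neg_sq_div_two :
    ∫ c : ℝ, Complex.exp (-((c : ℂ) ^ 2 / 2)) = (Real.sqrt (2 * Real.pi) : ℂ) := by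
  have h := integral_gaussian (1 / 2)
  rw [show Real.pi / (1 / 2) = 2 * Real.pi by ring] at h
  rw [← h, ← integral_complex_ofReal]
  refine integral_congr_ae (Eventually.of_forall fun c => ?_)
  dsimp only
  push_cast
  congr 1
  ring

theorem integrable_exp_one_sub_abs_div : Integrable fun c : ℝ => Real.exp (1 - |c| / 8) := by
  have h1 : IntegrableOn (fun c : ℝ => Real.exp (1 - |c| / 8)) (Ioi 0) := by
    have h : IntegrableOn (fun c : ℝ => Real.exp 1 * Real.exp (-(1 / 8) * c)) (Ioi 0) :=
      (integrableOn_exp_mul_Ioi (by norm_num) 0).const_mul _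
    refine h.congr_fun (fun c hc => ?_) measurableSet_Ioi
    dsimp only
    rw [abs_of_pos hc, ← Real.exp_add]
    congr 1
    ring
  have h2 : IntegrableOn (fun c : ℝ => Real.exp (1 - |c| / 8)) (Iic 0) := by
    have h : IntegrableOn (fun c : ℝ => Real.exp 1 * Real.exp (1 / 8 * c)) (Iic 0) :=
      (integrableOn_exp_mul_Iic (by norm_num) 0).const_mul _
    refine h.congr_fun (fun c hc => ?_) measurableSet_Iic
    dsimp only
    rw [abs_of_nonpos hc, ← Real.exp_add]
    congr 1
    ring
  rw [← integrableOn_univ, ← Iic_union_Ioi (a := (0 : ℝ))]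
  exact h2.union h1

/-- `1 / θ n` grows at most linearly up to a constant, so any geometric decay beats it. -/
theorem tendsto_mul_pow_div {θ : ℕ → ℝ} (hpos : ∀ n, 0 < θ n)
    (hlow : ∃ c : ℝ, 0 < c ∧ ∀ᶠ n : ℕ in atTop, c * ((n : ℝ) + 1) ^ (-(1 / 2) - 1 / 36 : ℝ) ≤ θ n)
    {ρ : ℝ} (hρ0 : 0 ≤ ρ) (hρ : ρ < 1) : Tendsto (fun n => ρ ^ n / θ n) atTop (𝓝 0) := by
  obtain ⟨c, hc, h⟩ := hlow
  have h1 : Tendsto (fun n : ℕ => c⁻¹ * ((n : ℝ) * ρ ^ n + ρ ^ n)) atTop (𝓝 (c⁻¹ * (0 + 0))) :=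
    ((tendsto_self_mul_const_pow_of_lt_one hρ0 hρ).add
      (tendsto_pow_atTop_nhds_zero_of_lt_one hρ0 hρ)).const_mul _
  rw [add_zero, mul_zero] at h1
  refine squeeze_zero' (Eventually.of_forall fun n => ?_) ?_ h1
  · exact div_nonneg (by positivity) (hpos n).le
  · filter_upwards [h] with n hn
    have h2 : ((n : ℝ) + 1)⁻¹ ≤ ((n : ℝ) + 1) ^ (-(1 / 2) - 1 / 36 : ℝ) := by
      rw [← Real.rpow_neg_one]
      exact Real.rpow_le_rpow_of_exponent_le (by linarith [(Nat.cast_nonneg n : (0 : ℝ) ≤ n)])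
        (by norm_num)
    rw [div_le_iff₀ (hpos n)]
    have h3 : c * ((n : ℝ) + 1)⁻¹ ≤ θ n := le_trans (by gcongr) hn
    have h4 : c⁻¹ * ((n : ℝ) * ρ ^ n + ρ ^ n) * (c * ((n : ℝ) + 1)⁻¹) = ρ ^ n := by
      field_simp
    calc ρ ^ n = c⁻¹ * ((n : ℝ) * ρ ^ n + ρ ^ n) * (c * ((n : ℝ) + 1)⁻¹) := h4.symm
      _ ≤ _ := by gcongr

theorem norm_pow_le_of_le {z : ℂ} {ρ : ℝ} (hz : ‖z‖ ≤ ρ) {m n : ℕ} (hmn : m ≤ n) :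
    ‖z ^ n‖ ≤ ρ ^ (n - m) * ‖z ^ m‖ := by
  rw [← Nat.sub_add_cancel hmn, pow_add, norm_mul, norm_pow z (n - m), Nat.add_sub_cancel]
  gcongr

/-- A local limit theorem: the inversion integral of the `n`-th power of a characteristic
function is of the order of the scale. -/
theorem IsScale.tendsto_setIntegral_charFun_pow {μ : Measure ℝ} [IsProbabilityMeasure μ]
    {θ : ℕ → ℝ} (hθ : IsScale μ θ) (hint : Integrable (fun y : ℝ => y) μ)
    (hmean : ∫ y, y ∂μ = 0) (h : IsSlowlyVarying (truncSq μ)) {D : Set ℝ} (hD : MeasurableSet D)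
    {δ₀ : ℝ} (hδ₀ : 0 < δ₀) (hsub : Icc (-δ₀) δ₀ ⊆ D)
    (hgap : ∀ δ > 0, ∃ ρ < 1, ∀ x ∈ D, δ ≤ |x| → ‖charFun μ x‖ ≤ ρ)
    {n₁ : ℕ} (hn₁ : IntegrableOn (fun x => charFun μ x ^ n₁) D) :
    Tendsto (fun n => (∫ x in D, charFun μ x ^ n) / (θ n : ℂ)) atTop
      (𝓝 (Real.sqrt (2 * Real.pi) : ℂ)) := by
  have hlow := hθ.exists_rpow_le hint hmean h
  obtain ⟨δ₁, hδ₁, hdom⟩ := hθ.exists_norm_charFun_pow_le hint hmean h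
  set δ := min δ₀ δ₁ with hδdef
  have hδ : 0 < δ := lt_min hδ₀ hδ₁
  obtain ⟨ρ, hρ, hgapδ⟩ := hgap δ hδ
  set E : Set ℝ := {x | |x| ≤ δ} with hE
  have hEm : MeasurableSet E := measurableSet_abs_le δ
  have hED : E ⊆ D := fun x hx => hsub (abs_le.1 (le_trans (show |x| ≤ δ from hx) (min_le_left _ _)))
  have hcont : Continuous (charFun μ) := continuous_charFun
  have hEint : ∀ n, IntegrableOn (fun x => charFun μ x ^ n) E := fun n => by
    have : E = Icc (-δ) δ := by ext x; exact abs_le (a := x) (b := δ)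
    rw [this]
    exact (hcont.pow n).continuousOn.integrableOn_compact isCompact_Icc
  -- If `D \ E` is empty, `ρ` may be negative, hence the maximum with `0`.
  have hρ' : ∀ x ∈ D \ E, ‖charFun μ x‖ ≤ max ρ 0 := fun x hx =>
    (hgapδ x hx.1 (le_of_lt (not_le.1 hx.2))).trans (le_max_left _ _)
  have hDE : ∀ n, n₁ ≤ n → IntegrableOn (fun x => charFun μ x ^ n) (D \ E) := fun n hn => by
    refine (hn₁.mono_set sdiff_subset).norm.const_mul (max ρ 0 ^ (n - n₁)) |>.mono'
      (hcont.pow n).aestronglyMeasurable ?_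
    refine (ae_restrict_iff' (hD.diff hEm)).2 (Eventually.of_forall fun x hx => ?_)
    exact norm_pow_le_of_le (hρ' x hx) hn
  have hsplit : ∀ n, n₁ ≤ n → ∫ x in D, charFun μ x ^ n =
      (∫ x in E, charFun μ x ^ n) + ∫ x in D \ E, charFun μ x ^ n := fun n hn => by
    rw [← setIntegral_union disjoint_sdiff_right (hD.diff hEm) (hEint n) (hDE n hn),
      union_sdiff_cancel hED]
  -- Near the origin substitute `x = c θ n`; the integrand tends to a Gaussian and is dominated
  -- uniformly in `n`.
  have hmain : Tendsto (fun n => (∫ x in E, charFun μ x ^ n) / (θ n : ℂ)) atTop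
      (𝓝 (Real.sqrt (2 * Real.pi) : ℂ)) := by
    have hchange : ∀ n, (∫ x in E, charFun μ x ^ n) / (θ n : ℂ) =
        ∫ c : ℝ, {c : ℝ | |c| * θ n ≤ δ}.indicator (fun c => charFun μ (c * θ n) ^ n) c := by
      intro n
      have h1 := Measure.integral_comp_mul_right (E.indicator fun x => charFun μ x ^ n) (θ n)
      rw [integral_indicator hEm, abs_of_pos (inv_pos.2 (hθ.pos n))] at h1
      rw [div_eq_inv_mul, ← Complex.ofReal_inv, ← Complex.real_smul, ← h1]
      refine integral_congr_ae (Eventually.of_forall fun c => ?_)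
      simp only [indicator_apply, hE, mem_ofPred_eq, abs_mul, abs_of_pos (hθ.pos n)]
    simp_rw [hchange]
    rw [← integral_cexp_neg_sq_div_two]
    refine tendsto_integral_filter_of_dominated_convergence
      (fun c => Real.exp (1 - |c| / 8)) (Eventually.of_forall fun n => ?_) ?_
      integrable_exp_one_sub_abs_div (Eventually.of_forall fun c => ?_)
    · refine (Measurable.indicator ?_ ?_).aestronglyMeasurable
      · exact ((hcont.comp (continuous_mul_const _)).pow n).measurable
      · exact measurableSet_le (by fun_prop) measurable_const
    · filter_upwards [hdom] with n hn
      refine Eventually.of_forall fun c => ?_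
      rw [indicator_apply]
      split_ifs with hc
      · rw [norm_pow]
        exact hn c (le_trans hc (min_le_right _ _))
      · rw [norm_zero]; positivity
    · refine (hθ.tendsto_charFun_pow hint hmean h c).congr' ?_
      have h1 := hθ.tendsto.const_mul |c|
      rw [mul_zero] at h1
      filter_upwards [h1.eventually_le_const hδ] with n hn
      rw [indicator_of_mem (show c ∈ {c : ℝ | |c| * θ n ≤ δ} from hn)]
  -- Away from the origin all but `n₁` of the factors are bounded by `ρ < 1`, and the remaining
  -- power is integrable.
  have hrest : Tendsto (fun n => (∫ x in D \ E, charFun μ x ^ n) / (θ n : ℂ)) atTop (𝓝 0) := by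
    have h1 := tendsto_mul_pow_div hθ.pos hlow (le_max_right ρ 0) (max_lt hρ one_pos)
    by_cases hρ0 : max ρ 0 = 0
    · refine tendsto_const_nhds.congr' ?_
      filter_upwards [eventually_ge_atTop 1] with n hn
      rw [setIntegral_congr_fun (g := fun _ => 0) (hD.diff hEm)]
      · simp
      · intro x hx
        have := hρ' x hx
        rw [hρ0, norm_le_zero_iff] at this
        simp [this, Nat.one_le_iff_ne_zero.1 hn]
    have hρ1 : 0 < max ρ 0 := lt_of_le_of_ne (le_max_right _ _) (Ne.symm hρ0)
    rw [tendsto_zero_iff_norm_tendsto_zero]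
    have h2 := h1.mul_const ((max ρ 0 ^ n₁)⁻¹ * ∫ x in D \ E, ‖charFun μ x ^ n₁‖)
    rw [zero_mul] at h2
    refine squeeze_zero' (Eventually.of_forall fun n => norm_nonneg _) ?_ h2
    filter_upwards [eventually_ge_atTop n₁] with n hn
    rw [norm_div, Complex.norm_real, Real.norm_of_nonneg (hθ.pos n).le, div_mul_eq_mul_div]
    refine div_le_div_of_nonneg_right ?_ (hθ.pos n).le
    rw [← mul_assoc, ← pow_sub₀ _ hρ1.ne' hn, ← integral_const_mul]
    refine norm_integral_le_of_norm_le
      (((hn₁.mono_set sdiff_subset).norm.const_mul _)) ?_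
    refine (ae_restrict_iff' (hD.diff hEm)).2 (Eventually.of_forall fun x hx => ?_)
    exact norm_pow_le_of_le (hρ' x hx) hn
  have := hmain.add hrest
  rw [add_zero] at this
  refine this.congr' ?_
  filter_upwards [eventually_ge_atTop n₁] with n hn
  rw [hsplit n hn, add_div]

/-! ### Fluctuation identities for a random walk. -/

section Walk

/-- The law of a sequence of independent steps. -/
noncomputable def stepSeq (μ : Measure ℝ) [IsProbabilityMeasure μ] : Measure (ℕ → ℝ) :=
  Measure.infinitePi fun _ => μ

instance (μ : Measure ℝ) [IsProbabilityMeasure μ] : IsProbabilityMeasure (stepSeq μ) := by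
  unfold stepSeq; infer_instance

/-- The sum of the first `n` steps. -/
def partialSum (y : ℕ → ℝ) (n : ℕ) : ℝ := ∑ i ∈ Finset.range n, y i

/-- The sequence with first term `a` followed by `z`. -/
def consSeq (a : ℝ) (z : ℕ → ℝ) : ℕ → ℝ
  | 0 => a
  | n + 1 => z n

/-- The sequence without its first `j` terms. -/
def shiftSeq (j : ℕ) (y : ℕ → ℝ) : ℕ → ℝ := fun i => y (j + i)

theorem measurable_partialSum (n : ℕ) : Measurable fun y => partialSum y n :=
  Finset.measurable_sum _ fun i _ => measurable_pi_apply i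

theorem measurable_consSeq : Measurable fun p : ℝ × (ℕ → ℝ) => consSeq p.1 p.2 := by
  rw [measurable_pi_iff]
  rintro (_ | n)
  · exact measurable_fst
  · exact (measurable_pi_apply n).comp measurable_snd

theorem measurable_shiftSeq (j : ℕ) : Measurable (shiftSeq j) :=
  measurable_pi_iff.2 fun i => measurable_pi_apply (j + i)

theorem partialSum_zero (y : ℕ → ℝ) : partialSum y 0 = 0 := rfl

theorem partialSum_consSeq (a : ℝ) (z : ℕ → ℝ) (n : ℕ) :
    partialSum (consSeq a z) (n + 1) = a + partialSum z n := by
  rw [partialSum, Finset.sum_range_succ', add_comm]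
  rfl

theorem partialSum_add (y : ℕ → ℝ) (j k : ℕ) :
    partialSum y (j + k) = partialSum y j + partialSum (shiftSeq j y) k :=
  Finset.sum_range_add y j k

variable (μ : Measure ℝ) [IsProbabilityMeasure μ]

theorem map_consSeq : (μ.prod (stepSeq μ)).map (fun p => consSeq p.1 p.2) = stepSeq μ := by
  refine Measure.eq_infinitePi _ fun s t ht => ?_
  rw [Measure.map_apply measurable_consSeq (.pi s.countable_toSet fun i _ => ht i)]
  have h1 : (fun p : ℝ × (ℕ → ℝ) => consSeq p.1 p.2) ⁻¹' (Set.pi s t) =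
      (if 0 ∈ s then t 0 else univ) ×ˢ
        Set.pi (s.preimage Nat.succ Nat.succ_injective.injOn) (fun i => t (i + 1)) := by
    ext p
    simp only [mem_preimage, Set.mem_pi, Finset.mem_coe, mem_prod, Finset.mem_preimage]
    constructor
    · intro h
      refine ⟨?_, fun i hi => h (i + 1) hi⟩
      split_ifs with h0
      · exact h 0 h0
      · trivial
    · rintro ⟨h0, h⟩ (_ | i) hi
      · rwa [if_pos hi] at h0
      · exact h i hi
  rw [h1, Measure.prod_prod, stepSeq, Measure.infinitePi_pi _ fun i _ => ht (i + 1)]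
  by_cases h0 : 0 ∈ s
  · rw [if_pos h0, ← Finset.mul_prod_erase s _ h0]
    congr 1
    refine Finset.prod_bij (fun i _ => Nat.succ i) (fun i hi => ?_) (fun i _ j _ h => by simpa using h)
      (fun i hi => ?_) fun i _ => rfl
    · exact Finset.mem_erase.2 ⟨i.succ_ne_zero, Finset.mem_preimage.1 hi⟩
    · obtain ⟨hi0, hi⟩ := Finset.mem_erase.1 hi
      obtain ⟨k, rfl⟩ := Nat.exists_eq_succ_of_ne_zero hi0
      exact ⟨k, Finset.mem_preimage.2 hi, rfl⟩
  · rw [if_neg h0, measure_univ, one_mul]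
    refine Finset.prod_bij (fun i _ => Nat.succ i) (fun i hi => ?_) (fun i _ j _ h => by simpa using h)
      (fun i hi => ?_) fun i _ => rfl
    · exact Finset.mem_preimage.1 hi
    · obtain ⟨k, rfl⟩ := Nat.exists_eq_succ_of_ne_zero (fun h => h0 (h ▸ hi) : i ≠ 0)
      exact ⟨k, Finset.mem_preimage.2 hi, rfl⟩

theorem lintegral_stepSeq {F : (ℕ → ℝ) → ℝ≥0∞} (hF : Measurable F) :
    ∫⁻ y, F y ∂(stepSeq μ) = ∫⁻ a, ∫⁻ z, F (consSeq a z) ∂(stepSeq μ) ∂μ := by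
  conv_lhs => rw [← map_consSeq μ]
  rw [lintegral_map hF measurable_consSeq, lintegral_prod]
  exact (hF.comp measurable_consSeq).aemeasurable

theorem stepSeq_apply {E : Set (ℕ → ℝ)} (hE : MeasurableSet E) :
    stepSeq μ E = ∫⁻ a, stepSeq μ {z | consSeq a z ∈ E} ∂μ := by
  conv_lhs => rw [← map_consSeq μ]
  rw [Measure.map_apply measurable_consSeq hE, Measure.prod_apply (measurable_consSeq hE)]
  rfl

theorem measurableSet_consSeq_mem (a : ℝ) {E : Set (ℕ → ℝ)} (hE : MeasurableSet E) :
    MeasurableSet {z | consSeq a z ∈ E} :=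
  (measurable_consSeq.comp (measurable_const.prodMk measurable_id)) hE

/-- The first `j` steps and the following ones are independent. -/
theorem stepSeq_inter_shiftSeq {A B : Set (ℕ → ℝ)} (hA : MeasurableSet A) (hB : MeasurableSet B)
    {j : ℕ} (hj : ∀ y z : ℕ → ℝ, (∀ i < j, y i = z i) → (y ∈ A ↔ z ∈ A)) :
    stepSeq μ (A ∩ shiftSeq j ⁻¹' B) = stepSeq μ A * stepSeq μ B := by
  induction j generalizing A with
  | zero =>
    have h0 : shiftSeq 0 = id := by funext y i; simp [shiftSeq]
    rw [h0, preimage_id]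
    by_cases h : (0 : ℕ → ℝ) ∈ A
    · have : A = univ := eq_univ_of_forall fun y => (hj y 0 (by simp)).2 h
      simp [this]
    · have : A = ∅ := eq_empty_of_forall_notMem fun y hy => h ((hj y 0 (by simp)).1 hy)
      simp [this]
  | succ j ih =>
    rw [stepSeq_apply μ (hA.inter (measurable_shiftSeq _ hB)), stepSeq_apply μ hA,
      ← lintegral_mul_const']
    · refine lintegral_congr fun a => ?_
      rw [← ih (measurableSet_consSeq_mem a hA)]
      · congr 1
        ext z
        have : shiftSeq (j + 1) (consSeq a z) = shiftSeq j z := by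
          funext i
          rw [shiftSeq, show j + 1 + i = (j + i) + 1 by ring]
          rfl
        simp only [mem_ofPred_eq, mem_inter_iff, mem_preimage, this]
      · intro y z hyz
        refine hj _ _ ?_
        rintro (_ | i) hi
        · rfl
        · exact hyz i (by omega)
    · exact measure_ne_top _ _

/-- Exchangeability of the steps; it is applied to the reversal and to the rotation of the first `n`
steps. -/
theorem stepSeq_preimage_comp {σ : ℕ → ℕ} (hσ : Function.Injective σ) {E : Set (ℕ → ℝ)}
    (hE : MeasurableSet E) : stepSeq μ {y | (fun i => y (σ i)) ∈ E} = stepSeq μ E := by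
  have h := Measure.map_infinitePi_infinitePi_of_inj (P := fun _ : ℕ => μ) hσ
  conv_rhs => rw [stepSeq, ← h]
  rw [Measure.map_apply (measurable_pi_iff.2 fun i => measurable_pi_apply _) hE]
  rfl

/-- The first `n` partial sums are positive. -/
def positiveSet (n : ℕ) : Set (ℕ → ℝ) := {y | ∀ k, 1 ≤ k → k ≤ n → 0 < partialSum y k}

/-- The walk enters the positive half-line at time `j`. -/
def firstPassage (j : ℕ) : Set (ℕ → ℝ) :=
  {y | (∀ k, 1 ≤ k → k < j → partialSum y k ≤ 0) ∧ 0 < partialSum y j}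

/-- Time `n` is a strict record. -/
def recordSet (n : ℕ) : Set (ℕ → ℝ) := {y | ∀ k, k < n → partialSum y k < partialSum y n}

theorem measurableSet_partialSum_lt (k n : ℕ) :
    MeasurableSet {y : ℕ → ℝ | partialSum y k < partialSum y n} :=
  measurableSet_lt (measurable_partialSum k) (measurable_partialSum n)

theorem measurableSet_partialSum_le (k n : ℕ) :
    MeasurableSet {y : ℕ → ℝ | partialSum y k ≤ partialSum y n} :=
  measurableSet_le (measurable_partialSum k) (measurable_partialSum n)

theorem measurableSet_partialSum_pos (n : ℕ) : MeasurableSet {y : ℕ → ℝ | 0 < partialSum y n} :=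
  measurableSet_partialSum_lt 0 n

theorem measurableSet_partialSum_nonpos (n : ℕ) :
    MeasurableSet {y : ℕ → ℝ | partialSum y n ≤ 0} :=
  measurableSet_partialSum_le n 0

theorem measurableSet_positiveSet (n : ℕ) : MeasurableSet (positiveSet n) := by
  simp only [positiveSet, ofPred_forall]
  exact .iInter fun k => .iInter fun _ => .iInter fun _ => measurableSet_partialSum_pos k

theorem measurableSet_firstPassage (n : ℕ) : MeasurableSet (firstPassage n) := by
  simp only [firstPassage, ofPred_and, ofPred_forall]
  exact .inter (.iInter fun k => .iInter fun _ => .iInter fun _ =>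
    measurableSet_partialSum_nonpos k) (measurableSet_partialSum_pos n)

theorem measurableSet_recordSet (n : ℕ) : MeasurableSet (recordSet n) := by
  simp only [recordSet, ofPred_forall]
  exact .iInter fun k => .iInter fun _ => measurableSet_partialSum_lt k n

theorem partialSum_congr {y z : ℕ → ℝ} {n : ℕ} (h : ∀ i < n, y i = z i) :
    partialSum y n = partialSum z n :=
  Finset.sum_congr rfl fun i hi => h i (Finset.mem_range.1 hi)

/-- Duality: reversal of the first `n` steps. -/
theorem stepSeq_recordSet (n : ℕ) : stepSeq μ (recordSet n) = stepSeq μ (positiveSet n) := by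
  set σ : ℕ → ℕ := fun i => if i < n then n - 1 - i else i with hσ
  have hinj : Function.Injective σ := by
    intro i j hij
    simp only [hσ] at hij
    split_ifs at hij <;> omega
  rw [← stepSeq_preimage_comp μ hinj (measurableSet_positiveSet n)]
  congr 1
  ext y
  have hs : ∀ k ≤ n, partialSum (fun i => y (σ i)) k = partialSum y n - partialSum y (n - k) := by
    intro k hk
    induction k with
    | zero => simp [partialSum_zero]
    | succ k ih =>
      have h1 : partialSum y (n - k) = partialSum y (n - (k + 1)) + y (n - 1 - k) := by
        rw [show n - k = (n - 1 - k) + 1 by omega, show n - (k + 1) = n - 1 - k by omega]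
        exact Finset.sum_range_succ _ _
      have h2 : partialSum (fun i => y (σ i)) (k + 1) =
          partialSum (fun i => y (σ i)) k + y (σ k) := Finset.sum_range_succ _ _
      rw [h2, ih (by omega), h1, hσ]
      simp only [show k < n by omega, if_true]
      ring
  constructor
  · intro h k hk1 hk
    rw [hs k hk]
    linarith [h (n - k) (by omega)]
  · intro h k hk
    have := h (n - k) (by omega) (by omega)
    rw [hs (n - k) (by omega), Nat.sub_sub_self hk.le] at this
    linarith

/-- Decomposition of a record according to the time of the first passage. -/
theorem recordSet_inter_eq {n i : ℕ} (hi : i < n) :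
    recordSet n ∩ {y | ∀ k, 1 ≤ k → k ≤ i → partialSum y k ≤ 0} =
      ⋃ j ∈ Finset.Ioc i n, (firstPassage j ∩ shiftSeq j ⁻¹' recordSet (n - j)) := by
  ext y
  simp only [mem_inter_iff, mem_iUnion, Finset.mem_Ioc, mem_preimage, exists_prop, mem_ofPred_eq]
  constructor
  · rintro ⟨h1, h2⟩
    have hex : ∃ j, 1 ≤ j ∧ 0 < partialSum y j := ⟨n, by omega, by
      simpa [partialSum_zero] using h1 0 (by omega)⟩
    classical
    have hj := Nat.find_spec hex
    have hmin : ∀ k, 1 ≤ k → k < Nat.find hex → partialSum y k ≤ 0 := fun k hk hk2 => by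
      have := Nat.find_min hex hk2
      push Not at this
      exact this hk
    have hjn : Nat.find hex ≤ n := Nat.find_le ⟨by omega, by
      simpa [partialSum_zero] using h1 0 (by omega)⟩
    refine ⟨Nat.find hex, ⟨?_, hjn⟩, ⟨hmin, hj.2⟩, fun k hk => ?_⟩
    · by_contra! hle
      exact absurd (h2 _ hj.1 hle) (not_le.2 hj.2)
    · have h3 := h1 (Nat.find hex + k) (by omega)
      have h4 := partialSum_add y (Nat.find hex) (n - Nat.find hex)
      rw [Nat.add_sub_cancel' hjn] at h4
      rw [h4, partialSum_add] at h3
      linarith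
  · rintro ⟨j, ⟨hij, hjn⟩, ⟨h1, h2⟩, h3⟩
    have h4 := partialSum_add y j (n - j)
    rw [Nat.add_sub_cancel' hjn] at h4
    have h5 : partialSum y j ≤ partialSum y n := by
      rcases hjn.eq_or_lt with rfl | hlt
      · exact le_rfl
      · have := h3 0 (by omega)
        rw [partialSum_zero] at this
        linarith
    refine ⟨fun k hk => ?_, fun k hk hki => h1 k hk (by omega)⟩
    rcases lt_or_ge k j with hkj | hkj
    · have : partialSum y k ≤ 0 := by
        rcases Nat.eq_zero_or_pos k with rfl | hk0
        · exact le_rfl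
        · exact h1 k hk0 hkj
      linarith
    · have h6 := h3 (k - j) (by omega)
      have h7 := partialSum_add y j (k - j)
      rw [Nat.add_sub_cancel' hkj] at h7
      linarith

theorem disjoint_firstPassage {i j : ℕ} (h : i ≠ j) : Disjoint (firstPassage i) (firstPassage j) := by
  wlog hij : i < j generalizing i j
  · exact (this h.symm (by omega)).symm
  rw [Set.disjoint_left]
  rintro y ⟨_, h1⟩ ⟨h2, _⟩
  rcases Nat.eq_zero_or_pos i with rfl | hi
  · simp [partialSum_zero] at h1
  · exact absurd (h2 i hi hij) (not_le.2 h1)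

theorem stepSeq_recordSet_inter {n i : ℕ} (hi : i < n) :
    stepSeq μ (recordSet n ∩ {y | ∀ k, 1 ≤ k → k ≤ i → partialSum y k ≤ 0}) =
      ∑ j ∈ Finset.Ioc i n, stepSeq μ (firstPassage j) * stepSeq μ (positiveSet (n - j)) := by
  rw [recordSet_inter_eq hi, measure_biUnion_finset]
  · refine Finset.sum_congr rfl fun j _ => ?_
    rw [stepSeq_inter_shiftSeq μ (measurableSet_firstPassage j) (measurableSet_recordSet _),
      stepSeq_recordSet]
    intro y z hyz
    have h1 : ∀ k ≤ j, partialSum y k = partialSum z k := fun k hk =>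
      partialSum_congr fun i hi => hyz i (by omega)
    refine and_congr (forall_congr' fun k => forall_congr' fun _ => forall_congr' fun hk => ?_) ?_
    · rw [h1 k hk.le]
    · rw [h1 j le_rfl]
  · intro j _ l _ hjl
    exact (disjoint_firstPassage hjl).mono inter_subset_left inter_subset_left
  · intro j _
    exact (measurableSet_firstPassage j).inter (measurable_shiftSeq j (measurableSet_recordSet _))

theorem sum_Ioc_eq_sum_range {M : Type*} [AddCommMonoid M] (f : ℕ → M) (n : ℕ) :
    ∑ j ∈ Finset.Ioc 0 n, f j = ∑ j ∈ Finset.range n, f (j + 1) := by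
  rw [Finset.range_eq_Ico, Finset.sum_Ico_add' f 0 n 1]
  refine Finset.sum_congr ?_ fun _ _ => rfl
  ext j
  simp only [Finset.mem_Ioc, Finset.mem_Ico]
  omega

/-- The case `i = 0` of `stepSeq_recordSet_inter`, in which the constraint is void. By duality
records are equiprobable with positive paths, so their probabilities solve the renewal equation of
the first passage law. -/
theorem stepSeq_positiveSet_succ (n : ℕ) : stepSeq μ (positiveSet (n + 1)) =
    ∑ j ∈ Finset.range (n + 1), stepSeq μ (firstPassage (j + 1)) * stepSeq μ (positiveSet (n - j)) := by
  have h := stepSeq_recordSet_inter μ (Nat.succ_pos n)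
  have h2 : recordSet (n + 1) ∩ {y | ∀ k, 1 ≤ k → k ≤ 0 → partialSum y k ≤ 0} =
      recordSet (n + 1) := by
    refine inter_eq_left.2 fun y _ k hk hk0 => ?_
    omega
  rw [Nat.succ_eq_add_one, h2, stepSeq_recordSet] at h
  rw [h, sum_Ioc_eq_sum_range]
  exact Finset.sum_congr rfl fun j _ => by rw [Nat.add_sub_add_right]

/-- The first maximum of `s_0, …, s_{n-1}` is attained at time `r`, and `s_n` is positive. -/
def maxSet (n r : ℕ) : Set (ℕ → ℝ) :=
  {y | 0 < partialSum y n ∧ (∀ l, l < r → partialSum y l < partialSum y r) ∧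
    ∀ l, r < l → l < n → partialSum y l ≤ partialSum y r}

theorem measurableSet_maxSet (n r : ℕ) : MeasurableSet (maxSet n r) := by
  simp only [maxSet, ofPred_and, ofPred_forall]
  exact (measurableSet_partialSum_pos n).inter (.inter
    (.iInter fun k => .iInter fun _ => measurableSet_partialSum_lt k r)
    (.iInter fun k => .iInter fun _ => .iInter fun _ => measurableSet_partialSum_le k r))

theorem setOf_partialSum_pos_eq {n : ℕ} (hn : 0 < n) :
    {y | 0 < partialSum y n} = ⋃ r ∈ Finset.range n, maxSet n r := by
  ext y
  simp only [mem_ofPred_eq, mem_iUnion, Finset.mem_range, exists_prop]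
  constructor
  · intro h
    have hex : ∃ r, r < n ∧ ∀ l < n, partialSum y l ≤ partialSum y r := by
      obtain ⟨r, hr, hr2⟩ := Finset.exists_max_image (Finset.range n) (partialSum y)
        ⟨0, Finset.mem_range.2 hn⟩
      exact ⟨r, Finset.mem_range.1 hr, fun l hl => hr2 l (Finset.mem_range.2 hl)⟩
    classical
    obtain ⟨h1, h2⟩ := Nat.find_spec hex
    refine ⟨Nat.find hex, h1, h, fun l hl => ?_, fun l _ hl => h2 l hl⟩
    have h3 := Nat.find_min hex hl
    push Not at h3
    obtain ⟨m, hm, hlt⟩ := h3 (hl.trans h1)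
    exact hlt.trans_le (h2 m hm)
  · rintro ⟨r, _, h, _⟩
    exact h

/-- Rotate the first `n` steps so that they begin at the time `r` of the first maximum. The path
then stays nonpositive for `n - 1 - r` steps and, as `s_n > 0`, ends at a strict record. -/
theorem stepSeq_maxSet {n r : ℕ} (hr : r < n) : stepSeq μ (maxSet n r) =
    stepSeq μ (recordSet n ∩ {y | ∀ k, 1 ≤ k → k ≤ n - 1 - r → partialSum y k ≤ 0}) := by
  set σ : ℕ → ℕ := fun i => if i < n - r then r + i else if i < n then i - (n - r) else i with hσ
  have hinj : Function.Injective σ := by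
    intro i j hij
    simp only [hσ] at hij
    split_ifs at hij <;> omega
  have hm : MeasurableSet (recordSet n ∩
      {y | ∀ k, 1 ≤ k → k ≤ n - 1 - r → partialSum y k ≤ 0}) := by
    simp only [ofPred_forall]
    exact (measurableSet_recordSet n).inter (.iInter fun k => .iInter fun _ => .iInter fun _ =>
      measurableSet_partialSum_nonpos k)
  rw [← stepSeq_preimage_comp μ hinj hm]
  congr 1
  ext y
  have hs1 : ∀ k ≤ n - r, partialSum (fun i => y (σ i)) k = partialSum y (r + k) - partialSum y r := by
    intro k hk
    rw [partialSum_add, add_sub_cancel_left]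
    refine partialSum_congr fun i hi => ?_
    simp only [hσ, show i < n - r by omega, if_true]
    rfl
  have hs2 : ∀ k ≤ r, partialSum (fun i => y (σ i)) (n - r + k) =
      partialSum y n - partialSum y r + partialSum y k := by
    intro k hk
    rw [partialSum_add, hs1 _ le_rfl, show r + (n - r) = n by omega]
    congr 1
    refine partialSum_congr fun i hi => ?_
    simp only [hσ, shiftSeq]
    rw [if_neg (by omega), if_pos (by omega), Nat.add_sub_cancel_left]
  have hsn : partialSum (fun i => y (σ i)) n = partialSum y n := by
    have := hs2 r le_rfl
    rw [show n - r + r = n by omega] at this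
    linarith
  simp only [maxSet, mem_ofPred_eq, mem_inter_iff, recordSet]
  rw [hsn]
  constructor
  · rintro ⟨h0, h1, h2⟩
    refine ⟨fun k hk => ?_, fun k hk1 hk => ?_⟩
    · rcases lt_or_ge k (n - r) with h | h
      · rw [hs1 k h.le]
        rcases Nat.eq_zero_or_pos k with rfl | hk0
        · simpa using h0
        · linarith [h2 (r + k) (by omega) (by omega)]
      · obtain ⟨l, rfl⟩ := Nat.exists_eq_add_of_le h
        rw [hs2 l (by omega)]
        linarith [h1 l (by omega)]
    · rw [hs1 k (by omega)]
      linarith [h2 (r + k) (by omega) (by omega)]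
  · rintro ⟨h1, h2⟩
    refine ⟨?_, fun l hl => ?_, fun l hl1 hl => ?_⟩
    · have := h1 0 (by omega)
      rwa [partialSum_zero] at this
    · have := h1 (n - r + l) (by omega)
      rw [hs2 l hl.le] at this
      linarith
    · have := h2 (l - r) (by omega) (by omega)
      rw [hs1 (l - r) (by omega), Nat.add_sub_cancel' hl1.le] at this
      linarith

/-- Summing `stepSeq_maxSet` over `r`, the rotated path with first passage at time `j` is admissible
for the `j` values of `r` with `n - 1 - r < j`; this produces the factor `j`. -/
theorem stepSeq_partialSum_pos {n : ℕ} (hn : 0 < n) :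
    stepSeq μ {y | 0 < partialSum y n} = ∑ j ∈ Finset.Ioc 0 n,
      j * (stepSeq μ (firstPassage j) * stepSeq μ (positiveSet (n - j))) := by
  rw [setOf_partialSum_pos_eq hn, measure_biUnion_finset]
  · have h1 : ∀ r ∈ Finset.range n, stepSeq μ (maxSet n r) = ∑ j ∈ Finset.Ioc 0 n,
        if n - 1 - r < j then stepSeq μ (firstPassage j) * stepSeq μ (positiveSet (n - j)) else 0 := by
      intro r hr
      have hr := Finset.mem_range.1 hr
      rw [stepSeq_maxSet μ hr, stepSeq_recordSet_inter μ (by omega), ← Finset.sum_filter]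
      refine Finset.sum_congr ?_ fun _ _ => rfl
      ext j
      simp only [Finset.mem_Ioc, Finset.mem_filter]
      omega
    rw [Finset.sum_congr rfl h1, Finset.sum_comm]
    refine Finset.sum_congr rfl fun j hj => ?_
    rw [← Finset.sum_filter, Finset.sum_const, nsmul_eq_mul]
    congr 2
    have : Finset.filter (fun r => n - 1 - r < j) (Finset.range n) = Finset.Ico (n - j) n := by
      have := Finset.mem_Ioc.1 hj
      ext r
      simp only [Finset.mem_filter, Finset.mem_range, Finset.mem_Ico]
      omega
    rw [this, Nat.card_Ico]
    have := Finset.mem_Ioc.1 hj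
    omega
  · intro r hr l hl hrl
    have hr := Finset.mem_range.1 hr
    have hl := Finset.mem_range.1 hl
    rw [Function.onFun, Set.disjoint_left]
    rintro y ⟨_, h1, h2⟩ ⟨_, h3, h4⟩
    rcases lt_or_gt_of_ne hrl with h | h
    · exact absurd (h3 r h) (not_lt.2 (h2 l h hl))
    · exact absurd (h1 l h) (not_lt.2 (h4 r h hr))
  · exact fun r _ => measurableSet_maxSet n r

end Walk

/-! ### The central limit theorem and the probability of staying positive. -/

section

variable (μ : Measure ℝ) [IsProbabilityMeasure μ]

/-- The law of the `n`-th partial sum. -/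
noncomputable def sumLaw (n : ℕ) : Measure ℝ := (stepSeq μ).map fun y => partialSum y n

instance (n : ℕ) : IsProbabilityMeasure (sumLaw μ n) :=
  Measure.isProbabilityMeasure_map (measurable_partialSum n).aemeasurable

theorem charFun_sumLaw (n : ℕ) (t : ℝ) : charFun (sumLaw μ n) t = charFun μ t ^ n := by
  have hindep : iIndepFun (fun (i : ℕ) (y : ℕ → ℝ) => y i) (stepSeq μ) :=
    iIndepFun_infinitePi (X := fun _ x => x) fun _ => measurable_id
  have h := iIndepFun.charFun_map_fun_finsetSum_eq_prod (s := Finset.range n)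
    (X := fun (i : ℕ) (y : ℕ → ℝ) => y i) (P := stepSeq μ)
    (fun i _ => (measurable_pi_apply i).aemeasurable)
    (iIndepFun_iff_finset.1 hindep (Finset.range n))
  have h2 := congrFun h t
  change charFun (sumLaw μ n) t = _ at h2
  rw [h2, Finset.prod_apply]
  have h3 : ∀ i, (stepSeq μ).map (fun y => y i) = μ := fun i => Measure.infinitePi_map_eval _ i
  simp [h3]

theorem measure_Ioi_gaussianReal : gaussianReal 0 1 (Ioi 0) = 1 / 2 := by
  have h1 : gaussianReal 0 1 (Iio 0) = gaussianReal 0 1 (Ioi 0) := by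
    have h := gaussianReal_map_neg (μ := 0) (v := 1)
    rw [neg_zero] at h
    conv_lhs => rw [← h]
    rw [Measure.map_apply measurable_neg measurableSet_Iio]
    congr 1
    ext; simp
  have := nullSingletonClass_gaussianReal (μ := 0) (v := 1) one_ne_zero
  have h2 : gaussianReal 0 1 (Iio 0) + gaussianReal 0 1 (Ioi 0) = 1 := by
    have hd : Disjoint (Iio (0 : ℝ)) (Ioi 0) :=
      Set.disjoint_left.2 fun x (hx : x < 0) (hx' : 0 < x) => lt_asymm hx hx'
    rw [← measure_union hd measurableSet_Ioi, Iio_union_Ioi, measure_compl (measurableSet_singleton _)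
      (measure_ne_top _ _)]
    simp
  rw [h1, ← two_mul] at h2
  rw [ENNReal.eq_div_iff two_ne_zero ENNReal.ofNat_ne_top, h2]

/-- The rescaled sums converge weakly to a standard Gaussian by Lévy's continuity theorem. The
half-line has a null boundary, and its probability is `1/2` by symmetry; positive rescaling does not
change the event. -/
theorem tendsto_measureReal_partialSum_pos (hint : Integrable (fun y : ℝ => y) μ)
    (hmean : ∫ y, y ∂μ = 0) (h : IsSlowlyVarying (truncSq μ)) :
    Tendsto (fun n => (stepSeq μ).real {y | 0 < partialSum y n}) atTop (𝓝 (1 / 2)) := by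
  obtain ⟨θ, hθ⟩ := exists_isScale h
  have hprob : ∀ n, IsProbabilityMeasure ((sumLaw μ n).map (fun x => θ n * x)) := fun n =>
    Measure.isProbabilityMeasure_map (by fun_prop)
  let P : ℕ → ProbabilityMeasure ℝ := fun n => ⟨(sumLaw μ n).map (fun x => θ n * x), hprob n⟩
  let G : ProbabilityMeasure ℝ := ⟨gaussianReal 0 1, inferInstance⟩
  have hlim : Tendsto P atTop (𝓝 G) := by
    refine ProbabilityMeasure.tendsto_iff_tendsto_charFun.2 fun t => ?_
    refine (hθ.tendsto_charFun_pow hint hmean h t).congr' ?_ |>.trans_eq ?_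
    · refine Eventually.of_forall fun n => ?_
      simp only [P, ProbabilityMeasure.coe_mk]
      rw [charFun_map_mul, charFun_sumLaw, mul_comm]
    · simp only [G, ProbabilityMeasure.coe_mk]
      rw [charFun_gaussianReal]
      simp
  have hnull : gaussianReal 0 1 (frontier (Ioi (0 : ℝ))) = 0 := by
    have := nullSingletonClass_gaussianReal (μ := 0) (v := 1) one_ne_zero
    rw [frontier_Ioi]
    simp
  have h2 := ProbabilityMeasure.tendsto_measure_of_null_frontier_of_tendsto' hlim
    (E := Ioi (0 : ℝ)) hnull
  simp only [P, G, ProbabilityMeasure.coe_mk] at h2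
  rw [measure_Ioi_gaussianReal] at h2
  have h3 := (ENNReal.tendsto_toReal (by simp)).comp h2
  have h4 : ((1 : ℝ≥0∞) / 2).toReal = 1 / 2 := by simp
  rw [h4] at h3
  refine h3.congr fun n => ?_
  rw [Function.comp_apply, Measure.map_apply (by fun_prop) measurableSet_Ioi, sumLaw,
    Measure.map_apply (measurable_partialSum n) (by
      exact (measurable_const_mul (θ n)) measurableSet_Ioi), Measure.real]
  congr 2
  ext y
  simp only [mem_preimage, mem_Ioi, mem_ofPred_eq]
  exact mul_pos_iff_of_pos_left (hθ.pos n)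

variable {μ}

-- A nonpositive variable with mean zero vanishes almost surely, and then the truncated variance is
-- identically zero.
omit [IsProbabilityMeasure μ] in
theorem measure_Ioi_pos (hint : Integrable (fun y : ℝ => y) μ)
    (hmean : ∫ y, y ∂μ = 0) (h : IsSlowlyVarying (truncSq μ)) : 0 < μ (Ioi 0) := by
  rw [pos_iff_ne_zero]
  intro h0
  have h1 : ∀ᵐ y ∂μ, y ≤ 0 := by
    rw [ae_iff]
    simp only [not_le]
    exact h0
  have h2 : ∀ᵐ y ∂μ, -y = 0 := by
    have := (integral_eq_zero_iff_of_nonneg_ae (f := fun y : ℝ => -y) (μ := μ) ?_ hint.neg).1 ?_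
    · exact this
    · filter_upwards [h1] with y hy
      exact neg_nonneg.2 hy
    · rw [integral_neg, hmean, neg_zero]
  obtain ⟨t, _, ht⟩ := eventually_truncSq_pos h
  refine ht.ne' ?_
  refine integral_eq_zero_of_ae (ae_restrict_of_ae ?_)
  filter_upwards [h2] with y hy
  simp [neg_eq_zero.1 hy]

omit [IsProbabilityMeasure μ] in
theorem measure_Iio_pos (hint : Integrable (fun y : ℝ => y) μ)
    (hmean : ∫ y, y ∂μ = 0) (h : IsSlowlyVarying (truncSq μ)) : 0 < μ (Iio 0) := by
  rw [pos_iff_ne_zero]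
  intro h0
  have h1 : ∀ᵐ y ∂μ, 0 ≤ y := by
    rw [ae_iff]
    simp only [not_le]
    exact h0
  have h2 := (integral_eq_zero_iff_of_nonneg_ae (f := fun y : ℝ => y) (μ := μ) h1 hint).1 hmean
  obtain ⟨t, _, ht⟩ := eventually_truncSq_pos h
  refine ht.ne' ?_
  refine integral_eq_zero_of_ae (ae_restrict_of_ae ?_)
  filter_upwards [h2] with y hy
  simp [show y = 0 from hy]

variable (μ)

/-- The probability that the first `n` partial sums are positive. -/
noncomputable def positivityProb (n : ℕ) : ℝ := (stepSeq μ).real (positiveSet n)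

/-- The law of the first entrance into the positive half-line. -/
noncomputable def passageProb (n : ℕ) : ℝ := (stepSeq μ).real (firstPassage n)

theorem positivityProb_zero : positivityProb μ 0 = 1 := by
  have : positiveSet 0 = univ := eq_univ_of_forall fun y k h1 h2 => by omega
  simp [positivityProb, this]

theorem passageProb_zero : passageProb μ 0 = 0 := by
  have : firstPassage 0 = ∅ := by
    refine eq_empty_of_forall_notMem fun y hy => ?_
    simpa [partialSum_zero] using hy.2
  simp [passageProb, this]

theorem positivityProb_succ (n : ℕ) : positivityProb μ (n + 1) =
    seqConv (fun i => passageProb μ (i + 1)) (positivityProb μ) n := by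
  rw [positivityProb, Measure.real, stepSeq_positiveSet_succ, ENNReal.toReal_sum fun j _ =>
    ENNReal.mul_ne_top (measure_ne_top _ _) (measure_ne_top _ _)]
  refine Finset.sum_congr rfl fun j _ => ?_
  rw [ENNReal.toReal_mul]
  rfl

theorem positivityProb_eq_renewalSeq : positivityProb μ = renewalSeq (passageProb μ) := by
  refine eq_renewalSeq (passageProb_zero μ) ?_
  rw [mk_eq_X_mul (passageProb_zero μ), mul_assoc, coeff_mk_mul_mk]
  ext n
  cases n with
  | zero => simp [positivityProb_zero]
  | succ n =>
    rw [map_add, PowerSeries.coeff_succ_X_mul]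
    simp [PowerSeries.coeff_one, positivityProb_succ]

theorem measureReal_partialSum_pos (n : ℕ) : (stepSeq μ).real {y | 0 < partialSum y (n + 1)} =
    seqConv (fun i => (i + 1 : ℝ) * passageProb μ (i + 1)) (positivityProb μ) n := by
  rw [Measure.real, stepSeq_partialSum_pos μ n.succ_pos, Nat.succ_eq_add_one,
    sum_Ioc_eq_sum_range, ENNReal.toReal_sum]
  · refine Finset.sum_congr rfl fun j _ => ?_
    rw [ENNReal.toReal_mul, ENNReal.toReal_mul, Nat.add_sub_add_right, ← mul_assoc]
    have h1 : ((j + 1 : ℕ) : ℝ≥0∞).toReal = (j : ℝ) + 1 := by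
      rw [ENNReal.toReal_natCast, Nat.cast_succ]
    rw [h1]
    rfl
  · exact fun j _ => ENNReal.mul_ne_top (ENNReal.natCast_ne_top _)
      (ENNReal.mul_ne_top (measure_ne_top _ _) (measure_ne_top _ _))

/-- The Sparre Andersen identity in differentiated form. In `u' = a' u² = (a' u) u`, with `a` the
first passage law, `measureReal_partialSum_pos` identifies the factor `a' u`. -/
theorem succ_mul_positivityProb (n : ℕ) : (n + 1 : ℝ) * positivityProb μ (n + 1) =
    seqConv (fun i => (stepSeq μ).real {y | 0 < partialSum y (i + 1)}) (positivityProb μ) n := by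
  have h := succ_mul_renewalSeq_succ (passageProb_zero μ) n
  rw [← positivityProb_eq_renewalSeq] at h
  rw [h]
  have h2 : (fun i => (stepSeq μ).real {y | 0 < partialSum y (i + 1)}) =
      seqConv (fun i => (i + 1 : ℝ) * passageProb μ (i + 1)) (positivityProb μ) :=
    funext (measureReal_partialSum_pos μ)
  rw [h2]
  have h3 : ∀ a b : ℕ → ℝ, ∀ n, seqConv a b n =
      PowerSeries.coeff n (PowerSeries.mk a * PowerSeries.mk b) := fun a b n => by
    rw [coeff_mk_mul_mk, PowerSeries.coeff_mk]
  rw [h3, h3, ← coeff_mk_mul_mk, ← coeff_mk_mul_mk, mul_assoc]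

theorem positivityProb_le_one (n : ℕ) : positivityProb μ n ≤ 1 := measureReal_le_one

theorem positivityProb_nonneg (n : ℕ) : 0 ≤ positivityProb μ n := measureReal_nonneg

theorem positivityProb_antitone : Antitone (positivityProb μ) := fun _ _ hmn =>
  measureReal_mono fun _ hy k h1 h2 => hy k h1 (h2.trans hmn)

variable {μ}

theorem positivityProb_pos (hint : Integrable (fun y : ℝ => y) μ)
    (hmean : ∫ y, y ∂μ = 0) (h : IsSlowlyVarying (truncSq μ)) (n : ℕ) :
    0 < positivityProb μ n := by
  rw [positivityProb_eq_renewalSeq]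
  refine renewalSeq_pos (passageProb_zero μ) (fun n => measureReal_nonneg) ?_ n
  have h1 : firstPassage 1 = (fun y : ℕ → ℝ => y 0) ⁻¹' Ioi 0 := by
    ext y
    simp only [firstPassage, mem_ofPred_eq, mem_preimage, mem_Ioi, partialSum, Finset.sum_range_one]
    exact ⟨fun h => h.2, fun h => ⟨fun k h1 h2 => by omega, h⟩⟩
  have h3 : (stepSeq μ).map (fun y => y 0) = μ := Measure.infinitePi_map_eval _ 0
  rw [passageProb, Measure.real, h1, ← Measure.map_apply (measurable_pi_apply 0) measurableSet_Ioi,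
    h3]
  exact ENNReal.toReal_pos (measure_Ioi_pos hint hmean h).ne' (measure_ne_top _ _)

/-- Apply `isFlat_of_mul_succ_eq_seqConv` to the Sparre Andersen identity; its first factor
converges to `1/2`, so it is flat. -/
theorem isFlat_positivityProb (hint : Integrable (fun y : ℝ => y) μ)
    (hmean : ∫ y, y ∂μ = 0) (h : IsSlowlyVarying (truncSq μ)) : IsFlat (positivityProb μ) := by
  have hα := (tendsto_add_atTop_iff_nat 1).2 (tendsto_measureReal_partialSum_pos μ hint hmean h)
  refine isFlat_of_mul_succ_eq_seqConv (succ_mul_positivityProb μ) (positivityProb_nonneg μ)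
    (fun n => measureReal_nonneg) ?_ (positivityProb_nonneg μ) ?_
  · refine isFlat_of_tendsto_div (hα.eventually_const_lt (by norm_num)) ?_
    have := ((tendsto_add_atTop_iff_nat 1).2 hα).div hα (by norm_num)
    rw [div_self (by norm_num)] at this
    exact this
  · intro J η hη
    -- Single terms are negligible: by monotonicity, `M ≥ 4/η` terms of the convolution are each at
    -- least `1/4` times the value at `n - J`.
    obtain ⟨j₀, hj₀⟩ := eventually_atTop.1 (hα.eventually_const_le (show (1 / 4 : ℝ) < 1 / 2 by norm_num))
    obtain ⟨M, hM⟩ := exists_nat_ge (4 / η)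
    filter_upwards [eventually_ge_atTop (J + j₀ + M)] with n hn m hm _
    rw [succ_mul_positivityProb]
    have h1 : positivityProb μ m ≤ positivityProb μ (n - J) :=
      positivityProb_antitone μ (by omega)
    have h2 : (M : ℝ) * (1 / 4 * positivityProb μ (n - J)) ≤
        seqConv (fun i => (stepSeq μ).real {y | 0 < partialSum y (i + 1)})
          (positivityProb μ) n := by
      calc (M : ℝ) * (1 / 4 * positivityProb μ (n - J)) =
          ∑ i ∈ Finset.Ico (J + j₀) (J + j₀ + M), 1 / 4 * positivityProb μ (n - J) := by
            simp
        _ ≤ ∑ i ∈ Finset.Ico (J + j₀) (J + j₀ + M),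
            (stepSeq μ).real {y | 0 < partialSum y (i + 1)} * positivityProb μ (n - i) := by
          refine Finset.sum_le_sum fun i hi => ?_
          have hi := Finset.mem_Ico.1 hi
          refine mul_le_mul (hj₀ i (by omega)) (positivityProb_antitone μ (by omega))
            (positivityProb_nonneg μ _) measureReal_nonneg
        _ ≤ _ := by
          refine Finset.sum_le_sum_of_subset_of_nonneg (fun i hi => ?_)
            fun i _ _ => mul_nonneg measureReal_nonneg (positivityProb_nonneg μ _)
          have hi := Finset.mem_Ico.1 hi
          exact Finset.mem_range.2 (by omega)
    have h3 : 1 ≤ η * (M * (1 / 4)) := by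
      rw [div_le_iff₀ hη] at hM
      linarith
    calc positivityProb μ m ≤ positivityProb μ (n - J) := h1
      _ ≤ η * (M * (1 / 4)) * positivityProb μ (n - J) :=
        le_mul_of_one_le_left (positivityProb_nonneg μ _) h3
      _ = η * (M * (1 / 4 * positivityProb μ (n - J))) := by ring
      _ ≤ _ := by gcongr

end

/-! ### Chains in terms of the random walk. -/

/-- The heights that the interface can take. -/
def IsSite : Setup → ℝ → Prop
  | .continuous, _ => True
  | .discrete, x => ∃ z : ℤ, x = z

theorem isSite_zero (s : Setup) : IsSite s 0 := by
  cases s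
  · trivial
  · exact ⟨0, by simp⟩

theorem IsSite.add {s : Setup} {x y : ℝ} (hx : IsSite s x) (hy : IsSite s y) :
    IsSite s (x + y) := by
  cases s
  · trivial
  · obtain ⟨a, rfl⟩ := hx
    obtain ⟨b, rfl⟩ := hy
    exact ⟨a + b, by push_cast; rfl⟩

theorem IsSite.neg {s : Setup} {x : ℝ} (hx : IsSite s x) : IsSite s (-x) := by
  cases s
  · trivial
  · obtain ⟨a, rfl⟩ := hx
    exact ⟨-a, by push_cast; rfl⟩

theorem measurable_intCast_real : Measurable fun z : ℤ => (z : ℝ) := measurable_of_countable _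

theorem ae_isSite (s : Setup) : ∀ᵐ x ∂(refMeasure s), IsSite s x := by
  cases s
  · exact Eventually.of_forall fun _ => trivial
  · have hemb : MeasurableEmbedding (fun z : ℤ => (z : ℝ)) :=
      Int.isClosedEmbedding_coe_real.measurableEmbedding
    exact (hemb.ae_map_iff).2 (Eventually.of_forall fun z => ⟨z, rfl⟩)

theorem lintegral_refMeasure_discrete {F : ℝ → ℝ≥0∞} (hF : Measurable F) :
    ∫⁻ y, F y ∂(refMeasure .discrete) = ∑' z : ℤ, F z := by
  rw [refMeasure, lintegral_map hF measurable_intCast_real, lintegral_count]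

/-- In the discrete set-up the reference measure is invariant only under integer translations, hence
the predicate `IsSite`. -/
theorem lintegral_refMeasure_add {s : Setup} {x : ℝ} (hx : IsSite s x) {F : ℝ → ℝ≥0∞}
    (hF : Measurable F) : ∫⁻ y, F (x + y) ∂(refMeasure s) = ∫⁻ y, F y ∂(refMeasure s) := by
  cases s
  · exact lintegral_add_left_eq_self (μ := (volume : Measure ℝ)) F x
  · obtain ⟨a, rfl⟩ := hx
    rw [lintegral_refMeasure_discrete hF,
      lintegral_refMeasure_discrete (F := fun y => F (a + y)) (hF.comp (measurable_const_add _)),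
      ← (Equiv.addLeft a).tsum_eq fun z : ℤ => F z]
    simp

theorem lintegral_refMeasure_neg (s : Setup) {F : ℝ → ℝ≥0∞} (hF : Measurable F) :
    ∫⁻ y, F (-y) ∂(refMeasure s) = ∫⁻ y, F y ∂(refMeasure s) := by
  cases s
  · exact lintegral_neg_eq_self (μ := (volume : Measure ℝ)) F
  · rw [lintegral_refMeasure_discrete hF,
      lintegral_refMeasure_discrete (F := fun y => F (-y)) (hF.comp measurable_neg),
      ← (Equiv.neg ℤ).tsum_eq fun z : ℤ => F z]
    simp

section

variable {s : Setup} {V : ℝ → EReal}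

theorem lintegral_stepLaw (hV : Measurable V) {F : ℝ → ℝ≥0∞} (hF : Measurable F) :
    ∫⁻ y, F y ∂(stepLaw s V) = (kappa s V)⁻¹ * ∫⁻ y, boltzmann V y * F y ∂(refMeasure s) := by
  rw [stepLaw, lintegral_smul_measure, smul_eq_mul,
    lintegral_withDensity_eq_lintegral_mul _ (measurable_boltzmann hV) hF]
  rfl

theorem isProbabilityMeasure_stepLaw (h0 : kappa s V ≠ 0) (htop : kappa s V ≠ ∞) :
    IsProbabilityMeasure (stepLaw s V) := by
  constructor
  rw [stepLaw, Measure.smul_apply, withDensity_apply _ .univ, Measure.restrict_univ, smul_eq_mul]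
  exact ENNReal.inv_mul_cancel h0 htop

theorem ae_isSite_stepLaw : ∀ᵐ x ∂(stepLaw s V), IsSite s x := by
  have h : stepLaw s V ≪ refMeasure s :=
    (Measure.smul_absolutelyContinuous).trans (withDensity_absolutelyContinuous _ _)
  exact h (ae_isSite s)

theorem lintegral_boltzmann_mul (hV : Measurable V) (h0 : kappa s V ≠ 0) (htop : kappa s V ≠ ∞)
    {F : ℝ → ℝ≥0∞} (hF : Measurable F) :
    ∫⁻ y, boltzmann V y * F y ∂(refMeasure s) = kappa s V * ∫⁻ y, F y ∂(stepLaw s V) := by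
  rw [lintegral_stepLaw hV hF, ← mul_assoc, ENNReal.mul_inv_cancel h0 htop, one_mul]

/-- The chain with sites restricted to `A`, in terms of the random walk. -/
theorem chain_replicate_eq_lintegral (hV : Measurable V) (h0 : kappa s V ≠ 0)
    (htop : kappa s V ≠ ∞) [IsProbabilityMeasure (stepLaw s V)] {A : Set ℝ} (hA : MeasurableSet A)
    {t : ℝ → ℝ≥0∞} (ht : Measurable t) (n : ℕ) {x : ℝ} (hx : IsSite s x) :
    chain (boltzmann V) t (List.replicate n ((refMeasure s).restrict A)) x =
      kappa s V ^ n * ∫⁻ y, {y | ∀ k, 1 ≤ k → k ≤ n → x + partialSum y k ∈ A}.indicator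
        (fun y => t (x + partialSum y n)) y ∂(stepSeq (stepLaw s V)) := by
  have hset : ∀ n x, MeasurableSet {y : ℕ → ℝ | ∀ k, 1 ≤ k → k ≤ n → x + partialSum y k ∈ A} := by
    intro n x
    simp only [ofPred_forall]
    exact .iInter fun k => .iInter fun _ => .iInter fun _ =>
      ((measurable_partialSum k).const_add x) hA
  have hmeas : ∀ n x, Measurable ({y : ℕ → ℝ | ∀ k, 1 ≤ k → k ≤ n → x + partialSum y k ∈ A}.indicator
        (fun y => t (x + partialSum y n))) := fun n x =>
    (ht.comp ((measurable_partialSum n).const_add x)).indicator (hset n x)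
  induction n generalizing x with
  | zero =>
    have : {y : ℕ → ℝ | ∀ k, 1 ≤ k → k ≤ 0 → x + partialSum y k ∈ A} = univ :=
      eq_univ_of_forall fun y k h1 h2 => by omega
    simp only [this, indicator_univ]
    simp [chain, partialSum_zero]
  | succ n ih =>
    have hl : ∀ ρ ∈ List.replicate n ((refMeasure s).restrict A), SFinite ρ := fun ρ hρ => by
      rw [List.eq_of_mem_replicate hρ]; infer_instance
    have hc := measurable_chain (measurable_boltzmann hV) ht hl
    have hm : Measurable fun y => A.indicator (fun y => boltzmann V (y - x) *
        chain (boltzmann V) t (List.replicate n ((refMeasure s).restrict A)) y) y :=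
      (((measurable_boltzmann hV).comp (measurable_id.sub_const x)).mul hc).indicator hA
    have hm2 : Measurable fun y => A.indicator
        (chain (boltzmann V) t (List.replicate n ((refMeasure s).restrict A))) (x + y) :=
      (hc.indicator hA).comp (measurable_const_add x)
    simp only [List.replicate_succ, chain]
    rw [← lintegral_indicator hA, ← lintegral_refMeasure_add hx hm]
    have h1 : ∀ y, A.indicator (fun y => boltzmann V (y - x) *
        chain (boltzmann V) t (List.replicate n ((refMeasure s).restrict A)) y) (x + y) =
        boltzmann V y * A.indicator
          (chain (boltzmann V) t (List.replicate n ((refMeasure s).restrict A))) (x + y) := by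
      intro y
      by_cases h : x + y ∈ A
      · rw [indicator_of_mem h, indicator_of_mem h, add_sub_cancel_left]
      · rw [indicator_of_notMem h, indicator_of_notMem h, mul_zero]
    rw [lintegral_congr h1, lintegral_boltzmann_mul hV h0 htop hm2, lintegral_stepSeq _ (hmeas _ _),
      pow_succ', mul_assoc, ← lintegral_const_mul' _ _ (ENNReal.pow_ne_top htop)]
    congr 1
    refine lintegral_congr_ae ?_
    -- The induction hypothesis is available only at sites, but almost every step leads to one.
    filter_upwards [ae_isSite_stepLaw] with a ha
    have h2 : ∀ z, {y : ℕ → ℝ | ∀ k, 1 ≤ k → k ≤ n + 1 → x + partialSum y k ∈ A}.indicator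
        (fun y => t (x + partialSum y (n + 1))) (consSeq a z) =
        A.indicator (fun _ => {y : ℕ → ℝ | ∀ k, 1 ≤ k → k ≤ n →
          x + a + partialSum y k ∈ A}.indicator (fun y => t (x + a + partialSum y n)) z) (x + a) := by
      intro z
      have hiff : consSeq a z ∈ {y : ℕ → ℝ | ∀ k, 1 ≤ k → k ≤ n + 1 → x + partialSum y k ∈ A} ↔
          x + a ∈ A ∧ z ∈ {y : ℕ → ℝ | ∀ k, 1 ≤ k → k ≤ n → x + a + partialSum y k ∈ A} := by
        constructor
        · intro h
          refine ⟨?_, fun k hk1 hk => ?_⟩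
          · have := h 1 le_rfl (by omega)
            rwa [show (1 : ℕ) = 0 + 1 from rfl, partialSum_consSeq, partialSum_zero, add_zero] at this
          · have := h (k + 1) (by omega) (by omega)
            rwa [partialSum_consSeq, ← add_assoc] at this
        · rintro ⟨h1, h2⟩ k hk1 hk
          obtain ⟨k, rfl⟩ := Nat.exists_eq_add_of_le' hk1
          rw [partialSum_consSeq, ← add_assoc]
          rcases Nat.eq_zero_or_pos k with rfl | hk0
          · rwa [partialSum_zero, add_zero]
          · exact h2 k hk0 (by omega)
      by_cases h3 : x + a ∈ A
      · rw [indicator_of_mem h3]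
        by_cases h4 : z ∈ {y : ℕ → ℝ | ∀ k, 1 ≤ k → k ≤ n → x + a + partialSum y k ∈ A}
        · rw [indicator_of_mem h4, indicator_of_mem (hiff.2 ⟨h3, h4⟩), partialSum_consSeq, add_assoc]
        · rw [indicator_of_notMem h4, indicator_of_notMem fun h => h4 (hiff.1 h).2]
      · rw [indicator_of_notMem h3, indicator_of_notMem fun h => h3 (hiff.1 h).1]
    rw [lintegral_congr h2]
    by_cases h3 : x + a ∈ A
    · simp only [indicator_of_mem h3]
      exact ih (hx.add ha)
    · simp only [indicator_of_notMem h3, lintegral_zero, mul_zero]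

/-- The free partition function without pinning. -/
theorem partitionFunction_free_zero (hV : Measurable V) (hV' : ∀ x, V x ≠ ⊥) (h0 : kappa s V ≠ 0)
    (htop : kappa s V ≠ ∞) [IsProbabilityMeasure (stepLaw s V)] (n : ℕ) :
    partitionFunction s V .free 0 n =
      kappa s V ^ n * stepSeq (stepLaw s V) (positiveSet n) := by
  rw [partitionFunction_zero_eq_chain hV hV']
  have h := chain_replicate_eq_lintegral hV h0 htop (measurableSet_Ioi (a := 0))
    (t := fun _ => (1 : ℝ≥0∞)) measurable_const n (isSite_zero s)
  refine Eq.trans h ?_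
  congr 1
  have hp : {y : ℕ → ℝ | ∀ k, 1 ≤ k → k ≤ n → 0 + partialSum y k ∈ Ioi (0 : ℝ)} = positiveSet n := by
    ext y
    simp [positiveSet]
  rw [hp, lintegral_indicator (measurableSet_positiveSet n)]
  simp

end

/-! ### Path decomposition at the minimum. -/

section Argmin

variable {b : ℝ → ℝ≥0∞}

theorem sFinite_of_mem_replicate {σ : Measure ℝ} [SFinite σ] {n : ℕ} :
    ∀ ρ ∈ List.replicate n σ, SFinite ρ := fun ρ hρ => by
  rw [List.eq_of_mem_replicate hρ]; infer_instance

/-- Here the level that restricts the sites is a variable as well. Joint measurability in the level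
and the starting point is what Tonelli requires once one integrates over the height of the minimum.
-/
theorem measurable_chain_param (hb : Measurable b) {t : ℝ → ℝ → ℝ≥0∞}
    (ht : Measurable fun p : ℝ × ℝ => t p.1 p.2) {A : ℝ → Set ℝ}
    (hA : MeasurableSet {p : ℝ × ℝ | p.2 ∈ A p.1}) (hA' : ∀ y, MeasurableSet (A y))
    (σ : Measure ℝ) [SFinite σ] (n : ℕ) :
    Measurable fun p : ℝ × ℝ => chain b (t p.1) (List.replicate n (σ.restrict (A p.1))) p.2 := by
  induction n with
  | zero => exact ht
  | succ n ih =>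
    simp only [List.replicate_succ, chain]
    have h1 : ∀ p : ℝ × ℝ, ∫⁻ z in A p.1, b (z - p.2) *
        chain b (t p.1) (List.replicate n (σ.restrict (A p.1))) z ∂σ =
        ∫⁻ z, {q : (ℝ × ℝ) × ℝ | q.2 ∈ A q.1.1}.indicator (fun q => b (q.2 - q.1.2) *
          chain b (t q.1.1) (List.replicate n (σ.restrict (A q.1.1))) q.2) (p, z) ∂σ := by
      intro p
      rw [← lintegral_indicator (hA' p.1)]
      rfl
    simp_rw [h1]
    refine Measurable.lintegral_prod_right' (f := {q : (ℝ × ℝ) × ℝ | q.2 ∈ A q.1.1}.indicator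
      (fun q => b (q.2 - q.1.2) *
        chain b (t q.1.1) (List.replicate n (σ.restrict (A q.1.1))) q.2)) ?_
    have hg : Measurable fun q : (ℝ × ℝ) × ℝ => (q.1.1, q.2) := by fun_prop
    refine Measurable.indicator (Measurable.mul (hb.comp (by fun_prop)) (ih.comp hg)) ?_
    exact hg hA

theorem measurable_bond (hb : Measurable b) : Measurable fun p : ℝ × ℝ => b (p.1 - p.2) :=
  hb.comp (measurable_fst.sub measurable_snd)

/-- The weight of the paths from `x` to `y` through `r` sites at height at least `y`. -/
noncomputable def weightAbove (b : ℝ → ℝ≥0∞) (σ : Measure ℝ) (r : ℕ) (y x : ℝ) : ℝ≥0∞ :=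
  chain b (fun w => b (y - w)) (List.replicate r (σ.restrict (Ici y))) x

/-- The weight of the paths from `y` through `j` sites above `y`. -/
noncomputable def excursionWeight (b t : ℝ → ℝ≥0∞) (σ : Measure ℝ) (j : ℕ) (y : ℝ) : ℝ≥0∞ :=
  chain b t (List.replicate j (σ.restrict (Ioi y))) y

theorem measurable_weightAbove (hb : Measurable b) (σ : Measure ℝ) [SFinite σ] (r : ℕ) :
    Measurable fun p : ℝ × ℝ => weightAbove b σ r p.1 p.2 :=
  measurable_chain_param hb (t := fun y w => b (y - w)) (measurable_bond hb) (A := Ici)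
    (measurableSet_le measurable_fst measurable_snd) (fun _ => measurableSet_Ici) σ r

theorem measurable_excursionWeight (hb : Measurable b) {t : ℝ → ℝ≥0∞} (ht : Measurable t)
    (σ : Measure ℝ) [SFinite σ] (j : ℕ) : Measurable (excursionWeight b t σ j) :=
  (measurable_chain_param hb (t := fun _ => t) (ht.comp measurable_snd) (A := Ioi)
    (measurableSet_lt measurable_fst measurable_snd) (fun _ => measurableSet_Ioi) σ j).comp
    (measurable_id.prodMk measurable_id)

/-- For `y` in an up-set `B`, sites above `y` lie in `B` anyway, so restricting all the sites to `B`
amounts to restricting the minimum. -/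
theorem sum_setLIntegral_restrict {t : ℝ → ℝ≥0∞} (σ : Measure ℝ)
    {B : Set ℝ} (hB : MeasurableSet B) (hup : ∀ y ∈ B, Ici y ⊆ B) (m : ℕ) (x : ℝ) :
    ∑ r ∈ Finset.range (m + 1), ∫⁻ y, weightAbove b (σ.restrict B) r y x *
      excursionWeight b t (σ.restrict B) (m - r) y ∂(σ.restrict B) =
    ∑ r ∈ Finset.range (m + 1), ∫⁻ y in B, weightAbove b σ r y x *
      excursionWeight b t σ (m - r) y ∂σ := by
  refine Finset.sum_congr rfl fun r _ => setLIntegral_congr_fun hB fun y hy => ?_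
  have h1 : (σ.restrict B).restrict (Ici y) = σ.restrict (Ici y) := by
    rw [Measure.restrict_restrict measurableSet_Ici, inter_eq_left.2 (hup y hy)]
  have h2 : (σ.restrict B).restrict (Ioi y) = σ.restrict (Ioi y) := by
    rw [Measure.restrict_restrict measurableSet_Ioi,
      inter_eq_left.2 (Ioi_subset_Ici_self.trans (hup y hy))]
  simp only [weightAbove, excursionWeight, h1, h2]

/-- Decomposition of a chain according to the last site of minimal height. -/
theorem chain_replicate_eq_sum_argmin (hb : Measurable b) {t : ℝ → ℝ≥0∞} (ht : Measurable t)
    (m : ℕ) (σ : Measure ℝ) [SFinite σ] (x : ℝ) :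
    chain b t (List.replicate (m + 1) σ) x = ∑ r ∈ Finset.range (m + 1),
      ∫⁻ y, weightAbove b σ r y x * excursionWeight b t σ (m - r) y ∂σ := by
  induction m generalizing σ x with
  | zero => simp [chain, weightAbove, excursionWeight]
  | succ m ih =>
    have hU := fun r => measurable_weightAbove hb σ r
    have hV := fun j => measurable_excursionWeight hb ht σ j
    have hUV : ∀ r j z, Measurable fun y => weightAbove b σ r y z * excursionWeight b t σ j y :=
      fun r j z => ((hU r).comp (measurable_id.prodMk measurable_const)).mul (hV j)
    -- Seen from the first site `z`, either all the following sites are strictly above `z`, so that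
    -- `z` is the last minimum, or the last minimum of the following sites is at some `y ≤ z`.
    have hsplit : ∀ z, chain b t (List.replicate (m + 1) σ) z = excursionWeight b t σ (m + 1) z +
        ∑ r ∈ Finset.range (m + 1), ∫⁻ y in Iic z, weightAbove b σ r y z *
          excursionWeight b t σ (m - r) y ∂σ := by
      intro z
      rw [excursionWeight, ih (σ.restrict (Ioi z)) z, sum_setLIntegral_restrict σ measurableSet_Ioi
        (fun y hy w hw => mem_Ioi.2 ((mem_Ioi.1 hy).trans_le (mem_Ici.1 hw))), ih σ z, ← Finset.sum_add_distrib]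
      refine Finset.sum_congr rfl fun r _ => ?_
      rw [← lintegral_add_compl _ (measurableSet_Ioi (a := z)), compl_Ioi]
    rw [List.replicate_succ]
    simp only [chain]
    have hm1 : Measurable fun z => b (z - x) * excursionWeight b t σ (m + 1) z :=
      (hb.comp (measurable_id.sub_const x)).mul (hV _)
    have hin : ∀ r, Measurable fun p : ℝ × ℝ => {p : ℝ × ℝ | p.2 ≤ p.1}.indicator
        (fun p => weightAbove b σ r p.2 p.1 * excursionWeight b t σ (m - r) p.2) p := fun r =>
      (((hU r).comp (measurable_snd.prodMk measurable_fst)).mul ((hV _).comp measurable_snd)).indicator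
        (measurableSet_le measurable_snd measurable_fst)
    have heq : ∀ r z, ∫⁻ y in Iic z, weightAbove b σ r y z *
          excursionWeight b t σ (m - r) y ∂σ = ∫⁻ y, {p : ℝ × ℝ | p.2 ≤ p.1}.indicator
        (fun p => weightAbove b σ r p.2 p.1 * excursionWeight b t σ (m - r) p.2) (z, y) ∂σ := by
      intro r z
      rw [← lintegral_indicator measurableSet_Iic]
      rfl
    simp_rw [hsplit, heq, mul_add, Finset.mul_sum]
    rw [lintegral_add_left hm1, lintegral_finsetSum, Finset.sum_range_succ' _ (m + 1), add_comm]
    · congr 1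
      refine Finset.sum_congr rfl fun r _ => ?_
      have h1 : ∀ z, b (z - x) * ∫⁻ y, {p : ℝ × ℝ | p.2 ≤ p.1}.indicator
          (fun p => weightAbove b σ r p.2 p.1 * excursionWeight b t σ (m - r) p.2) (z, y) ∂σ =
          ∫⁻ y, b (z - x) * {p : ℝ × ℝ | p.2 ≤ p.1}.indicator
          (fun p => weightAbove b σ r p.2 p.1 * excursionWeight b t σ (m - r) p.2) (z, y) ∂σ := by
        intro z
        rw [lintegral_const_mul]
        exact (hin r).comp (measurable_const.prodMk measurable_id)
      simp_rw [h1]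
      rw [lintegral_lintegral_swap]
      · refine lintegral_congr fun y => ?_
        have h2 : weightAbove b σ (r + 1) y x = ∫⁻ z, (Ici y).indicator
            (fun z => b (z - x) * weightAbove b σ r y z) z ∂σ := by
          rw [lintegral_indicator measurableSet_Ici]
          rfl
        rw [h2, Nat.add_sub_add_right, ← lintegral_mul_const]
        · refine lintegral_congr fun z => ?_
          by_cases h : y ≤ z
          · rw [indicator_of_mem (show z ∈ Ici y from h),
              indicator_of_mem (show (z, y) ∈ {p : ℝ × ℝ | p.2 ≤ p.1} from h), mul_assoc]
          · rw [indicator_of_notMem (show z ∉ Ici y from h),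
              indicator_of_notMem (show (z, y) ∉ {p : ℝ × ℝ | p.2 ≤ p.1} from h), mul_zero, zero_mul]
        · exact ((hb.comp (measurable_id.sub_const x)).mul
            ((hU r).comp (measurable_const.prodMk measurable_id))).indicator measurableSet_Ici
      · exact ((hb.comp (measurable_fst.sub_const x)).mul (hin r)).aemeasurable
    · intro r _
      exact (hb.comp (measurable_id.sub_const x)).mul (hin r).lintegral_prod_right'

/-- Tonelli; it turns an intermediate site at height `z` into an outer integral, so that the two
ways of cutting a bridge can be compared for fixed `z`. -/
theorem chain_lintegral_terminal (hb : Measurable b) {c : ℝ → ℝ≥0∞} (hc : Measurable c)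
    (σ τ : Measure ℝ) [SFinite σ] [SFinite τ] (n : ℕ) (x : ℝ) :
    chain b (fun w => ∫⁻ z, b (z - w) * c z ∂τ) (List.replicate n σ) x =
      ∫⁻ z, chain b (fun w => b (z - w)) (List.replicate n σ) x * c z ∂τ := by
  induction n generalizing x with
  | zero => rfl
  | succ n ih =>
    have hp := measurable_chain_param hb (t := fun y w => b (y - w)) (measurable_bond hb) (A := fun _ => univ)
      (by simp) (fun _ => .univ) σ n
    simp only [Measure.restrict_univ] at hp
    simp only [List.replicate_succ, chain]
    simp_rw [ih]
    have h1 : ∀ y, b (y - x) * ∫⁻ z, chain b (fun w => b (z - w)) (List.replicate n σ) y * c z ∂τ =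
        ∫⁻ z, b (y - x) * (chain b (fun w => b (z - w)) (List.replicate n σ) y * c z) ∂τ := by
      intro y
      rw [lintegral_const_mul]
      exact (hp.comp (measurable_id.prodMk measurable_const)).mul hc
    simp_rw [h1]
    rw [lintegral_lintegral_swap]
    · refine lintegral_congr fun z => ?_
      rw [← lintegral_mul_const]
      · exact lintegral_congr fun y => (mul_assoc _ _ _).symm
      · exact (hb.comp (measurable_id.sub_const x)).mul
          (hp.comp (measurable_const.prodMk measurable_id))
    · exact ((hb.comp (measurable_fst.sub_const x)).mul
        ((hp.comp (measurable_snd.prodMk measurable_fst)).mul (hc.comp measurable_snd))).aemeasurable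

end Argmin

/-! ### Rotation of bridges. -/

section Bridge

variable {b : ℝ → ℝ≥0∞}

theorem chain_translate (hb : Measurable b) {t : ℝ → ℝ≥0∞} (ht : Measurable t) {s : Setup} {a : ℝ}
    (ha : IsSite s a) {A : Set ℝ} (hA : MeasurableSet A) (n : ℕ) (x : ℝ) :
    chain b t (List.replicate n ((refMeasure s).restrict A)) (a + x) =
      chain b (fun w => t (a + w))
        (List.replicate n ((refMeasure s).restrict ((fun w => a + w) ⁻¹' A))) x := by
  induction n generalizing x with
  | zero => rfl
  | succ n ih =>
    simp only [List.replicate_succ, chain]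
    have hc := measurable_chain (l := List.replicate n ((refMeasure s).restrict A)) hb ht
      sFinite_of_mem_replicate
    rw [← lintegral_indicator hA, ← lintegral_refMeasure_add ha,
      ← lintegral_indicator (measurable_const_add a hA)]
    · refine lintegral_congr fun y => ?_
      by_cases h : a + y ∈ A
      · rw [indicator_of_mem h, indicator_of_mem (show y ∈ (fun w => a + w) ⁻¹' A from h), ih,
          add_sub_add_left_eq_sub]
      · rw [indicator_of_notMem h, indicator_of_notMem (show y ∉ (fun w => a + w) ⁻¹' A from h)]
    · exact ((hb.comp (measurable_id.sub_const _)).mul hc).indicator hA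

/-- Cyclic decomposition of the bridges according to the last minimum. -/
theorem chain_bridge_eq_sum (hb : Measurable b) (s : Setup) (m : ℕ) :
    chain b (fun w => b (-w)) (List.replicate m (refMeasure s)) 0 =
      ∑ i ∈ Finset.range (m + 1), chain b (fun w => b (-w))
        (List.replicate i (dryMeasure s) ++
          List.replicate (m - i) ((refMeasure s).restrict (Ici 0))) 0 := by
  cases m with
  | zero => simp
  | succ m =>
    have hb' : Measurable fun w => b (-w) := hb.comp measurable_neg
    have hU := fun r => measurable_weightAbove hb (refMeasure s) r
    have hV := fun j => measurable_excursionWeight hb hb' (refMeasure s) j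
    have h1 := chain_replicate_eq_sum_argmin hb hb' m (refMeasure s) 0
    have h2 := chain_replicate_eq_sum_argmin hb hb' m ((refMeasure s).restrict (Ici 0)) 0
    rw [sum_setLIntegral_restrict _ measurableSet_Ici (fun y hy w hw => mem_Ici.2 ((mem_Ici.1 hy).trans (mem_Ici.1 hw)))] at h2
    rw [h1, Finset.sum_range_succ' _ (m + 1), List.replicate_zero, List.nil_append, Nat.sub_zero, h2,
      ← Finset.sum_range_reflect (fun k => chain b (fun w => b (-w))
        (List.replicate (k + 1) (dryMeasure s) ++
          List.replicate (m + 1 - (k + 1)) ((refMeasure s).restrict (Ici 0))) 0),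
      ← Finset.sum_add_distrib]
    refine Finset.sum_congr rfl fun r hr => ?_
    have hr : r ≤ m := Nat.lt_succ_iff.1 (Finset.mem_range.1 hr)
    -- If the minimum is nonnegative, the bridge stays in `[0, ∞)`; these paths make up the term `i
    -- = 0`. If it is `-z < 0`, start the cycle at the last minimum: `m - r` sites strictly above
    -- it, then the old origin at height `z`, then `r` sites at height at least `0`. This is the
    -- term `i = m - r + 1`.
    rw [← lintegral_add_compl _ (measurableSet_Ici (a := (0 : ℝ))), add_comm, compl_Ici]
    congr 1
    rw [show m + 1 - 1 - r + 1 = (m - r) + 1 by omega, show m + 1 - (m - r + 1) = r by omega,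
      List.replicate_succ', List.append_assoc, chain_append]
    set c := chain b (fun w => b (-w)) (List.replicate r ((refMeasure s).restrict (Ici 0))) with hc
    have hcm : Measurable c := measurable_chain hb hb' sFinite_of_mem_replicate
    have h3 : chain b (fun w => b (-w)) ([dryMeasure s] ++
        List.replicate r ((refMeasure s).restrict (Ici 0))) =
        fun w => ∫⁻ z, b (z - w) * c z ∂(dryMeasure s) := rfl
    rw [h3, chain_lintegral_terminal hb hcm, dryMeasure, ← lintegral_indicator measurableSet_Ioi,
      ← lintegral_indicator measurableSet_Iio, ← lintegral_refMeasure_neg]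
    · refine lintegral_congr_ae ?_
      filter_upwards [ae_isSite s] with z hz
      by_cases h : 0 < z
      · rw [indicator_of_mem (show -z ∈ Iio (0 : ℝ) from neg_lt_zero.2 h),
          indicator_of_mem (show z ∈ Ioi (0 : ℝ) from h)]
        have e1 : weightAbove b (refMeasure s) r (-z) 0 = c z := by
          have := chain_translate hb (t := fun w => b (-z - w)) (hb.comp (measurable_const.sub
            measurable_id)) hz.neg (measurableSet_Ici (a := -z)) r z
          rw [neg_add_cancel] at this
          rw [weightAbove, this, hc]
          congr 1
          · funext w; congr 1; ring
          · congr 2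
            ext w
            simp
        have e2 : excursionWeight b (fun w => b (-w)) (refMeasure s) (m - r) (-z) =
            chain b (fun w => b (z - w)) (List.replicate (m - r) ((refMeasure s).restrict (Ioi 0))) 0 := by
          have := chain_translate hb hb' hz.neg (measurableSet_Ioi (a := -z)) (m - r) 0
          rw [add_zero] at this
          rw [excursionWeight, this]
          congr 1
          · funext w; congr 1; ring
          · congr 2
            ext w
            simp
        rw [e1, e2, mul_comm]
      · rw [indicator_of_notMem (show -z ∉ Iio (0 : ℝ) from fun h' => h (neg_lt_zero.1 h')),
          indicator_of_notMem (show z ∉ Ioi (0 : ℝ) from h)]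
    · exact (((hU r).comp (measurable_id.prodMk measurable_const)).mul (hV _)).indicator
        measurableSet_Iio

end Bridge

/-! ### Renewal equations for partition functions and bridges. -/

section Bridges

/-- The mass of the reference measure at zero. -/
def contactMass : Setup → ℝ≥0
  | .continuous => 0
  | .discrete => 1

/-- Nonnegative paths of the free walk are thus a wetting model with pinning strength `contactMass
s`, to which the expansion at the first contact applies. -/
theorem restrict_Ici_refMeasure (s : Setup) :
    (refMeasure s).restrict (Ici 0) = dryMeasure s + contactMass s • Measure.dirac 0 := by
  have h1 : (refMeasure s).restrict {0} = contactMass s • Measure.dirac 0 := by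
    rw [Measure.restrict_singleton]
    cases s
    · simp [refMeasure, contactMass]
    · have : refMeasure .discrete {(0 : ℝ)} = 1 := by
        have hp : (fun z : ℤ => (z : ℝ)) ⁻¹' {0} = {0} := by ext z; simp
        rw [refMeasure, Measure.map_apply measurable_intCast_real (measurableSet_singleton _), hp,
          Measure.count_singleton]
      rw [this, contactMass, one_smul, one_smul]
  rw [dryMeasure, ← h1, ← Measure.restrict_union (by simp) (measurableSet_singleton 0)]
  congr 1
  ext x
  simp [le_iff_lt_or_eq, eq_comm]

variable (s : Setup) (V : ℝ → EReal)

/-- The power of `κ` in the normalization of the partition functions. -/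
def bondCount : BoundaryCondition → ℕ → ℕ
  | .free, N => N
  | .constrained, N => N + 1

/-- The partition functions, normalized by the powers of `κ`. -/
noncomputable def normalizedPartition (a : BoundaryCondition) (ε : ℝ≥0) (N : ℕ) : ℝ :=
  (partitionFunction s V a ε N * (kappa s V)⁻¹ ^ bondCount a N).toReal

/-- `k (n) = Z^c_{0,n-1} / κ^n`. -/
noncomputable def excursionSeq : ℕ → ℝ
  | 0 => 0
  | n + 1 => normalizedPartition s V .constrained 0 n

/-- The weight of the bridges of the random walk. -/
noncomputable def bridgePartition (m : ℕ) : ℝ≥0∞ :=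
  chain (boltzmann V) (fun w => boltzmann V (-w)) (List.replicate m (refMeasure s)) 0

/-- The density at zero of the partial sums, `f (m) = P(S_{m+1} = 0)`. -/
noncomputable def bridgeSeq (m : ℕ) : ℝ :=
  (bridgePartition s V m * (kappa s V)⁻¹ ^ (m + 1)).toReal

theorem excursionSeq_nonneg (n : ℕ) : 0 ≤ excursionSeq s V n := by
  cases n
  · exact le_rfl
  · exact ENNReal.toReal_nonneg

theorem bridgeSeq_nonneg (n : ℕ) : 0 ≤ bridgeSeq s V n := ENNReal.toReal_nonneg

variable {s V}

section Renewal

variable (hV : Measurable V) (hV' : ∀ x, V x ≠ ⊥) (h0 : kappa s V ≠ 0)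
  (hfin : ∀ a N, partitionFunction s V a 0 N ≠ ∞)

include hV hV' hfin in
theorem partitionFunction_ne_top (a : BoundaryCondition) (ε : ℝ≥0) (N : ℕ) :
    partitionFunction s V a ε N ≠ ∞ := by
  induction N using Nat.strong_induction_on with
  | _ N ih =>
    rw [partitionFunction_renewal hV hV' s a ε N]
    refine ENNReal.add_ne_top.2 ⟨hfin a N, ENNReal.sum_ne_top.2 fun j hj => ?_⟩
    have := Finset.mem_range.1 hj
    exact ENNReal.mul_ne_top (hfin _ _) (ENNReal.mul_ne_top ENNReal.coe_ne_top (ih _ (by omega)))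

include hV hV' h0 hfin in
theorem normalizedPartition_renewal (a : BoundaryCondition) (ε : ℝ≥0) (N : ℕ) :
    normalizedPartition s V a ε N = normalizedPartition s V a 0 N + ∑ j ∈ Finset.range N,
      excursionSeq s V (j + 1) * (ε * normalizedPartition s V a ε (N - 1 - j)) := by
  have hι : (kappa s V)⁻¹ ≠ ∞ := ENNReal.inv_ne_top.2 h0
  have hZ := partitionFunction_ne_top hV hV' hfin
  rw [normalizedPartition, partitionFunction_renewal hV hV' s a ε N, add_mul, Finset.sum_mul,
    ENNReal.toReal_add, ENNReal.toReal_sum]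
  · congr 1
    refine Finset.sum_congr rfl fun j hj => ?_
    have hj := Finset.mem_range.1 hj
    have hN : bondCount a N = (j + 1) + bondCount a (N - 1 - j) := by
      cases a <;> simp only [bondCount] <;> omega
    rw [hN, pow_add, excursionSeq, normalizedPartition, normalizedPartition,
      ← ENNReal.coe_toReal ε, ← ENNReal.toReal_mul, ← ENNReal.toReal_mul]
    congr 1
    simp only [bondCount]
    ring
  · exact fun j _ => ENNReal.mul_ne_top (ENNReal.mul_ne_top (hfin _ _)
      (ENNReal.mul_ne_top ENNReal.coe_ne_top (hZ _ _ _))) (ENNReal.pow_ne_top hι)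
  · exact ENNReal.mul_ne_top (hfin _ _) (ENNReal.pow_ne_top hι)
  · exact ENNReal.sum_ne_top.2 fun j _ => ENNReal.mul_ne_top (ENNReal.mul_ne_top (hfin _ _)
      (ENNReal.mul_ne_top ENNReal.coe_ne_top (hZ _ _ _))) (ENNReal.pow_ne_top hι)

-- Multiplying the renewal equation of the constrained partition functions by `ε` and adding the
-- value `1` at time `0` gives the defining equation of the renewal mass function. The shift by one
-- occurs because `N` free sites span `N + 1` bonds.
include hV hV' h0 hfin in
theorem renewalSeq_excursionSeq (ε : ℝ≥0) (N : ℕ) :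
    renewalSeq (fun n => ε * excursionSeq s V n) (N + 1) =
      ε * normalizedPartition s V .constrained ε N := by
  set w : ℕ → ℝ := fun n => match n with
    | 0 => 1
    | n + 1 => ε * normalizedPartition s V .constrained ε n with hw
  have hz : (fun n => (ε : ℝ) * excursionSeq s V n) 0 = 0 := by simp [excursionSeq]
  have : w = renewalSeq (fun n => ε * excursionSeq s V n) := by
    refine eq_renewalSeq hz ?_
    rw [mk_eq_X_mul (a := fun n => (ε : ℝ) * excursionSeq s V n) hz, mul_assoc,
      coeff_mk_mul_mk]
    ext n
    cases n with
    | zero => simp [hw]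
    | succ n =>
      rw [map_add, PowerSeries.coeff_succ_X_mul]
      simp only [PowerSeries.coeff_mk, PowerSeries.coeff_one, seqConv, Nat.add_eq_zero_iff,
        one_ne_zero, and_false, if_false, zero_add]
      rw [hw]
      simp only
      rw [normalizedPartition_renewal hV hV' h0 hfin, Finset.sum_range_succ, Nat.sub_self, mul_one,
        mul_add, add_comm, Finset.mul_sum]
      congr 1
      refine Finset.sum_congr rfl fun j hj => ?_
      have hj := Finset.mem_range.1 hj
      rw [show n - j = (n - 1 - j) + 1 by omega]
      simp only
      ring
  rw [← this]

-- For the free boundary condition the last excursion is unfinished; solving the renewal equation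
-- convolves the mass function with the weight of that incomplete piece.
include hV hV' h0 hfin in
theorem normalizedPartition_free_eq_seqConv (ε : ℝ≥0) (N : ℕ) :
    normalizedPartition s V .free ε N =
      seqConv (renewalSeq fun n => ε * excursionSeq s V n) (normalizedPartition s V .free 0) N := by
  set a : ℕ → ℝ := fun n => ε * excursionSeq s V n with ha
  have hz : a 0 = 0 := by simp [ha, excursionSeq]
  have h1 : PowerSeries.mk (normalizedPartition s V .free ε) =
      PowerSeries.mk (normalizedPartition s V .free 0) +
        PowerSeries.mk a * PowerSeries.mk (normalizedPartition s V .free ε) := by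
    rw [mk_eq_X_mul hz, mul_assoc, coeff_mk_mul_mk]
    ext n
    cases n with
    | zero =>
      have := normalizedPartition_renewal hV hV' h0 hfin .free ε 0
      simpa using this
    | succ n =>
      rw [map_add, PowerSeries.coeff_succ_X_mul]
      simp only [PowerSeries.coeff_mk, seqConv]
      rw [normalizedPartition_renewal hV hV' h0 hfin]
      congr 1
      refine Finset.sum_congr rfl fun j hj => ?_
      rw [Nat.add_sub_cancel, ha]
      ring
  have h2 := mk_renewalSeq_mul hz
  have h3 : PowerSeries.mk (normalizedPartition s V .free ε) =
      PowerSeries.mk (renewalSeq a) * PowerSeries.mk (normalizedPartition s V .free 0) := by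
    have h4 : (1 - PowerSeries.mk a) * PowerSeries.mk (normalizedPartition s V .free ε) =
        PowerSeries.mk (normalizedPartition s V .free 0) := by
      rw [sub_mul, one_mul]
      nth_rewrite 1 [h1]
      rw [add_sub_cancel_right]
    rw [← h4, ← mul_assoc, h2, one_mul]
  have h5 := congrArg (PowerSeries.coeff N) h3
  rw [coeff_mk_mul_mk] at h5
  simpa using h5

-- In each term of `chain_bridge_eq_sum`, expand the sites allowed to touch `0` according to the
-- first of them that does so.
include hV hV' in
theorem bridgePartition_eq (m : ℕ) : bridgePartition s V m = ∑ i ∈ Finset.range (m + 1),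
    (partitionFunction s V .constrained 0 m + ∑ j ∈ Finset.range (m - i),
      partitionFunction s V .constrained 0 (i + j) *
        (contactMass s * partitionFunction s V .constrained (contactMass s) (m - i - 1 - j))) := by
  have hb := measurable_boltzmann hV
  rw [bridgePartition, chain_bridge_eq_sum hb]
  refine Finset.sum_congr rfl fun i hi => ?_
  have hi := Finset.mem_range.1 hi
  rw [restrict_Ici_refMeasure, chain_replicate_add_dirac hb (t := fun w => boltzmann V (-w)) (hb.comp measurable_neg)]
  simp only [partitionFunction_zero_eq_chain hV hV', partitionFunction_eq_chain hV hV']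
  rw [show i + (m - i) = m by omega]
  rfl

-- The cycle lemma. A bridge started from its last minimum begins with an excursion of some length
-- `l + 1`, and the parameter `i` of the rotation takes the values `0, …, l`; exchanging the sums
-- gives the weight `l + 1`. The rest is a renewal sequence of excursions with pinning `contactMass
-- s`.
include hV hV' h0 hfin in
theorem bridgeSeq_eq_seqConv (m : ℕ) : bridgeSeq s V m =
    seqConv (fun i => (i + 1 : ℝ) * excursionSeq s V (i + 1))
      (renewalSeq fun n => contactMass s * excursionSeq s V n) m := by
  have hι : (kappa s V)⁻¹ ≠ ∞ := ENNReal.inv_ne_top.2 h0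
  have hZ := partitionFunction_ne_top hV hV' hfin
  set u := renewalSeq fun n => contactMass s * excursionSeq s V n with hu
  have hu0 : u 0 = 1 := renewalSeq_zero (by simp [excursionSeq])
  have hterm : ∀ i ∈ Finset.range (m + 1), ((partitionFunction s V .constrained 0 m +
      ∑ j ∈ Finset.range (m - i), partitionFunction s V .constrained 0 (i + j) *
        (contactMass s * partitionFunction s V .constrained (contactMass s) (m - i - 1 - j))) *
        (kappa s V)⁻¹ ^ (m + 1)).toReal =
      ∑ l ∈ Finset.Ico i (m + 1), excursionSeq s V (l + 1) * u (m - l) := by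
    intro i hi
    have hi := Finset.mem_range.1 hi
    rw [add_mul, Finset.sum_mul, ENNReal.toReal_add, ENNReal.toReal_sum,
      Finset.sum_Ico_succ_top (by omega), Nat.sub_self, hu0, mul_one, add_comm]
    · congr 1
      rw [Finset.sum_Ico_eq_sum_range]
      refine Finset.sum_congr rfl fun j hj => ?_
      have hj := Finset.mem_range.1 hj
      rw [show m - (i + j) = (m - i - 1 - j) + 1 by omega, hu,
        renewalSeq_excursionSeq hV hV' h0 hfin, excursionSeq, normalizedPartition,
        normalizedPartition, ← ENNReal.coe_toReal (contactMass s), ← ENNReal.toReal_mul,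
        ← ENNReal.toReal_mul]
      congr 1
      simp only [bondCount]
      rw [show m + 1 = (i + j + 1) + (m - i - 1 - j + 1) by omega, pow_add]
      ring
    · exact fun j _ => ENNReal.mul_ne_top (ENNReal.mul_ne_top (hfin _ _)
        (ENNReal.mul_ne_top ENNReal.coe_ne_top (hZ _ _ _))) (ENNReal.pow_ne_top hι)
    · exact ENNReal.mul_ne_top (hfin _ _) (ENNReal.pow_ne_top hι)
    · exact ENNReal.sum_ne_top.2 fun j _ => ENNReal.mul_ne_top (ENNReal.mul_ne_top (hfin _ _)
        (ENNReal.mul_ne_top ENNReal.coe_ne_top (hZ _ _ _))) (ENNReal.pow_ne_top hι)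
  rw [bridgeSeq, bridgePartition_eq hV hV', Finset.sum_mul, ENNReal.toReal_sum,
    Finset.sum_congr rfl hterm]
  · have h1 : ∀ i ∈ Finset.range (m + 1), ∑ l ∈ Finset.Ico i (m + 1),
        excursionSeq s V (l + 1) * u (m - l) = ∑ l ∈ Finset.range (m + 1),
        if i ≤ l then excursionSeq s V (l + 1) * u (m - l) else 0 := by
      intro i _
      rw [← Finset.sum_filter]
      refine Finset.sum_congr ?_ fun _ _ => rfl
      ext l
      simp only [Finset.mem_Ico, Finset.mem_filter, Finset.mem_range]
      omega
    rw [Finset.sum_congr rfl h1, Finset.sum_comm]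
    refine Finset.sum_congr rfl fun l hl => ?_
    have hl := Finset.mem_range.1 hl
    have h2 : Finset.filter (fun i => i ≤ l) (Finset.range (m + 1)) = Finset.range (l + 1) := by
      ext i
      simp only [Finset.mem_filter, Finset.mem_range]
      omega
    rw [← Finset.sum_filter, h2, Finset.sum_const, Finset.card_range, nsmul_eq_mul]
    push_cast
    ring
  · intro i _
    refine ENNReal.mul_ne_top (ENNReal.add_ne_top.2 ⟨hfin _ _, ENNReal.sum_ne_top.2 fun j _ => ?_⟩)
      (ENNReal.pow_ne_top hι)
    exact ENNReal.mul_ne_top (hfin _ _) (ENNReal.mul_ne_top ENNReal.coe_ne_top (hZ _ _ _))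

-- Invert `bridgeSeq_eq_seqConv` by multiplying with `1 - e A`, where `e` is the contact mass and
-- `A` the series of excursions. In the continuous set-up `e = 0` and the convolution is absent.
include hV hV' h0 hfin in
theorem succ_mul_excursionSeq (m : ℕ) : (m + 1 : ℝ) * excursionSeq s V (m + 1) =
    bridgeSeq s V m - contactMass s * seqConv (excursionSeq s V) (bridgeSeq s V) m := by
  set a : ℕ → ℝ := fun n => contactMass s * excursionSeq s V n with ha
  have hz : a 0 = 0 := by simp [ha, excursionSeq]
  set g : ℕ → ℝ := fun i => (i + 1 : ℝ) * excursionSeq s V (i + 1) with hg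
  have h1 : PowerSeries.mk (bridgeSeq s V) = PowerSeries.mk g * PowerSeries.mk (renewalSeq a) := by
    rw [coeff_mk_mul_mk]
    congr 1
    exact funext (bridgeSeq_eq_seqConv hV hV' h0 hfin)
  have h2 : PowerSeries.mk g = PowerSeries.mk (bridgeSeq s V) -
      PowerSeries.mk a * PowerSeries.mk (bridgeSeq s V) := by
    have h3 : PowerSeries.mk (bridgeSeq s V) * (1 - PowerSeries.mk a) = PowerSeries.mk g := by
      rw [h1, mul_assoc, mk_renewalSeq_mul hz, mul_one]
    rw [← h3]
    ring
  have h4 := congrArg (PowerSeries.coeff m) h2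
  rw [coeff_mk_mul_mk, map_sub, PowerSeries.coeff_mk, PowerSeries.coeff_mk,
    PowerSeries.coeff_mk] at h4
  change g m = _
  rw [h4, seqConv, seqConv, Finset.mul_sum]
  congr 1
  exact Finset.sum_congr rfl fun i _ => by rw [ha]; ring

end Renewal

end Bridges

/-! ### From the local limit theorem to excursion asymptotics. -/

section

variable {k f θ : ℕ → ℝ} {e K : ℝ}

theorem exists_forall_le_mul_of_tendsto_div (hθ : ∀ n, 0 < θ n)
    (h : Tendsto (fun n => f n / θ n) atTop (𝓝 K)) : ∃ C, 0 < C ∧ ∀ n, f n ≤ C * θ n := by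
  obtain ⟨C, hC⟩ := h.bddAbove_range
  refine ⟨max C 1, lt_max_of_lt_right one_pos, fun n => ?_⟩
  have := hC (mem_range_self n)
  rw [← div_le_iff₀ (hθ n)]
  exact this.trans (le_max_left _ _)

/-- One big jump is excluded by `k (n) ≤ f (n - 1) / n`. For `i ≤ n/2` dominated convergence gives
the limit; for `i > n/2` the weights `k i` are at most of order `θ n / n`, and what remains is a
Cesàro mean of `f`, which tends to `0`. -/
theorem tendsto_seqConv_div (hk : ∀ n, 0 ≤ k n) (hks : Summable k) (hf0 : ∀ n, 0 ≤ f n)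
    (hkf : ∀ m : ℕ, (m + 1 : ℝ) * k (m + 1) ≤ f m)
    (hθ : ∀ n, 0 < θ n) (hanti : Antitone θ) (hθ0 : Tendsto θ atTop (𝓝 0)) (hflat : IsFlat θ)
    (hdouble : ∀ᶠ n in atTop, θ n ≤ 2 * θ (2 * n))
    (hf : Tendsto (fun n => f n / θ n) atTop (𝓝 K)) :
    Tendsto (fun n => seqConv k f n / θ n) atTop (𝓝 (∑' i, k i * K)) := by
  obtain ⟨C, hC, hfC⟩ := exists_forall_le_mul_of_tendsto_div hθ hf
  obtain ⟨N, hN⟩ := eventually_atTop.1 hdouble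
  have hratio : ∀ i : ℕ, Tendsto (fun n => f (n - i) / θ n) atTop (𝓝 K) := by
    intro i
    have h1 : Tendsto (fun n => θ n / θ (n + i)) atTop (𝓝 1) := by
      induction i with
      | zero =>
        refine tendsto_const_nhds.congr fun n => ?_
        rw [add_zero, div_self (hθ n).ne']
      | succ i ih =>
        have h2 := (hflat.tendsto_div (Eventually.of_forall hθ)).comp (tendsto_add_atTop_nat i)
        have h3 := ih.mul h2
        rw [mul_one] at h3
        refine h3.congr fun n => ?_
        rw [Function.comp_apply, add_assoc, div_mul_div_cancel₀ (hθ _).ne']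
    have h2 : Tendsto (fun n => f (n + i - i) / θ (n + i)) atTop (𝓝 K) := by
      have h3 := hf.mul h1
      rw [mul_one] at h3
      refine h3.congr fun n => ?_
      rw [Nat.add_sub_cancel, div_mul_div_cancel₀ (hθ _).ne']
    exact (tendsto_add_atTop_iff_nat i).1 h2
  set g : ℕ → ℕ → ℝ := fun n i => if 2 * i ≤ n then k i * (f (n - i) / θ n) else 0 with hg
  have hmain : Tendsto (fun n => ∑' i, g n i) atTop (𝓝 (∑' i, k i * K)) := by
    refine tendsto_tsum_of_dominated_convergence (bound := fun i => k i * (2 * C))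
      (hks.mul_right _) (fun i => ?_) ?_
    · refine ((hratio i).const_mul (k i)).congr' ?_
      filter_upwards [eventually_ge_atTop (2 * i)] with n hn
      rw [hg]
      simp only [hn, if_true]
    · filter_upwards [eventually_ge_atTop (2 * N)] with n hn i
      rw [hg]
      simp only
      split_ifs with hi
      · rw [Real.norm_of_nonneg (mul_nonneg (hk i) (div_nonneg (hf0 _) (hθ n).le))]
        refine mul_le_mul_of_nonneg_left ?_ (hk i)
        rw [div_le_iff₀ (hθ n)]
        have h1 := hfC (n - i)
        have h2 := hN (n - i) (by omega)
        have h3 := hanti (show n ≤ 2 * (n - i) by omega)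
        nlinarith
      · rw [norm_zero]
        exact mul_nonneg (hk i) (by positivity)
  have hfz : Tendsto f atTop (𝓝 0) := by
    have := hf.mul hθ0
    rw [mul_zero] at this
    exact this.congr fun n => div_mul_cancel₀ _ (hθ n).ne'
  have hces : Tendsto (fun n : ℕ => 8 * C * (((n + 1 : ℕ) : ℝ)⁻¹ *
      ∑ i ∈ Finset.range (n + 1), f i) * 2) atTop (𝓝 0) := by
    have := (((tendsto_add_atTop_iff_nat 1).2 hfz.cesaro).const_mul (8 * C)).mul_const 2
    simpa using this
  have hrest : Tendsto (fun n => seqConv k f n / θ n - ∑' i, g n i) atTop (𝓝 0) := by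
    have hsplit : ∀ n, seqConv k f n / θ n - ∑' i, g n i =
        ∑ i ∈ Finset.range (n + 1), if 2 * i ≤ n then 0 else k i * (f (n - i) / θ n) := by
      intro n
      rw [tsum_eq_sum (s := Finset.range (n + 1)) (fun i hi => by
        rw [Finset.mem_range] at hi
        rw [hg]
        exact if_neg (by omega)), seqConv, Finset.sum_div, ← Finset.sum_sub_distrib]
      refine Finset.sum_congr rfl fun i _ => ?_
      rw [hg]
      simp only
      split_ifs
      · ring
      · ring
    refine squeeze_zero' (f := fun n => seqConv k f n / θ n - ∑' i, g n i) ?_ ?_ hces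
    · refine Eventually.of_forall fun n => ?_
      rw [hsplit]
      refine Finset.sum_nonneg fun i _ => ?_
      split_ifs
      · exact le_rfl
      · exact mul_nonneg (hk i) (div_nonneg (hf0 _) (hθ n).le)
    · filter_upwards [eventually_ge_atTop (2 * N + 2)] with n hn
      rw [hsplit]
      have hrefl : ∑ i ∈ Finset.range (n + 1), f (n - i) = ∑ i ∈ Finset.range (n + 1), f i := by
        rw [← Finset.sum_range_reflect]
        refine Finset.sum_congr rfl fun i hi => ?_
        rw [Finset.mem_range] at hi
        congr 1
        omega
      rw [← hrefl, Finset.mul_sum, Finset.mul_sum, Finset.sum_mul]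
      refine Finset.sum_le_sum fun i hi => ?_
      have hn0 : (0 : ℝ) < ((n + 1 : ℕ) : ℝ) := by positivity
      split_ifs with h2
      · have := hf0 (n - i)
        positivity
      · obtain ⟨j, rfl⟩ : ∃ j, i = j + 1 := ⟨i - 1, by omega⟩
        -- As `n ≤ 2j + 1`, two doublings lead from `θ j` to `θ n`; with `n + 1 ≤ 2 (j + 1)` this
        -- accounts for the constant `8`.
        have h3 : θ j ≤ 2 * (2 * θ n) := by
          refine (hN j (by omega)).trans (mul_le_mul_of_nonneg_left ?_ zero_le_two)
          refine (hanti (show n - 1 ≤ 2 * j by omega)).trans ?_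
          refine (hN (n - 1) (by omega)).trans (mul_le_mul_of_nonneg_left ?_ zero_le_two)
          exact hanti (by omega)
        have h4 : ((n + 1 : ℕ) : ℝ) ≤ 2 * ((j : ℝ) + 1) := by
          have : n + 1 ≤ 2 * (j + 1) := by omega
          exact_mod_cast this
        have h5 : k (j + 1) * ((n + 1 : ℕ) : ℝ) ≤ 8 * C * θ n := by
          have h6 := (hkf j).trans (hfC j)
          have h7 := mul_le_mul_of_nonneg_left h4 (hk (j + 1))
          nlinarith
        have h8 : k (j + 1) ≤ 8 * C * θ n * ((n + 1 : ℕ) : ℝ)⁻¹ := by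
          rw [← div_eq_mul_inv, le_div_iff₀ hn0]
          exact h5
        have h9 := hf0 (n - (j + 1))
        calc k (j + 1) * (f (n - (j + 1)) / θ n)
            ≤ 8 * C * θ n * ((n + 1 : ℕ) : ℝ)⁻¹ * (f (n - (j + 1)) / θ n) := by
              exact mul_le_mul_of_nonneg_right h8 (div_nonneg h9 (hθ n).le)
          _ = 8 * C * (((n + 1 : ℕ) : ℝ)⁻¹ * f (n - (j + 1))) := by
              have := (hθ n).ne'
              field_simp
          _ ≤ 8 * C * (((n + 1 : ℕ) : ℝ)⁻¹ * f (n - (j + 1))) * 2 := by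
              have : 0 ≤ 8 * C * (((n + 1 : ℕ) : ℝ)⁻¹ * f (n - (j + 1))) := by positivity
              linarith
  have := hmain.add hrest
  rw [add_zero] at this
  exact this.congr fun n => by ring

/-- Dividing the identity by `θ` gives the limit `K (1 - e ∑ k)`, which is positive because `e ∑ k ≤
g < 1`. So `n k(n)` inherits flatness and the power bounds of `θ`. The upper bound needs only `n
k(n) ≤ f(n-1)` and comes first, since it makes `k` summable. -/
theorem hasSquareRootTail_of_tendsto (hk0 : k 0 = 0) (hk : ∀ n, 0 ≤ k n) (hk1 : 0 < k 1)
    (hf0 : ∀ n, 0 ≤ f n) (he : 0 ≤ e)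
    (heq : ∀ m : ℕ, (m + 1 : ℝ) * k (m + 1) = f m - e * seqConv k f m)
    {g : ℝ} (hg : g < 1) (hkg : ∀ n, e * ∑ i ∈ Finset.range n, k i ≤ g)
    {μ : Measure ℝ} [IsProbabilityMeasure μ] (hint : Integrable (fun y : ℝ => y) μ)
    (hmean : ∫ y, y ∂μ = 0) (h : IsSlowlyVarying (truncSq μ)) (hθ : IsScale μ θ) (hK : 0 < K)
    (hf : Tendsto (fun n => f n / θ n) atTop (𝓝 K)) : HasSquareRootTail k := by
  have hkf : ∀ m : ℕ, (m + 1 : ℝ) * k (m + 1) ≤ f m := fun m => by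
    rw [heq]
    have := mul_nonneg he (seqConv_nonneg hk hf0 m)
    linarith
  obtain ⟨C, hC, hfC⟩ := exists_forall_le_mul_of_tendsto_div hθ.pos hf
  obtain ⟨C', hC', hup⟩ := hθ.exists_le_rpow h
  obtain ⟨c', hc', hlow⟩ := hθ.exists_rpow_le hint hmean h
  have hupper : ∀ i : ℕ, (i + 1 : ℝ) * k (i + 1) ≤ C * C' * ((i : ℝ) + 1) ^ (-(1 / 2) : ℝ) :=
    fun i => (hkf i).trans ((hfC i).trans (by rw [mul_assoc]; gcongr; exact hup i))
  have hks : Summable k := by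
    rw [← summable_nat_add_iff 1]
    refine Summable.of_nonneg_of_le (fun n => hk _) (fun n => ?_)
      (((summable_nat_add_iff 1).2 (Real.summable_nat_rpow (p := -3 / 2)
        |>.2 (by norm_num))).mul_left (C * C'))
    have h1 := hupper n
    have h2 : (0 : ℝ) < (n : ℝ) + 1 := by positivity
    have h3 : ((n : ℝ) + 1) ^ (-(1 / 2) : ℝ) = ((n : ℝ) + 1) * ((n : ℝ) + 1) ^ (-3 / 2 : ℝ) := by
      nth_rewrite 2 [← Real.rpow_one ((n : ℝ) + 1)]
      rw [← Real.rpow_add h2]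
      norm_num
    rw [h3] at h1
    push_cast
    nlinarith
  have hdouble : ∀ᶠ n in atTop, θ n ≤ 2 * θ (2 * n) := by
    filter_upwards [hθ.eventually_mul_le_two_mul hint hmean h (r := 1 / 2) (by norm_num)
      (by norm_num)] with n hn
    linarith
  have hflat := hθ.isFlat hint hmean h
  have hconv := tendsto_seqConv_div hk hks hf0 hkf hθ.pos hθ.antitone hθ.tendsto hflat hdouble hf
  have hlam : e * ∑' i, k i ≤ g := by
    refine le_of_tendsto' (hks.hasSum.tendsto_sum_nat.const_mul e) hkg
  set L := K * (1 - e * ∑' i, k i) with hL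
  have hLpos : 0 < L := mul_pos hK (by linarith)
  have hlim : Tendsto (fun i : ℕ => (i + 1 : ℝ) * k (i + 1) / θ i) atTop (𝓝 L) := by
    have h1 := hf.sub (hconv.const_mul e)
    rw [tsum_mul_right] at h1
    have h2 : K - e * ((∑' i, k i) * K) = L := by rw [hL]; ring
    rw [h2] at h1
    refine h1.congr fun n => ?_
    rw [heq]
    ring
  have hhalf : (-1 / 2 : ℝ) = -(1 / 2) := by norm_num
  refine ⟨hk0, hk, hk1, ⟨C * C', by positivity, fun i => ?_⟩, ⟨c' * (L / 2), by positivity, ?_⟩, ?_⟩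
  · rw [hhalf]
    exact hupper i
  · filter_upwards [hlow, hlim.eventually_const_le (show L / 2 < L by linarith)] with i h1 h2
    rw [le_div_iff₀ (hθ.pos i)] at h2
    refine le_trans ?_ h2
    rw [hhalf]
    calc c' * (L / 2) * ((i : ℝ) + 1) ^ (-(1 / 2) - 1 / 36 : ℝ)
        = L / 2 * (c' * ((i : ℝ) + 1) ^ (-(1 / 2) - 1 / 36 : ℝ)) := by ring
      _ ≤ L / 2 * θ i := by gcongr
  · refine isFlat_of_tendsto_div ?_ ?_
    · filter_upwards [hlim.eventually_const_lt hLpos] with i hi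
      exact (div_pos_iff_of_pos_right (hθ.pos i)).1 hi
    · have h1 := (((tendsto_add_atTop_iff_nat 1).2 hlim).div hlim hLpos.ne').div
        (hflat.tendsto_div (Eventually.of_forall hθ.pos)) one_ne_zero
      rw [div_self hLpos.ne', div_one] at h1
      refine h1.congr fun n => ?_
      have ha := (hθ.pos n).ne'
      have hb := (hθ.pos (n + 1)).ne'
      simp only [Pi.div_apply]
      field_simp

end

/-! ### The local limit theorem on a lattice. -/

section

variable {μ : Measure ℝ} [IsProbabilityMeasure μ]

theorem integrable_cexp_mul_I (μ : Measure ℝ) [IsFiniteMeasure μ] (t : ℝ) :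
    Integrable (fun x : ℝ => Complex.exp (t * x * Complex.I)) μ := by
  refine Integrable.of_bound (C := 1) (by fun_prop) (Eventually.of_forall fun x => ?_)
  rw [← Complex.ofReal_mul, Complex.norm_exp_ofReal_mul_I]

theorem re_charFun (μ : Measure ℝ) [IsFiniteMeasure μ] (t : ℝ) :
    (charFun μ t).re = ∫ x, Real.cos (t * x) ∂μ := by
  rw [charFun_apply_real]
  refine (integral_re (integrable_cexp_mul_I μ t)).symm.trans (integral_congr_ae
    (Eventually.of_forall fun x => ?_))
  change (Complex.exp (t * x * Complex.I)).re = _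
  rw [← Complex.ofReal_mul, Complex.exp_ofReal_mul_I_re]

theorem integrable_cos (μ : Measure ℝ) [IsFiniteMeasure μ] (t a : ℝ) :
    Integrable (fun x : ℝ => Real.cos (t * x - a)) μ := by
  refine Integrable.of_bound (C := 1) (by fun_prop) (Eventually.of_forall fun x => ?_)
  exact Real.abs_cos_le_one _

theorem ae_cexp_eq_one {t : ℝ} (h : charFun μ t = 1) :
    ∀ᵐ x : ℝ ∂μ, Complex.exp (t * x * Complex.I) = 1 := by
  have h1 : ∫ x, (1 - Real.cos (t * x)) ∂μ = 0 := by
    have hi := integrable_cos μ t 0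
    simp only [sub_zero] at hi
    rw [integral_sub (integrable_const _) hi, ← re_charFun, h]
    simp
  rw [integral_eq_zero_iff_of_nonneg (fun x => sub_nonneg.2 (Real.cos_le_one _))] at h1
  · filter_upwards [h1] with x hx
    have hc : Real.cos (t * x) = 1 := by
      have : 1 - Real.cos (t * x) = 0 := hx
      linarith
    obtain ⟨k, hk⟩ := (Real.cos_eq_one_iff _).1 hc
    rw [Complex.exp_eq_one_iff]
    exact ⟨k, by rw [← Complex.ofReal_mul, ← hk]; push_cast; ring⟩
  · have hi := integrable_cos μ t 0
    simp only [sub_zero] at hi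
    exact (integrable_const _).sub hi

/-- Inversion formula at the origin for a law on a lattice. -/
theorem integral_charFun_eq_mul_measureReal {T : ℝ} (hT : 0 < T) (h : charFun μ T = 1) :
    ∫ t in Icc (-(T / 2)) (T / 2), charFun μ t = (T * μ.real {0} : ℝ) := by
  have h1 : ∀ᵐ x : ℝ ∂μ, ∫ t in Icc (-(T / 2)) (T / 2), Complex.exp (t * x * Complex.I) =
      ({0} : Set ℝ).indicator (fun _ => (T : ℂ)) x := by
    filter_upwards [ae_cexp_eq_one h] with x hx
    rw [integral_Icc_eq_integral_Ioc, ← intervalIntegral.integral_of_le (by linarith)]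
    by_cases hx0 : x = 0
    · subst hx0
      simp
    · rw [indicator_of_notMem (by simpa using hx0)]
      have hne : (x : ℂ) * Complex.I ≠ 0 :=
        mul_ne_zero (Complex.ofReal_ne_zero.2 hx0) Complex.I_ne_zero
      have h2 : ∀ t : ℝ, Complex.exp (t * x * Complex.I) = Complex.exp (x * Complex.I * t) :=
        fun t => by congr 1; ring
      simp_rw [h2]
      rw [integral_exp_mul_complex hne]
      have h3 : Complex.exp (x * Complex.I * (T / 2 : ℝ)) =
          Complex.exp (x * Complex.I * (-(T / 2) : ℝ)) * Complex.exp (T * x * Complex.I) := by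
        rw [← Complex.exp_add]
        congr 1
        push_cast
        ring
      rw [h3, hx, mul_one, sub_self, zero_div]
  have h4 : ∀ t : ℝ, charFun μ t = ∫ x, Complex.exp (t * x * Complex.I) ∂μ := fun t =>
    charFun_apply_real t
  simp_rw [h4]
  rw [integral_integral_swap, integral_congr_ae h1, integral_indicator (measurableSet_singleton _)]
  · rw [setIntegral_const]
    simp [mul_comm]
  · refine Integrable.of_bound (C := 1) (by fun_prop) (Eventually.of_forall fun p => ?_)
    rw [Function.uncurry, ← Complex.ofReal_mul, Complex.norm_exp_ofReal_mul_I]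

/-- Separate the atom at zero: the remainder has norm at most `1 - μ {0}`. Thus a characteristic
function of modulus one must equal one, so that the atom excludes periodicity. -/
theorem norm_charFun_sq_le (μ : Measure ℝ) [IsProbabilityMeasure μ] (t : ℝ) :
    ‖charFun μ t‖ ^ 2 ≤ 1 - 2 * μ.real {0} * (1 - (charFun μ t).re) := by
  set p := μ.real {0} with hp
  have hp0 : 0 ≤ p := measureReal_nonneg
  have h1 : charFun μ t - p = ∫ x in {0}ᶜ, Complex.exp (t * x * Complex.I) ∂μ := by
    rw [charFun_apply_real, ← integral_add_compl (measurableSet_singleton 0)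
      (integrable_cexp_mul_I μ t)]
    have : ∫ x in ({0} : Set ℝ), Complex.exp (t * x * Complex.I) ∂μ = p := by
      rw [integral_singleton]
      simp [hp]
    rw [this]
    ring
  have h2 : ‖charFun μ t - p‖ ≤ 1 - p := by
    rw [h1]
    refine (norm_setIntegral_le_of_norm_le_const (C := 1) (measure_lt_top _ _)
      (fun x _ => ?_)).trans ?_
    · rw [← Complex.ofReal_mul, Complex.norm_exp_ofReal_mul_I]
    · rw [one_mul, probReal_compl_eq_one_sub (measurableSet_singleton 0)]
  have h3 : ‖charFun μ t‖ ^ 2 = p ^ 2 + 2 * p * ((charFun μ t).re - p) + ‖charFun μ t - p‖ ^ 2 := by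
    rw [Complex.sq_norm, Complex.sq_norm, Complex.normSq_apply, Complex.normSq_apply]
    simp only [Complex.sub_re, Complex.sub_im, Complex.ofReal_re, Complex.ofReal_im]
    ring
  have h4 : ‖charFun μ t - p‖ ^ 2 ≤ (1 - p) ^ 2 := by gcongr
  nlinarith

theorem norm_charFun_lt_one {t : ℝ} (h0 : 0 < μ.real {0}) (h : charFun μ t ≠ 1) :
    ‖charFun μ t‖ < 1 := by
  refine lt_of_le_of_ne (norm_charFun_le_one t) fun h1 => h ?_
  have h2 := norm_charFun_sq_le μ t
  rw [h1] at h2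
  have h3 : 1 ≤ (charFun μ t).re := by nlinarith
  have h4 : ‖charFun μ t‖ ^ 2 = (charFun μ t).re ^ 2 + (charFun μ t).im ^ 2 := by
    rw [Complex.sq_norm, Complex.normSq_apply]
    ring
  rw [h1] at h4
  apply Complex.ext
  · simp only [Complex.one_re]
    nlinarith [sq_nonneg (charFun μ t).im]
  · simp only [Complex.one_im]
    nlinarith [sq_nonneg (charFun μ t).im]

theorem exists_norm_charFun_le_of_isCompact {K : Set ℝ} (hK : IsCompact K)
    (h : ∀ t ∈ K, ‖charFun μ t‖ < 1) : ∃ ρ < 1, ∀ t ∈ K, ‖charFun μ t‖ ≤ ρ := by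
  rcases K.eq_empty_or_nonempty with rfl | hne
  · exact ⟨0, one_pos, by simp⟩
  · obtain ⟨t, ht, hmax⟩ := hK.exists_isMaxOn hne
      (continuous_charFun (μ := μ)).norm.continuousOn
    exact ⟨_, h t ht, fun x hx => hmax hx⟩

/-- The least period is `2π` divided by the span of the lattice, which need not be `1`. Periods are
bounded below because `μ` charges some `(0, n]`, where `t x` must be a positive multiple of `2π`;
then closedness gives a minimum. -/
theorem exists_isLeast_charFun_eq_one (hpos : 0 < μ (Ioi 0)) {a : ℝ} (ha : 0 < a)
    (haμ : charFun μ a = 1) : ∃ T, IsLeast {t | 0 < t ∧ charFun μ t = 1} T := by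
  obtain ⟨n, hn⟩ : ∃ n : ℕ, μ (Ioc 0 (n : ℝ)) ≠ 0 := by
    by_contra! hall
    refine hpos.ne' (measure_mono_null (fun x hx => ?_) (measure_iUnion_null hall))
    obtain ⟨n, hn⟩ := exists_nat_ge x
    exact mem_iUnion.2 ⟨n, hx, hn⟩
  have hlow : ∀ t, 0 < t → charFun μ t = 1 → 2 * Real.pi ≤ t * n := by
    intro t ht htμ
    by_contra! hlt
    refine hn (measure_mono_null (fun x hx => ?_) (ae_iff.1 (ae_cexp_eq_one htμ)))
    intro hx1
    obtain ⟨k, hk⟩ := Complex.exp_eq_one_iff.1 hx1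
    have hk' : t * x = k * (2 * Real.pi) := by
      have : ((t * x : ℝ) : ℂ) * Complex.I = ((k * (2 * Real.pi) : ℝ) : ℂ) * Complex.I := by
        push_cast
        rw [hk]
        ring
      exact_mod_cast mul_right_cancel₀ Complex.I_ne_zero this
    have hx0 : 0 < t * x := mul_pos ht hx.1
    have hxn : t * x < 2 * Real.pi := (mul_le_mul_of_nonneg_left hx.2 ht.le).trans_lt hlt
    rw [hk'] at hx0 hxn
    have hk0 : 0 < k := by
      by_contra! hle
      have : (k : ℝ) ≤ 0 := by exact_mod_cast hle
      nlinarith [Real.pi_pos]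
    have hk1 : (1 : ℝ) ≤ k := by exact_mod_cast hk0
    nlinarith [Real.pi_pos]
  have hn0 : (0 : ℝ) < n := by
    have := hlow a ha haμ
    by_contra! hle
    nlinarith [Real.pi_pos]
  have hset : {t | 0 < t ∧ charFun μ t = 1} = {t | 2 * Real.pi / n ≤ t ∧ charFun μ t = 1} := by
    ext t
    refine ⟨fun h => ⟨(div_le_iff₀ hn0).2 (hlow t h.1 h.2), h.2⟩, fun h => ⟨?_, h.2⟩⟩
    exact lt_of_lt_of_le (by positivity) h.1
  rw [hset]
  have hclosed : IsClosed {t | 2 * Real.pi / n ≤ t ∧ charFun μ t = 1} :=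
    (isClosed_Ici).inter (isClosed_eq continuous_charFun continuous_const)
  refine ⟨_, hclosed.csInf_mem ⟨a, ?_⟩ ⟨2 * Real.pi / n, fun t ht => ht.1⟩,
    fun t ht => csInf_le ⟨2 * Real.pi / n, fun t ht => ht.1⟩ ht⟩
  exact ⟨(div_le_iff₀ hn0).2 (hlow a ha haμ), haμ⟩

/-- The local limit theorem at the origin for a law with an atom there, on a lattice. -/
theorem exists_tendsto_sumLaw_singleton_div (h0 : 0 < μ.real {0}) {a : ℝ} (ha : 0 < a)
    (haμ : charFun μ a = 1) (hint : Integrable (fun y : ℝ => y) μ) (hmean : ∫ y, y ∂μ = 0)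
    (h : IsSlowlyVarying (truncSq μ)) {θ : ℕ → ℝ} (hθ : IsScale μ θ) :
    ∃ K, 0 < K ∧ Tendsto (fun n => (sumLaw μ n).real {0} / θ n) atTop (𝓝 K) := by
  obtain ⟨T, ⟨hT, hTμ⟩, hTmin⟩ :=
    exists_isLeast_charFun_eq_one (measure_Ioi_pos hint hmean h) ha haμ
  -- By minimality of `T`, the value `1` is not taken on half a period except at `0`, and the atom
  -- at zero upgrades this to modulus less than one.
  have hlt : ∀ t ∈ Icc (-(T / 2)) (T / 2), t ≠ 0 → ‖charFun μ t‖ < 1 := by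
    have hpos : ∀ t, 0 < t → t ≤ T / 2 → ‖charFun μ t‖ < 1 := fun t ht htT =>
      norm_charFun_lt_one h0 fun h1 => by
        have := hTmin ⟨ht, h1⟩
        linarith
    intro t ht htz
    rcases lt_or_gt_of_ne htz with hneg | hp
    · rw [← neg_neg t, charFun_neg, RCLike.norm_conj]
      exact hpos (-t) (by linarith) (by linarith [ht.1])
    · exact hpos t hp ht.2
  have hlim := hθ.tendsto_setIntegral_charFun_pow hint hmean h (D := Icc (-(T / 2)) (T / 2))
    measurableSet_Icc (half_pos hT) subset_rfl (fun δ hδ => by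
      have hK : IsCompact (Icc (-(T / 2)) (T / 2) ∩ {t | δ ≤ |t|}) :=
        isCompact_Icc.inter_right (isClosed_le continuous_const continuous_abs)
      obtain ⟨ρ, hρ, hle⟩ := exists_norm_charFun_le_of_isCompact (μ := μ) hK fun t ht =>
        hlt t ht.1 fun h0 => by
          have : δ ≤ |t| := ht.2
          rw [h0, abs_zero] at this
          linarith
      exact ⟨ρ, hρ, fun t ht hδt => hle t ⟨ht, hδt⟩⟩) (n₁ := 0)
    (by simp)
  refine ⟨√(2 * Real.pi) / T, by positivity, ?_⟩
  have h1 : ∀ n, ∫ t in Icc (-(T / 2)) (T / 2), charFun μ t ^ n =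
      (T * (sumLaw μ n).real {0} : ℝ) := by
    intro n
    rw [← integral_charFun_eq_mul_measureReal hT
      (by rw [charFun_sumLaw, hTμ, one_pow])]
    simp_rw [charFun_sumLaw]
  simp_rw [h1] at hlim
  have h2 : Tendsto (fun n => T * (sumLaw μ n).real {0} / θ n) atTop (𝓝 √(2 * Real.pi)) := by
    have := (Complex.continuous_re.tendsto _).comp hlim
    rw [Complex.ofReal_re] at this
    refine this.congr fun n => ?_
    rw [Function.comp_apply, ← Complex.ofReal_div, Complex.ofReal_re]
  refine (h2.div_const T).congr fun n => ?_
  field_simp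

theorem sumLaw_succ_apply_singleton_zero (n : ℕ) :
    sumLaw μ (n + 1) {0} = ∫⁻ x, μ {-x} ∂(sumLaw μ n) := by
  have hm : Measurable fun x : ℝ => μ {-x} := by
    have : (fun x : ℝ => μ {-x}) = fun x => μ (Prod.mk x ⁻¹' {p : ℝ × ℝ | p.2 = -p.1}) := rfl
    rw [this]
    exact measurable_measure_prodMk_left
      (measurableSet_eq_fun measurable_snd measurable_fst.neg)
  have hs : MeasurableSet {y : ℕ → ℝ | partialSum y (n + 1) = 0} :=
    measurable_partialSum (n + 1) (measurableSet_singleton 0)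
  rw [sumLaw, sumLaw, Measure.map_apply (measurable_partialSum _) (measurableSet_singleton 0),
    lintegral_map hm (measurable_partialSum _)]
  change stepSeq μ {y : ℕ → ℝ | partialSum y (n + 1) = 0} = _
  rw [stepSeq_apply _ hs]
  have hprod : MeasurableSet {p : ℝ × (ℕ → ℝ) | p.1 + partialSum p.2 n = 0} :=
    measurableSet_eq_fun (measurable_fst.add ((measurable_partialSum n).comp measurable_snd))
      measurable_const
  have h1 : (μ.prod (stepSeq μ)) {p : ℝ × (ℕ → ℝ) | p.1 + partialSum p.2 n = 0} =
      ∫⁻ a, stepSeq μ {z | consSeq a z ∈ {y : ℕ → ℝ | partialSum y (n + 1) = 0}} ∂μ := by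
    rw [Measure.prod_apply hprod]
    refine lintegral_congr fun a => ?_
    congr 1
    ext z
    simp [partialSum_consSeq]
  rw [← h1, Measure.prod_apply_symm hprod]
  refine lintegral_congr fun z => ?_
  congr 1
  ext a
  simp [eq_neg_iff_add_eq_zero]

end

/-! ### Bridges as return densities of the walk. -/

section

variable {s : Setup} {V : ℝ → EReal}

theorem bridgePartition_eq_lintegral (hV : Measurable V) (h0 : kappa s V ≠ 0)
    (htop : kappa s V ≠ ∞) [IsProbabilityMeasure (stepLaw s V)] (m : ℕ) :
    bridgePartition s V m =
      kappa s V ^ m * ∫⁻ x, boltzmann V (-x) ∂(sumLaw (stepLaw s V) m) := by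
  have hb : Measurable fun w => boltzmann V (-w) := (measurable_boltzmann hV).comp measurable_neg
  have h := chain_replicate_eq_lintegral hV h0 htop MeasurableSet.univ hb m (isSite_zero s)
  rw [Measure.restrict_univ] at h
  rw [bridgePartition, h, sumLaw, lintegral_map hb (measurable_partialSum m)]
  simp

/-- The first `m` steps form a walk, and the last bond is the step density evaluated at the jump
back to `0`. -/
theorem bridgeSeq_eq_toReal_lintegral (hV : Measurable V) (h0 : kappa s V ≠ 0)
    (htop : kappa s V ≠ ∞) [IsProbabilityMeasure (stepLaw s V)] (m : ℕ) :
    bridgeSeq s V m =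
      (∫⁻ x, (kappa s V)⁻¹ * boltzmann V (-x) ∂(sumLaw (stepLaw s V) m)).toReal := by
  have hb : Measurable fun w => boltzmann V (-w) := (measurable_boltzmann hV).comp measurable_neg
  rw [bridgeSeq, bridgePartition_eq_lintegral hV h0 htop, lintegral_const_mul _ hb]
  congr 1
  rw [pow_succ, mul_right_comm, ← mul_assoc, ← mul_pow, ENNReal.mul_inv_cancel h0 htop, one_pow,
    one_mul, mul_comm]

theorem ae_isSite_sumLaw [IsProbabilityMeasure (stepLaw s V)] (n : ℕ) :
    ∀ᵐ y ∂(stepSeq (stepLaw s V)), IsSite s (partialSum y n) := by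
  induction n with
  | zero =>
    refine Eventually.of_forall fun y => ?_
    rw [partialSum, Finset.sum_range_zero]
    exact isSite_zero s
  | succ n ih =>
    have h := (measurePreserving_eval_infinitePi
      (fun _ : ℕ => stepLaw s V) n).quasiMeasurePreserving.ae ae_isSite_stepLaw
    filter_upwards [ih, h] with y h1 h2
    rw [partialSum, Finset.sum_range_succ]
    exact h1.add h2

theorem constrained_le_bridgePartition (hV : Measurable V) (hV' : ∀ x, V x ≠ ⊥) (m : ℕ) :
    partitionFunction s V .constrained 0 m ≤ bridgePartition s V m := by
  rw [bridgePartition_eq hV hV']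
  rw [Finset.sum_range_succ']
  exact le_add_left le_self_add

end

/-! ### The discrete set-up. -/

section Discrete

variable {V : ℝ → EReal}

theorem stepLaw_singleton (hV : Measurable V) (z : ℤ) :
    stepLaw .discrete V {(z : ℝ)} = (kappa .discrete V)⁻¹ * boltzmann V z := by
  have hm : Measurable (({(z : ℝ)} : Set ℝ).indicator (1 : ℝ → ℝ≥0∞)) :=
    measurable_one.indicator (measurableSet_singleton _)
  rw [← lintegral_indicator_one (measurableSet_singleton _), lintegral_stepLaw hV hm,
    lintegral_refMeasure_discrete (F := fun y => boltzmann V y * ({(z : ℝ)} : Set ℝ).indicator 1 y)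
      ((measurable_boltzmann hV).mul hm), tsum_eq_single z]
  · simp
  · intro w hw
    simp [hw]

theorem sumLaw_succ_singleton_zero_eq (hV : Measurable V)
    [IsProbabilityMeasure (stepLaw .discrete V)] (m : ℕ) :
    ∫⁻ x, (kappa .discrete V)⁻¹ * boltzmann V (-x) ∂(sumLaw (stepLaw .discrete V) m) =
      sumLaw (stepLaw .discrete V) (m + 1) {0} := by
  rw [sumLaw_succ_apply_singleton_zero]
  have hm : ∀ᵐ x ∂(sumLaw (stepLaw .discrete V) m), IsSite .discrete x := by
    have hs : MeasurableSet {x | IsSite .discrete x} := by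
      have : {x | IsSite .discrete x} = range fun z : ℤ => (z : ℝ) := by
        ext x
        simp [IsSite, eq_comm]
      rw [this]
      exact (countable_range _).measurableSet
    exact (ae_map_iff (measurable_partialSum m).aemeasurable hs).2 (ae_isSite_sumLaw m)
  refine lintegral_congr_ae (hm.mono fun x hx => ?_)
  obtain ⟨z, rfl⟩ := hx
  have := stepLaw_singleton hV (-z)
  push_cast at this
  exact this.symm

theorem bridgeSeq_discrete (hV : Measurable V) (h0 : kappa .discrete V ≠ 0)
    (htop : kappa .discrete V ≠ ∞) [IsProbabilityMeasure (stepLaw .discrete V)] (m : ℕ) :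
    bridgeSeq .discrete V m = (sumLaw (stepLaw .discrete V) (m + 1)).real {0} := by
  rw [bridgeSeq_eq_toReal_lintegral hV h0 htop, sumLaw_succ_singleton_zero_eq hV]
  rfl

/-- Up to a power of `κ` this is a probability, which is why finiteness need not be assumed on the
lattice. -/
theorem bridgePartition_discrete_ne_top (hV : Measurable V) (h0 : kappa .discrete V ≠ 0)
    (htop : kappa .discrete V ≠ ∞) [IsProbabilityMeasure (stepLaw .discrete V)] (m : ℕ) :
    bridgePartition .discrete V m ≠ ∞ := by
  have hb : Measurable fun w => boltzmann V (-w) := (measurable_boltzmann hV).comp measurable_neg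
  rw [bridgePartition_eq_lintegral hV h0 htop]
  refine ENNReal.mul_ne_top (ENNReal.pow_ne_top htop) fun h => ?_
  have h1 := sumLaw_succ_singleton_zero_eq hV m
  rw [lintegral_const_mul _ hb, h, ENNReal.mul_top (ENNReal.inv_ne_zero.2 htop)] at h1
  exact measure_ne_top _ _ h1.symm

theorem charFun_stepLaw_discrete [IsProbabilityMeasure (stepLaw .discrete V)] :
    charFun (stepLaw .discrete V) (2 * Real.pi) = 1 := by
  rw [charFun_apply_real]
  have h : ∀ᵐ x : ℝ ∂(stepLaw .discrete V),
      Complex.exp ((2 * Real.pi : ℝ) * x * Complex.I) = 1 := by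
    filter_upwards [ae_isSite_stepLaw] with x hx
    obtain ⟨z, rfl⟩ := hx
    rw [Complex.exp_eq_one_iff]
    exact ⟨z, by push_cast; ring⟩
  rw [integral_congr_ae h]
  simp

theorem boltzmann_zero_pos (h : V 0 < ⊤) : 0 < boltzmann V 0 := by
  rw [boltzmann, pos_iff_ne_zero, Ne, EReal.exp_eq_zero_iff, EReal.neg_eq_bot_iff]
  exact h.ne

/-- The excursions weighted by powers of `κ`, up to a finite length. -/
theorem sum_chain_le (hV : Measurable V) (h0 : kappa .discrete V ≠ 0)
    (htop : kappa .discrete V ≠ ∞) (N : ℕ) {x : ℝ} (hx : IsSite .discrete x) :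
    ∑ n ∈ Finset.range N, (kappa .discrete V)⁻¹ ^ (n + 1) * chain (boltzmann V)
      (terminal V .constrained) (List.replicate n (dryMeasure .discrete)) x ≤
      (kappa .discrete V)⁻¹ * ∫⁻ y in Ici 0, boltzmann V (y - x) ∂(refMeasure .discrete) := by
  have hb := measurable_boltzmann hV
  have hc : ∀ n, Measurable (chain (boltzmann V) (terminal V .constrained)
      (List.replicate n (dryMeasure .discrete))) := fun n =>
    measurable_chain hb (measurable_terminal hV _) fun ρ hρ => by
      rw [List.eq_of_mem_replicate hρ]
      infer_instance
  induction N generalizing x with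
  | zero => simp
  | succ N ih =>
    have hbx : Measurable fun y => boltzmann V (y - x) := hb.comp (measurable_id.sub_const x)
    rw [Finset.sum_range_succ', restrict_Ici_refMeasure, lintegral_add_measure, mul_add]
    refine add_le_add ?_ ?_
    · have hone : ∀ y, IsSite .discrete y → ∑ n ∈ Finset.range N, (kappa .discrete V)⁻¹ ^ (n + 1) *
          chain (boltzmann V) (terminal V .constrained)
            (List.replicate n (dryMeasure .discrete)) y ≤ 1 := fun y hy => by
        refine (ih hy).trans ?_
        have h1 : ∫⁻ z in Ici 0, boltzmann V (z - y) ∂(refMeasure .discrete) ≤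
            kappa .discrete V := by
          refine (setLIntegral_le_lintegral _ _).trans (le_of_eq ?_)
          have := lintegral_refMeasure_add hy.neg hb
          simp_rw [neg_add_eq_sub] at this
          exact this
        calc _ ≤ (kappa .discrete V)⁻¹ * kappa .discrete V := by gcongr
          _ = 1 := ENNReal.inv_mul_cancel h0 htop
      have hae : ∀ᵐ y ∂(dryMeasure .discrete), IsSite .discrete y :=
        ae_restrict_of_ae (ae_isSite _)
      have hstep : ∑ n ∈ Finset.range N, (kappa .discrete V)⁻¹ ^ (n + 1 + 1) *
          chain (boltzmann V) (terminal V .constrained)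
            (List.replicate (n + 1) (dryMeasure .discrete)) x =
          (kappa .discrete V)⁻¹ * ∫⁻ y, boltzmann V (y - x) * ∑ n ∈ Finset.range N,
            (kappa .discrete V)⁻¹ ^ (n + 1) * chain (boltzmann V) (terminal V .constrained)
              (List.replicate n (dryMeasure .discrete)) y ∂(dryMeasure .discrete) := by
        simp_rw [Finset.mul_sum]
        have hm : ∀ n, Measurable fun y => boltzmann V (y - x) * ((kappa .discrete V)⁻¹ ^ (n + 1) *
            chain (boltzmann V) (terminal V .constrained)
              (List.replicate n (dryMeasure .discrete)) y) := fun n =>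
          hbx.mul ((hc n).const_mul _)
        have hm' : ∀ n, Measurable fun y => boltzmann V (y - x) * chain (boltzmann V)
            (terminal V .constrained) (List.replicate n (dryMeasure .discrete)) y := fun n =>
          hbx.mul (hc n)
        rw [lintegral_finsetSum _ fun n _ => hm n, Finset.mul_sum]
        refine Finset.sum_congr rfl fun n _ => ?_
        rw [List.replicate_succ, chain, pow_succ', mul_assoc, ← lintegral_const_mul _ (hm' n)]
        congr 1
        refine lintegral_congr fun y => ?_
        ring
      rw [hstep]
      refine mul_le_mul_right (lintegral_mono_ae (hae.mono fun y hy => ?_)) _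
      calc _ ≤ boltzmann V (y - x) * 1 := by
            gcongr
            exact hone y hy
        _ = _ := mul_one _
    · rw [contactMass, one_smul, lintegral_dirac' _ hbx, zero_sub, zero_add, pow_one]
      exact le_rfl

/-- The bound is `g = P(Y₁ ≥ 0)`, which is less than one since the step is negative with positive
probability. -/
theorem exists_sum_excursionSeq_le (hV : Measurable V) (hV' : ∀ x, V x ≠ ⊥)
    (h0 : kappa .discrete V ≠ 0) (htop : kappa .discrete V ≠ ∞)
    (hneg : 0 < stepLaw .discrete V (Iio 0)) [IsProbabilityMeasure (stepLaw .discrete V)] :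
    ∃ g < 1, ∀ n, ∑ i ∈ Finset.range n, excursionSeq .discrete V i ≤ g := by
  refine ⟨(stepLaw .discrete V).real (Ici 0), ?_, fun n => ?_⟩
  · have h1 : (stepLaw .discrete V).real (Iio 0) + (stepLaw .discrete V).real (Ici 0) = 1 := by
      rw [← compl_Iio, probReal_compl_eq_one_sub measurableSet_Iio]
      ring
    have h2 : 0 < (stepLaw .discrete V).real (Iio 0) :=
      ENNReal.toReal_pos hneg.ne' (measure_ne_top _ _)
    linarith
  · have hcase : ∑ i ∈ Finset.range (n + 1), excursionSeq .discrete V i ≤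
        (stepLaw .discrete V).real (Ici 0) := by
      rw [Finset.sum_range_succ']
      simp only [excursionSeq, add_zero, normalizedPartition]
      have hm : Measurable ((Ici (0 : ℝ)).indicator (1 : ℝ → ℝ≥0∞)) :=
        measurable_one.indicator measurableSet_Ici
      have h1 := sum_chain_le hV h0 htop n (isSite_zero .discrete)
      have h2 : (kappa .discrete V)⁻¹ * ∫⁻ y in Ici 0, boltzmann V (y - 0) ∂(refMeasure .discrete) =
          stepLaw .discrete V (Ici 0) := by
        rw [← lintegral_indicator_one measurableSet_Ici, lintegral_stepLaw hV hm,
          ← lintegral_indicator measurableSet_Ici]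
        congr 1
        refine lintegral_congr fun y => ?_
        by_cases hy : y ∈ Ici (0 : ℝ)
        · simp only [sub_zero, indicator_of_mem hy, Pi.one_apply, mul_one]
        · simp only [indicator_of_notMem hy, mul_zero]
      rw [h2] at h1
      have h3 : ∀ i ∈ Finset.range n, partitionFunction .discrete V .constrained 0 i *
          (kappa .discrete V)⁻¹ ^ bondCount .constrained i ≠ ∞ := fun i _ => by
        refine ENNReal.mul_ne_top ?_ (ENNReal.pow_ne_top (ENNReal.inv_ne_top.2 h0))
        exact ne_top_of_le_ne_top (bridgePartition_discrete_ne_top hV h0 htop i)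
          (constrained_le_bridgePartition hV hV' i)
      rw [← ENNReal.toReal_sum h3]
      refine ENNReal.toReal_mono (measure_ne_top _ _) (le_trans (le_of_eq ?_) h1)
      refine Finset.sum_congr rfl fun i _ => ?_
      rw [partitionFunction_zero_eq_chain hV hV', mul_comm]
      rfl
    refine le_trans ?_ hcase
    rw [Finset.sum_range_succ]
    linarith [excursionSeq_nonneg .discrete V n]

theorem exists_tendsto_bridgeSeq_div_discrete (hV : Measurable V) (hV0 : V 0 < ⊤)
    (h0 : kappa .discrete V ≠ 0) (htop : kappa .discrete V ≠ ∞)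
    [IsProbabilityMeasure (stepLaw .discrete V)]
    (hint : Integrable (fun y : ℝ => y) (stepLaw .discrete V))
    (hmean : ∫ y, y ∂(stepLaw .discrete V) = 0)
    (h : IsSlowlyVarying (truncSq (stepLaw .discrete V))) {θ : ℕ → ℝ}
    (hθ : IsScale (stepLaw .discrete V) θ) :
    ∃ K, 0 < K ∧ Tendsto (fun n => bridgeSeq .discrete V n / θ (n + 1)) atTop (𝓝 K) := by
  have hatom : 0 < (stepLaw .discrete V).real {0} := by
    refine ENNReal.toReal_pos ?_ (measure_ne_top _ _)
    have := stepLaw_singleton hV 0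
    rw [Int.cast_zero] at this
    rw [this]
    exact mul_ne_zero (ENNReal.inv_ne_zero.2 htop) (boltzmann_zero_pos hV0).ne'
  obtain ⟨K, hK, hlim⟩ := exists_tendsto_sumLaw_singleton_div hatom Real.two_pi_pos
    charFun_stepLaw_discrete hint hmean h hθ
  refine ⟨K, hK, ((tendsto_add_atTop_iff_nat 1).2 hlim).congr fun n => ?_⟩
  rw [bridgeSeq_discrete hV h0 htop]

end Discrete

/-! ### Fourier inversion of characteristic functions. -/

/-- A Gaussian approximate identity. -/
noncomputable def gaussKernel (c u : ℝ) : ℝ :=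
  Real.sqrt (Real.pi * c) * Real.exp (-(Real.pi ^ 2 * c) * u ^ 2)

theorem gaussKernel_nonneg (c u : ℝ) : 0 ≤ gaussKernel c u := by
  unfold gaussKernel; positivity

theorem continuous_gaussKernel (c : ℝ) : Continuous (gaussKernel c) := by
  unfold gaussKernel; fun_prop

theorem lintegral_gaussKernel {c : ℝ} (hc : 0 < c) :
    ∫⁻ u, ENNReal.ofReal (gaussKernel c u) = 1 := by
  have hb : 0 < Real.pi ^ 2 * c := by positivity
  have hi : Integrable (gaussKernel c) := (integrable_exp_neg_mul_sq hb).const_mul _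
  rw [← ofReal_integral_eq_lintegral_ofReal hi (Eventually.of_forall (gaussKernel_nonneg c))]
  unfold gaussKernel
  rw [integral_const_mul, integral_gaussian, ← Real.sqrt_mul (by positivity)]
  have : Real.pi * c * (Real.pi / (Real.pi ^ 2 * c)) = 1 := by
    have := Real.pi_pos.ne'
    field_simp
  rw [this, Real.sqrt_one, ENNReal.ofReal_one]

theorem lintegral_gaussKernel_sub {c : ℝ} (hc : 0 < c) (x : ℝ) :
    ∫⁻ u, ENNReal.ofReal (gaussKernel c (u - x)) = 1 := by
  rw [← lintegral_gaussKernel hc]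
  exact lintegral_sub_right_eq_self (fun u => ENNReal.ofReal (gaussKernel c u)) x

theorem gaussKernel_le {c : ℝ} (u : ℝ) (hc : 0 ≤ c) :
    gaussKernel c u ≤ Real.sqrt (Real.pi * c) := by
  unfold gaussKernel
  refine mul_le_of_le_one_right (Real.sqrt_nonneg _) (Real.exp_le_one_iff.2 ?_)
  have : 0 ≤ Real.pi ^ 2 * c * u ^ 2 := by positivity
  linarith

theorem gaussKernel_neg (c u : ℝ) : gaussKernel c (-u) = gaussKernel c u := by
  simp [gaussKernel]

theorem integral_cexp_mul_gauss {c : ℝ} (hc : 0 < c) (u : ℝ) :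
    ∫ t : ℝ, Complex.exp ((2 * Real.pi * t * u : ℝ) * Complex.I) * (Real.exp (-t ^ 2 / c) : ℝ) =
      (gaussKernel c u : ℂ) := by
  have hb : 0 < ((c⁻¹ : ℝ) : ℂ).re := by
    rw [Complex.ofReal_re]
    positivity
  have h := fourierIntegral_gaussian hb ((2 * Real.pi * u : ℝ) : ℂ)
  have h1 : ∀ t : ℝ, Complex.exp ((2 * Real.pi * t * u : ℝ) * Complex.I) *
      (Real.exp (-t ^ 2 / c) : ℝ) = Complex.exp (Complex.I * (2 * Real.pi * u : ℝ) * t) *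
        Complex.exp (-((c⁻¹ : ℝ) : ℂ) * t ^ 2) := by
    intro t
    push_cast
    congr 1
    · congr 1
      ring
    · congr 1
      ring
  simp_rw [h1]
  have h2 : ((Real.sqrt (Real.pi * c) : ℝ) : ℂ) = ((Real.pi * c : ℝ) : ℂ) ^ ((1 / 2 : ℝ) : ℂ) := by
    rw [Real.sqrt_eq_rpow, Complex.ofReal_cpow (by positivity)]
  rw [h, gaussKernel, Complex.ofReal_mul (Real.sqrt _), h2]
  push_cast
  congr 1
  · congr 1
    field_simp
  · congr 1
    have : (c : ℂ) ≠ 0 := Complex.ofReal_ne_zero.2 hc.ne'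
    field_simp
    ring

theorem integrable_gauss {c : ℝ} (hc : 0 < c) : Integrable fun t : ℝ => Real.exp (-t ^ 2 / c) := by
  have : ∀ t : ℝ, -t ^ 2 / c = -c⁻¹ * t ^ 2 := fun t => by ring
  simp_rw [this]
  exact integrable_exp_neg_mul_sq (by positivity)

section

variable {ν : Measure ℝ} [IsProbabilityMeasure ν]

/-- Parseval's identity against a modulated Gaussian. -/
theorem integral_charFun_mul_gauss {c : ℝ} (hc : 0 < c) (x : ℝ) :
    ∫ t : ℝ, Complex.exp ((2 * Real.pi * t * x : ℝ) * Complex.I) *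
      (charFun ν (-(2 * Real.pi) * t) * (Real.exp (-t ^ 2 / c) : ℝ)) =
      ((∫ y, gaussKernel c (x - y) ∂ν : ℝ) : ℂ) := by
  have h1 : ∀ t : ℝ, Complex.exp ((2 * Real.pi * t * x : ℝ) * Complex.I) *
      (charFun ν (-(2 * Real.pi) * t) * (Real.exp (-t ^ 2 / c) : ℝ)) =
      ∫ y, Complex.exp ((2 * Real.pi * t * (x - y) : ℝ) * Complex.I) *
        (Real.exp (-t ^ 2 / c) : ℝ) ∂ν := by
    intro t
    rw [charFun_apply_real, ← integral_mul_const, ← integral_const_mul]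
    refine integral_congr_ae (Eventually.of_forall fun y => ?_)
    dsimp only
    rw [← mul_assoc, ← Complex.exp_add]
    congr 2
    push_cast
    ring
  simp_rw [h1]
  rw [integral_integral_swap, ← integral_complex_ofReal]
  · refine integral_congr_ae (Eventually.of_forall fun y => ?_)
    exact integral_cexp_mul_gauss hc (x - y)
  · have hi := (integrable_gauss hc).comp_fst ν
    refine hi.mono (by fun_prop) (Eventually.of_forall fun p => ?_)
    rw [Function.uncurry, norm_mul, Complex.norm_exp_ofReal_mul_I, one_mul, Complex.norm_real]

theorem lintegral_gaussKernel_prob {c : ℝ} (hc : 0 < c) :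
    ∫⁻ x, ENNReal.ofReal (∫ y, gaussKernel c (x - y) ∂ν) = 1 := by
  have hi : ∀ x, Integrable (fun y => gaussKernel c (x - y)) ν := fun x => by
    refine Integrable.of_bound (C := Real.sqrt (Real.pi * c))
      ((continuous_gaussKernel c).comp (continuous_const.sub continuous_id)).aestronglyMeasurable
      (Eventually.of_forall fun y => ?_)
    rw [Real.norm_of_nonneg (gaussKernel_nonneg _ _)]
    exact gaussKernel_le _ hc.le
  have h1 : ∀ x, ENNReal.ofReal (∫ y, gaussKernel c (x - y) ∂ν) =
      ∫⁻ y, ENNReal.ofReal (gaussKernel c (x - y)) ∂ν := fun x =>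
    ofReal_integral_eq_lintegral_ofReal (hi x) (Eventually.of_forall fun y => gaussKernel_nonneg _ _)
  simp_rw [h1]
  rw [lintegral_lintegral_swap]
  · simp_rw [lintegral_gaussKernel_sub hc]
    simp
  · exact (ENNReal.continuous_ofReal.comp ((continuous_gaussKernel c).comp
      (continuous_fst.sub continuous_snd))).measurable.aemeasurable

theorem tendsto_exp_neg_sq_div (t : ℝ) :
    Tendsto (fun n : ℕ => Real.exp (-t ^ 2 / ((n : ℝ) + 1))) atTop (𝓝 1) := by
  have h : Tendsto (fun n : ℕ => -t ^ 2 / ((n : ℝ) + 1)) atTop (𝓝 0) :=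
    tendsto_const_nhds.div_atTop (tendsto_atTop_add_const_right _ _ tendsto_natCast_atTop_atTop)
  have h1 := (Real.continuous_exp.tendsto _).comp h
  rw [Real.exp_zero] at h1
  exact h1

theorem exp_neg_sq_div_le_one (t : ℝ) {c : ℝ} (hc : 0 < c) : Real.exp (-t ^ 2 / c) ≤ 1 :=
  Real.exp_le_one_iff.2 (div_nonpos_of_nonpos_of_nonneg (by nlinarith [sq_nonneg t]) hc.le)

/-- A nonnegative characteristic function of a law with bounded density is integrable. -/
theorem integrable_charFun_of_nonneg {C : ℝ≥0} (hν : ν ≤ C • (volume : Measure ℝ)) {r : ℝ → ℝ}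
    (hr : ∀ t, 0 ≤ r t) (hrν : ∀ t, charFun ν t = (r t : ℂ)) : Integrable r := by
  have hrc : Continuous r := by
    have : r = fun t => (charFun ν t).re := funext fun t => by rw [hrν, Complex.ofReal_re]
    rw [this]
    exact Complex.continuous_re.comp continuous_charFun
  have hpi : -(2 * Real.pi) ≠ 0 := neg_ne_zero.2 Real.two_pi_pos.ne'
  rw [← integrable_comp_mul_left_iff r hpi]
  refine ⟨(hrc.comp (continuous_const_mul _)).aestronglyMeasurable, ?_⟩
  set G : ℕ → ℝ → ℝ := fun n t => r (-(2 * Real.pi) * t) * Real.exp (-t ^ 2 / ((n : ℝ) + 1)) with hG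
  have hGm : ∀ n, Continuous (G n) := fun n => by
    refine (hrc.comp (continuous_const_mul _)).mul ?_
    fun_prop
  have hG0 : ∀ n t, 0 ≤ G n t := fun n t => mul_nonneg (hr _) (Real.exp_nonneg _)
  -- Fatou along Gaussian cut-offs: by Parseval each cut-off integral is a Gaussian average of `ν`
  -- at the origin, and the density bound keeps it below `C`. Nonnegativity of `r` removes the
  -- absolute value.
  have hlim := lintegral_enorm_le_liminf_of_tendsto (μ := volume) (G := G)
    (f := fun t => r (-(2 * Real.pi) * t)) (Eventually.of_forall fun t => by
      have := (tendsto_exp_neg_sq_div t).const_mul (r (-(2 * Real.pi) * t))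
      rwa [mul_one] at this)
    (fun n => (hGm n).enorm.measurable.aemeasurable)
  refine hlim.trans_lt (lt_of_le_of_lt ?_ (ENNReal.coe_lt_top (r := C)))
  refine liminf_le_of_le (by isBoundedDefault) fun b hb => ?_
  obtain ⟨n, hn⟩ := hb.exists
  refine hn.trans ?_
  have hc : (0 : ℝ) < (n : ℝ) + 1 := by positivity
  have hGi : Integrable (G n) := by
    refine (integrable_gauss hc).mono (hGm n).aestronglyMeasurable (Eventually.of_forall fun t => ?_)
    rw [hG, norm_mul]
    refine mul_le_of_le_one_left (norm_nonneg _) ?_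
    rw [← Complex.norm_real, ← hrν]
    exact norm_charFun_le_one _
  have h1 : ∫ t, G n t = ∫ y, gaussKernel ((n : ℝ) + 1) (0 - y) ∂ν := by
    have := integral_charFun_mul_gauss (ν := ν) hc 0
    rw [← Complex.ofReal_inj, ← this, ← integral_complex_ofReal]
    refine integral_congr_ae (Eventually.of_forall fun t => ?_)
    simp [hG, hrν]
  have h2 : ∫⁻ t, ‖G n t‖ₑ = ENNReal.ofReal (∫ t, G n t) := by
    rw [ofReal_integral_eq_lintegral_ofReal hGi (Eventually.of_forall (hG0 n))]
    refine lintegral_congr fun t => ?_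
    exact Real.enorm_of_nonneg (hG0 n t)
  have h3 : Integrable (fun y => gaussKernel ((n : ℝ) + 1) (0 - y)) ν := by
    refine Integrable.of_bound (C := Real.sqrt (Real.pi * ((n : ℝ) + 1)))
      ((continuous_gaussKernel _).comp (continuous_const.sub continuous_id)).aestronglyMeasurable
      (Eventually.of_forall fun y => ?_)
    rw [Real.norm_of_nonneg (gaussKernel_nonneg _ _)]
    exact gaussKernel_le _ hc.le
  rw [h2, h1, ofReal_integral_eq_lintegral_ofReal h3
    (Eventually.of_forall fun y => gaussKernel_nonneg _ _)]
  refine (lintegral_mono' hν le_rfl).trans ?_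
  simp_rw [zero_sub, gaussKernel_neg]
  rw [lintegral_smul_measure, lintegral_gaussKernel hc]
  simp [ENNReal.smul_def]

/-- Symmetrization: `|φ|²` is the characteristic function of the convolution of `ν` with its
reflection. It is nonnegative, and the convolution inherits the bound on the density. -/
theorem integrable_norm_charFun_sq {C : ℝ≥0} (hν : ν ≤ C • (volume : Measure ℝ)) :
    Integrable fun t => ‖charFun ν t‖ ^ 2 := by
  have hneg : IsProbabilityMeasure (ν.map fun x => -1 * x) :=
    Measure.isProbabilityMeasure_map (by fun_prop)
  set lam : Measure ℝ := (ν.map fun x => -1 * x).conv ν with hlam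
  have hle : lam ≤ C • (volume : Measure ℝ) := by
    refine Measure.le_iff.2 fun B hB => ?_
    rw [← lintegral_indicator_one hB, hlam, Measure.lintegral_conv (measurable_one.indicator hB)]
    have h1 : ∀ x : ℝ, ∫⁻ y, B.indicator (1 : ℝ → ℝ≥0∞) (x + y) ∂ν ≤
        (C • (volume : Measure ℝ)) B := fun x => by
      refine (lintegral_mono' hν le_rfl).trans (le_of_eq ?_)
      rw [lintegral_smul_measure, lintegral_add_left_eq_self, lintegral_indicator_one hB]
      rfl
    refine (lintegral_mono h1).trans ?_
    rw [lintegral_const, measure_univ, mul_one]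
  refine integrable_charFun_of_nonneg hle (fun t => by positivity) fun t => ?_
  rw [hlam, charFun_conv, charFun_map_mul, neg_one_mul, charFun_neg, mul_comm, Complex.mul_conj,
    Complex.sq_norm]

end

section

variable (ν : Measure ℝ)

/-- The Fourier inverse of a characteristic function. -/
noncomputable def inverseCharFun (x : ℝ) : ℂ :=
  ∫ t : ℝ, Complex.exp ((2 * Real.pi * t * x : ℝ) * Complex.I) * charFun ν (-(2 * Real.pi) * t)

open scoped FourierTransform in
theorem fourierInv_charFun :
    𝓕⁻ (fun t : ℝ => charFun ν (-(2 * Real.pi) * t)) = inverseCharFun ν := by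
  ext x
  rw [Real.fourierInv_eq', inverseCharFun]
  refine integral_congr_ae (Eventually.of_forall fun t => ?_)
  simp only [smul_eq_mul]
  congr 4
  rw [real_inner_eq_re_inner]
  simp
  ring

variable {ν}

theorem integrable_charFun_comp (hν : Integrable (charFun ν)) :
    Integrable fun t : ℝ => charFun ν (-(2 * Real.pi) * t) :=
  (integrable_comp_mul_left_iff _ (neg_ne_zero.2 Real.two_pi_pos.ne')).2 hν

variable [IsProbabilityMeasure ν]

theorem tendsto_integral_gaussKernel (hν : Integrable (charFun ν)) (x : ℝ) :
    Tendsto (fun n : ℕ => ((∫ y, gaussKernel ((n : ℝ) + 1) (x - y) ∂ν : ℝ) : ℂ)) atTop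
      (𝓝 (inverseCharFun ν x)) := by
  have h1 : ∀ n : ℕ, ((∫ y, gaussKernel ((n : ℝ) + 1) (x - y) ∂ν : ℝ) : ℂ) = _ := fun n =>
    (integral_charFun_mul_gauss (ν := ν) (show (0 : ℝ) < (n : ℝ) + 1 by positivity) x).symm
  simp_rw [h1]
  have hc : Continuous fun t : ℝ => charFun ν (-(2 * Real.pi) * t) :=
    continuous_charFun.comp (continuous_const_mul _)
  refine tendsto_integral_of_dominated_convergence
    (fun t => ‖charFun ν (-(2 * Real.pi) * t)‖) (fun n => ?_) (integrable_charFun_comp hν).norm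
    (fun n => Eventually.of_forall fun t => ?_) (Eventually.of_forall fun t => ?_)
  · exact Continuous.aestronglyMeasurable (by fun_prop)
  · rw [norm_mul, Complex.norm_exp_ofReal_mul_I, one_mul, norm_mul, Complex.norm_real]
    refine mul_le_of_le_one_right (norm_nonneg _) ?_
    rw [Real.norm_of_nonneg (Real.exp_nonneg _)]
    exact exp_neg_sq_div_le_one t (by positivity)
  · have h2 : Tendsto (fun n : ℕ => ((Real.exp (-t ^ 2 / ((n : ℝ) + 1)) : ℝ) : ℂ)) atTop
        (𝓝 ((1 : ℝ) : ℂ)) :=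
      (Complex.continuous_ofReal.tendsto _).comp (tendsto_exp_neg_sq_div t)
    have h3 := (h2.const_mul (charFun ν (-(2 * Real.pi) * t))).const_mul
      (Complex.exp ((2 * Real.pi * t * x : ℝ) * Complex.I))
    rwa [Complex.ofReal_one, mul_one] at h3

theorem tendsto_re_inverseCharFun (hν : Integrable (charFun ν)) (x : ℝ) :
    Tendsto (fun n : ℕ => ∫ y, gaussKernel ((n : ℝ) + 1) (x - y) ∂ν) atTop
      (𝓝 (inverseCharFun ν x).re) :=
  (Complex.continuous_re.tendsto _).comp (tendsto_integral_gaussKernel hν x)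

theorem ofReal_re_inverseCharFun (hν : Integrable (charFun ν)) (x : ℝ) :
    (((inverseCharFun ν x).re : ℝ) : ℂ) = inverseCharFun ν x :=
  tendsto_nhds_unique ((Complex.continuous_ofReal.tendsto _).comp (tendsto_re_inverseCharFun hν x))
    (tendsto_integral_gaussKernel hν x)

/-- The inverse transform is a pointwise limit of Gaussian smoothings of `ν`, which are real and
nonnegative. -/
theorem re_inverseCharFun_nonneg (hν : Integrable (charFun ν)) (x : ℝ) :
    0 ≤ (inverseCharFun ν x).re :=
  ge_of_tendsto' (tendsto_re_inverseCharFun hν x) fun _ =>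
    integral_nonneg fun _ => gaussKernel_nonneg _ _

theorem continuous_inverseCharFun (hν : Integrable (charFun ν)) :
    Continuous (inverseCharFun ν) := by
  have hc : Continuous fun t : ℝ => charFun ν (-(2 * Real.pi) * t) :=
    continuous_charFun.comp (continuous_const_mul _)
  refine continuous_of_dominated (bound := fun t => ‖charFun ν (-(2 * Real.pi) * t)‖)
    (fun x => ?_) (fun x => Eventually.of_forall fun t => ?_) (integrable_charFun_comp hν).norm
    (Eventually.of_forall fun t => by fun_prop)
  · exact Continuous.aestronglyMeasurable (by fun_prop)
  · rw [norm_mul, Complex.norm_exp_ofReal_mul_I, one_mul]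

/-- Fatou again: every Gaussian smoothing of `ν` has total integral one. -/
theorem integrable_inverseCharFun (hν : Integrable (charFun ν)) :
    Integrable (inverseCharFun ν) := by
  refine ⟨(continuous_inverseCharFun hν).aestronglyMeasurable, ?_⟩
  set G : ℕ → ℝ → ℝ := fun n x => ∫ y, gaussKernel ((n : ℝ) + 1) (x - y) ∂ν with hG
  have hGm : ∀ n, Measurable (G n) := fun n => by
    have : StronglyMeasurable (Function.uncurry fun x y : ℝ => gaussKernel ((n : ℝ) + 1) (x - y)) :=
      ((continuous_gaussKernel _).comp (continuous_fst.sub continuous_snd)).stronglyMeasurable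
    exact this.integral_prod_right.measurable
  have hlim := lintegral_enorm_le_liminf_of_tendsto (μ := volume) (G := G)
    (f := fun x => (inverseCharFun ν x).re)
    (Eventually.of_forall fun x => tendsto_re_inverseCharFun hν x)
    (fun n => (hGm n).enorm.aemeasurable)
  have h1 : ∀ n, ∫⁻ x, ‖G n x‖ₑ = 1 := fun n => by
    rw [← lintegral_gaussKernel_prob (ν := ν) (show (0 : ℝ) < (n : ℝ) + 1 by positivity)]
    exact lintegral_congr fun x =>
      Real.enorm_of_nonneg (integral_nonneg fun y => gaussKernel_nonneg _ _)
  simp_rw [h1, liminf_const] at hlim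
  have h2 : ∀ x, ‖inverseCharFun ν x‖ₑ = ‖(inverseCharFun ν x).re‖ₑ := fun x => by
    conv_lhs => rw [← ofReal_re_inverseCharFun hν x]
    rw [← ofReal_norm, ← ofReal_norm, Complex.norm_real]
  change ∫⁻ x, ‖inverseCharFun ν x‖ₑ < ∞
  simp_rw [h2]
  exact hlim.trans_lt ENNReal.one_lt_top

open scoped FourierTransform in
theorem fourier_inverseCharFun (hν : Integrable (charFun ν)) :
    𝓕 (inverseCharFun ν) = fun t : ℝ => charFun ν (-(2 * Real.pi) * t) := by
  rw [← fourierInv_charFun]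
  refine Continuous.fourier_fourierInv_eq (continuous_charFun.comp (continuous_const_mul _))
    (integrable_charFun_comp hν) ?_
  have h : 𝓕 (fun t : ℝ => charFun ν (-(2 * Real.pi) * t)) = fun x => inverseCharFun ν (-x) := by
    ext x
    rw [← fourierInv_charFun, Real.fourierInv_eq_fourier_neg, neg_neg]
  rw [h]
  exact (integrable_inverseCharFun hν).comp_neg

/-- A law with integrable characteristic function has a density. -/
theorem eq_withDensity_inverseCharFun (hν : Integrable (charFun ν)) :
    ν = (volume : Measure ℝ).withDensity
      fun x => ENNReal.ofReal (inverseCharFun ν x).re := by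
  have hi := integrable_inverseCharFun hν
  have hfin : IsFiniteMeasure ((volume : Measure ℝ).withDensity
      fun x => ENNReal.ofReal (inverseCharFun ν x).re) :=
    isFiniteMeasure_withDensity_ofReal hi.re.2
  have hm : Measurable fun x => ENNReal.ofReal (inverseCharFun ν x).re :=
    (ENNReal.continuous_ofReal.comp
      (Complex.continuous_re.comp (continuous_inverseCharFun hν))).measurable
  -- Both laws are compared through their characteristic functions; Fourier inversion is legitimate
  -- because the transform and its inverse are both integrable.
  refine Measure.ext_of_charFun (funext fun t => ?_)
  rw [charFun_apply_real (μ := Measure.withDensity _ _),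
    integral_withDensity_eq_integral_toReal_smul hm
    (Eventually.of_forall fun x => ENNReal.ofReal_lt_top)]
  have h1 := congrFun (fourier_inverseCharFun hν) (-(2 * Real.pi)⁻¹ * t)
  have h2 : -(2 * Real.pi) * (-(2 * Real.pi)⁻¹ * t) = t := by
    have := Real.pi_pos.ne'
    field_simp
  rw [h2, Real.fourier_eq'] at h1
  rw [← h1]
  refine integral_congr_ae (Eventually.of_forall fun x => ?_)
  dsimp only
  rw [ENNReal.toReal_ofReal (re_inverseCharFun_nonneg hν x), Complex.real_smul,
    ofReal_re_inverseCharFun hν, smul_eq_mul, mul_comm]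
  congr 2
  have h3 : -2 * Real.pi * inner ℝ x (-(2 * Real.pi)⁻¹ * t) = t * x := by
    have := Real.pi_pos.ne'
    rw [real_inner_eq_re_inner]
    simp
    field_simp
  rw [h3]
  push_cast
  ring

/-- The density at zero of a convolution. -/
theorem toReal_lintegral_density_eq (hν : Integrable (charFun ν)) {ρ : ℝ → ℝ}
    (hρ0 : ∀ x, 0 ≤ ρ x) (hρ : Integrable ρ) (hρm : Measurable ρ) {μ : Measure ℝ}
    (hμ : μ = (volume : Measure ℝ).withDensity fun x => ENNReal.ofReal (ρ x)) :
    (((∫⁻ x, ENNReal.ofReal (ρ (-x)) ∂ν).toReal : ℝ) : ℂ) =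
      (2 * Real.pi : ℝ)⁻¹ * ∫ t, charFun ν t * charFun μ t := by
  have hcont := continuous_inverseCharFun hν
  have hm : Measurable fun x => ENNReal.ofReal (inverseCharFun ν x).re :=
    (ENNReal.continuous_ofReal.comp (Complex.continuous_re.comp hcont)).measurable
  have hρn : Measurable fun x => ρ (-x) := hρm.comp measurable_neg
  -- Only `ν` is inverted; `ρ` need not be bounded nor have an integrable transform.
  have h1 : ∫⁻ x, ENNReal.ofReal (ρ (-x)) ∂ν =
      ∫⁻ x, ENNReal.ofReal ((inverseCharFun ν x).re * ρ (-x)) := by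
    conv_lhs => rw [eq_withDensity_inverseCharFun hν]
    rw [lintegral_withDensity_eq_lintegral_mul _ hm hρn.ennreal_ofReal]
    exact lintegral_congr fun x =>
      (ENNReal.ofReal_mul (re_inverseCharFun_nonneg hν x)).symm
  have h2 : (∫⁻ x, ENNReal.ofReal (ρ (-x)) ∂ν).toReal =
      ∫ x, (inverseCharFun ν x).re * ρ (-x) := by
    rw [h1, integral_eq_lintegral_of_nonneg_ae]
    · exact Eventually.of_forall fun x => mul_nonneg (re_inverseCharFun_nonneg hν x) (hρ0 _)
    · exact ((Complex.continuous_re.comp hcont).measurable.mul hρn).aestronglyMeasurable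
  have h3 : ∀ t : ℝ, charFun μ t = ∫ x : ℝ, Complex.exp (-(t * x : ℝ) * Complex.I) * ρ (-x) := by
    intro t
    rw [charFun_apply_real, hμ, integral_withDensity_eq_integral_toReal_smul hρm.ennreal_ofReal
      (Eventually.of_forall fun x => ENNReal.ofReal_lt_top), ← integral_neg_eq_self]
    refine integral_congr_ae (Eventually.of_forall fun x => ?_)
    dsimp only
    rw [ENNReal.toReal_ofReal (hρ0 _), Complex.real_smul, mul_comm]
    congr 2
    push_cast
    ring
  rw [h2, ← integral_complex_ofReal]
  have h4 : ∀ x, (((inverseCharFun ν x).re * ρ (-x) : ℝ) : ℂ) =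
      ∫ t : ℝ, Complex.exp ((2 * Real.pi * t * x : ℝ) * Complex.I) *
        charFun ν (-(2 * Real.pi) * t) * ρ (-x) := by
    intro x
    rw [Complex.ofReal_mul, ofReal_re_inverseCharFun hν, inverseCharFun, integral_mul_const]
  simp_rw [h4]
  have hc : Continuous fun t : ℝ => charFun ν (-(2 * Real.pi) * t) :=
    continuous_charFun.comp (continuous_const_mul _)
  rw [integral_integral_swap]
  · have h5 := Measure.integral_comp_mul_left (fun t => charFun ν t * charFun μ t)
      (-(2 * Real.pi))
    have h6 : |(-(2 * Real.pi))⁻¹| = (2 * Real.pi)⁻¹ := by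
      rw [abs_inv, abs_neg, abs_of_pos Real.two_pi_pos]
    rw [h6, Complex.real_smul] at h5
    rw [← h5]
    refine integral_congr_ae (Eventually.of_forall fun t => ?_)
    dsimp only
    rw [h3, ← integral_const_mul]
    refine integral_congr_ae (Eventually.of_forall fun x => ?_)
    dsimp only
    rw [mul_comm (Complex.exp _) (charFun ν _), mul_assoc]
    congr 3
    push_cast
    ring
  · have hi := (hρ.comp_neg).mul_prod (integrable_charFun_comp hν).norm
    have hρn2 : Measurable fun p : ℝ × ℝ => ρ (-p.1) := hρn.comp measurable_fst
    refine hi.mono ?_ (Eventually.of_forall fun p => ?_)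
    · have hc2 : Continuous fun p : ℝ × ℝ => Complex.exp ((2 * Real.pi * p.2 * p.1 : ℝ) * Complex.I) *
          charFun ν (-(2 * Real.pi) * p.2) := by
        refine Continuous.mul (by fun_prop) (hc.comp continuous_snd)
      exact (hc2.measurable.mul (Complex.measurable_ofReal.comp hρn2)).aestronglyMeasurable
    · rw [Function.uncurry, norm_mul, norm_mul, norm_mul, Complex.norm_exp_ofReal_mul_I, one_mul,
        Complex.norm_real, norm_norm, mul_comm]

end

/-! ### The local limit theorem for densities. -/

section

variable {μ : Measure ℝ}

/-- Modulus one at `t ≠ 0` aligns all the phases, which confines `μ` to a translate of a lattice;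
such a set is countable, hence Lebesgue null. -/
theorem norm_charFun_lt_one_of_absolutelyContinuous [IsProbabilityMeasure μ]
    (hμ : μ ≪ (volume : Measure ℝ)) {t : ℝ} (ht : t ≠ 0) : ‖charFun μ t‖ < 1 := by
  refine lt_of_le_of_ne (norm_charFun_le_one t) fun h1 => ?_
  set a := (charFun μ t).arg with ha
  have h2 : charFun μ t = Complex.exp (a * Complex.I) := by
    have := Complex.norm_mul_exp_arg_mul_I (charFun μ t)
    rw [h1, Complex.ofReal_one, one_mul] at this
    exact this.symm
  have h3 : ∫ x, Real.cos (t * x - a) ∂μ = 1 := by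
    have h4 : charFun μ t * Complex.exp (-(a * Complex.I)) = 1 := by
      rw [h2, ← Complex.exp_add, add_neg_cancel, Complex.exp_zero]
    rw [charFun_apply_real, ← integral_mul_const] at h4
    have h5 := congrArg Complex.re h4
    rw [Complex.one_re] at h5
    rw [← h5]
    refine Eq.trans (integral_congr_ae (Eventually.of_forall fun x => ?_))
      (integral_re ((integrable_cexp_mul_I μ t).mul_const _))
    change _ = (Complex.exp (t * x * Complex.I) * Complex.exp (-(a * Complex.I))).re
    have h6 : (t * x * Complex.I + -(a * Complex.I) : ℂ) = ((t * x - a : ℝ) : ℂ) * Complex.I := by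
      push_cast
      ring
    rw [← Complex.exp_add, h6, Complex.exp_ofReal_mul_I_re]
  have h4 : ∫ x, (1 - Real.cos (t * x - a)) ∂μ = 0 := by
    rw [integral_sub (integrable_const _) (integrable_cos μ t a), h3]
    simp
  rw [integral_eq_zero_iff_of_nonneg (fun x => sub_nonneg.2 (Real.cos_le_one _))
    ((integrable_const _).sub (integrable_cos μ t a))] at h4
  have h5 : ∀ᵐ x ∂μ, x ∈ range fun k : ℤ => (k * (2 * Real.pi) + a) / t := by
    filter_upwards [h4] with x hx
    have hc : Real.cos (t * x - a) = 1 := by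
      have : 1 - Real.cos (t * x - a) = 0 := hx
      linarith
    obtain ⟨k, hk⟩ := (Real.cos_eq_one_iff _).1 hc
    refine ⟨k, ?_⟩
    dsimp only
    rw [hk]
    field_simp
    ring
  have h6 : ∀ᵐ x ∂μ, x ∉ range fun k : ℤ => (k * (2 * Real.pi) + a) / t :=
    measure_eq_zero_iff_ae_notMem.1 (hμ ((countable_range _).measure_zero _))
  obtain ⟨x, hx1, hx2⟩ := (h5.and h6).exists
  exact hx2 hx1

-- The Riemann–Lebesgue lemma, with the frequency rescaled to the convention of `charFun`.
open scoped FourierTransform in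
theorem tendsto_charFun_cocompact {ρ : ℝ → ℝ} (hρ0 : ∀ x, 0 ≤ ρ x) (hρm : Measurable ρ)
    (hμ : μ = (volume : Measure ℝ).withDensity fun x => ENNReal.ofReal (ρ x)) :
    Tendsto (charFun μ) (cocompact ℝ) (𝓝 0) := by
  have hne : -(2 * Real.pi)⁻¹ ≠ 0 := neg_ne_zero.2 (inv_ne_zero Real.two_pi_pos.ne')
  have h1 := (Real.zero_at_infty_fourier fun x => (ρ x : ℂ)).comp
    (Homeomorph.mulLeft₀ _ hne).isClosedEmbedding.tendsto_cocompact
  refine h1.congr fun t => ?_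
  rw [charFun_apply_real, hμ, integral_withDensity_eq_integral_toReal_smul hρm.ennreal_ofReal
      (Eventually.of_forall fun x => ENNReal.ofReal_lt_top), Function.comp_apply,
    Real.fourier_eq']
  refine integral_congr_ae (Eventually.of_forall fun x => ?_)
  dsimp only
  rw [ENNReal.toReal_ofReal (hρ0 _), Complex.real_smul, smul_eq_mul, mul_comm]
  have h3 : -2 * Real.pi * inner ℝ x ((Homeomorph.mulLeft₀ _ hne) t) = t * x := by
    have := Real.pi_pos.ne'
    rw [real_inner_eq_re_inner]
    simp
    field_simp
  rw [h3]
  push_cast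
  rfl

/-- Decay at infinity handles all but a compact set of frequencies, where continuity gives a maximum
less than one. -/
theorem exists_norm_charFun_le_of_tendsto [IsProbabilityMeasure μ]
    (hlim : Tendsto (charFun μ) (cocompact ℝ) (𝓝 0)) (hlt : ∀ t, t ≠ 0 → ‖charFun μ t‖ < 1)
    {δ : ℝ} (hδ : 0 < δ) : ∃ ρ < 1, ∀ t, δ ≤ |t| → ‖charFun μ t‖ ≤ ρ := by
  have h1 := hlim.norm.eventually_le_const (show ‖(0 : ℂ)‖ < 1 / 2 by norm_num)
  obtain ⟨K, hK, hKle⟩ := (hasBasis_cocompact (X := ℝ)).eventually_iff.1 h1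
  have hK2 : IsCompact (K ∩ {t | δ ≤ |t|}) :=
    hK.inter_right (isClosed_le continuous_const continuous_abs)
  obtain ⟨ρ, hρ, hle⟩ := exists_norm_charFun_le_of_isCompact (μ := μ) hK2 fun t ht =>
    hlt t fun h0 => by
      have : δ ≤ |t| := ht.2
      rw [h0, abs_zero] at this
      linarith
  refine ⟨max ρ (1 / 2), max_lt hρ (by norm_num), fun t ht => ?_⟩
  by_cases htK : t ∈ K
  · exact (hle t ⟨htK, ht⟩).trans (le_max_left _ _)
  · exact (hKle htK).trans (le_max_right _ _)

theorem map_sum_pi_eq_sumLaw [IsProbabilityMeasure μ] (n : ℕ) :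
    (Measure.pi fun _ : Fin n => μ).map (fun y => ∑ i, y i) = sumLaw μ n := by
  have hm : Measurable fun y : Fin n → ℝ => ∑ i, y i := by fun_prop
  have : IsProbabilityMeasure ((Measure.pi fun _ : Fin n => μ).map (fun y => ∑ i, y i)) :=
    Measure.isProbabilityMeasure_map hm.aemeasurable
  refine Measure.ext_of_charFun (funext fun t => ?_)
  rw [charFun_sumLaw, charFun_apply_real, integral_map hm.aemeasurable (by fun_prop),
    charFun_apply_real]
  have h := integral_fintype_prod_eq_pow (ι := Fin n) (μ := μ)
    (fun x : ℝ => Complex.exp (t * x * Complex.I))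
  rw [Fintype.card_fin] at h
  rw [← h]
  refine integral_congr_ae (Eventually.of_forall fun y => ?_)
  dsimp only
  rw [← Complex.exp_sum]
  congr 1
  push_cast
  rw [Finset.mul_sum, Finset.sum_mul]

/-- The local limit theorem for the density at zero. -/
theorem exists_tendsto_density_div [IsProbabilityMeasure μ] {ρ : ℝ → ℝ} (hρ0 : ∀ x, 0 ≤ ρ x)
    (hρ : Integrable ρ) (hρm : Measurable ρ)
    (hμ : μ = (volume : Measure ℝ).withDensity fun x => ENNReal.ofReal (ρ x))
    {m : ℕ} {C : ℝ≥0} (hC : sumLaw μ m ≤ C • (volume : Measure ℝ))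
    (hint : Integrable (fun y : ℝ => y) μ) (hmean : ∫ y, y ∂μ = 0)
    (h : IsSlowlyVarying (truncSq μ)) {θ : ℕ → ℝ} (hθ : IsScale μ θ) :
    ∃ K, 0 < K ∧ Tendsto (fun n =>
      (∫⁻ x, ENNReal.ofReal (ρ (-x)) ∂(sumLaw μ n)).toReal / θ (n + 1)) atTop (𝓝 K) := by
  have hac : μ ≪ (volume : Measure ℝ) := hμ ▸ withDensity_absolutelyContinuous _ _
  have hgap : ∀ δ > 0, ∃ r < 1, ∀ t ∈ (univ : Set ℝ), δ ≤ |t| → ‖charFun μ t‖ ≤ r := fun δ hδ => by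
    obtain ⟨r, hr, hle⟩ := exists_norm_charFun_le_of_tendsto
      (tendsto_charFun_cocompact hρ0 hρm hμ)
      (fun t ht => norm_charFun_lt_one_of_absolutelyContinuous hac ht) hδ
    exact ⟨r, hr, fun t _ => hle t⟩
  -- The bounded density of the `m`-th sum makes the `m`-th power of the characteristic function
  -- square integrable, so the powers from `2m` on are integrable.
  have hpow : ∀ n, m + m ≤ n → Integrable fun t => charFun μ t ^ n := fun n hn => by
    refine (integrable_norm_charFun_sq hC).mono
      (continuous_charFun.pow n).aestronglyMeasurable (Eventually.of_forall fun t => ?_)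
    rw [charFun_sumLaw, norm_pow, Real.norm_of_nonneg (by positivity), norm_pow, ← pow_mul]
    exact pow_le_pow_of_le_one (norm_nonneg _) (norm_charFun_le_one t) (by omega)
  have hlim := hθ.tendsto_setIntegral_charFun_pow hint hmean h MeasurableSet.univ one_pos
    (subset_univ _) hgap (n₁ := m + m) (by rw [integrableOn_univ]; exact hpow _ le_rfl)
  rw [Measure.restrict_univ] at hlim
  refine ⟨(2 * Real.pi)⁻¹ * √(2 * Real.pi), by positivity, ?_⟩
  have h2 := ((Complex.continuous_re.tendsto _).comp
    ((tendsto_add_atTop_iff_nat 1).2 hlim)).const_mul (2 * Real.pi)⁻¹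
  rw [Complex.ofReal_re] at h2
  refine h2.congr' ?_
  filter_upwards [eventually_ge_atTop (m + m)] with n hn
  have h3 : Integrable (charFun (sumLaw μ n)) := by
    have : charFun (sumLaw μ n) = fun t => charFun μ t ^ n := funext fun t => charFun_sumLaw μ n t
    rw [this]
    exact hpow n hn
  have h4 := congrArg Complex.re (toReal_lintegral_density_eq h3 hρ0 hρ hρm hμ)
  rw [Complex.ofReal_re, Complex.re_ofReal_mul] at h4
  simp_rw [charFun_sumLaw, ← pow_succ] at h4
  rw [h4, Function.comp_apply, Complex.div_ofReal_re, mul_div_assoc]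

end

/-! ### The continuous set-up. -/

section Continuous

variable {V : ℝ → EReal}

theorem boltzmann_ne_top (hV' : ∀ x, V x ≠ ⊥) (x : ℝ) : boltzmann V x ≠ ∞ := by
  rw [boltzmann, Ne, EReal.exp_eq_top_iff, EReal.neg_eq_top_iff]
  exact hV' x

theorem exists_tendsto_bridgeSeq_div_continuous (hV : Measurable V) (hV' : ∀ x, V x ≠ ⊥)
    (h0 : kappa .continuous V ≠ 0) (htop : kappa .continuous V ≠ ∞)
    [IsProbabilityMeasure (stepLaw .continuous V)] {m : ℕ} {C : ℝ≥0}
    (hC : walkLaw .continuous V m ≤ C • (volume : Measure ℝ))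
    (hint : Integrable (fun y : ℝ => y) (stepLaw .continuous V))
    (hmean : ∫ y, y ∂(stepLaw .continuous V) = 0)
    (h : IsSlowlyVarying (truncSq (stepLaw .continuous V))) {θ : ℕ → ℝ}
    (hθ : IsScale (stepLaw .continuous V) θ) :
    ∃ K, 0 < K ∧ Tendsto (fun n => bridgeSeq .continuous V n / θ (n + 1)) atTop (𝓝 K) := by
  have hb := measurable_boltzmann hV
  set ρ : ℝ → ℝ := fun x => ((kappa .continuous V)⁻¹ * boltzmann V x).toReal with hρ
  have hne : ∀ x, (kappa .continuous V)⁻¹ * boltzmann V x ≠ ∞ := fun x =>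
    ENNReal.mul_ne_top (ENNReal.inv_ne_top.2 h0) (boltzmann_ne_top hV' x)
  have hρe : ∀ x, ENNReal.ofReal (ρ x) = (kappa .continuous V)⁻¹ * boltzmann V x := fun x =>
    ENNReal.ofReal_toReal (hne x)
  have hρm : Measurable ρ := (hb.const_mul _).ennreal_toReal
  have hμ : stepLaw .continuous V =
      (volume : Measure ℝ).withDensity fun x => ENNReal.ofReal (ρ x) := by
    simp_rw [hρe]
    exact (withDensity_smul _ hb).symm
  have hρi : Integrable ρ := by
    refine integrable_toReal_of_lintegral_ne_top (hb.const_mul _).aemeasurable ?_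
    rw [lintegral_const_mul _ hb]
    exact ENNReal.mul_ne_top (ENNReal.inv_ne_top.2 h0) htop
  rw [walkLaw, map_sum_pi_eq_sumLaw] at hC
  obtain ⟨K, hK, hlim⟩ := exists_tendsto_density_div (ρ := ρ) (fun x => ENNReal.toReal_nonneg) hρi hρm hμ hC
    hint hmean h hθ
  refine ⟨K, hK, hlim.congr fun n => ?_⟩
  rw [bridgeSeq_eq_toReal_lintegral hV h0 htop]
  simp_rw [hρe]

end Continuous

/-! ### Admissible potentials: the asymptotics assembled. -/

section

variable {s : Setup} {V : ℝ → EReal}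

/-- If `κ = 0`, the step law is the zero measure, the truncated variance vanishes and the ratios in
the definition of slow variation are `0 / 0 = 0`. -/
theorem IsAdmissible.kappa_ne_zero (hV : IsAdmissible s V) : kappa s V ≠ 0 := by
  intro h0
  have h1 : (refMeasure s).withDensity (boltzmann V) = 0 := by
    rw [← Measure.measure_univ_eq_zero, withDensity_apply _ .univ, Measure.restrict_univ]
    exact h0
  have h2 : ∀ t, truncatedVariance s V t = 0 := fun t => by
    rw [truncatedVariance, stepLaw, h1]
    simp
  have h3 := hV.slowlyVarying 1 one_pos
  simp_rw [h2, div_zero] at h3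
  exact zero_ne_one (tendsto_nhds_unique tendsto_const_nhds h3)

theorem IsAdmissible.isProbabilityMeasure_stepLaw (hV : IsAdmissible s V) :
    IsProbabilityMeasure (stepLaw s V) :=
  Wetting.isProbabilityMeasure_stepLaw hV.kappa_ne_zero hV.kappa_lt_top.ne

theorem IsAdmissible.partitionFunction_zero_ne_top (hV : IsAdmissible s V)
    (a : BoundaryCondition) (N : ℕ) : partitionFunction s V a 0 N ≠ ∞ := by
  have := hV.isProbabilityMeasure_stepLaw
  have h0 := hV.kappa_ne_zero
  have htop := hV.kappa_lt_top.ne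
  cases a with
  | free =>
    rw [partitionFunction_free_zero hV.measurable hV.ne_bot h0 htop]
    exact ENNReal.mul_ne_top (ENNReal.pow_ne_top htop) (measure_ne_top _ _)
  | constrained =>
    cases s with
    | continuous => exact (hV.partitionFunction_lt_top rfl N).ne
    | discrete =>
      exact ne_top_of_le_ne_top (bridgePartition_discrete_ne_top hV.measurable h0 htop N)
        (constrained_le_bridgePartition hV.measurable hV.ne_bot N)

theorem IsAdmissible.excursionSeq_one_pos (hV : IsAdmissible s V) : 0 < excursionSeq s V 1 := by
  have h1 : partitionFunction s V .constrained 0 0 = boltzmann V 0 := by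
    rw [partitionFunction_zero_eq_chain hV.measurable hV.ne_bot]
    simp [chain, terminal]
  rw [excursionSeq, normalizedPartition, h1]
  refine ENNReal.toReal_pos (mul_ne_zero (boltzmann_zero_pos hV.zero_lt_top).ne'
    (pow_ne_zero _ (ENNReal.inv_ne_zero.2 hV.kappa_lt_top.ne))) ?_
  exact ENNReal.mul_ne_top (boltzmann_ne_top hV.ne_bot _)
    (ENNReal.pow_ne_top (ENNReal.inv_ne_top.2 hV.kappa_ne_zero))

/-- Combines the local limit theorem of each set-up with the cycle lemma. The bound `e ∑ k < 1` is
trivial in the continuous set-up, where `e = 0`. -/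
theorem IsAdmissible.hasSquareRootTail (hV : IsAdmissible s V) :
    HasSquareRootTail (excursionSeq s V) := by
  have := hV.isProbabilityMeasure_stepLaw
  have h0 := hV.kappa_ne_zero
  have htop := hV.kappa_lt_top.ne
  have hsv : IsSlowlyVarying (truncSq (stepLaw s V)) := hV.slowlyVarying
  have hint := hV.integrable_step
  have hmean := hV.mean_zero
  obtain ⟨θ, hθ⟩ := exists_isScale hsv
  have hflat := hθ.isFlat hint hmean hsv
  obtain ⟨K, hK, hlim⟩ : ∃ K, 0 < K ∧
      Tendsto (fun n => bridgeSeq s V n / θ (n + 1)) atTop (𝓝 K) := by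
    cases s with
    | continuous =>
      obtain ⟨m, -, C, hC⟩ := hV.bounded_density rfl
      exact exists_tendsto_bridgeSeq_div_continuous hV.measurable hV.ne_bot h0 htop hC hint hmean
        hsv hθ
    | discrete =>
      exact exists_tendsto_bridgeSeq_div_discrete hV.measurable hV.zero_lt_top h0 htop hint hmean
        hsv hθ
  obtain ⟨g, hg, hkg⟩ : ∃ g < 1, ∀ n,
      (contactMass s : ℝ) * ∑ i ∈ Finset.range n, excursionSeq s V i ≤ g := by
    cases s with
    | continuous => exact ⟨0, one_pos, fun n => by simp [contactMass]⟩
    | discrete =>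
      obtain ⟨g, hg, hle⟩ := exists_sum_excursionSeq_le hV.measurable hV.ne_bot h0 htop
        (measure_Iio_pos hint hmean hsv)
      exact ⟨g, hg, fun n => by simpa [contactMass] using hle n⟩
  have hlim' : Tendsto (fun n => bridgeSeq s V n / θ n) atTop (𝓝 K) := by
    have h1 := hlim.div (hflat.tendsto_div (Eventually.of_forall hθ.pos)) one_ne_zero
    rw [div_one] at h1
    refine h1.congr fun n => ?_
    have ha := (hθ.pos n).ne'
    have hb := (hθ.pos (n + 1)).ne'
    simp only [Pi.div_apply]
    field_simp
  exact hasSquareRootTail_of_tendsto rfl (excursionSeq_nonneg s V) hV.excursionSeq_one_pos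
    (bridgeSeq_nonneg s V) (contactMass s).coe_nonneg
    (succ_mul_excursionSeq hV.measurable hV.ne_bot h0 hV.partitionFunction_zero_ne_top)
    hg hkg hint hmean hsv hθ hK hlim'

theorem IsAdmissible.normalizedPartition_free_zero (hV : IsAdmissible s V)
    [IsProbabilityMeasure (stepLaw s V)] :
    normalizedPartition s V .free 0 = positivityProb (stepLaw s V) := by
  have h0 := hV.kappa_ne_zero
  have htop := hV.kappa_lt_top.ne
  ext N
  rw [normalizedPartition, partitionFunction_free_zero hV.measurable hV.ne_bot h0 htop, bondCount,
    mul_right_comm, ← mul_pow, ENNReal.mul_inv_cancel h0 htop, one_pow, one_mul]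
  rfl

theorem IsAdmissible.normalizedPartition_pos (hV : IsAdmissible s V) (a : BoundaryCondition)
    {ε : ℝ≥0} (hε : 0 < ε) (N : ℕ) : 0 < normalizedPartition s V a ε N := by
  have := hV.isProbabilityMeasure_stepLaw
  have hren := normalizedPartition_renewal hV.measurable hV.ne_bot hV.kappa_ne_zero
    hV.partitionFunction_zero_ne_top a ε
  induction N with
  | zero =>
    rw [hren 0, Finset.range_zero, Finset.sum_empty, add_zero]
    cases a with
    | free =>
      rw [hV.normalizedPartition_free_zero, positivityProb_zero]
      exact one_pos
    | constrained => exact hV.excursionSeq_one_pos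
  | succ N ih =>
    rw [hren (N + 1)]
    have hnn : ∀ ε N, 0 ≤ normalizedPartition s V a ε N := fun _ _ => ENNReal.toReal_nonneg
    refine add_pos_of_nonneg_of_pos (hnn 0 (N + 1)) (Finset.sum_pos' (fun j _ => ?_)
      ⟨0, Finset.mem_range.2 N.succ_pos, ?_⟩)
    · exact mul_nonneg (excursionSeq_nonneg s V _) (mul_nonneg ε.coe_nonneg (hnn _ _))
    · exact mul_pos hV.excursionSeq_one_pos (mul_pos (by exact_mod_cast hε) ih)

/-- For `ε = 0` and constrained ends the partition function is positive only for large `N` a priori;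
this follows from the lower bound in `HasSquareRootTail`. -/
theorem IsAdmissible.eventually_normalizedPartition_pos (hV : IsAdmissible s V)
    (a : BoundaryCondition) (ε : ℝ≥0) : ∀ᶠ N in atTop, 0 < normalizedPartition s V a ε N := by
  have := hV.isProbabilityMeasure_stepLaw
  rcases eq_or_ne ε 0 with rfl | hε
  · cases a with
    | free =>
      refine Eventually.of_forall fun N => ?_
      rw [hV.normalizedPartition_free_zero]
      exact positivityProb_pos hV.integrable_step hV.mean_zero hV.slowlyVarying N
    | constrained =>
      obtain ⟨c, hc, h⟩ := hV.hasSquareRootTail.lower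
      filter_upwards [h] with N hN
      have h1 : 0 < ((N : ℝ) + 1) * excursionSeq s V (N + 1) :=
        lt_of_lt_of_le (by positivity) hN
      exact pos_of_mul_pos_right h1 (by positivity)
  · exact Eventually.of_forall (hV.normalizedPartition_pos a (pos_iff_ne_zero.2 hε))

theorem IsAdmissible.isProbabilityMeasure_contactLaw (hV : IsAdmissible s V)
    {a : BoundaryCondition} {ε : ℝ≥0} {N : ℕ} (h : 0 < normalizedPartition s V a ε N) :
    IsProbabilityMeasure (contactLaw s V a ε N) := by
  have h1 : partitionFunction s V a ε N ≠ 0 := fun h1 => by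
    rw [normalizedPartition, h1, zero_mul, ENNReal.toReal_zero] at h
    exact lt_irrefl _ h
  have : IsProbabilityMeasure (interfaceLaw s V a ε N) := by
    constructor
    rw [interfaceLaw, Measure.smul_apply, withDensity_apply _ .univ, Measure.restrict_univ,
      smul_eq_mul]
    exact ENNReal.inv_mul_cancel h1 (partitionFunction_ne_top hV.measurable hV.ne_bot
      hV.partitionFunction_zero_ne_top a ε N)
  exact Measure.isProbabilityMeasure_map measurable_contactSet.aemeasurable

/-- The free energy, and the ratios of consecutive partition functions. -/
theorem IsAdmissible.exists_freeEnergy (hV : IsAdmissible s V) {ε : ℝ≥0} (hε : 0 < ε) {γ : ℝ}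
    (hγ : HasSum (excursionSeq s V) γ) :
    ∃ F : ℝ, (ε * γ ≤ 1 → F = 0) ∧
      (1 < ε * γ → 0 < F ∧
        HasSum (fun n : ℕ => ε * excursionSeq s V n * Real.exp (-F * n)) 1) ∧
      ∀ a, Tendsto (fun n => normalizedPartition s V a ε n / normalizedPartition s V a ε (n + 1))
        atTop (𝓝 (Real.exp (-F))) := by
  have := hV.isProbabilityMeasure_stepLaw
  have hε' : (0 : ℝ) < ε := by exact_mod_cast hε
  obtain ⟨F, hF0, hF1, hc, hf⟩ := hV.hasSquareRootTail.exists_ratio_limit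
    (positivityProb_pos hV.integrable_step hV.mean_zero hV.slowlyVarying)
    (positivityProb_le_one _)
    (isFlat_positivityProb hV.integrable_step hV.mean_zero hV.slowlyVarying) hε' hγ
  refine ⟨F, hF0, hF1, fun a => ?_⟩
  cases a with
  | free =>
    refine hf.congr fun n => ?_
    rw [normalizedPartition_free_eq_seqConv hV.measurable hV.ne_bot hV.kappa_ne_zero
      hV.partitionFunction_zero_ne_top ε n, normalizedPartition_free_eq_seqConv hV.measurable
      hV.ne_bot hV.kappa_ne_zero hV.partitionFunction_zero_ne_top ε (n + 1),
      hV.normalizedPartition_free_zero]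
  | constrained =>
    refine ((tendsto_add_atTop_iff_nat 1).2 hc).congr fun n => ?_
    rw [renewalSeq_excursionSeq hV.measurable hV.ne_bot hV.kappa_ne_zero
      hV.partitionFunction_zero_ne_top ε n, renewalSeq_excursionSeq hV.measurable hV.ne_bot
      hV.kappa_ne_zero hV.partitionFunction_zero_ne_top ε (n + 1)]
    exact mul_div_mul_left _ _ hε'.ne'

theorem IsAdmissible.ofReal_normalizedPartition (hV : IsAdmissible s V) (a : BoundaryCondition)
    (ε : ℝ≥0) (N : ℕ) : partitionFunction s V a ε N =
      ENNReal.ofReal (normalizedPartition s V a ε N) * kappa s V ^ bondCount a N := by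
  have h0 := hV.kappa_ne_zero
  rw [normalizedPartition, ENNReal.ofReal_toReal, mul_assoc, ← mul_pow,
    ENNReal.inv_mul_cancel h0 hV.kappa_lt_top.ne, one_pow, mul_one]
  exact ENNReal.mul_ne_top (partitionFunction_ne_top hV.measurable hV.ne_bot
    hV.partitionFunction_zero_ne_top a ε N) (ENNReal.pow_ne_top (ENNReal.inv_ne_top.2 h0))

theorem prod_map_mul_pow (c : ℝ≥0∞) (x : ℕ → ℝ≥0∞) (l : List ℕ) :
    (l.map fun n => x n * c ^ n).prod = (l.map x).prod * c ^ l.sum := by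
  rw [List.prod_map_mul]
  congr 1
  induction l with
  | nil => simp
  | cons n l ih => simp [ih, pow_add]

theorem pow_mul_div_mul_pow {c : ℝ≥0∞} (h0 : c ≠ 0) (htop : c ≠ ∞) (x y : ℝ≥0∞) (m b : ℕ) :
    c ^ m * (x * c ^ b / (y * c ^ (b + m))) = x / y := by
  rw [← mul_div_assoc, ← ENNReal.mul_div_mul_right x y (pow_ne_zero (b + m) h0)
    (ENNReal.pow_ne_top htop), pow_add, mul_comm (c ^ m), mul_assoc]

/-- The gaps add up to the length of the pattern, so the powers of `κ` in the excursion weights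
cancel those in the ratio of partition functions. -/
theorem IsAdmissible.contactLaw_cylinder_eq (hV : IsAdmissible s V) (a : BoundaryCondition)
    {ε : ℝ≥0} {N : ℕ} {l : List Bool} (hl : l.length + 1 ≤ N)
    (hpos : 0 < normalizedPartition s V a ε N) :
    contactLaw s V a ε N (cylinder (l ++ [true])) =
      ((gaps 0 l).map fun n => ε * ENNReal.ofReal (excursionSeq s V n)).prod *
        ENNReal.ofReal (normalizedPartition s V a ε (N - (l.length + 1)) /
          normalizedPartition s V a ε N) := by
  have h0 := hV.kappa_ne_zero
  have htop := hV.kappa_lt_top.ne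
  rw [contactLaw_cylinder_append hV.measurable hV.ne_bot s a ε hl]
  have h1 : (gaps 0 l).map (fun n => partitionFunction s V .constrained 0 (n - 1) * ε) =
      (gaps 0 l).map fun n => ε * ENNReal.ofReal (excursionSeq s V n) * kappa s V ^ n := by
    refine List.map_congr_left fun n hn => ?_
    obtain ⟨m, rfl⟩ : ∃ m, n = m + 1 := ⟨n - 1, by have := pos_of_mem_gaps hn; omega⟩
    rw [Nat.add_sub_cancel, hV.ofReal_normalizedPartition, excursionSeq, bondCount]
    ring
  have hbond : bondCount a N = bondCount a (N - (l.length + 1)) + (l.length + 1) := by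
    cases a <;> simp only [bondCount] <;> omega
  rw [h1, prod_map_mul_pow, sum_gaps, zero_add, ENNReal.ofReal_div_of_pos hpos, mul_assoc]
  congr 1
  rw [hV.ofReal_normalizedPartition a ε N, hV.ofReal_normalizedPartition a ε (N - _), hbond]
  exact pow_mul_div_mul_pow h0 htop _ _ _ _

theorem tendsto_sub_div {b : ℕ → ℝ} (hb : ∀ n, 0 < b n) {x : ℝ}
    (h : Tendsto (fun n => b n / b (n + 1)) atTop (𝓝 x)) (m : ℕ) :
    Tendsto (fun n => b (n - m) / b n) atTop (𝓝 (x ^ m)) := by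
  have h1 : Tendsto (fun n => b n / b (n + m)) atTop (𝓝 (x ^ m)) := by
    induction m with
    | zero =>
      rw [pow_zero]
      refine tendsto_const_nhds.congr fun n => ?_
      rw [add_zero, div_self (hb n).ne']
    | succ m ih =>
      have h3 := ih.mul (h.comp (tendsto_add_atTop_nat m))
      rw [← pow_succ] at h3
      refine h3.congr fun n => ?_
      rw [Function.comp_apply, add_assoc, div_mul_div_cancel₀ (hb _).ne']
  refine (tendsto_add_atTop_iff_nat m).1 (h1.congr fun n => ?_)
  rw [Nat.add_sub_cancel]

theorem IsAdmissible.gammaConst_eq (hV : IsAdmissible s V) {γ : ℝ}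
    (hγ : HasSum (excursionSeq s V) γ) : gammaConst s V = ENNReal.ofReal γ := by
  have h1 : HasSum (fun n => excursionSeq s V (n + 1)) γ := by
    have := (hasSum_nat_add_iff' 1).2 hγ
    simpa [excursionSeq] using this
  rw [gammaConst, ← h1.tsum_eq, ENNReal.ofReal_tsum_of_nonneg (fun n => excursionSeq_nonneg s V _)
    h1.summable]
  refine tsum_congr fun n => ?_
  rw [hV.ofReal_normalizedPartition, bondCount, ENNReal.mul_div_cancel_right
    (pow_ne_zero _ hV.kappa_ne_zero) (ENNReal.pow_ne_top hV.kappa_lt_top.ne)]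
  rfl

theorem IsAdmissible.q_eq (hV : IsAdmissible s V) (n : ℕ) :
    q s V n = (gammaConst s V)⁻¹ * ENNReal.ofReal (excursionSeq s V n) := by
  cases n with
  | zero => simp [q, excursionSeq]
  | succ n =>
    rw [q, hV.ofReal_normalizedPartition, bondCount, ENNReal.mul_div_cancel_right
      (pow_ne_zero _ hV.kappa_ne_zero) (ENNReal.pow_ne_top hV.kappa_lt_top.ne)]
    rfl

theorem IsAdmissible.gammaConst_ne (hV : IsAdmissible s V) :
    gammaConst s V ≠ 0 ∧ gammaConst s V ≠ ∞ := by
  have hγ := hV.hasSquareRootTail.summable.hasSum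
  rw [hV.gammaConst_eq hγ]
  refine ⟨(ENNReal.ofReal_pos.2 ?_).ne', ENNReal.ofReal_ne_top⟩
  exact hV.hasSquareRootTail.summable.tsum_pos (excursionSeq_nonneg s V) 1 hV.excursionSeq_one_pos

theorem IsAdmissible.delta_mul_q (hV : IsAdmissible s V) (ε : ℝ≥0) (n : ℕ) :
    delta s V ε * q s V n = ε * ENNReal.ofReal (excursionSeq s V n) := by
  rw [hV.q_eq, delta, mul_comm (gammaConst s V), mul_assoc, ← mul_assoc (gammaConst s V),
    ENNReal.mul_inv_cancel hV.gammaConst_ne.1 hV.gammaConst_ne.2, one_mul]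

theorem tilted_zero_right (s : Setup) (V : ℝ → EReal) (ε : ℝ≥0) :
    tilted s V ε 0 = fun t => delta s V ε * q s V t := by
  ext t
  simp [tilted]

theorem IsAdmissible.tilted_eq (hV : IsAdmissible s V) (ε : ℝ≥0) (F : ℝ) (n : ℕ) :
    tilted s V ε F n =
      ENNReal.ofReal (ε * excursionSeq s V n * Real.exp (-F * n)) := by
  have := excursionSeq_nonneg s V n
  rw [tilted, hV.delta_mul_q, ENNReal.ofReal_mul (by positivity), ENNReal.ofReal_mul (by positivity),
    ENNReal.ofReal_coe_nnreal]

/-- Convergence of the contact sets to the renewal process with exponentially tilted law. -/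
theorem IsAdmissible.convergesWeakly_renewalLaw (hV : IsAdmissible s V) {ε : ℝ≥0} {F : ℝ}
    (hK : ∑' n, tilted s V ε F n ≤ 1) (a : BoundaryCondition)
    (h : 0 < ε → Tendsto
      (fun n => normalizedPartition s V a ε n / normalizedPartition s V a ε (n + 1)) atTop
        (𝓝 (Real.exp (-F)))) :
    ConvergesWeakly (fun N => contactLaw s V a ε N) (renewalLaw (tilted s V ε F)) := by
  have h0 : tilted s V ε F 0 = 0 := by simp [tilted, q]
  have hpos := hV.eventually_normalizedPartition_pos a ε
  refine convergesWeakly_of_cylinder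
    (hpos.mono fun N hN => hV.isProbabilityMeasure_contactLaw hN)
    (isProbabilityMeasure_renewalLaw hK) fun l => ?_
  rw [renewalLaw_cylinder h0 hK]
  have h1 : (gaps 0 l).map (tilted s V ε F) = (gaps 0 l).map fun n =>
      ε * ENNReal.ofReal (excursionSeq s V n) * ENNReal.ofReal (Real.exp (-F)) ^ n := by
    refine List.map_congr_left fun n _ => ?_
    rw [tilted, hV.delta_mul_q, ← ENNReal.ofReal_pow (Real.exp_nonneg _), ← Real.exp_nat_mul,
      mul_comm (n : ℝ)]
  rw [h1, prod_map_mul_pow, sum_gaps, zero_add]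
  set P := ((gaps 0 l).map fun n => ε * ENNReal.ofReal (excursionSeq s V n)).prod with hP
  have hPtop : P ≠ ∞ := by
    rw [hP]
    induction gaps 0 l with
    | nil => simp
    | cons n L ih =>
      rw [List.map_cons, List.prod_cons]
      exact ENNReal.mul_ne_top (ENNReal.mul_ne_top ENNReal.coe_ne_top ENNReal.ofReal_ne_top) ih
  -- The limit of the ratio is `exp (-F)` to the power of the length of the pattern, which is the
  -- product over the gaps of the tilting factors.
  have h2 : (fun N => P * ENNReal.ofReal (normalizedPartition s V a ε (N - (l.length + 1)) /
      normalizedPartition s V a ε N)) =ᶠ[atTop]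
        fun N => contactLaw s V a ε N (cylinder (l ++ [true])) := by
    filter_upwards [hpos, eventually_ge_atTop (l.length + 1)] with N hN hl
    exact (hV.contactLaw_cylinder_eq a hl hN).symm
  refine Tendsto.congr' h2 ?_
  rcases eq_or_ne ε 0 with rfl | hε
  -- Without pinning every pattern with a contact has weight zero, and no ratio limit is needed.
  · have hP0 : P = 0 := by
      rw [hP, List.prod_eq_zero_iff, List.mem_map]
      have hne : gaps 0 l ≠ [] := fun hnil => by
        have := sum_gaps 0 l
        rw [hnil] at this
        simp at this
      obtain ⟨n, hn⟩ := List.exists_mem_of_ne_nil _ hne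
      exact ⟨n, hn, by simp⟩
    simp [hP0]
  · have hε' := pos_iff_ne_zero.2 hε
    have h3 := tendsto_sub_div (hV.normalizedPartition_pos a hε') (h hε') (l.length + 1)
    have h4 := (ENNReal.continuous_ofReal.tendsto _).comp h3
    rw [ENNReal.ofReal_pow (Real.exp_nonneg _)] at h4
    exact ENNReal.Tendsto.const_mul h4 (Or.inr hPtop)

end

end Wetting

/-! ### The three regimes. -/

theorem proposition1 (s : Wetting.Setup) (V : ℝ → EReal) (hV : Wetting.IsAdmissible s V) :
    (0 < Wetting.gammaConst s V ∧ Wetting.gammaConst s V < ∞) ∧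
    ∀ ε : ℝ≥0, ∃ p : Measure (ℕ+ → Bool),
      (∀ a : Wetting.BoundaryCondition,
        Wetting.ConvergesWeakly (fun N => Wetting.contactLaw s V a ε N) p) ∧
      (Wetting.epsCrit s V < ε →
        ∃ F : ℝ, 0 < F ∧ ∑' t, Wetting.tilted s V ε F t = 1 ∧
          Wetting.IsRenewalProcess p Wetting.contactTime (Wetting.tilted s V ε F)) ∧
      (ε < Wetting.epsCrit s V →
        Wetting.IsTerminatingRenewalProcess p Wetting.contactTime
          (fun t => Wetting.delta s V ε * Wetting.q s V t)) ∧
      (ε = Wetting.epsCrit s V →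
        Wetting.IsRenewalProcess p Wetting.contactTime (Wetting.q s V)) := by
  obtain ⟨hγ0, hγt⟩ := hV.gammaConst_ne
  refine ⟨⟨pos_iff_ne_zero.2 hγ0, hγt.lt_top⟩, fun ε => ?_⟩
  set γ := ∑' n, Wetting.excursionSeq s V n with hγdef
  have hγ : HasSum (Wetting.excursionSeq s V) γ := hV.hasSquareRootTail.summable.hasSum
  have hγe := hV.gammaConst_eq hγ
  have hγpos : 0 < γ := by
    rw [← ENNReal.ofReal_pos, ← hγe]
    exact pos_iff_ne_zero.2 hγ0
  have hdelta : Wetting.delta s V ε = ENNReal.ofReal (ε * γ) := by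
    rw [Wetting.delta, hγe, mul_comm, ENNReal.ofReal_mul ε.coe_nonneg, ENNReal.ofReal_coe_nnreal]
  have hgt : Wetting.epsCrit s V < ε ↔ 1 < Wetting.delta s V ε := by
    rw [Wetting.epsCrit, Wetting.delta, mul_comm, ← one_div,
      ENNReal.div_lt_iff (Or.inl hγ0) (Or.inl hγt)]
  have hlt : (ε : ℝ≥0∞) < Wetting.epsCrit s V ↔ Wetting.delta s V ε < 1 := by
    rw [Wetting.epsCrit, Wetting.delta, mul_comm, ← one_div,
      ENNReal.lt_div_iff_mul_lt (Or.inl hγ0) (Or.inl hγt)]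
  have hsumq : ∑' t, Wetting.delta s V ε * Wetting.q s V t = Wetting.delta s V ε := by
    simp_rw [hV.delta_mul_q]
    rw [ENNReal.tsum_mul_left, hdelta, ENNReal.ofReal_mul ε.coe_nonneg, ENNReal.ofReal_coe_nnreal,
      ← hγ.tsum_eq, ENNReal.ofReal_tsum_of_nonneg (Wetting.excursionSeq_nonneg s V) hγ.summable]
  have hq0 : Wetting.q s V 0 = 0 := rfl
  -- The subcritical and critical regimes are treated together: in both `F = 0` and the limit is the
  -- renewal law of `δ q`, defective or not.
  rcases lt_or_ge 1 (ε * γ) with hsup | hsub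
  · have hε : 0 < ε := by
      rw [pos_iff_ne_zero]
      rintro rfl
      rw [NNReal.coe_zero, zero_mul] at hsup
      exact absurd hsup (by norm_num)
    obtain ⟨F, -, hF, hlim⟩ := hV.exists_freeEnergy hε hγ
    obtain ⟨hFpos, hFsum⟩ := hF hsup
    have hsum : ∑' t, Wetting.tilted s V ε F t = 1 := by
      simp_rw [hV.tilted_eq]
      rw [← ENNReal.ofReal_tsum_of_nonneg (fun n => ?_) hFsum.summable, hFsum.tsum_eq,
        ENNReal.ofReal_one]
      have := Wetting.excursionSeq_nonneg s V n
      positivity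
    have hd : 1 < Wetting.delta s V ε := by
      rw [hdelta, ← ENNReal.ofReal_one]
      exact (ENNReal.ofReal_lt_ofReal_iff (zero_lt_one.trans hsup)).2 hsup
    have hK0 : Wetting.tilted s V ε F 0 = 0 := by rw [Wetting.tilted, hq0, mul_zero, zero_mul]
    refine ⟨Wetting.renewalLaw (Wetting.tilted s V ε F),
      fun a => hV.convergesWeakly_renewalLaw hsum.le a fun _ => hlim a,
      fun _ => ⟨F, hFpos, hsum, hK0, hsum, Wetting.hasRenewalLaw_renewalLaw hK0 hsum.le⟩,
      fun h => absurd (hlt.1 h) hd.not_gt, fun h => absurd (hgt.2 hd) ?_⟩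
    rw [h]
    exact lt_irrefl _
  · have hd : Wetting.delta s V ε ≤ 1 := by
      rw [hdelta, ← ENNReal.ofReal_one]
      exact ENNReal.ofReal_le_ofReal hsub
    have hsum : ∑' t, Wetting.tilted s V ε 0 t ≤ 1 := by
      rw [Wetting.tilted_zero_right, hsumq]
      exact hd
    have hK0 : Wetting.tilted s V ε 0 0 = 0 := by rw [Wetting.tilted, hq0, mul_zero, zero_mul]
    have hren := Wetting.hasRenewalLaw_renewalLaw hK0 hsum
    refine ⟨Wetting.renewalLaw (Wetting.tilted s V ε 0),
      fun a => hV.convergesWeakly_renewalLaw hsum a fun hε => ?_,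
      fun h => absurd (hgt.1 h) hd.not_gt, fun h => ?_, fun h => ?_⟩
    · obtain ⟨F, hF, -, hlim⟩ := hV.exists_freeEnergy hε hγ
      rw [← hF hsub]
      exact hlim a
    · rw [Wetting.tilted_zero_right] at hren hK0 ⊢
      exact ⟨hK0, hsumq.trans_lt (hlt.1 h), hren⟩
    · have hone : Wetting.delta s V ε = 1 := by
        rw [Wetting.delta, h, Wetting.epsCrit, ENNReal.mul_inv_cancel hγ0 hγt]
      have hKq : Wetting.tilted s V ε 0 = Wetting.q s V := by
        rw [Wetting.tilted_zero_right, hone]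
        simp_rw [one_mul]
      simp_rw [hone, one_mul] at hsumq
      rw [hKq] at hren ⊢
      exact ⟨hq0, hsumq, hren⟩
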